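/- For $k\ge 2$ let $\tau_k(n)$ be the number of ordered factorizations of $n$ into $k$ positive integers, and put $$C_k=\prod_p\Big(1-\frac1p\Big)^{k^2}\sum_{\nu\ge0}\frac{\tau_k(p^\nu)^2}{p^\nu},\qquad G_{d,k}(s)=\prod_{p\mid d}\Big(1-\frac1{p^s}\Big)^k\Big(1+\sum_{m\ge1}\frac{\tau_k(p^{m+v_p(d)})}{\tau_k(p^{v_p(d)})p^{ms}}\Big).$$ For $0\le j<k$ let $$b_{j,k}(d)=\Big(\frac{\{(s-1)\zeta(s)\}^kG_{d,k}(s)}{s\,d^{s-1}}\Big)^{(j)}\Big|_{s=1},\qquad h_{j,k}(d)=\tau_k(d)\Big(\frac{b_{j,k}(d)}{j!}+\frac{b_{j-1,k}(d)}{(j-1)!}\Big),\qquad u_{j,k}(t)=\frac{(\log t)^{k-1-j}}{(k-1-j)!},$$ where the second summand of $h_{j,k}$ is omitted if $j=0$. With Dirichlet convolution $*$ and $(r,n)=\gcd(r,n)$, define the major arcs approximation of $\tau_k$ and its error by $$F_R(n)=\sum_{0\le j<k}u_{j,k}(n)\sum_{r\le R}\frac{(h_{j,k}*\mu)(r)}{\phi(r/(r,n))}\,\mu\Big(\frac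 r{(r,n)}\Big),\qquad \Delta_R(n)=\tau_k(n)-F_R(n),$$ and write $\|f\|_2^2=\sum_{n\le x}f(n)^2$. Let $$P_k(v)=\sum_{0\le j,j'<k}\frac{(k^2-1)!\,c_{j,j'}\,v^{j+j'}}{(k-j-1)!\,(k-j'-1)!},\qquad c_{j,j'}=\operatorname{Res}_{s=0}\ \operatorname{Res}_{s_1=0,\,s_2=0}\ \frac{e^s(s+s_1)^k(s+s_2)^k}{s_1^{j+1}s_2^{j'+1}s^2(s+s_1+s_2)^{k^2}}$$ (the residues in $s_1,s_2$ are taken first, for fixed $s\neq 0$). **Theorem.** There is an absolute constant $c'>0$ such that for every $k\ge2$ the following holds. The polynomial $P_k$ has degree $2k-2$. There is a real polynomial $Q_k$ of degree at most $k^2-2$ such that for some $\delta>0$ (depending on $k$) $$\|\tau_k\|_2^2=C_k\,x\,\frac{(\log x)^{k^2-1}}{(k^2-1)!}\Big(1+\frac1{\log x}Q_k\Big(\frac1{\log x}\Big)\Big)+O_k\big(x^{1-\delta}\big)\qquad(x\ge2),$$ which determines $Q_k$ uniquely, and for this $Q_k$ and all $x\ge 1$ and real $R$ with $2\le R\le x^{c'/k}$,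 $$\|\Delta_R\|_2^2=C_k\,x\,\frac{(\log x)^{k^2-1}}{(k^2-1)!}\Big(1-\Big(\frac{\log R}{\log x}\Big)^{(k-1)^2}P_k\Big(\frac{\log R}{\log x}\Big)+\frac1{\log x}Q_k\Big(\frac1{\log x}\Big)\Big)+O_k\big(x(\log x)^{2k-2}(\log R)^{k^2-2k}\big).$$ -/

import Mathlib

open scoped Topology

namespace MajorArcs

noncomputable section

/-! ### The divisor functions -/

/-- The `k`-th divisor function `τ_k`, the `k`-fold Dirichlet convolution power of the constant
function `1`: `τ_k(n)` is the number of ways of writing `n` as an ordered product of `k` positive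
integers. -/
def tau (k : ℕ) : ArithmeticFunction ℕ := ArithmeticFunction.zeta ^ k

/-- The local factor at `p` of `C_k`: `(1 - 1/p)^{k²} ∑_{ν ≥ 0} τ_k(p^ν)² / p^ν`. -/
def localFactor (k p : ℕ) : ℝ :=
  (1 - 1 / (p : ℝ)) ^ (k ^ 2) * ∑' ν : ℕ, ((tau k (p ^ ν) : ℕ) : ℝ) ^ 2 / (p : ℝ) ^ ν

/-- The constant `C_k`, an absolutely convergent product over all primes. -/
def constC (k : ℕ) : ℝ := ∏' p : Nat.Primes, localFactor k (p : ℕ)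

/-! ### The data `h_{j,k}`, `u_{j,k}` attached to `τ_k` -/

/-- The entire function `(s - 1) ζ(s)`, whose value at `s = 1` is `1`. -/
def zetaReg : ℂ → ℂ := Function.update (fun s : ℂ => (s - 1) * riemannZeta s) 1 1

/-- The finite Euler product `G_{d,k}(s)` over the primes dividing `d`, for which
`∑_n τ_k(dn) / (τ_k(d) n^s) = ζ(s)^k G_{d,k}(s)`. -/
def eulerG (k d : ℕ) (s : ℂ) : ℂ :=
  ∏ p ∈ d.primeFactors, (1 - 1 / (p : ℂ) ^ s) ^ k *
    (1 + ∑' m : ℕ, ((tau k (p ^ ((m + 1) + padicValNat p d)) : ℕ) : ℂ) /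
      (((tau k (p ^ padicValNat p d) : ℕ) : ℂ) * (p : ℂ) ^ (((m + 1 : ℕ) : ℂ) * s)))

/-- `b_{j,k}(d)`: the `j`-th derivative at `s = 1` of `{(s - 1) ζ(s)}^k G_{d,k}(s) / (s d^{s-1})`.
This number is real, since the function is real on the real axis. -/
def coeffB (k j d : ℕ) : ℝ :=
  (iteratedDeriv j
    (fun s : ℂ => zetaReg s ^ k * eulerG k d s / (s * (d : ℂ) ^ (s - 1))) 1).re

/-- `h_{j,k}(d) = τ_k(d) (b_{j,k}(d)/j! + b_{j-1,k}(d)/(j-1)!)`, where the second summand is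
absent for `j = 0`. -/
def hFun (k j : ℕ) : ArithmeticFunction ℝ where
  toFun d := ((tau k d : ℕ) : ℝ) *
    (coeffB k j d / (j.factorial : ℝ) +
      (if j = 0 then 0 else coeffB k (j - 1) d / ((j - 1).factorial : ℝ)))
  map_zero' := by simp

/-- `u_{j,k}(t) = (log t)^{k-1-j} / (k-1-j)!`, used for `0 ≤ j < k`. -/
def uFun (k j : ℕ) (t : ℝ) : ℝ := Real.log t ^ (k - 1 - j) / ((k - 1 - j).factorial : ℝ)

/-! ### The major arcs approximation and its 2-norm -/

/-- The major arcs approximation to `τ_k`: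
`F_R(n) = ∑_{0 ≤ j < k} u_{j,k}(n) ∑_{r ≤ R} (h_{j,k} * μ)(r) μ(r/(r,n)) / φ(r/(r,n))`. -/
def majorArc (k : ℕ) (R : ℝ) (n : ℕ) : ℝ :=
  ∑ j ∈ Finset.range k, uFun k j (n : ℝ) *
    ∑ r ∈ Finset.Icc 1 ⌊R⌋₊,
      (hFun k j * ((ArithmeticFunction.moebius : ArithmeticFunction ℤ) : ArithmeticFunction ℝ)) r /
          (Nat.totient (r / Nat.gcd r n) : ℝ) *
        ((ArithmeticFunction.moebius (r / Nat.gcd r n) : ℤ) : ℝ)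

/-- `Δ_R(n) = τ_k(n) - F_R(n)`. -/
def Delta (k : ℕ) (R : ℝ) (n : ℕ) : ℝ := ((tau k n : ℕ) : ℝ) - majorArc k R n

/-- The square of the 2-norm, `‖f‖₂² = ∑_{1 ≤ n ≤ x} f(n)²`. -/
def normSq (f : ℕ → ℝ) (x : ℝ) : ℝ := ∑ n ∈ Finset.Icc 1 ⌊x⌋₊, f n ^ 2

/-! ### The polynomials `P_k` and `Q_k` -/

/-- The residue at `a` of a function that is holomorphic in a punctured neighbourhood of `a`:
the common value of `(2πi)⁻¹ ∮ f` over all sufficiently small circles centred at `a`. -/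
def residue (f : ℂ → ℂ) (a : ℂ) : ℂ :=
  Filter.limUnder (𝓝[>] (0 : ℝ)) fun ρ : ℝ =>
    (2 * (Real.pi : ℂ) * Complex.I)⁻¹ * ∮ z in C(a, ρ), f z

/-- The iterated residue
`c_{j,j'} = Res_{s=0} Res_{s₁=0, s₂=0} e^s (s+s₁)^k (s+s₂)^k /
  (s₁^{j+1} s₂^{j'+1} s² (s+s₁+s₂)^{k²})`, which is a real (indeed rational) number. The residues
in `s₁`, `s₂` are taken first, for fixed `s ≠ 0`. -/
def coeffC (k j j' : ℕ) : ℝ :=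
  (residue (fun s : ℂ => residue (fun s₁ : ℂ => residue (fun s₂ : ℂ =>
    Complex.exp s * (s + s₁) ^ k * (s + s₂) ^ k /
      (s₁ ^ (j + 1) * s₂ ^ (j' + 1) * s ^ 2 * (s + s₁ + s₂) ^ (k ^ 2))) 0) 0) 0).re

/-- `P_k(v) = ∑_{0 ≤ j, j' < k} (k²-1)! c_{j,j'} v^{j+j'} / ((k-j-1)! (k-j'-1)!)`. -/
def polyP (k : ℕ) : Polynomial ℝ :=
  ∑ j ∈ Finset.range k, ∑ j' ∈ Finset.range k,
    Polynomial.monomial (j + j')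
      (((k ^ 2 - 1).factorial : ℝ) * coeffC k j j' /
        (((k - j - 1).factorial : ℝ) * ((k - j' - 1).factorial : ℝ)))

/-- `Q` is the polynomial `Q_k` of the lower order terms of `‖τ_k‖₂²`: it has degree at most
`k² - 2` and, with a power saving,
`‖τ_k‖₂² = C_k x (log x)^{k²-1}/(k²-1)! · (1 + Q(1/log x)/log x) + O(x^{1-δ})`.
As `C_k > 0` and the main term is `x` times a polynomial in `log x`, at most one `Q` satisfies
this. -/
def IsPolyQ (k : ℕ) (Q : Polynomial ℝ) : Prop :=
  Q.natDegree ≤ k ^ 2 - 2 ∧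
  ∃ δ : ℝ, 0 < δ ∧ ∃ C : ℝ, ∀ x : ℝ, 2 ≤ x →
    |normSq (fun n => ((tau k n : ℕ) : ℝ)) x -
        constC k * x * (Real.log x ^ (k ^ 2 - 1) / ((k ^ 2 - 1).factorial : ℝ)) *
          (1 + 1 / Real.log x * Q.eval (1 / Real.log x))| ≤ C * x ^ (1 - δ)

end

end MajorArcs

/-!
Throughout, `h_j = h_{j,k}` and `u_j = u_{j,k}`.

**Reduction to a diagonal form.** In `F_R`, the value `(h_j * μ)(r)` is multiplied by `c_r(n) /
φ(r)`, where `c_r(n) = ∑_{d ∣ (r,n)} d μ(r/d)` is the Ramanujan sum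
(`dvdId_mul_moebius_eq_sterneck`), so `F_R(n)` is a divisor sum over `d ∣ n`, `d ≤ R`, weighted by
the `u_j(n)` (`majorArc_eq`). On expanding `‖τ_k - F_R‖²` one needs the sums of `τ_k` and of `1`
over the multiples of `d`. For the first of these the main term has derivative `d⁻¹ ∑_j u_j(t)
h_j(d)`, which is what makes `F_R` the right approximation (`ev_eq_sum_uFun_mul_hFun`).
Orthogonality of the Ramanujan sums (`sum_dualCoeff_mul_gcd`) and Möbius inversion
(`sum_divCoeff_mul_hFun`) then turn both `⟨τ_k, F_R⟩` and `‖F_R‖²` into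
`∑_{j,j'} ∫_1^x u_j u_{j'} · ∑_{r ≤ R} (h_j * μ)(r) (h_{j'} * μ)(r) / φ(r)`,
so that `‖Δ_R‖²` is `‖τ_k‖²` minus this form (`exists_abs_normSq_Delta_sub_le`). The error saves
`x^{1/(4k)}` and loses `R^{12}`; the exponent `12` does not depend on `k`, and therefore `R ≤
x^{c'/k}` with an absolute constant `c'` suffices.

**Sums of `τ_k` over multiples.** The hyperbola method gives `∑_{n ≤ x} τ_k(n)` with a power saving
(`exists_powerAsymp_tauR`). Since `τ_k(p^ν n)` is a fixed combination of the values `τ_k(n / p^i)`,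
`i < k`, the result passes to multiples of `d` by induction over the primes dividing `d`, with an
error that is polynomial in `d` (`exists_psum_dvd_tauR_sub_le`). The polynomial in the main term is
identified with the residue of `ζ(s)^k x^s / s` by comparing Laplace transforms as `s → 1+`
(`coeff_one_add_X_mul_eq`), which needs no contour integration.

**The sums over `r`.** By `hFun_eq`, `h_j(d)` is the coefficient of `z^j` of a fixed power series
times a power series `H(d)` that is multiplicative in `d`. All pairs `(j, j')` are thus handled at
once by a multiplicative function `gramF` with values in power series in `z, w`. Up to an absolutely
convergent factor it is the convolution of the coefficients of
`(ζ(1+s+z+w)/ζ(1+s+z))^k (ζ(1+s+z+w)/ζ(1+s+w))^k ζ(1+s+z+w)^{k²-2k} ζ(1+s)`.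
For the coefficients in `z` and `w` of each factor, sums over `n ≤ x` are a constant times a power
of `log x`, with an error smaller by one logarithm; this needs nothing beyond the theorem of Mertens
(`isType_vm`). Such asymptotics multiply under convolution (`IsType`, `HasSymbol`). The leading
constants are the coefficients of the symbol `(1+z)^k (1+w)^k / (1+z+w)^{k²}` times the value at `0`
of the absolutely convergent factor (`isType_gram`). That value is `C_k`: at each prime this is a
variance identity for a geometric distribution (`hasSum_sq_sub_tail`, `tsum_gramE`).

**The polynomials.** The iterated residues `c_{j,j'}` are the coefficients of the same symbol
divided by factorials (`coeffC_eq`), so the main terms assemble to `P_k`. The top coefficient of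
`P_k` comes from a diagonal coefficient of the symbol, and those are positive (`symCoeff_pos`).
Finally `Q_k` comes from `τ_k² = τ_{k²} * g` with `∑ g(n)/n` absolutely convergent and equal to
`C_k` (`exists_powerAsymp_tauSq`, `exists_isPolyQ`).
-/

open scoped Topology

namespace MajorArcs

noncomputable section

/-! ### Partial sums of arithmetic functions and Dirichlet convolution -/

/-- The summatory function `∑_{1 ≤ n ≤ x} a(n)`. -/
def psum (a : ℕ → ℝ) (x : ℝ) : ℝ := ∑ n ∈ Finset.Icc 1 ⌊x⌋₊, a n

lemma mem_Icc_floor {n : ℕ} {x : ℝ} (h : n ∈ Finset.Icc 1 ⌊x⌋₊) :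
    (1 : ℝ) ≤ n ∧ (n : ℝ) ≤ x := by
  rw [Finset.mem_Icc] at h
  refine ⟨by exact_mod_cast h.1, ?_⟩
  exact (Nat.le_floor_iff' (by omega)).mp h.2

lemma mem_Icc_floor_iff {n : ℕ} {x : ℝ} :
    n ∈ Finset.Icc 1 ⌊x⌋₊ ↔ 1 ≤ n ∧ (n : ℝ) ≤ x := by
  rw [Finset.mem_Icc]
  constructor
  · rintro ⟨h1, h2⟩
    exact ⟨h1, (Nat.le_floor_iff' (by omega)).mp h2⟩
  · rintro ⟨h1, h2⟩
    exact ⟨h1, (Nat.le_floor_iff' (by omega)).mpr h2⟩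

lemma abs_psum_le (a : ℕ → ℝ) (x : ℝ) : |psum a x| ≤ psum (fun n => |a n|) x :=
  Finset.abs_sum_le_sum_abs _ _

lemma psum_le_psum {a b : ℕ → ℝ} {x : ℝ} (h : ∀ n : ℕ, 1 ≤ n → (n : ℝ) ≤ x → a n ≤ b n) :
    psum a x ≤ psum b x :=
  Finset.sum_le_sum fun n hn => by
    have := mem_Icc_floor_iff.mp hn
    exact h n this.1 this.2

lemma psum_congr {a b : ℕ → ℝ} {x : ℝ} (h : ∀ n : ℕ, 1 ≤ n → (n : ℝ) ≤ x → a n = b n) :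
    psum a x = psum b x :=
  Finset.sum_congr rfl fun n hn => by
    have := mem_Icc_floor_iff.mp hn
    exact h n this.1 this.2

lemma psum_add (a b : ℕ → ℝ) (x : ℝ) : psum (fun n => a n + b n) x = psum a x + psum b x :=
  Finset.sum_add_distrib

lemma psum_sub (a b : ℕ → ℝ) (x : ℝ) : psum (fun n => a n - b n) x = psum a x - psum b x :=
  Finset.sum_sub_distrib _ _

lemma psum_const_mul (c : ℝ) (a : ℕ → ℝ) (x : ℝ) : psum (fun n => c * a n) x = c * psum a x :=
  (Finset.mul_sum _ _ _).symm

lemma psum_mul_const (c : ℝ) (a : ℕ → ℝ) (x : ℝ) : psum (fun n => a n * c) x = psum a x * c :=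
  (Finset.sum_mul _ _ _).symm

lemma psum_of_lt_one (a : ℕ → ℝ) {x : ℝ} (hx : x < 1) : psum a x = 0 := by
  simp [psum, Nat.floor_eq_zero.mpr hx]

/-- Summing a Dirichlet convolution over the first variable. -/
lemma psum_mul (a b : ArithmeticFunction ℝ) (x : ℝ) :
    psum ((a * b : ArithmeticFunction ℝ) : ℕ → ℝ) x = psum (fun m => a m * psum b (x / m)) x := by
  have h := ArithmeticFunction.sum_Ioc_mul_eq_sum_sum a b ⌊x⌋₊
  simp only [psum, ← Nat.floor_div_natCast] at h ⊢
  simpa [← Finset.Icc_add_one_left_eq_Ioc] using h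

lemma abs_mul_apply_le (a b : ArithmeticFunction ℝ) (n : ℕ) :
    |(a * b) n| ≤ ∑ d ∈ n.divisorsAntidiagonal, |a d.1| * |b d.2| := by
  rw [ArithmeticFunction.mul_apply]
  refine (Finset.abs_sum_le_sum_abs _ _).trans (le_of_eq ?_)
  simp [abs_mul]

/-- The pointwise absolute value of an arithmetic function. -/
def absA (a : ArithmeticFunction ℝ) : ArithmeticFunction ℝ := ⟨fun n => |a n|, by simp⟩

lemma psum_abs_mul_le (a b : ArithmeticFunction ℝ) (x : ℝ) :
    psum (fun n => |(a * b) n|) x ≤ psum (fun m => |a m| * psum (fun n => |b n|) (x / m)) x := by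
  have h := psum_mul (absA a) (absA b) x
  calc psum (fun n => |(a * b) n|) x ≤ psum ((absA a * absA b : ArithmeticFunction ℝ) : ℕ → ℝ) x := by
        refine psum_le_psum fun n _ _ => ?_
        rw [ArithmeticFunction.mul_apply]
        exact abs_mul_apply_le a b n
    _ = _ := h

lemma one_le_div_of_mem {n : ℕ} {x : ℝ} (h1 : 1 ≤ n) (h2 : (n : ℝ) ≤ x) : 1 ≤ x / n := by
  have : (0 : ℝ) < n := by exact_mod_cast h1
  rwa [one_le_div this]

lemma log_div_nonneg {n : ℕ} {x : ℝ} (h1 : 1 ≤ n) (h2 : (n : ℝ) ≤ x) :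
    0 ≤ Real.log (x / n) := Real.log_nonneg (one_le_div_of_mem h1 h2)

lemma log_div_le {n : ℕ} {x : ℝ} (h1 : 1 ≤ n) (h2 : (n : ℝ) ≤ x) :
    Real.log (x / n) ≤ Real.log x := by
  have : (1 : ℝ) ≤ n := by exact_mod_cast h1
  have hx : 0 < x := by linarith
  exact Real.log_le_log (by positivity) (div_le_self hx.le this)

/-! ### Arithmetic functions whose sums are governed by powers of the logarithm -/

/-- `a` is of type `(κ, c)`: for `κ ≥ 1`, this means that
`∑_{n ≤ x} a(n) = c (log x)^κ / κ! + O((log x)^{κ-1})` and `∑_{n ≤ x} |a(n)| = O((log x)^κ)`;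
for `κ = 0` it means that `a` is `c` times the unit of Dirichlet convolution. The pair `(κ, c)`
stands for the Laplace transform `c s^{-κ}` of the main term, so that convolution multiplies. -/
def IsType : ℕ → ℝ → ArithmeticFunction ℝ → Prop
  | 0, c, a => ∀ n, a n = if n = 1 then c else 0
  | κ + 1, c, a => ∃ C : ℝ, ∀ x : ℝ, 1 ≤ x →
      |psum a x - c * Real.log x ^ (κ + 1) / (κ + 1).factorial| ≤ C * (1 + Real.log x) ^ κ ∧
      psum (fun n => |a n|) x ≤ C * (1 + Real.log x) ^ (κ + 1)

/-- The logarithmic means `∑_{n ≤ x} a(n) (log (x/n))^κ / κ!`. -/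
def jsum (κ : ℕ) (a : ℕ → ℝ) (x : ℝ) : ℝ :=
  psum (fun n => a n * (Real.log (x / n) ^ κ / κ.factorial)) x

lemma jsum_zero (a : ℕ → ℝ) (x : ℝ) : jsum 0 a x = psum a x := by simp [jsum]

lemma integral_log_div_pow {m : ℕ} (hm : 1 ≤ m) {x : ℝ} (hx : (m : ℝ) ≤ x) (κ : ℕ) :
    ∫ t in (m : ℝ)..x, Real.log (t / m) ^ κ / κ.factorial / t =
      Real.log (x / m) ^ (κ + 1) / (κ + 1).factorial := by
  have hm0 : (0 : ℝ) < m := by exact_mod_cast hm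
  have hd : ∀ t ∈ Set.uIcc (m : ℝ) x,
      HasDerivAt (fun t => Real.log (t / m) ^ (κ + 1) / (κ + 1).factorial)
        (Real.log (t / m) ^ κ / κ.factorial / t) t := by
    intro t ht
    rw [Set.uIcc_of_le hx] at ht
    have ht0 : 0 < t := lt_of_lt_of_le hm0 ht.1
    have h1 : HasDerivAt (fun t : ℝ => Real.log (t / m)) (1 / t) t := by
      have := (HasDerivAt.log ((hasDerivAt_id t).div_const (m : ℝ)) (by simp; constructor <;> linarith))
      refine this.congr_deriv ?_
      simp only [id]
      field_simp
    refine ((h1.pow (κ + 1)).div_const ((κ + 1).factorial : ℝ)).congr_deriv ?_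
    rw [Nat.factorial_succ]; push_cast
    have : (κ.factorial : ℝ) ≠ 0 := by positivity
    field_simp
  rw [intervalIntegral.integral_eq_sub_of_hasDerivAt hd]
  · simp [hm0.ne']
  · apply ContinuousOn.intervalIntegrable
    rw [Set.uIcc_of_le hx]
    intro t ht
    have ht0 : 0 < t := lt_of_lt_of_le hm0 ht.1
    apply ContinuousAt.continuousWithinAt
    have : t / m ≠ 0 := by positivity
    have : t ≠ 0 := ht0.ne'
    fun_prop (disch := assumption)

lemma intervalIntegrable_indicator_log {m : ℕ} (hm : 1 ≤ m) (κ : ℕ) {x : ℝ} (hx : 1 ≤ x) :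
    IntervalIntegrable (fun t => (Set.Ici (m : ℝ)).indicator
      (fun t => Real.log (t / m) ^ κ / κ.factorial / t) t) MeasureTheory.volume 1 x := by
  have hm0 : (0 : ℝ) < m := by exact_mod_cast hm
  rw [intervalIntegrable_iff, Set.uIoc_of_le hx]
  apply MeasureTheory.IntegrableOn.indicator _ measurableSet_Ici
  apply (ContinuousOn.integrableOn_Icc (a := 1) (b := x) _).mono_set Set.Ioc_subset_Icc_self
  intro t ht
  have ht0 : 0 < t := lt_of_lt_of_le one_pos ht.1
  apply ContinuousAt.continuousWithinAt
  have : t / m ≠ 0 := by positivity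
  have : t ≠ 0 := ht0.ne'
  fun_prop (disch := assumption)

lemma jsum_div_eq_sum_indicator (κ : ℕ) (a : ℕ → ℝ) {x t : ℝ} (ht : t ∈ Set.Icc 1 x) :
    jsum κ a t / t = ∑ m ∈ Finset.Icc 1 ⌊x⌋₊, a m * (Set.Ici (m : ℝ)).indicator
      (fun t => Real.log (t / m) ^ κ / κ.factorial / t) t := by
  have hsub : Finset.Icc 1 ⌊t⌋₊ ⊆ Finset.Icc 1 ⌊x⌋₊ :=
    Finset.Icc_subset_Icc_right (Nat.floor_le_floor ht.2)
  rw [jsum, psum, Finset.sum_div, ← Finset.sum_subset hsub]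
  · refine Finset.sum_congr rfl fun m hm => ?_
    rw [Set.indicator_of_mem (Set.mem_Ici.mpr (mem_Icc_floor hm).2)]
    ring
  · intro m hm hmt
    rw [Set.indicator_of_notMem, mul_zero]
    intro hmem
    exact hmt (mem_Icc_floor_iff.mpr ⟨(Finset.mem_Icc.mp hm).1, hmem⟩)

lemma intervalIntegrable_jsum_div (κ : ℕ) (a : ℕ → ℝ) {x : ℝ} (hx : 1 ≤ x) :
    IntervalIntegrable (fun t => jsum κ a t / t) MeasureTheory.volume 1 x := by
  have h : IntervalIntegrable (fun t => ∑ m ∈ Finset.Icc 1 ⌊x⌋₊, a m *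
      (Set.Ici (m : ℝ)).indicator (fun t => Real.log (t / m) ^ κ / κ.factorial / t) t)
      MeasureTheory.volume 1 x := by
    have := IntervalIntegrable.sum (μ := MeasureTheory.volume) (a := 1) (b := x)
      (Finset.Icc 1 ⌊x⌋₊) (f := fun (m : ℕ) t => a m * (Set.Ici (m : ℝ)).indicator
        (fun t => Real.log (t / m) ^ κ / κ.factorial / t) t)
      (fun m hm => (intervalIntegrable_indicator_log (Finset.mem_Icc.mp hm).1 κ hx).const_mul _)
    exact this.congr (fun t _ => by simp)
  refine h.congr fun t ht => ?_
  rw [Set.uIoc_of_le hx] at ht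
  exact (jsum_div_eq_sum_indicator κ a ⟨ht.1.le, ht.2⟩).symm

/-- Each logarithmic mean is the integral of the preceding one against `dt / t`. -/
lemma jsum_succ (κ : ℕ) (a : ℕ → ℝ) {x : ℝ} (hx : 1 ≤ x) :
    jsum (κ + 1) a x = ∫ t in (1 : ℝ)..x, jsum κ a t / t := by
  rw [intervalIntegral.integral_congr (g := fun t => ∑ m ∈ Finset.Icc 1 ⌊x⌋₊, a m *
      (Set.Ici (m : ℝ)).indicator (fun t => Real.log (t / m) ^ κ / κ.factorial / t) t)]
  · rw [jsum, psum, intervalIntegral.integral_finsetSum]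
    · refine Finset.sum_congr rfl fun m hm => ?_
      obtain ⟨h1, h2⟩ := mem_Icc_floor_iff.mp hm
      have h1' : (1 : ℝ) ≤ m := by exact_mod_cast h1
      rw [intervalIntegral.integral_const_mul]
      congr 1
      rw [intervalIntegral.integral_of_le hx, MeasureTheory.setIntegral_indicator measurableSet_Ici,
        ← integral_log_div_pow h1 h2 κ, intervalIntegral.integral_of_le h2,
        ← MeasureTheory.integral_Icc_eq_integral_Ioc]
      apply MeasureTheory.setIntegral_congr_set
      have : Set.Icc (m : ℝ) x =ᵐ[MeasureTheory.volume] (Set.Ioc 1 x ∩ Set.Ici (m : ℝ) : Set ℝ) := by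
        refine (MeasureTheory.Ioc_ae_eq_Icc.symm).trans ?_
        rw [Filter.eventuallyEq_set]
        filter_upwards [MeasureTheory.Measure.ae_ne MeasureTheory.volume (m : ℝ)] with t ht
        simp only [Set.mem_Ioc, Set.mem_inter_iff, Set.mem_Ici]
        constructor
        · rintro ⟨ha, hb⟩
          exact ⟨⟨by linarith, hb⟩, ha.le⟩
        · rintro ⟨⟨ha, hb⟩, hc⟩
          exact ⟨lt_of_le_of_ne hc (Ne.symm ht), hb⟩
      exact this
    · exact fun m hm =>
        (intervalIntegrable_indicator_log (Finset.mem_Icc.mp hm).1 κ hx).const_mul _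
  · intro t ht
    rw [Set.uIcc_of_le hx] at ht
    exact jsum_div_eq_sum_indicator κ a ht

lemma integral_log_pow_div (n : ℕ) {x : ℝ} (hx : 1 ≤ x) :
    ∫ t in (1 : ℝ)..x, Real.log t ^ n / n.factorial / t =
      Real.log x ^ (n + 1) / (n + 1).factorial := by
  have := integral_log_div_pow (m := 1) le_rfl (x := x) (by simpa using hx) n
  simpa using this

lemma intervalIntegrable_log_pow_div (n : ℕ) {x : ℝ} (hx : 1 ≤ x) :
    IntervalIntegrable (fun t => Real.log t ^ n / n.factorial / t) MeasureTheory.volume 1 x := by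
  apply ContinuousOn.intervalIntegrable
  rw [Set.uIcc_of_le hx]
  intro t ht
  have ht0 : t ≠ 0 := (lt_of_lt_of_le one_pos ht.1).ne'
  apply ContinuousAt.continuousWithinAt
  fun_prop (disch := assumption)

/-- If a function is `c (log t)^n / n! + O((log t)^m)`, then its integral against `dt / t` over
`[1, x]` is `c (log x)^{n+1} / (n+1)! + O((log x)^{m+1})`. -/
lemma integral_div_asymp {g : ℝ → ℝ} {c C : ℝ} {n m : ℕ} {x : ℝ} (hx : 1 ≤ x)
    (hg : IntervalIntegrable (fun t => g t / t) MeasureTheory.volume 1 x)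
    (h : ∀ t ∈ Set.Icc 1 x, |g t - c * Real.log t ^ n / n.factorial| ≤
      C * (1 + Real.log t) ^ m) (hC : 0 ≤ C) :
    |(∫ t in (1 : ℝ)..x, g t / t) - c * Real.log x ^ (n + 1) / (n + 1).factorial| ≤
      C * (1 + Real.log x) ^ (m + 1) := by
  have hL : 0 ≤ Real.log x := Real.log_nonneg hx
  have e : c * Real.log x ^ (n + 1) / (n + 1).factorial =
      ∫ t in (1 : ℝ)..x, c * (Real.log t ^ n / n.factorial / t) := by
    rw [intervalIntegral.integral_const_mul, integral_log_pow_div n hx]; ring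
  rw [e, ← intervalIntegral.integral_sub hg ((intervalIntegrable_log_pow_div n hx).const_mul c)]
  have hb : IntervalIntegrable (fun t : ℝ => C * (1 + Real.log x) ^ m * t⁻¹)
      MeasureTheory.volume 1 x := by
    apply IntervalIntegrable.const_mul
    apply ContinuousOn.intervalIntegrable
    rw [Set.uIcc_of_le hx]
    exact continuousOn_inv₀.mono fun t ht => (lt_of_lt_of_le one_pos ht.1).ne'
  have := intervalIntegral.norm_integral_le_of_norm_le (f := fun t => g t / t -
      c * (Real.log t ^ n / n.factorial / t)) hx (g := fun t : ℝ => C * (1 + Real.log x) ^ m * t⁻¹)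
      (MeasureTheory.ae_of_all _ fun t ht => ?_) hb
  · rw [Real.norm_eq_abs] at this
    refine this.trans ?_
    rw [intervalIntegral.integral_const_mul, integral_inv_of_pos one_pos (by linarith), div_one,
      pow_succ, ← mul_assoc]
    gcongr
    linarith
  · have ht0 : 0 < t := by linarith [ht.1]
    have h1 := h t ⟨ht.1.le, ht.2⟩
    have h2 : g t / t - c * (Real.log t ^ n / n.factorial / t) =
      (g t - c * Real.log t ^ n / n.factorial) * t⁻¹ := by field_simp
    rw [h2, norm_mul, Real.norm_eq_abs, Real.norm_eq_abs, abs_of_pos (inv_pos.mpr ht0)]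
    gcongr
    refine h1.trans ?_
    have := Real.log_nonneg ht.1.le
    gcongr
    exact ht.2

/-- The logarithmic means of a function of given type, by iterated integration against `dt / t`. -/
lemma jsum_asymp {κ : ℕ} {c : ℝ} {a : ArithmeticFunction ℝ} (h : IsType (κ + 1) c a) (l : ℕ) :
    ∃ C : ℝ, 0 ≤ C ∧ ∀ x : ℝ, 1 ≤ x →
      |jsum l a x - c * Real.log x ^ (κ + 1 + l) / (κ + 1 + l).factorial| ≤
        C * (1 + Real.log x) ^ (κ + l) := by
  induction l with
  | zero =>
    obtain ⟨C, hC⟩ := h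
    refine ⟨C, ?_, fun x hx => by simpa [jsum_zero] using (hC x hx).1⟩
    have := (abs_nonneg _).trans (hC 1 le_rfl).1
    simpa using this
  | succ l ih =>
    obtain ⟨C, hC0, hC⟩ := ih
    refine ⟨C, hC0, fun x hx => ?_⟩
    rw [jsum_succ l a hx]
    exact integral_div_asymp hx (intervalIntegrable_jsum_div l a hx) (fun t ht => hC t ht.1) hC0

lemma IsType.nonneg_const {κ : ℕ} {c C : ℝ} {a : ℕ → ℝ}
    (h : ∀ x : ℝ, 1 ≤ x → |psum a x - c * Real.log x ^ (κ + 1) / (κ + 1).factorial| ≤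
      C * (1 + Real.log x) ^ κ) : 0 ≤ C := by
  have := (abs_nonneg _).trans (h 1 le_rfl)
  simpa using this

lemma IsType.congr {κ : ℕ} {c c' : ℝ} {a b : ArithmeticFunction ℝ} (h : IsType κ c a)
    (hc : c = c') (hab : a = b) : IsType κ c' b := hc ▸ hab ▸ h

/-- Convolution adds the orders and multiplies the constants. -/
lemma IsType.mul {κ₁ κ₂ : ℕ} {c₁ c₂ : ℝ} {a b : ArithmeticFunction ℝ}
    (ha : IsType κ₁ c₁ a) (hb : IsType κ₂ c₂ b) : IsType (κ₁ + κ₂) (c₁ * c₂) (a * b) := by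
  have smul_case : ∀ {κ : ℕ} {c c' : ℝ} {a b : ArithmeticFunction ℝ},
      (∀ n, a n = if n = 1 then c else 0) → IsType κ c' b → IsType κ (c * c') (a * b) := by
    intro κ c c' a b ha hb
    have e : ∀ n, (a * b) n = c * b n := by
      intro n
      rcases Nat.eq_zero_or_pos n with rfl | hn
      · simp
      rw [ArithmeticFunction.mul_apply, Finset.sum_eq_single_of_mem (1, n) (by simp [hn.ne'])]
      · simp [ha]
      · rintro ⟨d, e⟩ hd hne
        have : d ≠ 1 := by
          rintro rfl
          simp at hd
          exact hne (by simp [hd])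
        simp [ha, this]
    match κ, hb with
    | 0, hb =>
      intro n
      rw [e, hb n]
      split_ifs <;> simp
    | κ + 1, ⟨C, hC⟩ =>
      refine ⟨|c| * C, fun x hx => ⟨?_, ?_⟩⟩
      · have : psum ((a * b : ArithmeticFunction ℝ) : ℕ → ℝ) x -
            c * c' * Real.log x ^ (κ + 1) / (κ + 1).factorial =
            c * (psum b x - c' * Real.log x ^ (κ + 1) / (κ + 1).factorial) := by
          rw [psum_congr (fun n _ _ => e n), psum_const_mul]; ring
        rw [this, abs_mul, mul_assoc]
        exact mul_le_mul_of_nonneg_left (hC x hx).1 (abs_nonneg _)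
      · rw [psum_congr (b := fun n => |c| * |b n|) (fun n _ _ => by rw [e n, abs_mul]),
          psum_const_mul, mul_assoc]
        exact mul_le_mul_of_nonneg_left (hC x hx).2 (abs_nonneg _)
  match κ₁, κ₂, ha, hb with
  | 0, κ₂, ha, hb => simpa using smul_case ha hb
  | κ₁ + 1, 0, ha, hb =>
    have := smul_case hb ha
    rw [mul_comm c₁, mul_comm a]
    exact this
  | κ₁ + 1, κ₂ + 1, ha, hb =>
    obtain ⟨C, hC0, hJ⟩ := jsum_asymp ha (κ₂ + 1)
    obtain ⟨C₁, hC₁⟩ := ha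
    obtain ⟨C₂, hC₂⟩ := hb
    have hC₁0 := IsType.nonneg_const fun x hx => (hC₁ x hx).1
    have hC₂0 := IsType.nonneg_const fun x hx => (hC₂ x hx).1
    rw [show κ₁ + 1 + (κ₂ + 1) = (κ₁ + κ₂ + 1) + 1 by ring]
    refine ⟨C₁ * C₂ + |c₂| * C, fun x hx => ?_⟩
    have hL := Real.log_nonneg hx
    constructor
    -- replacing the inner sums of `b` by their main term leaves a logarithmic mean of `a`
    · have h1 : |psum ((a * b : ArithmeticFunction ℝ) : ℕ → ℝ) x - c₂ * jsum (κ₂ + 1) a x| ≤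
          C₁ * C₂ * (1 + Real.log x) ^ (κ₁ + κ₂ + 1) := by
        rw [psum_mul, jsum, ← psum_const_mul, ← psum_sub]
        refine (abs_psum_le _ _).trans ?_
        refine (psum_le_psum (b := fun n => |a n| * (C₂ * (1 + Real.log x) ^ κ₂)) ?_).trans ?_
        · intro n h1 h2
          have : a n * psum b (x / n) -
              c₂ * (a n * (Real.log (x / n) ^ (κ₂ + 1) / (κ₂ + 1).factorial)) =
              a n * (psum b (x / n) - c₂ * Real.log (x / n) ^ (κ₂ + 1) / (κ₂ + 1).factorial) := by
            ring
          rw [this, abs_mul]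
          have h3 := log_div_nonneg h1 h2
          have h4 := log_div_le h1 h2
          gcongr
          refine (hC₂ _ (one_le_div_of_mem h1 h2)).1.trans ?_
          gcongr
        · rw [psum_mul_const]
          calc _ ≤ C₁ * (1 + Real.log x) ^ (κ₁ + 1) * (C₂ * (1 + Real.log x) ^ κ₂) := by
                gcongr
                exact (hC₁ x hx).2
            _ = _ := by ring
      have h2 := hJ x hx
      have e : psum ((a * b : ArithmeticFunction ℝ) : ℕ → ℝ) x -
          c₁ * c₂ * Real.log x ^ (κ₁ + κ₂ + 1 + 1) / (κ₁ + κ₂ + 1 + 1).factorial =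
          (psum ((a * b : ArithmeticFunction ℝ) : ℕ → ℝ) x - c₂ * jsum (κ₂ + 1) a x) +
          c₂ * (jsum (κ₂ + 1) a x -
            c₁ * Real.log x ^ (κ₁ + 1 + (κ₂ + 1)) / (κ₁ + 1 + (κ₂ + 1)).factorial) := by
        rw [show κ₁ + 1 + (κ₂ + 1) = (κ₁ + κ₂ + 1) + 1 by ring]; ring
      rw [e]
      refine (abs_add_le _ _).trans ?_
      rw [abs_mul, add_mul]
      refine add_le_add h1 ?_
      rw [mul_assoc]
      exact mul_le_mul_of_nonneg_left (by simpa [add_assoc] using h2) (abs_nonneg _)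
    · refine (psum_abs_mul_le a b x).trans ?_
      refine (psum_le_psum (b := fun n => |a n| * (C₂ * (1 + Real.log x) ^ (κ₂ + 1))) ?_).trans ?_
      · intro n h1 h2
        have h3 := log_div_nonneg h1 h2
        have h4 := log_div_le h1 h2
        gcongr
        refine (hC₂ _ (one_le_div_of_mem h1 h2)).2.trans ?_
        gcongr
      · rw [psum_mul_const]
        calc _ ≤ C₁ * (1 + Real.log x) ^ (κ₁ + 1) * (C₂ * (1 + Real.log x) ^ (κ₂ + 1)) := by
              gcongr
              exact (hC₁ x hx).2
          _ = C₁ * C₂ * (1 + Real.log x) ^ (κ₁ + κ₂ + 1 + 1) := by ring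
          _ ≤ _ := by
              gcongr
              have : 0 ≤ |c₂| * C := by positivity
              linarith

/-! ### Further operations on types -/

lemma one_le_one_add_log {x : ℝ} (hx : 1 ≤ x) : 1 ≤ 1 + Real.log x := by
  linarith [Real.log_nonneg hx]

lemma IsType.add {κ : ℕ} {c₁ c₂ : ℝ} {a b : ArithmeticFunction ℝ}
    (ha : IsType κ c₁ a) (hb : IsType κ c₂ b) : IsType κ (c₁ + c₂) (a + b) := by
  match κ, ha, hb with
  | 0, ha, hb =>
    intro n
    rw [ArithmeticFunction.add_apply, ha n, hb n]
    split_ifs <;> simp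
  | κ + 1, ⟨C₁, h₁⟩, ⟨C₂, h₂⟩ =>
    refine ⟨C₁ + C₂, fun x hx => ⟨?_, ?_⟩⟩
    · have e : psum ((a + b : ArithmeticFunction ℝ) : ℕ → ℝ) x = psum a x + psum b x :=
        psum_add _ _ _
      rw [e, show psum a x + psum b x - (c₁ + c₂) * Real.log x ^ (κ + 1) / (κ + 1).factorial =
        (psum a x - c₁ * Real.log x ^ (κ + 1) / (κ + 1).factorial) +
        (psum b x - c₂ * Real.log x ^ (κ + 1) / (κ + 1).factorial) by ring, add_mul]
      exact (abs_add_le _ _).trans (add_le_add (h₁ x hx).1 (h₂ x hx).1)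
    · rw [add_mul]
      refine le_trans ?_ (add_le_add (h₁ x hx).2 (h₂ x hx).2)
      rw [← psum_add]
      exact psum_le_psum fun n _ _ => abs_add_le _ _

lemma IsType.zero (κ : ℕ) : IsType κ 0 0 := by
  match κ with
  | 0 => intro n; simp
  | κ + 1 => exact ⟨0, fun x _ => by simp [psum]⟩

lemma isType_one : IsType 0 1 (1 : ArithmeticFunction ℝ) := fun n => by
  rw [ArithmeticFunction.one_apply]

/-- The arithmetic function `c` at `1` and `0` elsewhere. -/
def deltaA {R : Type*} [Zero R] (c : R) : ArithmeticFunction R :=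
  ⟨fun n => if n = 1 then c else 0, by simp⟩

lemma deltaA_mul_apply {R : Type*} [CommSemiring R] (c : R) (a : ArithmeticFunction R) (n : ℕ) :
    (deltaA c * a) n = c * a n := by
  rcases Nat.eq_zero_or_pos n with rfl | hn
  · simp
  rw [ArithmeticFunction.mul_apply, Finset.sum_eq_single_of_mem (1, n) (by simp [hn.ne'])]
  · simp [deltaA]
  · rintro ⟨d, e⟩ hd hne
    have : d ≠ 1 := by
      rintro rfl
      simp at hd
      exact hne (by simp [hd])
    simp [deltaA, this]

lemma IsType.const_mul {κ : ℕ} {c : ℝ} {a b : ArithmeticFunction ℝ} (d : ℝ)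
    (ha : IsType κ c a) (hb : ∀ n, b n = d * a n) : IsType κ (d * c) b := by
  have h : IsType 0 d (deltaA d) := fun n => rfl
  refine (h.mul ha).congr (κ := 0 + κ) rfl ?_ |> fun h => by simpa using h
  ext n
  rw [deltaA_mul_apply, hb]

lemma IsType.sum {ι : Type*} (s : Finset ι) {κ : ℕ} {c : ι → ℝ} {a : ι → ArithmeticFunction ℝ}
    (h : ∀ i ∈ s, IsType κ (c i) (a i)) : IsType κ (∑ i ∈ s, c i) (∑ i ∈ s, a i) := by
  classical
  induction s using Finset.induction_on with
  | empty => simpa using IsType.zero κ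
  | insert i s hi ih =>
    rw [Finset.sum_insert hi, Finset.sum_insert hi]
    exact (h i (by simp)).add (ih fun j hj => h j (by simp [hj]))

/-- A function of lower type is negligible. -/
lemma IsType.of_lt {κ κ' : ℕ} {c : ℝ} {a : ArithmeticFunction ℝ} (h : IsType κ c a)
    (hκ : κ < κ') : IsType κ' 0 a := by
  obtain ⟨m, rfl⟩ : ∃ m, κ' = m + 1 := ⟨κ' - 1, by omega⟩
  have key : ∃ C : ℝ, 0 ≤ C ∧ ∀ x : ℝ, 1 ≤ x →
      psum (fun n => |a n|) x ≤ C * (1 + Real.log x) ^ κ := by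
    match κ, h with
    | 0, h =>
      refine ⟨|c|, abs_nonneg _, fun x hx => ?_⟩
      have : ∀ n, |a n| = if n = 1 then |c| else 0 := fun n => by
        rw [h n]; split_ifs <;> simp
      simp only [psum, this]
      rw [Finset.sum_ite_eq']
      split_ifs <;> simp
    | κ + 1, ⟨C, hC⟩ =>
      exact ⟨C, IsType.nonneg_const fun x hx => (hC x hx).1, fun x hx => (hC x hx).2⟩
  obtain ⟨C, hC0, hC⟩ := key
  refine ⟨C, fun x hx => ⟨?_, ?_⟩⟩
  · simp only [zero_mul, zero_div, sub_zero]
    refine (abs_psum_le _ _).trans ((hC x hx).trans ?_)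
    gcongr
    · exact one_le_one_add_log hx
    · omega
  · refine (hC x hx).trans ?_
    gcongr
    exact one_le_one_add_log hx

/-- Pointwise multiplication by `log n`, a derivation for Dirichlet convolution. -/
def logMul (a : ArithmeticFunction ℝ) : ArithmeticFunction ℝ :=
  ⟨fun n => Real.log n * a n, by simp⟩

@[simp] lemma logMul_apply (a : ArithmeticFunction ℝ) (n : ℕ) :
    logMul a n = Real.log n * a n := rfl

lemma logMul_mul (a b : ArithmeticFunction ℝ) :
    logMul (a * b) = logMul a * b + a * logMul b := by
  ext n
  simp only [logMul_apply, ArithmeticFunction.add_apply, ArithmeticFunction.mul_apply,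
    Finset.mul_sum, ← Finset.sum_add_distrib]
  refine Finset.sum_congr rfl fun d hd => ?_
  obtain ⟨h1, h2⟩ := Nat.mem_divisorsAntidiagonal.mp hd
  have h3 : d.1 ≠ 0 := by rintro h; simp [h] at h1; omega
  have h4 : d.2 ≠ 0 := by rintro h; simp [h] at h1; omega
  rw [← h1]; push_cast
  rw [Real.log_mul (by exact_mod_cast h3) (by exact_mod_cast h4)]
  ring

/-- Multiplication by the logarithm acts on types as `-d/ds` acts on `c s^{-κ}`. -/
lemma IsType.logMul {κ : ℕ} {c : ℝ} {a : ArithmeticFunction ℝ} (h : IsType (κ + 1) c a) :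
    IsType (κ + 2) ((κ + 1) * c) (logMul a) := by
  obtain ⟨C', hC'0, hJ⟩ := jsum_asymp h 1
  obtain ⟨C, hC⟩ := h
  have hC0 := IsType.nonneg_const fun x hx => (hC x hx).1
  refine ⟨C + C', fun x hx => ?_⟩
  have hL := Real.log_nonneg hx
  have hx0 : 0 < x := by linarith
  constructor
  · have e : psum (MajorArcs.logMul a) x = Real.log x * psum a x - jsum 1 a x := by
      rw [jsum, ← psum_const_mul, ← psum_sub]
      refine psum_congr fun n h1 h2 => ?_
      have : (n : ℝ) ≠ 0 := by positivity
      rw [Real.log_div hx0.ne' this, logMul_apply]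
      simp; ring
    have e2 : psum (MajorArcs.logMul a) x -
        (κ + 1) * c * Real.log x ^ (κ + 1 + 1) / (κ + 1 + 1).factorial =
        Real.log x * (psum a x - c * Real.log x ^ (κ + 1) / (κ + 1).factorial) -
        (jsum 1 a x - c * Real.log x ^ (κ + 1 + 1) / (κ + 1 + 1).factorial) := by
      rw [e, Nat.factorial_succ (κ + 1)]
      have : ((κ + 1).factorial : ℝ) ≠ 0 := by positivity
      push_cast
      field_simp
      ring
    rw [e2]
    refine (abs_sub _ _).trans ?_
    rw [add_mul, abs_mul, abs_of_nonneg hL]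
    refine add_le_add ?_ (hJ x hx)
    calc _ ≤ (1 + Real.log x) * (C * (1 + Real.log x) ^ κ) := by
          gcongr
          · linarith
          · exact (hC x hx).1
      _ = _ := by ring
  · calc psum (fun n => |MajorArcs.logMul a n|) x
        ≤ psum (fun n => (1 + Real.log x) * |a n|) x := by
          refine psum_le_psum fun n h1 h2 => ?_
          have h1' : (1 : ℝ) ≤ n := by exact_mod_cast h1
          rw [logMul_apply, abs_mul, abs_of_nonneg (Real.log_nonneg h1')]
          gcongr
          have := Real.log_le_log (by linarith) h2
          linarith
      _ ≤ (1 + Real.log x) * (C * (1 + Real.log x) ^ (κ + 1)) := by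
          rw [psum_const_mul]
          gcongr
          exact (hC x hx).2
      _ = C * (1 + Real.log x) ^ (κ + 1 + 1) := by ring
      _ ≤ _ := by
          gcongr
          linarith

lemma IsType.logMul_iterate {κ : ℕ} {c : ℝ} {a : ArithmeticFunction ℝ} (h : IsType (κ + 1) c a)
    (i : ℕ) : IsType (κ + 1 + i) (((κ + i).factorial / κ.factorial : ℝ) * c)
      (MajorArcs.logMul^[i] a) := by
  induction i with
  | zero =>
    have : (κ.factorial : ℝ) ≠ 0 := by positivity
    simpa [this] using h
  | succ i ih =>
    rw [Function.iterate_succ_apply']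
    have := IsType.logMul (κ := κ + i) (by convert ih using 1; ring)
    refine (IsType.congr (κ := κ + 1 + (i + 1)) (by convert this using 1; ring) ?_ rfl)
    rw [← add_assoc, Nat.factorial_succ]
    push_cast
    ring

lemma logMul_iterate_apply (i : ℕ) (a : ArithmeticFunction ℝ) (n : ℕ) :
    logMul^[i] a n = Real.log n ^ i * a n := by
  induction i with
  | zero => simp
  | succ i ih => rw [Function.iterate_succ_apply', logMul_apply, ih]; ring

/-- The tail of a series that converges absolutely with an extra factor `log n`. -/
lemma abs_tsum_sub_psum_mul_log_le {e : ℕ → ℝ} (he0 : e 0 = 0)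
    (he : Summable fun n : ℕ => |e n| * (1 + Real.log n)) {x : ℝ} (hx : 1 ≤ x) :
    |∑' n, e n - psum e x| * Real.log x ≤ ∑' n : ℕ, |e n| * (1 + Real.log n) := by
  classical
  have hL := Real.log_nonneg hx
  have hle : ∀ n : ℕ, |e n| ≤ |e n| * (1 + Real.log n) := fun n => by
    have := Real.log_natCast_nonneg n
    nlinarith [abs_nonneg (e n)]
  have habs : Summable fun n : ℕ => |e n| :=
    Summable.of_nonneg_of_le (fun n => abs_nonneg _) hle he
  set g : ℕ → ℝ := fun n => if n ∈ Finset.Icc 1 ⌊x⌋₊ then e n else 0 with hg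
  have hgs : HasSum g (psum e x) := by
    have : HasSum g (∑ n ∈ Finset.Icc 1 ⌊x⌋₊, g n) :=
      hasSum_sum_of_ne_finset_zero fun n hn => by simp only [hg]; rw [if_neg hn]
    convert this using 1
    exact Finset.sum_congr rfl fun n hn => by simp only [hg]; rw [if_pos hn]
  have hdiff : HasSum (fun n => e n - g n) (∑' n, e n - psum e x) := habs.of_abs.hasSum.sub hgs
  have hterm : ∀ n, |e n - g n| * Real.log x ≤ |e n| * (1 + Real.log n) := by
    intro n
    by_cases hn : n ∈ Finset.Icc 1 ⌊x⌋₊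
    · simp only [hg, hn, if_true, sub_self, abs_zero, zero_mul]
      exact (abs_nonneg _).trans (hle n)
    · simp only [hg, hn, if_false, sub_zero]
      rcases Nat.eq_zero_or_pos n with h0 | h0
      · simp [h0, he0]
      · have h2 : x < n := by
          by_contra hcon
          exact hn (mem_Icc_floor_iff.mpr ⟨h0, not_lt.mp hcon⟩)
        have := Real.log_le_log (by linarith) h2.le
        gcongr
        linarith
  have hs : Summable fun n => |e n - g n| * Real.log x :=
    Summable.of_nonneg_of_le (fun n => by positivity) hterm he
  rw [← hdiff.tsum_eq, ← abs_of_nonneg hL, ← abs_mul, ← tsum_mul_right]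
  refine (norm_tsum_le_tsum_norm (f := fun n => (e n - g n) * Real.log x) ?_).trans ?_
  · simpa [abs_mul, abs_of_nonneg hL] using hs
  · simpa [abs_mul, abs_of_nonneg hL] using hs.tsum_le_tsum hterm he

/-- Convolution with an absolutely convergent factor multiplies the leading constant by the sum
of that factor. -/
lemma IsType.mul_summable {κ : ℕ} {c : ℝ} {a e : ArithmeticFunction ℝ}
    (ha : IsType (κ + 1) c a) (he : Summable fun n : ℕ => |e n| * (1 + Real.log n)) :
    IsType (κ + 1) (c * ∑' n, e n) (e * a) := by
  obtain ⟨C, hC⟩ := ha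
  have hC0 := IsType.nonneg_const fun x hx => (hC x hx).1
  set M := ∑' n : ℕ, |e n| * (1 + Real.log n) with hM
  have hterm : ∀ n : ℕ, 0 ≤ |e n| * (1 + Real.log n) := fun n => by
    have := Real.log_natCast_nonneg n
    positivity
  have hM0 : 0 ≤ M := tsum_nonneg hterm
  have habs : Summable fun n : ℕ => |e n| := by
    refine Summable.of_nonneg_of_le (fun n => abs_nonneg _) (fun n => ?_) he
    have := Real.log_natCast_nonneg n
    nlinarith [abs_nonneg (e n)]
  have hpart : ∀ x : ℝ, psum (fun n => |e n| * (1 + Real.log n)) x ≤ M := fun x =>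
    he.sum_le_tsum _ fun n _ => hterm n
  have hpart1 : ∀ x : ℝ, psum (fun n => |e n|) x ≤ M := fun x => by
    refine (psum_le_psum fun n h1 h2 => ?_).trans (hpart x)
    have := Real.log_natCast_nonneg n
    nlinarith [abs_nonneg (e n)]
  refine ⟨C * M + (κ + 2) * (|c| * M), fun x hx => ?_⟩
  have hL := Real.log_nonneg hx
  have hx0 : 0 < x := by linarith
  constructor
  · -- replace `psum a (x / n)` by its main term, then `log (x / n)` by `log x`
    have h1 : |psum ((e * a : ArithmeticFunction ℝ) : ℕ → ℝ) x -
        psum (fun n => e n * (c * Real.log (x / n) ^ (κ + 1) / (κ + 1).factorial)) x| ≤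
        C * M * (1 + Real.log x) ^ κ := by
      rw [psum_mul, ← psum_sub]
      refine (abs_psum_le _ _).trans ?_
      refine (psum_le_psum (b := fun n => |e n| * (C * (1 + Real.log x) ^ κ)) ?_).trans ?_
      · intro n h1 h2
        rw [← mul_sub, abs_mul]
        have h3 := log_div_nonneg h1 h2
        have h4 := log_div_le h1 h2
        gcongr
        refine (hC _ (one_le_div_of_mem h1 h2)).1.trans ?_
        gcongr
      · rw [psum_mul_const]
        calc _ ≤ M * (C * (1 + Real.log x) ^ κ) := by
              gcongr
              exact hpart1 x
          _ = _ := by ring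
    have h2 : |psum (fun n => e n * (c * Real.log (x / n) ^ (κ + 1) / (κ + 1).factorial)) x -
        psum (fun n => e n * (c * Real.log x ^ (κ + 1) / (κ + 1).factorial)) x| ≤
        (κ + 1) * (|c| * M) * (1 + Real.log x) ^ κ := by
      rw [← psum_sub]
      refine (abs_psum_le _ _).trans ?_
      refine (psum_le_psum (b := fun n => (κ + 1) * |c| * (1 + Real.log x) ^ κ *
        (|e n| * (1 + Real.log n))) ?_).trans ?_
      · intro n h1 h2
        have hn : (1 : ℝ) ≤ n := by exact_mod_cast h1
        have h3 := log_div_nonneg h1 h2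
        have h4 := log_div_le h1 h2
        have h5 : Real.log x - Real.log (x / n) = Real.log n := by
          rw [Real.log_div hx0.ne' (by linarith)]; ring
        rw [← mul_sub, abs_mul]
        have h6 : |Real.log (x / n) ^ (κ + 1) - Real.log x ^ (κ + 1)| ≤
            (κ + 1) * (1 + Real.log x) ^ κ * (1 + Real.log n) := by
          rw [abs_sub_comm]
          have := abs_pow_sub_pow_le (Real.log x) (Real.log (x / n)) (κ + 1)
          refine this.trans ?_
          rw [h5, max_eq_left (by rwa [abs_of_nonneg h3, abs_of_nonneg hL]),
            abs_of_nonneg hL, abs_of_nonneg (Real.log_nonneg hn)]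
          push_cast
          have := Real.log_nonneg hn
          calc Real.log n * (κ + 1) * Real.log x ^ (κ + 1 - 1) ≤
              (1 + Real.log n) * (κ + 1) * (1 + Real.log x) ^ κ := by
                simp only [Nat.add_sub_cancel]
                gcongr <;> linarith
            _ = _ := by ring
        have h7 : |c * Real.log (x / n) ^ (κ + 1) / (κ + 1).factorial -
            c * Real.log x ^ (κ + 1) / (κ + 1).factorial| ≤
            |c| * ((κ + 1) * (1 + Real.log x) ^ κ * (1 + Real.log n)) := by
          rw [← sub_div, ← mul_sub, abs_div, abs_mul]
          have : (1 : ℝ) ≤ |((κ + 1).factorial : ℝ)| := by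
            rw [abs_of_nonneg (by positivity)]
            exact_mod_cast Nat.one_le_iff_ne_zero.mpr (Nat.factorial_ne_zero _)
          refine (div_le_self (by positivity) this).trans ?_
          gcongr
        calc _ ≤ |e n| * (|c| * ((κ + 1) * (1 + Real.log x) ^ κ * (1 + Real.log n))) := by
              gcongr
          _ = _ := by ring
      · rw [psum_const_mul]
        calc _ ≤ (κ + 1) * |c| * (1 + Real.log x) ^ κ * M := by
              gcongr
              exact hpart x
          _ = _ := by ring
    have h3 : |psum e x * (c * Real.log x ^ (κ + 1) / (κ + 1).factorial) -
        (c * ∑' n, e n) * Real.log x ^ (κ + 1) / (κ + 1).factorial| ≤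
        |c| * M * (1 + Real.log x) ^ κ := by
      have hsplit := abs_tsum_sub_psum_mul_log_le e.map_zero he hx
      have e3 : psum e x * (c * Real.log x ^ (κ + 1) / (κ + 1).factorial) -
        (c * ∑' n, e n) * Real.log x ^ (κ + 1) / (κ + 1).factorial =
        -(c * ((∑' n, e n - psum e x) * Real.log x) * Real.log x ^ κ / (κ + 1).factorial) := by
        ring
      rw [e3, abs_neg, abs_div, abs_mul, abs_mul, abs_mul, abs_of_nonneg hL]
      have : (1 : ℝ) ≤ |((κ + 1).factorial : ℝ)| := by
        rw [abs_of_nonneg (by positivity)]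
        exact_mod_cast Nat.one_le_iff_ne_zero.mpr (Nat.factorial_ne_zero _)
      refine (div_le_self (by positivity) this).trans ?_
      rw [abs_of_nonneg (pow_nonneg hL κ)]
      gcongr
      linarith
    rw [psum_mul_const] at h2
    calc _ ≤ C * M * (1 + Real.log x) ^ κ + (κ + 1) * (|c| * M) * (1 + Real.log x) ^ κ +
          |c| * M * (1 + Real.log x) ^ κ := by
          refine le_trans ?_ (add_le_add (add_le_add h1 h2) h3)
          refine le_trans (le_of_eq ?_) (abs_add_three _ _ _)
          congr 1; ring
      _ = _ := by ring
  · refine (psum_abs_mul_le e a x).trans ?_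
    refine (psum_le_psum (b := fun n => |e n| * (C * (1 + Real.log x) ^ (κ + 1))) ?_).trans ?_
    · intro n h1 h2
      have h3 := log_div_nonneg h1 h2
      have h4 := log_div_le h1 h2
      gcongr
      refine (hC _ (one_le_div_of_mem h1 h2)).2.trans ?_
      gcongr
    · rw [psum_mul_const]
      calc _ ≤ M * (C * (1 + Real.log x) ^ (κ + 1)) := by
            gcongr
            exact hpart1 x
        _ = C * M * (1 + Real.log x) ^ (κ + 1) := by ring
        _ ≤ _ := by
            gcongr
            have : 0 ≤ (κ + 2) * (|c| * M) := by positivity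
            linarith

open scoped ArithmeticFunction.Moebius ArithmeticFunction.vonMangoldt ArithmeticFunction.zeta

/-! ### Sums with the weight `1/n` -/

/-- Pointwise multiplication of an arithmetic function by `φ`. -/
def twist {R : Type*} [CommSemiring R] (φ : ℕ → R) (f : ArithmeticFunction R) :
    ArithmeticFunction R := ⟨fun n => φ n * f n, by simp⟩

@[simp] lemma twist_apply {R : Type*} [CommSemiring R] (φ : ℕ → R) (f : ArithmeticFunction R)
    (n : ℕ) : twist φ f n = φ n * f n := rfl

lemma twist_mul {R : Type*} [CommSemiring R] {φ : ℕ → R}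
    (hφ : ∀ a b, a ≠ 0 → b ≠ 0 → φ (a * b) = φ a * φ b) (f g : ArithmeticFunction R) :
    twist φ (f * g) = twist φ f * twist φ g := by
  ext n
  simp only [twist_apply, ArithmeticFunction.mul_apply, Finset.mul_sum]
  refine Finset.sum_congr rfl fun d hd => ?_
  obtain ⟨h1, h2⟩ := Nat.mem_divisorsAntidiagonal.mp hd
  have h3 : d.1 ≠ 0 := by rintro h; simp [h] at h1; omega
  have h4 : d.2 ≠ 0 := by rintro h; simp [h] at h1; omega
  rw [← h1, hφ _ _ h3 h4]
  ring

lemma twist_one {R : Type*} [CommSemiring R] {φ : ℕ → R} (h1 : φ 1 = 1) :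
    twist φ (1 : ArithmeticFunction R) = 1 := by
  ext n
  rw [twist_apply, ArithmeticFunction.one_apply]
  split_ifs with h
  · simp [h, h1]
  · simp

/-- The weight `1 / n`. -/
def invN (n : ℕ) : ℝ := (n : ℝ)⁻¹

lemma invN_mul (a b : ℕ) : invN (a * b) = invN a * invN b := by
  simp [invN, mul_comm]

@[simp] lemma invN_one : invN 1 = 1 := by simp [invN]

lemma logMul_twist (φ : ℕ → ℝ) (a : ArithmeticFunction ℝ) :
    logMul (twist φ a) = twist φ (logMul a) := by
  ext n; simp; ring

/-- `∑_{n ≤ x} 1/n = log x + O(1)`. -/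
lemma isType_invN : IsType 1 1 (twist invN (ζ : ArithmeticFunction ℝ)) := by
  have e : ∀ x : ℝ, psum (twist invN (ζ : ArithmeticFunction ℝ)) x = harmonic ⌊x⌋₊ := by
    intro x
    rw [harmonic_eq_sum_Icc]
    push_cast
    refine Finset.sum_congr rfl fun n hn => ?_
    have : n ≠ 0 := by have := (Finset.mem_Icc.mp hn).1; omega
    simp [invN, this]
  refine ⟨1, fun x hx => ?_⟩
  have h1 := log_le_harmonic_floor x (by linarith)
  have h2 := harmonic_floor_le_one_add_log x hx
  constructor
  · rw [e]
    simp only [zero_add, pow_one, Nat.factorial_one, Nat.cast_one, div_one, one_mul, pow_zero]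
    rw [abs_le]; constructor <;> linarith
  · have : ∀ n, |twist invN (ζ : ArithmeticFunction ℝ) n| =
        twist invN (ζ : ArithmeticFunction ℝ) n := by
      intro n
      rw [abs_of_nonneg]
      simp only [twist_apply, ArithmeticFunction.natCoe_apply, invN]
      positivity
    simp only [this]
    rw [e]
    simpa using h2

lemma psum_zeta (x : ℝ) : psum ((ζ : ArithmeticFunction ℝ) : ℕ → ℝ) x = ⌊x⌋₊ := by
  have : psum ((ζ : ArithmeticFunction ℝ) : ℕ → ℝ) x = psum (fun _ => 1) x :=
    psum_congr fun n h1 _ => by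
      have : n ≠ 0 := by omega
      simp [this]
  rw [this]
  simp [psum]

lemma psum_log_bounds {x : ℝ} (hx : 1 ≤ x) :
    |psum (fun n => Real.log n) x - x * Real.log x| ≤ x + (1 + Real.log x) := by
  have hL := Real.log_nonneg hx
  have hx0 : 0 < x := by linarith
  have e : psum (fun n => Real.log n) x =
      Real.log x * ⌊x⌋₊ - jsum 1 (ζ : ArithmeticFunction ℝ) x := by
    rw [← psum_zeta x, ← psum_const_mul, jsum, ← psum_sub]
    refine psum_congr fun n h1 h2 => ?_
    have hn : n ≠ 0 := by omega
    rw [Real.log_div hx0.ne' (by exact_mod_cast hn)]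
    simp [hn]
  have h1 : jsum 1 (ζ : ArithmeticFunction ℝ) x ≤ x := by
    rw [jsum_succ 0 _ hx]
    calc _ ≤ ∫ t in (1 : ℝ)..x, (1 : ℝ) := by
          apply intervalIntegral.integral_mono_on hx (intervalIntegrable_jsum_div 0 _ hx) (by simp)
          intro t ht
          rw [jsum_zero, psum_zeta, div_le_one (by linarith [ht.1])]
          exact Nat.floor_le (by linarith [ht.1])
      _ ≤ x := by simp
  have h0 : 0 ≤ jsum 1 (ζ : ArithmeticFunction ℝ) x := by
    rw [jsum, psum]
    refine Finset.sum_nonneg fun n hn => ?_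
    obtain ⟨h1, h2⟩ := mem_Icc_floor_iff.mp hn
    have := log_div_nonneg h1 h2
    simp only [ArithmeticFunction.natCoe_apply]
    positivity
  have h2 := Nat.floor_le hx0.le
  have h3 := (Nat.lt_floor_add_one x).le
  rw [e, abs_le]
  constructor <;> nlinarith

/-- Mertens' theorem `∑_{n ≤ x} Λ(n)/n = log x + O(1)`. -/
lemma isType_vonMangoldt : IsType 1 1 (twist invN Λ) := by
  obtain ⟨C, hC⟩ : ∃ C : ℝ, ∀ x : ℝ, 1 ≤ x → |psum (twist invN Λ) x - Real.log x| ≤ C := by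
    refine ⟨Real.log 4 + 4 + 3, fun x hx => ?_⟩
    have hL := Real.log_nonneg hx
    have hx0 : 0 < x := by linarith
    have h1 : psum (fun n => Real.log n) x = psum (fun m => Λ m * ⌊x / m⌋₊) x := by
      have : psum (fun n => Real.log n) x = psum ((Λ * ζ : ArithmeticFunction ℝ) : ℕ → ℝ) x := by
        rw [ArithmeticFunction.vonMangoldt_mul_zeta]; rfl
      rw [this, psum_mul]
      refine psum_congr fun n h1 h2 => ?_
      rw [psum_zeta]
    have h2 : |x * psum (twist invN Λ) x - psum (fun m => Λ m * ⌊x / m⌋₊) x| ≤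
        (Real.log 4 + 4) * x := by
      rw [← psum_const_mul, ← psum_sub]
      refine (abs_psum_le _ _).trans ?_
      refine le_trans ?_ (Chebyshev.psi_le_const_mul_self hx0.le)
      rw [Chebyshev.psi, ← Finset.Icc_add_one_left_eq_Ioc]
      refine psum_le_psum (b := fun n => Λ n) fun n h1 h2 => ?_
      have hn : (0 : ℝ) < n := by exact_mod_cast h1
      have h3 := Nat.floor_le (show 0 ≤ x / n by positivity)
      have h4 := (Nat.lt_floor_add_one (x / n)).le
      have : x * twist invN Λ n - Λ n * ⌊x / n⌋₊ = Λ n * (x / n - ⌊x / n⌋₊) := by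
        simp [invN]; ring
      rw [this, abs_mul, abs_of_nonneg ArithmeticFunction.vonMangoldt_nonneg,
        abs_of_nonneg (by linarith)]
      have := ArithmeticFunction.vonMangoldt_nonneg (n := n)
      nlinarith
    have h3 := psum_log_bounds hx
    rw [h1] at h3
    have hlog : 1 + Real.log x ≤ x := by linarith [Real.log_le_sub_one_of_pos hx0]
    have h4 : |x * (psum (twist invN Λ) x - Real.log x)| ≤ (Real.log 4 + 4 + 3) * x := by
      have : x * (psum (twist invN Λ) x - Real.log x) =
        (x * psum (twist invN Λ) x - psum (fun m => Λ m * ⌊x / m⌋₊) x) +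
        (psum (fun m => Λ m * ⌊x / m⌋₊) x - x * Real.log x) := by ring
      rw [this]
      refine (abs_add_le _ _).trans ?_
      linarith
    rw [abs_mul, abs_of_pos hx0] at h4
    nlinarith
  have habs : ∀ n, |twist invN Λ n| = twist invN Λ n := by
    intro n
    rw [abs_of_nonneg]
    have := ArithmeticFunction.vonMangoldt_nonneg (n := n)
    simp only [twist_apply, invN]
    positivity
  refine ⟨C + 1, fun x hx => ⟨?_, ?_⟩⟩
  · have := hC x hx
    simp
    linarith
  · simp only [habs]
    have := (abs_le.mp (hC x hx)).2
    have hL := Real.log_nonneg hx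
    have hC0 := (abs_nonneg _).trans (hC x hx)
    have h : psum (twist invN Λ) x ≤ (C + 1) * (1 + Real.log x) := by nlinarith
    have e : psum (fun n => twist invN Λ n) x = psum (twist invN Λ) x := rfl
    rw [e, zero_add, pow_one]
    exact h

/-- The generalised von Mangoldt functions `(log)^j * μ`. -/
def vm (j : ℕ) : ArithmeticFunction ℝ :=
  logMul^[j] (ζ : ArithmeticFunction ℝ) * (μ : ArithmeticFunction ℝ)

lemma logMul_zeta : logMul (ζ : ArithmeticFunction ℝ) = ArithmeticFunction.log := by
  ext n
  rcases Nat.eq_zero_or_pos n with rfl | h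
  · simp
  · have : n ≠ 0 := by omega
    simp [this, ArithmeticFunction.log_apply]

lemma logMul_one : logMul (1 : ArithmeticFunction ℝ) = 0 := by
  ext n
  rw [logMul_apply, ArithmeticFunction.one_apply]
  split_ifs with h <;> simp [h]

lemma logMul_moebius : logMul (μ : ArithmeticFunction ℝ) = -((μ : ArithmeticFunction ℝ) * Λ) := by
  have h1 := logMul_mul (μ : ArithmeticFunction ℝ) (ζ : ArithmeticFunction ℝ)
  rw [ArithmeticFunction.coe_moebius_mul_coe_zeta, logMul_one, logMul_zeta,
    ← ArithmeticFunction.vonMangoldt_mul_zeta] at h1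
  have h2 : (logMul (μ : ArithmeticFunction ℝ) + (μ : ArithmeticFunction ℝ) * Λ) *
      (ζ : ArithmeticFunction ℝ) * (μ : ArithmeticFunction ℝ) = 0 := by
    rw [add_mul, mul_assoc (μ : ArithmeticFunction ℝ), ← h1, zero_mul]
  rw [mul_assoc, ArithmeticFunction.coe_zeta_mul_coe_moebius, mul_one] at h2
  exact eq_neg_of_add_eq_zero_left h2

lemma vm_zero : vm 0 = 1 := by
  simp [vm, ArithmeticFunction.coe_zeta_mul_coe_moebius]

lemma vm_succ (j : ℕ) : vm (j + 1) = logMul (vm j) + vm j * Λ := by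
  simp only [vm, Function.iterate_succ_apply', logMul_mul, logMul_moebius]
  ring

/-- `∑_{n ≤ x} ((log)^j * μ)(n) / n = (log x)^j + O((log x)^{j-1})`. -/
lemma isType_vm (j : ℕ) : IsType j j.factorial (twist invN (vm j)) := by
  have hmul : ∀ a b, a ≠ 0 → b ≠ 0 → invN (a * b) = invN a * invN b := fun a b _ _ => invN_mul a b
  induction j with
  | zero =>
    rw [vm_zero, twist_one invN_one]
    simpa using isType_one
  | succ j ih =>
    have e : twist invN (vm (j + 1)) =
        logMul (twist invN (vm j)) + twist invN (vm j) * twist invN Λ := by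
      rw [vm_succ, logMul_twist, ← twist_mul hmul]
      ext n; simp [mul_add]
    rw [e]
    have h2 := ih.mul isType_vonMangoldt
    match j, ih, h2 with
    | 0, ih, h2 =>
      have h3 : logMul (twist invN (vm 0)) = 0 := by
        rw [vm_zero, twist_one invN_one, logMul_one]
      rw [h3, zero_add]
      simpa using h2
    | j + 1, ih, h2 =>
      refine (ih.logMul.add h2).congr ?_ rfl
      rw [Nat.factorial_succ (j + 1)]
      push_cast
      ring

/-! ### Arithmetic functions with values in formal power series in two variables -/

/-- Formal power series in two variables, an inner variable `z` and an outer variable `w`. -/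
abbrev Ser2 := PowerSeries (PowerSeries ℝ)

/-- The coefficient of `z^i w^j`. -/
def cf (i j : ℕ) (F : Ser2) : ℝ := PowerSeries.coeff i (PowerSeries.coeff j F)

/-- A series in one variable as a series in `z`. -/
def inZ : PowerSeries ℝ →+* Ser2 := PowerSeries.C

/-- A series in one variable as a series in `w`. -/
def inW : PowerSeries ℝ →+* Ser2 := PowerSeries.map PowerSeries.C

/-- A real number as a constant series. -/
def inC : ℝ →+* Ser2 := PowerSeries.C.comp PowerSeries.C

lemma cf_mul (i j : ℕ) (F G : Ser2) : cf i j (F * G) =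
    ∑ q ∈ Finset.HasAntidiagonal.antidiagonal j, ∑ p ∈ Finset.HasAntidiagonal.antidiagonal i, cf p.1 q.1 F * cf p.2 q.2 G := by
  simp [cf, PowerSeries.coeff_mul]

lemma cf_add (i j : ℕ) (F G : Ser2) : cf i j (F + G) = cf i j F + cf i j G := by simp [cf]

@[simp] lemma cf_zero (i j : ℕ) : cf i j 0 = 0 := by simp [cf]

lemma cf_inZ_mul_inW (i j : ℕ) (a b : PowerSeries ℝ) :
    cf i j (inZ a * inW b) = PowerSeries.coeff i a * PowerSeries.coeff j b := by
  simp [cf, inZ, inW]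

lemma cf_inC_mul (i j : ℕ) (r : ℝ) (F : Ser2) : cf i j (inC r * F) = r * cf i j F := by
  simp [cf, inC]

lemma cf_one (i j : ℕ) : cf i j 1 = if i = 0 ∧ j = 0 then 1 else 0 := by
  have := cf_inZ_mul_inW i j 1 1
  rw [map_one, map_one, one_mul] at this
  rw [this, PowerSeries.coeff_one, PowerSeries.coeff_one]
  split_ifs <;> simp_all

lemma ser2_ext {F G : Ser2} (h : ∀ i j, cf i j F = cf i j G) : F = G := by
  ext j i
  exact h i j

/-- Application of a ring homomorphism to the values of an arithmetic function. -/
def mapA {R S : Type*} [CommSemiring R] [CommSemiring S] (f : R →+* S)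
    (a : ArithmeticFunction R) : ArithmeticFunction S := ⟨fun n => f (a n), by simp⟩

@[simp] lemma mapA_apply {R S : Type*} [CommSemiring R] [CommSemiring S] (f : R →+* S)
    (a : ArithmeticFunction R) (n : ℕ) : mapA f a n = f (a n) := rfl

lemma mapA_mul {R S : Type*} [CommSemiring R] [CommSemiring S] (f : R →+* S)
    (a b : ArithmeticFunction R) : mapA f (a * b) = mapA f a * mapA f b := by
  ext n; simp [ArithmeticFunction.mul_apply, map_sum]

lemma mapA_one {R S : Type*} [CommSemiring R] [CommSemiring S] (f : R →+* S) :
    mapA f 1 = 1 := by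
  ext n; simp only [mapA_apply, ArithmeticFunction.one_apply]; split_ifs <;> simp

lemma mapA_pow {R S : Type*} [CommSemiring R] [CommSemiring S] (f : R →+* S)
    (a : ArithmeticFunction R) (k : ℕ) : mapA f (a ^ k) = mapA f a ^ k := by
  induction k with
  | zero => simp [mapA_one]
  | succ k ih => rw [pow_succ, pow_succ, mapA_mul, ih]

lemma mapA_zeta {R S : Type*} [CommSemiring R] [CommSemiring S] (f : R →+* S) :
    mapA f (ζ : ArithmeticFunction R) = (ζ : ArithmeticFunction S) := by
  ext n; simp

lemma mapA_moebius {R S : Type*} [CommRing R] [CommRing S] (f : R →+* S) :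
    mapA f (μ : ArithmeticFunction R) = (μ : ArithmeticFunction S) := by
  ext n; simp

/-- The coefficient of `z^i w^j` of an arithmetic function with values in power series. -/
def cfA (i j : ℕ) (F : ArithmeticFunction Ser2) : ArithmeticFunction ℝ :=
  ⟨fun n => cf i j (F n), by simp⟩

@[simp] lemma cfA_apply (i j : ℕ) (F : ArithmeticFunction Ser2) (n : ℕ) :
    cfA i j F n = cf i j (F n) := rfl

lemma cf_sum {ι : Type*} (s : Finset ι) (F : ι → Ser2) (i j : ℕ) :
    cf i j (∑ x ∈ s, F x) = ∑ x ∈ s, cf i j (F x) := by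
  simp [cf, map_sum]

lemma arithmeticFunction_sum_apply {R ι : Type*} [CommSemiring R] (s : Finset ι)
    (f : ι → ArithmeticFunction R) (n : ℕ) : (∑ x ∈ s, f x) n = ∑ x ∈ s, f x n := by
  classical
  induction s using Finset.induction_on with
  | empty => simp
  | insert i s hi ih => rw [Finset.sum_insert hi, Finset.sum_insert hi,
      ArithmeticFunction.add_apply, ih]

lemma cfA_mul (i j : ℕ) (F G : ArithmeticFunction Ser2) : cfA i j (F * G) =
    ∑ q ∈ Finset.HasAntidiagonal.antidiagonal j, ∑ p ∈ Finset.HasAntidiagonal.antidiagonal i,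
      cfA p.1 q.1 F * cfA p.2 q.2 G := by
  ext n
  simp only [arithmeticFunction_sum_apply, cfA_apply, ArithmeticFunction.mul_apply, cf_sum, cf_mul]
  rw [Finset.sum_comm]
  refine Finset.sum_congr rfl fun q _ => ?_
  rw [Finset.sum_comm]

/-- `F` has symbol `(κ, c)`: for all `i, j`, the coefficient of `z^i w^j` of `F` is of type
`(κ + i + j, c_{ij})`. Thus the sums of `F` have, up to lower order terms, the Laplace transform
`s^{-κ} c(z/s, w/s)`. -/
def HasSymbol (κ : ℕ) (F : ArithmeticFunction Ser2) (c : Ser2) : Prop :=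
  ∀ i j, IsType (κ + i + j) (cf i j c) (cfA i j F)

lemma HasSymbol.mul {κ₁ κ₂ : ℕ} {F G : ArithmeticFunction Ser2} {c d : Ser2}
    (hF : HasSymbol κ₁ F c) (hG : HasSymbol κ₂ G d) : HasSymbol (κ₁ + κ₂) (F * G) (c * d) := by
  intro i j
  rw [cf_mul, cfA_mul]
  refine IsType.sum _ fun q hq => IsType.sum _ fun p hp => ?_
  have := (hF p.1 q.1).mul (hG p.2 q.2)
  rw [Finset.HasAntidiagonal.mem_antidiagonal] at hp hq
  convert this using 1
  omega

lemma HasSymbol.one : HasSymbol 0 1 1 := by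
  intro i j
  have e : cfA i j 1 = deltaA (cf i j 1) := by
    ext n
    simp only [cfA_apply, ArithmeticFunction.one_apply, deltaA, ArithmeticFunction.coe_mk]
    split_ifs <;> simp
  rw [e, cf_one]
  split_ifs with h
  · rw [h.1, h.2]
    exact fun n => rfl
  · have : deltaA (0 : ℝ) = 0 := by ext n; simp [deltaA]
    rw [this]
    exact IsType.zero _

lemma HasSymbol.pow {κ : ℕ} {F : ArithmeticFunction Ser2} {c : Ser2} (hF : HasSymbol κ F c)
    (m : ℕ) : HasSymbol (m * κ) (F ^ m) (c ^ m) := by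
  induction m with
  | zero => simpa using HasSymbol.one
  | succ m ih =>
    rw [pow_succ, pow_succ, add_mul, one_mul]
    exact ih.mul hF

/-- Convolution with an absolutely convergent factor only changes the leading constants. -/
lemma HasSymbol.isType_mul_summable {κ : ℕ} {G E : ArithmeticFunction Ser2} {c : Ser2}
    (hG : HasSymbol (κ + 1) G c)
    (hE : ∀ i j, Summable fun n : ℕ => |cf i j (E n)| * (1 + Real.log n)) (i j : ℕ) :
    IsType (κ + 1 + i + j) (cf i j c * ∑' n, cf 0 0 (E n)) (cfA i j (E * G)) := by
  rw [cfA_mul]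
  have key : ∀ q ∈ Finset.HasAntidiagonal.antidiagonal j, ∀ p ∈ Finset.HasAntidiagonal.antidiagonal i,
      IsType (κ + 1 + i + j)
        (if q = (0, j) then if p = (0, i) then cf i j c * ∑' n, cf 0 0 (E n) else 0 else 0)
        (cfA p.1 q.1 E * cfA p.2 q.2 G) := by
    rintro ⟨q1, q2⟩ hq ⟨p1, p2⟩ hp
    rw [Finset.HasAntidiagonal.mem_antidiagonal] at hp hq
    dsimp only at hp hq ⊢
    have h1 := hG p2 q2
    rw [show κ + 1 + p2 + q2 = (κ + p2 + q2) + 1 by ring] at h1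
    have h2 := h1.mul_summable (e := cfA p1 q1 E) (hE p1 q1)
    by_cases h : q1 = 0 ∧ p1 = 0
    · obtain ⟨rfl, rfl⟩ := h
      obtain rfl : q2 = j := by omega
      obtain rfl : p2 = i := by omega
      simp only [if_true]
      rw [show κ + 1 + p2 + q2 = κ + p2 + q2 + 1 by ring]
      exact h2
    · have h3 : ¬ ((q1, q2) = (0, j) ∧ (p1, p2) = (0, i)) := by
        rintro ⟨e1, e2⟩
        simp only [Prod.mk.injEq] at e1 e2
        exact h ⟨e1.1, e2.1⟩
      have h4 : (if (q1, q2) = (0, j) then if (p1, p2) = (0, i) then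
          cf i j c * ∑' n, cf 0 0 (E n) else 0 else 0) = 0 := by
        split_ifs with e1 e2
        · exact absurd ⟨e1, e2⟩ h3
        · rfl
        · rfl
      rw [h4]
      exact h2.of_lt (by omega)
  have := IsType.sum _ fun q hq => IsType.sum _ fun p hp => key q hq p hp
  refine this.congr ?_ rfl
  rw [Finset.sum_eq_single_of_mem (0, j) (by simp)]
  · rw [Finset.sum_eq_single_of_mem (0, i) (by simp)]
    · simp
    · intro p _ hp
      simp [hp]
  · intro q _ hq
    simp [hq]

/-! ### The powers `n^{-z}` as formal power series -/

/-- The power series `n^{-z} = ∑ (-log n)^i z^i / i!`. -/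
def pw (n : ℕ) : PowerSeries ℝ := PowerSeries.rescale (-Real.log n) (PowerSeries.exp ℝ)

lemma coeff_pw (n i : ℕ) : PowerSeries.coeff i (pw n) = (-Real.log n) ^ i / i.factorial := by
  simp [pw, PowerSeries.coeff_rescale, PowerSeries.coeff_exp, div_eq_mul_inv]

lemma pw_mul {a b : ℕ} (ha : a ≠ 0) (hb : b ≠ 0) : pw (a * b) = pw a * pw b := by
  rw [pw, pw, pw, PowerSeries.exp_mul_exp_eq_exp_add]
  push_cast
  rw [Real.log_mul (by exact_mod_cast ha) (by exact_mod_cast hb)]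
  ring_nf

lemma pw_one : pw 1 = 1 := by
  ext i
  rw [coeff_pw, PowerSeries.coeff_one]
  split_ifs with h <;> simp [h]

/-- The weight `n^{-1}`. -/
def wt0 (n : ℕ) : Ser2 := inC (invN n)

/-- The weight `n^{-1-z}`. -/
def wtZ (n : ℕ) : Ser2 := inC (invN n) * inZ (pw n)

/-- The weight `n^{-1-w}`. -/
def wtW (n : ℕ) : Ser2 := inC (invN n) * inW (pw n)

/-- The weight `n^{-1-z-w}`. -/
def wtZW (n : ℕ) : Ser2 := inC (invN n) * (inZ (pw n) * inW (pw n))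

lemma wt0_mul (a b : ℕ) (_ : a ≠ 0) (_ : b ≠ 0) : wt0 (a * b) = wt0 a * wt0 b := by
  simp [wt0, invN_mul]
lemma wtZ_mul (a b : ℕ) (ha : a ≠ 0) (hb : b ≠ 0) : wtZ (a * b) = wtZ a * wtZ b := by
  simp only [wtZ, invN_mul, pw_mul ha hb, map_mul]; ring
lemma wtW_mul (a b : ℕ) (ha : a ≠ 0) (hb : b ≠ 0) : wtW (a * b) = wtW a * wtW b := by
  simp only [wtW, invN_mul, pw_mul ha hb, map_mul]; ring
lemma wtZW_mul (a b : ℕ) (ha : a ≠ 0) (hb : b ≠ 0) : wtZW (a * b) = wtZW a * wtZW b := by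
  simp only [wtZW, invN_mul, pw_mul ha hb, map_mul]; ring

lemma wt0_one : wt0 1 = 1 := by simp [wt0]
lemma wtZ_one : wtZ 1 = 1 := by simp [wtZ, pw_one]
lemma wtW_one : wtW 1 = 1 := by simp [wtW, pw_one]
lemma wtZW_one : wtZW 1 = 1 := by simp [wtZW, pw_one]

lemma twist_zeta_mul_twist_moebius {R : Type*} [CommRing R] {φ : ℕ → R}
    (hφ : ∀ a b, a ≠ 0 → b ≠ 0 → φ (a * b) = φ a * φ b) (h1 : φ 1 = 1) :
    twist φ (ζ : ArithmeticFunction R) * twist φ (μ : ArithmeticFunction R) = 1 := by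
  rw [← twist_mul hφ, ArithmeticFunction.coe_zeta_mul_coe_moebius, twist_one h1]

/-! ### Symbols of the basic factors -/

/-- The power series `1 / (1 + z + w)`. -/
def symS : Ser2 :=
  PowerSeries.mk fun j => PowerSeries.mk fun i => (-1) ^ (i + j) * ((i + j).choose i : ℝ)

/-- The variable `z`. -/
def varZ : Ser2 := inZ PowerSeries.X

/-- The variable `w`. -/
def varW : Ser2 := PowerSeries.X

lemma cf_symS (i j : ℕ) : cf i j symS = (-1) ^ (i + j) * ((i + j).choose i : ℝ) := by
  simp [cf, symS]

lemma cf_varZ_mul (i j : ℕ) (F : Ser2) :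
    cf i j (varZ * F) = if i = 0 then 0 else cf (i - 1) j F := by
  cases i <;> simp [cf, varZ, inZ, PowerSeries.coeff_succ_X_mul]

lemma cf_varW_mul (i j : ℕ) (F : Ser2) :
    cf i j (varW * F) = if j = 0 then 0 else cf i (j - 1) F := by
  cases j <;> simp [cf, varW, PowerSeries.coeff_succ_X_mul]

lemma one_add_varZ_add_varW_mul_symS : (1 + varZ + varW) * symS = 1 := by
  apply ser2_ext
  intro i j
  rw [add_mul, add_mul, one_mul, cf_add, cf_add, cf_varZ_mul, cf_varW_mul, cf_one]
  simp only [cf_symS]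
  rcases i with _ | i <;> rcases j with _ | j
  · simp
  · simp [pow_succ]
  · simp [pow_succ]
  · simp only [Nat.add_sub_cancel, Nat.succ_ne_zero, false_and, if_false]
    rw [show i + 1 + (j + 1) = (i + j + 1) + 1 by ring, Nat.choose_succ_succ,
      show i + (j + 1) = i + j + 1 by ring, show i + 1 + j = i + j + 1 by ring]
    push_cast
    ring

/-- The coefficients of `(1 + z) / (1 + z + w)`. -/
def symQ (i j : ℕ) : ℝ :=
  if j = 0 then (if i = 0 then 1 else 0) else (-1) ^ (i + j) * ((i + j - 1).choose i : ℝ)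

lemma cf_one_add_varZ_mul_symS (i j : ℕ) : cf i j ((1 + varZ) * symS) = symQ i j := by
  rw [add_mul, one_mul, cf_add, cf_varZ_mul, symQ]
  simp only [cf_symS]
  rcases i with _ | i <;> rcases j with _ | j
  · simp
  · simp
  · simp [pow_succ]
  · simp only [Nat.add_sub_cancel, Nat.succ_ne_zero, if_false]
    rw [show i + 1 + (j + 1) - 1 = i + j + 1 by omega,
      show i + 1 + (j + 1) = (i + j + 1) + 1 by ring, Nat.choose_succ_succ,
      show i + (j + 1) = i + j + 1 by ring]
    push_cast
    ring

lemma cf_one_add_varW_mul_symS (i j : ℕ) : cf i j ((1 + varW) * symS) = symQ j i := by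
  rw [add_mul, one_mul, cf_add, cf_varW_mul, symQ]
  simp only [cf_symS]
  rcases i with _ | i <;> rcases j with _ | j
  · simp
  · simp [pow_succ]
  · simp
  · simp only [Nat.add_sub_cancel, Nat.succ_ne_zero, if_false]
    rw [show j + 1 + (i + 1) - 1 = i + j + 1 by omega,
      show i + 1 + (j + 1) = (i + j + 1) + 1 by ring, Nat.choose_succ_succ,
      show (-1 : ℝ) ^ (j + 1 + (i + 1)) = (-1) ^ (i + j + 1 + 1) by congr 1; ring,
      show i + 1 + j = i + j + 1 by ring]
    have h := Nat.choose_symm_of_eq_add (show i + j + 1 = i + (j + 1) by ring)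
    rw [h]
    push_cast
    ring

lemma hasSymbol_twist_wt0_zeta : HasSymbol 1 (twist wt0 (ζ : ArithmeticFunction Ser2)) 1 := by
  intro i j
  have e : cfA i j (twist wt0 (ζ : ArithmeticFunction Ser2)) =
      if i = 0 ∧ j = 0 then twist invN (ζ : ArithmeticFunction ℝ) else 0 := by
    ext n
    rcases Nat.eq_zero_or_pos n with rfl | hn
    · simp
    have : (ζ : ArithmeticFunction Ser2) n = 1 := by simp [hn.ne']
    rw [cfA_apply, twist_apply, this, wt0, cf_inC_mul, cf_one]
    split_ifs <;> simp [hn.ne']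
  rw [e, cf_one]
  split_ifs with h
  · rw [h.1, h.2]; exact isType_invN
  · exact IsType.zero _

lemma hasSymbol_twist_wtZW_zeta : HasSymbol 1 (twist wtZW (ζ : ArithmeticFunction Ser2)) symS := by
  intro i j
  have h := (isType_invN.logMul_iterate (κ := 0) (i + j)).const_mul
    ((-1) ^ (i + j) / (i.factorial * j.factorial))
    (b := cfA i j (twist wtZW (ζ : ArithmeticFunction Ser2))) ?_
  · refine IsType.congr (κ := 1 + i + j) (by convert h using 1; ring) ?_ rfl
    rw [cf_symS, Nat.choose_eq_factorial_div_factorial (by omega), Nat.add_sub_cancel_left,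
      Nat.cast_div (Nat.factorial_mul_factorial_dvd_factorial_add i j) (by positivity)]
    push_cast
    simp
    ring
  · intro n
    rcases Nat.eq_zero_or_pos n with rfl | hn
    · simp
    have : (ζ : ArithmeticFunction Ser2) n = 1 := by simp [hn.ne']
    rw [cfA_apply, twist_apply, this, wtZW, mul_one, cf_inC_mul, cf_inZ_mul_inW, coeff_pw,
      coeff_pw, logMul_iterate_apply, twist_apply]
    have h2 : (ζ : ArithmeticFunction ℝ) n = 1 := by simp [hn.ne']
    rw [h2, neg_pow, neg_pow (Real.log n) j]
    field_simp
    ring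

/-- The coefficients in `w` of the convolution of `n^{-w}` and `μ` are, up to constants, the
generalised von Mangoldt functions. -/
lemma twist_pw_zeta_mul_moebius_apply (n : ℕ) :
    (twist pw (ζ : ArithmeticFunction (PowerSeries ℝ)) * (μ : ArithmeticFunction (PowerSeries ℝ))) n
      = PowerSeries.mk fun j => (-1) ^ j / j.factorial * vm j n := by
  ext j
  rw [PowerSeries.coeff_mk, ArithmeticFunction.mul_apply, map_sum, vm,
    ArithmeticFunction.mul_apply, Finset.mul_sum]
  refine Finset.sum_congr rfl fun d hd => ?_
  obtain ⟨h1, h2⟩ := Nat.mem_divisorsAntidiagonal.mp hd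
  have h3 : d.1 ≠ 0 := by rintro h; simp [h] at h1; omega
  rw [logMul_iterate_apply, twist_apply, ArithmeticFunction.intCoe_apply,
    ArithmeticFunction.intCoe_apply]
  have e1 : (ζ : ArithmeticFunction (PowerSeries ℝ)) d.1 = 1 := by simp [h3]
  have e2 : (ζ : ArithmeticFunction ℝ) d.1 = 1 := by simp [h3]
  rw [e1, e2, mul_one, mul_comm (pw _), ← zsmul_eq_mul, map_zsmul, coeff_pw, zsmul_eq_mul, neg_pow]
  ring

/-- The coefficient of `z^i w^j` of `n^{-1-z} ∑_{d ∣ n} d^{-w} μ(n/d)`. For `j = 0` it vanishes at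
`n ≠ 1`; for `j > 0` it is of type `i + j`, since `(log)^j * μ` with the weight `1/n` is of type `j`. -/
lemma isType_log_pow_mul_vm {a : ArithmeticFunction ℝ} (i j : ℕ)
    (ha : ∀ n, a n = invN n * ((-Real.log n) ^ i / i.factorial *
      ((-1) ^ j / j.factorial * vm j n))) : IsType (i + j) (symQ i j) a := by
  rcases j with _ | j
  · have e : a = deltaA (symQ i 0) := by
      ext n
      rw [ha n, vm_zero, ArithmeticFunction.one_apply]
      simp only [deltaA, ArithmeticFunction.coe_mk, symQ, if_true]
      rcases i with _ | i
      · by_cases h : n = 1 <;> simp [h]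
      · by_cases h : n = 1 <;> simp [h]
    rw [e]
    rcases i with _ | i
    · exact fun n => rfl
    · have : deltaA (symQ (i + 1) 0) = 0 := by ext n; simp [deltaA, symQ]
      rw [this]
      have : symQ (i + 1) 0 = 0 := by simp [symQ]
      rw [this]
      exact IsType.zero _
  · have h := ((isType_vm (j + 1)).logMul_iterate i).const_mul
      ((-1) ^ (i + (j + 1)) / (i.factorial * (j + 1).factorial)) (b := a) ?_
    · refine IsType.congr (κ := i + (j + 1)) (by convert h using 1; ring) ?_ rfl
      rw [symQ, if_neg (by omega), show i + (j + 1) - 1 = i + j by omega,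
        Nat.choose_eq_factorial_div_factorial (by omega), Nat.add_sub_cancel_left,
        Nat.cast_div (Nat.factorial_mul_factorial_dvd_factorial_add i j) (by positivity),
        add_comm j i]
      have : ((j + 1).factorial : ℝ) ≠ 0 := by positivity
      push_cast
      field_simp
    · intro n
      rw [ha n, logMul_iterate_apply, twist_apply, neg_pow]
      field_simp
      ring

/-- The coefficients of the quotient `ζ(1+s+z+w)/ζ(1+s+z)`. -/
def quotZ : ArithmeticFunction Ser2 :=
  twist wtZW (ζ : ArithmeticFunction Ser2) * twist wtZ (μ : ArithmeticFunction Ser2)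

/-- The coefficients of the quotient `ζ(1+s+z+w)/ζ(1+s+w)`. -/
def quotW : ArithmeticFunction Ser2 :=
  twist wtZW (ζ : ArithmeticFunction Ser2) * twist wtW (μ : ArithmeticFunction Ser2)

/-- The zeta factors cancel at `z = w = 0`, hence the order `0`; the quotient behaves like
`(s + z) / (s + z + w)`. -/
lemma hasSymbol_quotZ : HasSymbol 0 quotZ ((1 + varZ) * symS) := by
  intro i j
  have e : quotZ = twist wtZ (mapA inW (twist pw (ζ : ArithmeticFunction (PowerSeries ℝ)) *
      (μ : ArithmeticFunction (PowerSeries ℝ)))) := by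
    rw [mapA_mul, twist_mul wtZ_mul, quotZ, mapA_moebius]
    congr 1
    ext1 n
    simp only [twist_apply, mapA_apply, wtZW, wtZ, map_mul]
    have := congrArg (fun f => f n) (mapA_zeta inW)
    simp only [mapA_apply] at this
    rw [this]; ring
  rw [cf_one_add_varZ_mul_symS, zero_add]
  apply isType_log_pow_mul_vm
  intro n
  rw [e, cfA_apply, twist_apply, mapA_apply, wtZ, mul_assoc, cf_inC_mul, cf_inZ_mul_inW, coeff_pw,
    twist_pw_zeta_mul_moebius_apply, PowerSeries.coeff_mk]

lemma hasSymbol_quotW : HasSymbol 0 quotW ((1 + varW) * symS) := by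
  intro i j
  have e : quotW = twist wtW (mapA inZ (twist pw (ζ : ArithmeticFunction (PowerSeries ℝ)) *
      (μ : ArithmeticFunction (PowerSeries ℝ)))) := by
    rw [mapA_mul, twist_mul wtW_mul, quotW, mapA_moebius]
    congr 1
    ext1 n
    simp only [twist_apply, mapA_apply, wtZW, wtW, map_mul]
    have := congrArg (fun f => f n) (mapA_zeta inZ)
    simp only [mapA_apply] at this
    rw [this]; ring
  rw [cf_one_add_varW_mul_symS, zero_add, add_comm i j]
  apply isType_log_pow_mul_vm
  intro n
  rw [e, cfA_apply, twist_apply, mapA_apply, wtW, mul_assoc, cf_inC_mul, mul_comm (inW _),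
    cf_inZ_mul_inW, coeff_pw, twist_pw_zeta_mul_moebius_apply, PowerSeries.coeff_mk,
    mul_comm (_ * vm i n)]

/-! ### Absolute convergence of multiplicative series -/

/-- A function on the positive integers that is determined multiplicatively by its values at
prime powers. -/
def multExt (e : ℕ → ℝ) (n : ℕ) : ℝ :=
  if n = 0 then 0 else ∏ p ∈ n.primeFactors, e (p ^ n.factorization p)

lemma multExt_one (e : ℕ → ℝ) : multExt e 1 = 1 := by simp [multExt]

lemma prod_primeFactors_mul_of_coprime {M : Type*} [CommMonoid M] (g : ℕ → ℕ → M) {m n : ℕ}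
    (hmn : m.Coprime n) :
    ∏ p ∈ (m * n).primeFactors, g p ((m * n).factorization p) =
      (∏ p ∈ m.primeFactors, g p (m.factorization p)) *
        ∏ p ∈ n.primeFactors, g p (n.factorization p) := by
  rw [hmn.primeFactors_mul, Finset.prod_union hmn.disjoint_primeFactors]
  congr 1
  · refine Finset.prod_congr rfl fun p hp => ?_
    rw [Nat.factorization_eq_of_coprime_left hmn (by simpa using hp)]
  · refine Finset.prod_congr rfl fun p hp => ?_
    rw [Nat.factorization_eq_of_coprime_right hmn (by simpa using hp)]

lemma multExt_mul (e : ℕ → ℝ) {m n : ℕ} (hmn : m.Coprime n) :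
    multExt e (m * n) = multExt e m * multExt e n := by
  unfold multExt
  by_cases hm : m = 0
  · simp [hm]
  by_cases hn : n = 0
  · simp [hn]
  rw [if_neg hm, if_neg hn, if_neg (mul_ne_zero hm hn)]
  exact prod_primeFactors_mul_of_coprime (fun p v => e (p ^ v)) hmn

lemma multExt_prime_pow (e : ℕ → ℝ) {p ν : ℕ} (hp : p.Prime) (hν : ν ≠ 0) :
    multExt e (p ^ ν) = e (p ^ ν) := by
  rw [multExt, if_neg (pow_ne_zero _ hp.ne_zero), Nat.primeFactors_prime_pow hν hp,
    Finset.prod_singleton]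
  simp [hp.factorization]

lemma le_multExt {e : ℕ → ℝ} (h0 : ∀ n, 0 ≤ e n) (he0 : e 0 = 0) (h1 : e 1 ≤ 1)
    (hmul : ∀ m n : ℕ, m.Coprime n → e (m * n) ≤ e m * e n) (n : ℕ) : e n ≤ multExt e n := by
  induction n using Nat.recOnPosPrimePosCoprime with
  | zero => simp [multExt, he0]
  | one => rw [multExt_one]; exact h1
  | prime_pow p n hp hn => rw [multExt_prime_pow e hp hn.ne']
  | coprime a b ha hb hab iha ihb =>
    rw [multExt_mul e hab]
    exact (hmul a b hab).trans (mul_le_mul iha ihb (h0 b) ((h0 a).trans iha))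

/-- A nonnegative submultiplicative function whose sums over prime powers are bounded by an
absolutely convergent series is summable, by comparison with its Euler product. -/
lemma summable_of_submultiplicative {e : ℕ → ℝ} (h0 : ∀ n, 0 ≤ e n) (he0 : e 0 = 0)
    (h1 : e 1 ≤ 1) (hmul : ∀ m n : ℕ, m.Coprime n → e (m * n) ≤ e m * e n) {S : ℕ → ℝ} {T : ℝ}
    (hS : ∀ p : ℕ, p.Prime → Summable (fun ν : ℕ => e (p ^ (ν + 1))) ∧
      ∑' ν : ℕ, e (p ^ (ν + 1)) ≤ S p)
    (hT : ∀ s : Finset ℕ, (∀ p ∈ s, p.Prime) → ∑ p ∈ s, S p ≤ T) :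
    Summable e ∧ ∑' n, e n ≤ Real.exp T := by
  have hM0 : ∀ n, 0 ≤ multExt e n := fun n => by
    unfold multExt; split_ifs
    · exact le_rfl
    · exact Finset.prod_nonneg fun p _ => h0 _
  have hle := le_multExt h0 he0 h1 hmul
  have hsM : ∀ {p : ℕ}, p.Prime → Summable (fun ν : ℕ => multExt e (p ^ ν)) := by
    intro p hp
    rw [← summable_nat_add_iff 1]
    refine (hS p hp).1.congr fun ν => ?_
    rw [multExt_prime_pow e hp (by omega)]
  have hfin : ∀ s : Finset ℕ, ∑ n ∈ s, e n ≤ Real.exp T := by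
    intro s
    obtain ⟨N, hN⟩ : ∃ N, ∀ n ∈ s, n < N := ⟨s.sup id + 1, fun n hn =>
      Nat.lt_succ_of_le (Finset.le_sup (f := id) hn)⟩
    obtain ⟨hsum, hhas⟩ := EulerProduct.summable_and_hasSum_smoothNumbers_prod_primesBelow_tsum
      (f := multExt e) (multExt_one e) (fun {m n} h => multExt_mul e h)
      (fun hp => by simpa [abs_of_nonneg (hM0 _)] using hsM hp) N
    have hprod : ∏ p ∈ N.primesBelow, ∑' ν : ℕ, multExt e (p ^ ν) ≤ Real.exp T := by
      calc _ ≤ ∏ p ∈ N.primesBelow, Real.exp (S p) := by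
            refine Finset.prod_le_prod (fun p _ => tsum_nonneg fun _ => hM0 _) fun p hp => ?_
            have hp' := Nat.prime_of_mem_primesBelow hp
            rw [(hsM hp').tsum_eq_zero_add, pow_zero, multExt_one]
            have : ∑' ν : ℕ, multExt e (p ^ (ν + 1)) = ∑' ν : ℕ, e (p ^ (ν + 1)) :=
              tsum_congr fun ν => multExt_prime_pow e hp' (by omega)
            rw [this, add_comm]
            exact (add_le_add_left (hS p hp').2 1).trans (Real.add_one_le_exp _)
        _ = Real.exp (∑ p ∈ N.primesBelow, S p) := (Real.exp_sum _ _).symm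
        _ ≤ _ := Real.exp_le_exp.mpr (hT _ fun p hp => Nat.prime_of_mem_primesBelow hp)
    refine le_trans ?_ hprod
    rw [← hhas.tsum_eq, tsum_subtype (N.smoothNumbers) (multExt e)]
    have hs2 : Summable ((N.smoothNumbers).indicator (multExt e)) := by
      rw [← summable_subtype_iff_indicator]
      exact hhas.summable
    refine le_trans ?_ (hs2.sum_le_tsum s fun n _ => Set.indicator_nonneg (fun n _ => hM0 n) n)
    refine Finset.sum_le_sum fun n hn => ?_
    rcases Nat.eq_zero_or_pos n with rfl | hpos
    · rw [he0]; exact Set.indicator_nonneg (fun n _ => hM0 n) 0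
    · rw [Set.indicator_of_mem]
      · exact hle n
      · exact Nat.mem_smoothNumbers_of_lt hpos (hN n hn)
  have hs : Summable e := summable_of_sum_le h0 hfin
  exact ⟨hs, hs.tsum_le_of_sum_le hfin⟩

/-! ### Weighted norms on power series -/

/-- A submultiplicative size function on a commutative ring. -/
structure IsSubNorm {R : Type*} [CommRing R] (N : R → ℝ) : Prop where
  nonneg : ∀ a, 0 ≤ N a
  zero : N 0 = 0
  one : N 1 ≤ 1
  neg : ∀ a, N (-a) = N a
  add_le : ∀ a b, N (a + b) ≤ N a + N b
  mul_le : ∀ a b, N (a * b) ≤ N a * N b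

lemma isSubNorm_abs : IsSubNorm (fun a : ℝ => |a|) where
  nonneg := abs_nonneg
  zero := abs_zero
  one := by simp
  neg := abs_neg
  add_le := abs_add_le
  mul_le a b := (abs_mul a b).le

namespace IsSubNorm

variable {R : Type*} [CommRing R] {N : R → ℝ}

lemma sub_le (h : IsSubNorm N) (a b : R) : N (a - b) ≤ N a + N b := by
  rw [sub_eq_add_neg, ← h.neg b]
  exact h.add_le _ _

lemma sum_le (h : IsSubNorm N) {ι : Type*} (s : Finset ι) (f : ι → R) :
    N (∑ i ∈ s, f i) ≤ ∑ i ∈ s, N (f i) := by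
  classical
  induction s using Finset.induction_on with
  | empty => simp [h.zero]
  | insert i s hi ih =>
    rw [Finset.sum_insert hi, Finset.sum_insert hi]
    exact (h.add_le _ _).trans (add_le_add_right ih _)

lemma pow_le (h : IsSubNorm N) (a : R) (n : ℕ) : N (a ^ n) ≤ N a ^ n := by
  induction n with
  | zero => simpa using h.one
  | succ n ih =>
    rw [pow_succ, pow_succ]
    exact (h.mul_le _ _).trans (mul_le_mul_of_nonneg_right ih (h.nonneg _))

lemma natCast_mul_le (h : IsSubNorm N) (n : ℕ) (a : R) : N (n * a) ≤ n * N a := by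
  induction n with
  | zero => simp [h.zero]
  | succ n ih =>
    push_cast
    rw [add_mul, add_mul, one_mul, one_mul]
    exact (h.add_le _ _).trans (add_le_add_left ih _)

end IsSubNorm

lemma sum_antidiagonal_le_sum_product (f : ℕ × ℕ → ℝ) (hf : ∀ q, 0 ≤ f q) (M : ℕ) :
    ∑ j ∈ Finset.range (M + 1), ∑ q ∈ Finset.HasAntidiagonal.antidiagonal j, f q ≤
      ∑ q ∈ Finset.range (M + 1) ×ˢ Finset.range (M + 1), f q := by
  rw [← Finset.sum_biUnion]
  · refine Finset.sum_le_sum_of_subset_of_nonneg ?_ fun q _ _ => hf q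
    intro q hq
    simp only [Finset.mem_biUnion, Finset.mem_range, Finset.HasAntidiagonal.mem_antidiagonal,
      Finset.mem_product] at hq ⊢
    omega
  · intro a _ b _ hab
    rw [Function.onFun, Finset.disjoint_left]
    intro q h1 h2
    rw [Finset.HasAntidiagonal.mem_antidiagonal] at h1 h2
    exact hab (h1.symm.trans h2)

/-- The weighted `ℓ¹` norm `∑_{j ≤ M} N(a_j) ρ^j` of a power series truncated at degree `M`. -/
def wnorm {R : Type*} [CommRing R] (N : R → ℝ) (ρ : ℝ) (M : ℕ) (F : PowerSeries R) : ℝ :=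
  ∑ j ∈ Finset.range (M + 1), N (PowerSeries.coeff j F) * ρ ^ j

lemma isSubNorm_wnorm {R : Type*} [CommRing R] {N : R → ℝ} (h : IsSubNorm N) {ρ : ℝ} (hρ : 0 ≤ ρ)
    (M : ℕ) : IsSubNorm (wnorm N ρ M) where
  nonneg F := Finset.sum_nonneg fun j _ => mul_nonneg (h.nonneg _) (by positivity)
  zero := by simp [wnorm, h.zero]
  one := by
    rw [wnorm, Finset.sum_eq_single_of_mem 0 (by simp)]
    · simpa using h.one
    · intro j _ hj
      simp [PowerSeries.coeff_one, hj, h.zero]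
  neg F := by simp [wnorm, h.neg]
  add_le F G := by
    rw [wnorm, wnorm, wnorm, ← Finset.sum_add_distrib]
    refine Finset.sum_le_sum fun j _ => ?_
    rw [← add_mul, map_add]
    exact mul_le_mul_of_nonneg_right (h.add_le _ _) (by positivity)
  mul_le F G := by
    have h1 : wnorm N ρ M (F * G) ≤ ∑ j ∈ Finset.range (M + 1),
        ∑ q ∈ Finset.HasAntidiagonal.antidiagonal j,
          (N (PowerSeries.coeff q.1 F) * ρ ^ q.1) * (N (PowerSeries.coeff q.2 G) * ρ ^ q.2) := by
      refine Finset.sum_le_sum fun j _ => ?_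
      rw [PowerSeries.coeff_mul]
      refine (mul_le_mul_of_nonneg_right (h.sum_le _ _) (by positivity)).trans ?_
      rw [Finset.sum_mul]
      refine Finset.sum_le_sum fun q hq => ?_
      rw [← Finset.HasAntidiagonal.mem_antidiagonal.mp hq, pow_add]
      calc _ ≤ (N (PowerSeries.coeff q.1 F) * N (PowerSeries.coeff q.2 G)) * (ρ ^ q.1 * ρ ^ q.2) :=
            mul_le_mul_of_nonneg_right (h.mul_le _ _) (by positivity)
        _ = _ := by ring
    refine h1.trans ?_
    rw [wnorm, wnorm, Finset.sum_mul_sum, ← Finset.sum_product']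
    exact sum_antidiagonal_le_sum_product (fun q => (N (PowerSeries.coeff q.1 F) * ρ ^ q.1) *
      (N (PowerSeries.coeff q.2 G) * ρ ^ q.2)) (fun q => mul_nonneg
        (mul_nonneg (h.nonneg _) (by positivity)) (mul_nonneg (h.nonneg _) (by positivity))) M

/-- The norm of a series in one variable, truncated at degree `M`, with weight `1/16`. -/
def nrm1 (M : ℕ) : PowerSeries ℝ → ℝ := wnorm (fun a : ℝ => |a|) (1 / 16) M

/-- The norm of a series in two variables, truncated at degree `M` in each, with weight `1/16`. -/
def nrm2 (M : ℕ) : Ser2 → ℝ := wnorm (nrm1 M) (1 / 16) M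

lemma isSubNorm_nrm1 (M : ℕ) : IsSubNorm (nrm1 M) :=
  isSubNorm_wnorm isSubNorm_abs (by norm_num) M

lemma isSubNorm_nrm2 (M : ℕ) : IsSubNorm (nrm2 M) :=
  isSubNorm_wnorm (isSubNorm_nrm1 M) (by norm_num) M

lemma wnorm_C {R : Type*} [CommRing R] {N : R → ℝ} (h : IsSubNorm N) (ρ : ℝ) (M : ℕ) (a : R) :
    wnorm N ρ M (PowerSeries.C a) = N a := by
  rw [wnorm, Finset.sum_eq_single_of_mem 0 (by simp)]
  · simp
  · intro j _ hj
    simp [PowerSeries.coeff_C, hj, h.zero]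

lemma nrm1_C (M : ℕ) (r : ℝ) : nrm1 M (PowerSeries.C r) = |r| := wnorm_C isSubNorm_abs _ _ _

lemma nrm2_inZ (M : ℕ) (a : PowerSeries ℝ) : nrm2 M (inZ a) = nrm1 M a :=
  wnorm_C (isSubNorm_nrm1 M) _ _ _

lemma nrm2_inC (M : ℕ) (r : ℝ) : nrm2 M (inC r) = |r| := by
  rw [← nrm1_C M r, ← nrm2_inZ]; rfl

lemma nrm2_inW (M : ℕ) (a : PowerSeries ℝ) : nrm2 M (inW a) = nrm1 M a := by
  rw [nrm2, wnorm, nrm1, wnorm]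
  refine Finset.sum_congr rfl fun j _ => ?_
  rw [inW, PowerSeries.coeff_map]
  congr 1
  exact wnorm_C isSubNorm_abs _ _ _

lemma abs_coeff_le_nrm1 {M i : ℕ} (hi : i ≤ M) (F : PowerSeries ℝ) :
    |PowerSeries.coeff i F| ≤ 16 ^ i * nrm1 M F := by
  have : |PowerSeries.coeff i F| * (1 / 16) ^ i ≤ nrm1 M F :=
    Finset.single_le_sum (f := fun i => |PowerSeries.coeff i F| * (1 / 16 : ℝ) ^ i)
      (fun j _ => by positivity) (Finset.mem_range.mpr (by omega))
  calc _ = 16 ^ i * (|PowerSeries.coeff i F| * (1 / 16) ^ i) := by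
        rw [mul_left_comm, ← mul_pow]; norm_num
    _ ≤ _ := by gcongr

lemma abs_cf_le_nrm2 {M i j : ℕ} (hi : i ≤ M) (hj : j ≤ M) (F : Ser2) :
    |cf i j F| ≤ 16 ^ i * 16 ^ j * nrm2 M F := by
  have : nrm1 M (PowerSeries.coeff j F) * (1 / 16) ^ j ≤ nrm2 M F :=
    Finset.single_le_sum (f := fun j => nrm1 M (PowerSeries.coeff j F) * (1 / 16 : ℝ) ^ j)
      (fun j _ => mul_nonneg ((isSubNorm_nrm1 M).nonneg _) (by positivity))
      (Finset.mem_range.mpr (by omega))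
  calc _ ≤ 16 ^ i * nrm1 M (PowerSeries.coeff j F) := abs_coeff_le_nrm1 hi _
    _ = 16 ^ i * 16 ^ j * (nrm1 M (PowerSeries.coeff j F) * (1 / 16) ^ j) := by
        rw [one_div, inv_pow]; field_simp
    _ ≤ _ := by gcongr

/-- The weight `1/16` is chosen such that `n^{-z}` has size at most `n^{1/16}`. -/
lemma nrm1_pw_le (M : ℕ) {n : ℕ} (hn : 1 ≤ n) : nrm1 M (pw n) ≤ (n : ℝ) ^ (1 / 16 : ℝ) := by
  have hn' : (1 : ℝ) ≤ n := by exact_mod_cast hn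
  have hL := Real.log_nonneg hn'
  rw [Real.rpow_def_of_pos (by linarith)]
  refine le_trans (le_of_eq ?_)
    (Real.sum_le_exp_of_nonneg (x := Real.log n * (1 / 16)) (by positivity) (M + 1))
  rw [nrm1, wnorm]
  refine Finset.sum_congr rfl fun i _ => ?_
  rw [coeff_pw, abs_div, abs_pow, abs_neg, abs_of_nonneg hL, mul_pow,
    abs_of_nonneg (by positivity : (0 : ℝ) ≤ i.factorial)]
  ring

/-! ### Growth of arithmetic functions at prime powers -/

lemma mul_apply_prime_pow {R : Type*} [CommSemiring R] (f g : ArithmeticFunction R) {p : ℕ}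
    (hp : p.Prime) (n : ℕ) : (f * g) (p ^ n) =
      ∑ q ∈ Finset.HasAntidiagonal.antidiagonal n, f (p ^ q.1) * g (p ^ q.2) := by
  rw [ArithmeticFunction.mul_apply,
    Nat.sum_divisorsAntidiagonal (f := fun a b => f a * g b), Nat.sum_divisors_prime_pow hp]
  refine (Finset.sum_congr rfl fun i hi => ?_).trans
    (Finset.Nat.sum_antidiagonal_eq_sum_range_succ (fun a b => f (p ^ a) * g (p ^ b)) n).symm
  rw [Nat.pow_div (by simpa [Nat.lt_succ_iff] using hi) hp.pos]

/-- Growth at most `ν^{O(1)} p^{-7ν/8}` at the prime powers `p^ν`. -/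
def LocBd {R : Type*} [CommRing R] (N : R → ℝ) (F : ArithmeticFunction R) : Prop :=
  ∃ C : ℝ, 0 ≤ C ∧ ∃ B : ℕ, ∀ p : ℕ, p.Prime → ∀ ν : ℕ,
    N (F (p ^ ν)) ≤ C * ((ν : ℝ) + 1) ^ B * ((p : ℝ) ^ (-(7 / 8) : ℝ)) ^ ν

/-- Bounds of this form are stable under convolution since only the polynomial factor grows. -/
lemma LocBd.mul {R : Type*} [CommRing R] {N : R → ℝ} (h : IsSubNorm N)
    {F G : ArithmeticFunction R} (hF : LocBd N F) (hG : LocBd N G) : LocBd N (F * G) := by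
  obtain ⟨C₁, hC₁, B₁, h₁⟩ := hF
  obtain ⟨C₂, hC₂, B₂, h₂⟩ := hG
  refine ⟨C₁ * C₂, by positivity, B₁ + B₂ + 1, fun p hp ν => ?_⟩
  set σ : ℝ := (p : ℝ) ^ (-(7 / 8) : ℝ) with hσ
  have hσ0 : 0 ≤ σ := by positivity
  rw [mul_apply_prime_pow F G hp]
  refine (h.sum_le _ _).trans ?_
  have : ∀ q ∈ Finset.HasAntidiagonal.antidiagonal ν, N (F (p ^ q.1) * G (p ^ q.2)) ≤
      C₁ * C₂ * ((ν : ℝ) + 1) ^ (B₁ + B₂) * σ ^ ν := by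
    intro q hq
    have hq' := Finset.HasAntidiagonal.mem_antidiagonal.mp hq
    have e1 : (q.1 : ℝ) ≤ ν := by exact_mod_cast (by omega : q.1 ≤ ν)
    have e2 : (q.2 : ℝ) ≤ ν := by exact_mod_cast (by omega : q.2 ≤ ν)
    calc _ ≤ N (F (p ^ q.1)) * N (G (p ^ q.2)) := h.mul_le _ _
      _ ≤ (C₁ * ((q.1 : ℝ) + 1) ^ B₁ * σ ^ q.1) * (C₂ * ((q.2 : ℝ) + 1) ^ B₂ * σ ^ q.2) :=
          mul_le_mul (h₁ p hp _) (h₂ p hp _) (h.nonneg _) (by positivity)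
      _ ≤ (C₁ * ((ν : ℝ) + 1) ^ B₁ * σ ^ q.1) * (C₂ * ((ν : ℝ) + 1) ^ B₂ * σ ^ q.2) := by gcongr
      _ = C₁ * C₂ * ((ν : ℝ) + 1) ^ (B₁ + B₂) * σ ^ (q.1 + q.2) := by ring
      _ = _ := by rw [hq']
  refine (Finset.sum_le_card_nsmul _ _ _ this).trans (le_of_eq ?_)
  rw [Finset.Nat.card_antidiagonal, nsmul_eq_mul]
  push_cast
  ring

lemma LocBd.one {R : Type*} [CommRing R] {N : R → ℝ} (h : IsSubNorm N) :
    LocBd N (1 : ArithmeticFunction R) := by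
  refine ⟨1, zero_le_one, 0, fun p hp ν => ?_⟩
  rcases ν with _ | ν
  · simpa using h.one
  · rw [ArithmeticFunction.one_apply_ne (by
      have := hp.one_lt
      exact (Nat.one_lt_pow (by omega) this).ne'), h.zero]
    positivity

lemma LocBd.pow {R : Type*} [CommRing R] {N : R → ℝ} (h : IsSubNorm N)
    {F : ArithmeticFunction R} (hF : LocBd N F) (k : ℕ) : LocBd N (F ^ k) := by
  induction k with
  | zero => simpa using LocBd.one h
  | succ k ih => rw [pow_succ]; exact ih.mul h hF

lemma apply_prime_pow_of_mul {R : Type*} [CommRing R] {φ : ℕ → R}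
    (hφ : ∀ a b, a ≠ 0 → b ≠ 0 → φ (a * b) = φ a * φ b) (h1 : φ 1 = 1) {p : ℕ} (hp : p ≠ 0)
    (ν : ℕ) : φ (p ^ ν) = φ p ^ ν := by
  induction ν with
  | zero => simpa using h1
  | succ ν ih => rw [pow_succ, hφ _ _ (pow_ne_zero _ hp) hp, ih, pow_succ]

lemma LocBd.twist_zeta {R : Type*} [CommRing R] {N : R → ℝ} (h : IsSubNorm N) {φ : ℕ → R}
    (hφ : ∀ a b, a ≠ 0 → b ≠ 0 → φ (a * b) = φ a * φ b) (h1 : φ 1 = 1)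
    (hN : ∀ p : ℕ, p.Prime → N (φ p) ≤ (p : ℝ) ^ (-(7 / 8) : ℝ)) :
    LocBd N (twist φ (ζ : ArithmeticFunction R)) := by
  refine ⟨1, zero_le_one, 0, fun p hp ν => ?_⟩
  have : (ζ : ArithmeticFunction R) (p ^ ν) = 1 := by simp [hp.ne_zero]
  rw [twist_apply, this, mul_one, apply_prime_pow_of_mul hφ h1 hp.ne_zero, pow_zero, one_mul,
    one_mul]
  refine (h.pow_le _ _).trans ?_
  have := h.nonneg (φ p)
  gcongr
  exact hN p hp

lemma LocBd.twist_moebius {R : Type*} [CommRing R] {N : R → ℝ} (h : IsSubNorm N) {φ : ℕ → R}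
    (h1 : φ 1 = 1)
    (hN : ∀ p : ℕ, p.Prime → N (φ p) ≤ (p : ℝ) ^ (-(7 / 8) : ℝ)) :
    LocBd N (twist φ (μ : ArithmeticFunction R)) := by
  refine ⟨1, zero_le_one, 0, fun p hp ν => ?_⟩
  rw [twist_apply, pow_zero, one_mul, one_mul]
  rcases ν with _ | _ | ν
  · simpa [h1] using h.one
  · simpa [ArithmeticFunction.moebius_apply_prime hp, h.neg] using hN p hp
  · have : (μ : ArithmeticFunction R) (p ^ (ν + 1 + 1)) = 0 := by
      rw [ArithmeticFunction.intCoe_apply, ArithmeticFunction.moebius_apply_prime_pow hp (by omega)]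
      simp
    rw [this, mul_zero, h.zero]
    positivity

lemma summable_poly_mul_geometric (B : ℕ) {r : ℝ} (h0 : 0 ≤ r) (h1 : r < 1) :
    Summable fun ν : ℕ => ((ν : ℝ) + 1) ^ B * r ^ ν := by
  rcases h0.eq_or_lt with rfl | hr
  · refine summable_of_ne_finset_zero (s := {0}) fun ν hν => ?_
    simp at hν
    simp [hν]
  have hs : Summable fun n : ℕ => (n : ℝ) ^ B * r ^ n :=
    summable_pow_mul_geometric_of_norm_lt_one B (by rwa [Real.norm_of_nonneg h0])
  have h2 : Summable fun n : ℕ => ((n + 1 : ℕ) : ℝ) ^ B * r ^ (n + 1) :=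
    (summable_nat_add_iff 1).mpr hs
  refine (h2.mul_left r⁻¹).congr fun ν => ?_
  rw [pow_succ, Nat.cast_succ]
  calc r⁻¹ * (((ν : ℝ) + 1) ^ B * (r ^ ν * r)) = ((ν : ℝ) + 1) ^ B * r ^ ν * (r⁻¹ * r) := by ring
    _ = _ := by rw [inv_mul_cancel₀ hr.ne', mul_one]

/-- A multiplicative function that is `O(p^{-7/4})` at primes and `ν^{O(1)} p^{-7ν/8}` at prime
powers is absolutely summable, even with an extra factor `n^{1/8}`. -/
lemma summable_of_locBd {R : Type*} [CommRing R] {N : R → ℝ} (h : IsSubNorm N)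
    {F : ArithmeticFunction R} (hF : F.IsMultiplicative) (hloc : LocBd N F) {C₀ : ℝ}
    (hp1 : ∀ p : ℕ, p.Prime → N (F p) ≤ C₀ * (p : ℝ) ^ (-(7 / 4) : ℝ)) :
    Summable fun n : ℕ => N (F n) * (n : ℝ) ^ (1 / 8 : ℝ) := by
  obtain ⟨C, hC, B, hB⟩ := hloc
  have hr1 : (2 : ℝ) ^ (-(3 / 4) : ℝ) < 1 :=
    Real.rpow_lt_one_of_one_lt_of_neg (by norm_num) (by norm_num)
  have hgeo0 : Summable fun ν : ℕ => ((ν : ℝ) + 1) ^ B * ((2 : ℝ) ^ (-(3 / 4) : ℝ)) ^ ν :=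
    summable_poly_mul_geometric B (by positivity) hr1
  have hgeo := ((summable_nat_add_iff 2).mpr hgeo0).mul_left (((2 : ℝ) ^ (-(3 / 4) : ℝ)) ^ 2)⁻¹
  set K : ℝ := ∑' ν : ℕ, (((2 : ℝ) ^ (-(3 / 4) : ℝ)) ^ 2)⁻¹ * ((((ν + 2 : ℕ) : ℝ) + 1) ^ B *
    ((2 : ℝ) ^ (-(3 / 4) : ℝ)) ^ (ν + 2)) with hK
  have hK0 : 0 ≤ K := tsum_nonneg fun ν => by positivity
  have hsumP : Summable fun n : ℕ => (n : ℝ) ^ (-(3 / 2) : ℝ) :=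
    Real.summable_nat_rpow.mpr (by norm_num)
  set S : ℕ → ℝ := fun p => (|C₀| + C * K) * (p : ℝ) ^ (-(3 / 2) : ℝ) with hS
  refine (summable_of_submultiplicative (e := fun n : ℕ => N (F n) * (n : ℝ) ^ (1 / 8 : ℝ))
    (S := S) (T := ∑' p, S p) (fun n => mul_nonneg (h.nonneg _) (by positivity)) (by simp)
    (by simpa [hF.map_one] using h.one) ?_ ?_ ?_).1
  · intro m n hmn
    rw [hF.map_mul_of_coprime hmn]
    push_cast
    rw [Real.mul_rpow (by positivity) (by positivity)]
    calc _ ≤ (N (F m) * N (F n)) * ((m : ℝ) ^ (1 / 8 : ℝ) * (n : ℝ) ^ (1 / 8 : ℝ)) := by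
          gcongr
          exact h.mul_le _ _
      _ = _ := by ring
  · intro p hp
    have hp2 : (2 : ℝ) ≤ p := by exact_mod_cast hp.two_le
    have hp0 : (0 : ℝ) < p := by linarith
    have hnn : ∀ ν : ℕ, 0 ≤ N (F (p ^ ν)) * ((p ^ ν : ℕ) : ℝ) ^ (1 / 8 : ℝ) := fun ν =>
      mul_nonneg (h.nonneg _) (by positivity)
    have hbd : ∀ ν : ℕ, N (F (p ^ (ν + 2))) * ((p ^ (ν + 2) : ℕ) : ℝ) ^ (1 / 8 : ℝ) ≤
        C * (p : ℝ) ^ (-(3 / 2) : ℝ) * ((((2 : ℝ) ^ (-(3 / 4) : ℝ)) ^ 2)⁻¹ *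
          ((((ν + 2 : ℕ) : ℝ) + 1) ^ B * ((2 : ℝ) ^ (-(3 / 4) : ℝ)) ^ (ν + 2))) := by
      intro ν
      have e1 : ((p ^ (ν + 2) : ℕ) : ℝ) ^ (1 / 8 : ℝ) = ((p : ℝ) ^ (1 / 8 : ℝ)) ^ (ν + 2) := by
        push_cast
        rw [← Real.rpow_natCast, ← Real.rpow_natCast, ← Real.rpow_mul hp0.le,
          ← Real.rpow_mul hp0.le, mul_comm]
      have e2 : (p : ℝ) ^ (-(7 / 8) : ℝ) * (p : ℝ) ^ (1 / 8 : ℝ) = (p : ℝ) ^ (-(3 / 4) : ℝ) := by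
        rw [← Real.rpow_add hp0]; norm_num
      have e3 : ((p : ℝ) ^ (-(3 / 4) : ℝ)) ^ 2 = (p : ℝ) ^ (-(3 / 2) : ℝ) := by
        rw [← Real.rpow_natCast, ← Real.rpow_mul hp0.le]; norm_num
      have e4 : (p : ℝ) ^ (-(3 / 4) : ℝ) ≤ (2 : ℝ) ^ (-(3 / 4) : ℝ) :=
        Real.rpow_le_rpow_of_nonpos (by norm_num) hp2 (by norm_num)
      calc _ ≤ (C * (((ν + 2 : ℕ) : ℝ) + 1) ^ B * ((p : ℝ) ^ (-(7 / 8) : ℝ)) ^ (ν + 2)) *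
            ((p ^ (ν + 2) : ℕ) : ℝ) ^ (1 / 8 : ℝ) := by
            gcongr
            exact hB p hp (ν + 2)
        _ = C * (((ν + 2 : ℕ) : ℝ) + 1) ^ B * (((p : ℝ) ^ (-(3 / 4) : ℝ)) ^ 2 *
            ((p : ℝ) ^ (-(3 / 4) : ℝ)) ^ ν) := by
            rw [e1, mul_assoc, ← mul_pow, e2]; ring
        _ ≤ C * (((ν + 2 : ℕ) : ℝ) + 1) ^ B * ((p : ℝ) ^ (-(3 / 2) : ℝ) *
            ((2 : ℝ) ^ (-(3 / 4) : ℝ)) ^ ν) := by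
            rw [e3]; gcongr
        _ = _ := by
            rw [pow_add _ ν 2]; field_simp
    have hs2 : Summable fun ν : ℕ =>
        N (F (p ^ (ν + 2))) * ((p ^ (ν + 2) : ℕ) : ℝ) ^ (1 / 8 : ℝ) :=
      Summable.of_nonneg_of_le (fun ν => hnn _) hbd (hgeo.mul_left _)
    have hs1 : Summable fun ν : ℕ =>
        N (F (p ^ (ν + 1))) * ((p ^ (ν + 1) : ℕ) : ℝ) ^ (1 / 8 : ℝ) := by
      rw [← summable_nat_add_iff 1]
      exact hs2
    refine ⟨hs1, ?_⟩
    rw [hs1.tsum_eq_zero_add, hS]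
    simp only [zero_add, pow_one, add_assoc, Nat.reduceAdd]
    rw [add_mul]
    refine add_le_add ?_ ?_
    · calc _ ≤ (|C₀| * (p : ℝ) ^ (-(7 / 4) : ℝ)) * (p : ℝ) ^ (1 / 8 : ℝ) := by
            gcongr
            refine (hp1 p hp).trans ?_
            gcongr
            exact le_abs_self _
        _ = |C₀| * (p : ℝ) ^ (-(13 / 8) : ℝ) := by
            rw [mul_assoc, ← Real.rpow_add hp0]; norm_num
        _ ≤ _ := mul_le_mul_of_nonneg_left
            (Real.rpow_le_rpow_of_exponent_le (by linarith) (by norm_num)) (abs_nonneg _)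
    · calc _ ≤ ∑' ν : ℕ, C * (p : ℝ) ^ (-(3 / 2) : ℝ) * ((((2 : ℝ) ^ (-(3 / 4) : ℝ)) ^ 2)⁻¹ *
          ((((ν + 2 : ℕ) : ℝ) + 1) ^ B * ((2 : ℝ) ^ (-(3 / 4) : ℝ)) ^ (ν + 2))) :=
            hs2.tsum_le_tsum hbd (hgeo.mul_left _)
        _ = C * K * (p : ℝ) ^ (-(3 / 2) : ℝ) := by rw [tsum_mul_left, ← hK]; ring
  · intro s _
    exact (hsumP.mul_left _).sum_le_tsum s fun p _ => by positivity

/-! ### The divisor function at prime powers -/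

lemma sum_range_multichoose (k n : ℕ) :
    ∑ i ∈ Finset.range (n + 1), Nat.multichoose k i = Nat.multichoose (k + 1) n := by
  induction n with
  | zero => simp
  | succ n ih => rw [Finset.sum_range_succ, ih, Nat.multichoose_succ_succ, add_comm]

lemma multichoose_le_pow (k m : ℕ) : Nat.multichoose k m ≤ (m + 1) ^ k := by
  induction k generalizing m with
  | zero => cases m <;> simp
  | succ k ih =>
    rw [← sum_range_multichoose]
    calc _ ≤ ∑ _i ∈ Finset.range (m + 1), (m + 1) ^ k :=
          Finset.sum_le_sum fun i hi => (ih i).trans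
            (Nat.pow_le_pow_left (by simpa using hi) k)
      _ = _ := by simp [pow_succ']

lemma multichoose_le_succ (k m : ℕ) : Nat.multichoose k m ≤ Nat.multichoose (k + 1) m := by
  cases m with
  | zero => simp
  | succ m => rw [Nat.multichoose_succ_succ]; omega

lemma multichoose_add_le (k a b : ℕ) :
    Nat.multichoose k (a + b) ≤ Nat.multichoose k a * Nat.multichoose k b := by
  induction k generalizing a b with
  | zero =>
    rcases a with _ | a
    · simp
    · rw [show a + 1 + b = (a + b) + 1 by ring, Nat.multichoose_zero_succ]; exact Nat.zero_le _
  | succ k ih =>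
    induction b with
    | zero => simp
    | succ b ihb =>
      rw [← add_assoc, Nat.multichoose_succ_succ, Nat.multichoose_succ_succ, mul_add]
      exact add_le_add ((ih a (b + 1)).trans
        (Nat.mul_le_mul_right _ (multichoose_le_succ k a))) ihb

lemma tau_succ (k : ℕ) : tau (k + 1) = tau k * ArithmeticFunction.zeta := pow_succ _ _

lemma tau_prime_pow (k : ℕ) {p : ℕ} (hp : p.Prime) (n : ℕ) :
    tau k (p ^ n) = Nat.multichoose k n := by
  induction k generalizing n with
  | zero =>
    rw [tau, pow_zero]
    cases n with
    | zero => simp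
    | succ n =>
      rw [ArithmeticFunction.one_apply_ne (Nat.one_lt_pow (by omega) hp.one_lt).ne',
        Nat.multichoose_zero_succ]
  | succ k ih =>
    rw [tau_succ, mul_apply_prime_pow _ _ hp, ← sum_range_multichoose]
    refine (Finset.Nat.sum_antidiagonal_eq_sum_range_succ
      (fun a b => tau k (p ^ a) * ArithmeticFunction.zeta (p ^ b)) n).trans ?_
    refine Finset.sum_congr rfl fun i _ => ?_
    rw [ih, ArithmeticFunction.zeta_apply_ne (pow_ne_zero _ hp.ne_zero), mul_one]

lemma isMultiplicative_pow {R : Type*} [CommSemiring R] {f : ArithmeticFunction R}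
    (hf : f.IsMultiplicative) (k : ℕ) : (f ^ k).IsMultiplicative := by
  induction k with
  | zero => exact ArithmeticFunction.isMultiplicative_one
  | succ k ih => rw [pow_succ]; exact ih.mul hf

lemma isMultiplicative_tau (k : ℕ) : (tau k).IsMultiplicative :=
  isMultiplicative_pow ArithmeticFunction.isMultiplicative_zeta k

lemma isMultiplicative_twist {R : Type*} [CommSemiring R] {φ : ℕ → R} (h1 : φ 1 = 1)
    (hφ : ∀ a b, a ≠ 0 → b ≠ 0 → φ (a * b) = φ a * φ b) {f : ArithmeticFunction R}
    (hf : f.IsMultiplicative) : (twist φ f).IsMultiplicative := by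
  refine ⟨by simp [h1, hf.map_one], fun {m n} hmn => ?_⟩
  rcases eq_or_ne m 0 with rfl | hm
  · simp
  rcases eq_or_ne n 0 with rfl | hn
  · simp
  rw [twist_apply, twist_apply, twist_apply, hφ m n hm hn, hf.map_mul_of_coprime hmn]
  ring

/-! ### The local polynomials -/

/-- The polynomial `(1 - x)^k ∑_m τ_k(p^{m+ν}) x^m` in `x`; see `lpoly_eq_tsum`. -/
def lpoly {R : Type*} [CommRing R] (k ν : ℕ) (x : R) : R :=
  if ν = 0 then 1 else ∑ i ∈ Finset.range k, (Nat.multichoose (i + 1) (ν - 1) : R) * (1 - x) ^ i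

lemma lpoly_succ {R : Type*} [CommRing R] (k ν : ℕ) (x : R) : lpoly (k + 1) ν x =
    lpoly k ν x + (if ν = 0 then 0 else (Nat.multichoose (k + 1) (ν - 1) : R) * (1 - x) ^ k) := by
  unfold lpoly
  split_ifs
  · simp
  · rw [Finset.sum_range_succ]

lemma map_lpoly {R S : Type*} [CommRing R] [CommRing S] (f : R →+* S) (k ν : ℕ) (x : R) :
    f (lpoly k ν x) = lpoly k ν (f x) := by
  unfold lpoly
  split_ifs
  · simp
  · simp [map_sum]

lemma norm_natCast_eq {𝕜 : Type*} [RCLike 𝕜] (n : ℕ) : ‖(n : 𝕜)‖ = n := by simp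

lemma summable_multichoose_mul_pow {𝕜 : Type*} [RCLike 𝕜] (k ν : ℕ) {x : 𝕜} (hx : ‖x‖ < 1) :
    Summable fun m : ℕ => (Nat.multichoose k (m + ν) : 𝕜) * x ^ m := by
  refine Summable.of_norm_bounded
    ((summable_poly_mul_geometric k (norm_nonneg x) hx).mul_left (Nat.multichoose k ν : ℝ))
    fun m => ?_
  rw [norm_mul, norm_pow, norm_natCast_eq, ← mul_assoc]
  gcongr
  have := (multichoose_add_le k m ν).trans (Nat.mul_le_mul_right _ (multichoose_le_pow k m))
  rw [mul_comm]
  exact_mod_cast this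

/-- The local factors of `G_{d,k}` are polynomials in `p^{-s}`. -/
lemma lpoly_eq_tsum {𝕜 : Type*} [RCLike 𝕜] (k ν : ℕ) {x : 𝕜} (hx : ‖x‖ < 1) :
    (1 - x) ^ k * ∑' m : ℕ, (Nat.multichoose k (m + ν) : 𝕜) * x ^ m = lpoly k ν x := by
  induction k with
  | zero =>
    rw [pow_zero, one_mul, lpoly]
    rcases ν with _ | ν
    · rw [tsum_eq_single 0]
      · simp
      · intro m hm
        obtain ⟨n, rfl⟩ := Nat.exists_eq_succ_of_ne_zero hm
        simp
    · simp [← add_assoc]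
  | succ k ih =>
    have hs := summable_multichoose_mul_pow (k + 1) ν hx
    have hs' := summable_multichoose_mul_pow k ν hx
    rw [lpoly_succ, ← ih]
    set A := ∑' m : ℕ, (Nat.multichoose (k + 1) (m + ν) : 𝕜) * x ^ m with hA
    set B := ∑' m : ℕ, (Nat.multichoose k (m + ν) : 𝕜) * x ^ m with hB
    have h1 : A = (Nat.multichoose (k + 1) ν : 𝕜) +
        ∑' m : ℕ, (Nat.multichoose (k + 1) (m + 1 + ν) : 𝕜) * x ^ (m + 1) := by
      rw [hA, hs.tsum_eq_zero_add]; simp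
    have h2 : B = (Nat.multichoose k ν : 𝕜) +
        ∑' m : ℕ, (Nat.multichoose k (m + 1 + ν) : 𝕜) * x ^ (m + 1) := by
      rw [hB, hs'.tsum_eq_zero_add]; simp
    have h3 : ∑' m : ℕ, (Nat.multichoose (k + 1) (m + 1 + ν) : 𝕜) * x ^ (m + 1) =
        (∑' m : ℕ, (Nat.multichoose k (m + 1 + ν) : 𝕜) * x ^ (m + 1)) + x * A := by
      rw [hA, ← tsum_mul_left, ← Summable.tsum_add ((summable_nat_add_iff 1).mpr hs')
        (hs.mul_left x)]
      refine tsum_congr fun m => ?_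
      rw [show m + 1 + ν = (m + ν) + 1 by ring, Nat.multichoose_succ_succ]
      push_cast
      ring
    have h4 : (1 - x) * A = B + (if ν = 0 then 0 else (Nat.multichoose (k + 1) (ν - 1) : 𝕜)) := by
      have e : (Nat.multichoose (k + 1) ν : 𝕜) = Nat.multichoose k ν +
          (if ν = 0 then 0 else (Nat.multichoose (k + 1) (ν - 1) : 𝕜)) := by
        rcases ν with _ | ν
        · simp
        · rw [Nat.multichoose_succ_succ]; simp
      linear_combination h1 - h2 + h3 + e
    rw [pow_succ, mul_assoc, h4]
    split_ifs <;> ring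

lemma lpoly_norm_le {R : Type*} [CommRing R] {N : R → ℝ} (h : IsSubNorm N) (k ν : ℕ) {x : R}
    (hx : N x ≤ 1) : N (lpoly k ν x) ≤ (k + 1) * 2 ^ k * ((ν : ℝ) + 1) ^ k := by
  unfold lpoly
  split_ifs with hν
  · subst hν
    refine h.one.trans ?_
    simp only [Nat.cast_zero, zero_add, one_pow, mul_one]
    have : (1 : ℝ) ≤ 2 ^ k := one_le_pow₀ (by norm_num)
    nlinarith [(Nat.cast_nonneg k : (0 : ℝ) ≤ k)]
  · refine (h.sum_le _ _).trans ?_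
    have h1x : N (1 - x) ≤ 2 := (h.sub_le _ _).trans (by linarith [h.one])
    have : ∀ i ∈ Finset.range k, N ((Nat.multichoose (i + 1) (ν - 1) : R) * (1 - x) ^ i) ≤
        2 ^ k * ((ν : ℝ) + 1) ^ k := by
      intro i hi
      have hi' : i + 1 ≤ k := by simpa using hi
      calc _ ≤ (Nat.multichoose (i + 1) (ν - 1) : ℝ) * N ((1 - x) ^ i) := h.natCast_mul_le _ _
        _ ≤ ((ν : ℝ) + 1) ^ k * 2 ^ k := by
          have e1 : (Nat.multichoose (i + 1) (ν - 1) : ℝ) ≤ ((ν : ℝ) + 1) ^ k := by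
            have : Nat.multichoose (i + 1) (ν - 1) ≤ (ν + 1) ^ k :=
              (multichoose_le_pow _ _).trans ((Nat.pow_le_pow_left (by omega) _).trans
                (Nat.pow_le_pow_right (by omega) hi'))
            exact_mod_cast this
          have e2 : N ((1 - x) ^ i) ≤ 2 ^ k :=
            (h.pow_le _ _).trans ((pow_le_pow_left₀ (h.nonneg _) h1x i).trans
              (pow_le_pow_right₀ (by norm_num) (by omega)))
          exact mul_le_mul e1 e2 (h.nonneg _) (by positivity)
        _ = _ := mul_comm _ _
    refine (Finset.sum_le_card_nsmul _ _ _ this).trans ?_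
    rw [Finset.card_range, nsmul_eq_mul, mul_assoc]
    gcongr
    linarith

/-! ### The Taylor series of the local densities -/

/-- The factor at `p` of the series `H(d)` for `p^ν ∥ d`. -/
def hloc (k p ν : ℕ) : PowerSeries ℝ :=
  pw p ^ ν * lpoly k ν (PowerSeries.C (invN p) * pw p)

/-- The Taylor series in `z` of `τ_k(d) G_{d,k}(1 + z) d^{-z}`, as a function of `d`. -/
def hSer (k : ℕ) : ArithmeticFunction (PowerSeries ℝ) :=
  ⟨fun n => if n = 0 then 0 else ∏ p ∈ n.primeFactors, hloc k p (n.factorization p), by simp⟩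

lemma hSer_apply (k n : ℕ) : hSer k n =
    if n = 0 then 0 else ∏ p ∈ n.primeFactors, hloc k p (n.factorization p) := rfl

lemma hloc_zero (k p : ℕ) : hloc k p 0 = 1 := by simp [hloc, lpoly]

lemma isMultiplicative_hSer (k : ℕ) : (hSer k).IsMultiplicative := by
  refine ⟨by simp [hSer_apply], fun {m n} hmn => ?_⟩
  rw [hSer_apply, hSer_apply, hSer_apply]
  by_cases hm : m = 0
  · simp [hm]
  by_cases hn : n = 0
  · simp [hn]
  rw [if_neg hm, if_neg hn, if_neg (mul_ne_zero hm hn)]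
  exact prod_primeFactors_mul_of_coprime (hloc k) hmn

lemma hSer_prime_pow (k : ℕ) {p : ℕ} (hp : p.Prime) (ν : ℕ) : hSer k (p ^ ν) = hloc k p ν := by
  rw [hSer_apply, if_neg (pow_ne_zero _ hp.ne_zero)]
  rcases ν with _ | ν
  · simp [hloc_zero]
  · rw [Nat.primeFactors_prime_pow (by omega) hp, Finset.prod_singleton]
    simp [hp.factorization]

/-- The power series `(H * μ)(n)`, whose coefficients are, up to a fixed factor, the values
`(h_{j,k} * μ)(n)`. -/
def hMu (k : ℕ) : ArithmeticFunction (PowerSeries ℝ) := hSer k * (μ : ArithmeticFunction _)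

lemma isMultiplicative_moebius_cast (R : Type*) [CommRing R] :
    (μ : ArithmeticFunction R).IsMultiplicative := ArithmeticFunction.isMultiplicative_moebius.intCast

lemma isMultiplicative_zeta_cast (R : Type*) [CommRing R] :
    (ζ : ArithmeticFunction R).IsMultiplicative := ArithmeticFunction.isMultiplicative_zeta.natCast

lemma isMultiplicative_hMu (k : ℕ) : (hMu k).IsMultiplicative :=
  (isMultiplicative_hSer k).mul (isMultiplicative_moebius_cast _)

lemma mul_moebius_prime_pow {R : Type*} [CommRing R] (f : ArithmeticFunction R) {p : ℕ}
    (hp : p.Prime) (ν : ℕ) :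
    (f * (μ : ArithmeticFunction R)) (p ^ (ν + 1)) = f (p ^ (ν + 1)) - f (p ^ ν) := by
  rw [mul_apply_prime_pow _ _ hp, Finset.Nat.sum_antidiagonal_succ']
  have h1 : (μ : ArithmeticFunction R) (p ^ 0) = 1 := by simp
  rw [h1, mul_one]
  cases ν with
  | zero =>
    simp [ArithmeticFunction.moebius_apply_prime hp]
    ring
  | succ ν =>
    rw [Finset.Nat.sum_antidiagonal_succ']
    have h2 : (μ : ArithmeticFunction R) (p ^ (0 + 1)) = -1 := by
      simp [ArithmeticFunction.moebius_apply_prime hp]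
    rw [h2, Finset.sum_eq_zero]
    · ring
    · intro q _
      rw [ArithmeticFunction.intCoe_apply,
        ArithmeticFunction.moebius_apply_prime_pow hp (by omega)]
      simp

/-- The generating function in `z` and `w` of the coefficients of the quadratic form in the
functions `h_{j,k} * μ`. -/
def gramF (k : ℕ) : ArithmeticFunction Ser2 :=
  ⟨fun n => inC ((n.totient : ℝ)⁻¹) * (inZ (hMu k n) * inW (hMu k n)), by simp⟩

lemma gramF_apply (k n : ℕ) : gramF k n =
    inC ((n.totient : ℝ)⁻¹) * (inZ (hMu k n) * inW (hMu k n)) := rfl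

lemma isMultiplicative_gramF (k : ℕ) : (gramF k).IsMultiplicative := by
  refine ⟨by simp [gramF_apply, (isMultiplicative_hMu k).map_one], fun {m n} hmn => ?_⟩
  rw [gramF_apply, gramF_apply, gramF_apply, (isMultiplicative_hMu k).map_mul_of_coprime hmn,
    Nat.totient_mul hmn]
  push_cast
  rw [mul_inv, map_mul, map_mul, map_mul]
  ring

/-! ### Comparison of the quadratic form with zeta factors -/

/-- A product of zeta-type factors that agrees with `gramF` up to an absolutely convergent
Dirichlet series: its Dirichlet series in `s` is
`(ζ(1+s+z+w)/ζ(1+s+z))^k (ζ(1+s+z+w)/ζ(1+s+w))^k ζ(1+s+z+w)^{k²-2k} ζ(1+s)`. -/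
def gramG (k : ℕ) : ArithmeticFunction Ser2 :=
  quotZ ^ k * quotW ^ k * twist wtZW (ζ : ArithmeticFunction Ser2) ^ (k ^ 2 - 2 * k) *
    twist wt0 (ζ : ArithmeticFunction Ser2)

/-- The Dirichlet inverse of `gramG`. -/
def gramInv (k : ℕ) : ArithmeticFunction Ser2 :=
  twist wtZW (μ : ArithmeticFunction Ser2) ^ (k ^ 2) *
    twist wtZ (ζ : ArithmeticFunction Ser2) ^ k * twist wtW (ζ : ArithmeticFunction Ser2) ^ k *
    twist wt0 (μ : ArithmeticFunction Ser2)

/-- The quotient of `gramF` by `gramG`. -/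
def gramE (k : ℕ) : ArithmeticFunction Ser2 := gramF k * gramInv k

lemma two_mul_le_sq {k : ℕ} (hk : 2 ≤ k) : 2 * k ≤ k ^ 2 := by nlinarith

lemma gramInv_mul_gramG {k : ℕ} (hk : 2 ≤ k) : gramInv k * gramG k = 1 := by
  obtain ⟨n, hn⟩ := Nat.exists_eq_add_of_le (two_mul_le_sq hk)
  have hA := twist_zeta_mul_twist_moebius wtZW_mul wtZW_one
  have hB := twist_zeta_mul_twist_moebius wtZ_mul wtZ_one
  have hC := twist_zeta_mul_twist_moebius wtW_mul wtW_one
  have hD := twist_zeta_mul_twist_moebius wt0_mul wt0_one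
  rw [gramInv, gramG, quotZ, quotW, hn, Nat.add_sub_cancel_left]
  set A := twist wtZW (ζ : ArithmeticFunction Ser2)
  set A' := twist wtZW (μ : ArithmeticFunction Ser2)
  set B := twist wtZ (ζ : ArithmeticFunction Ser2)
  set B' := twist wtZ (μ : ArithmeticFunction Ser2)
  set C := twist wtW (ζ : ArithmeticFunction Ser2)
  set C' := twist wtW (μ : ArithmeticFunction Ser2)
  set D := twist wt0 (ζ : ArithmeticFunction Ser2)
  set D' := twist wt0 (μ : ArithmeticFunction Ser2)
  calc _ = (A * A') ^ (2 * k + n) * (B * B') ^ k * (C * C') ^ k * (D * D') := by ring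
    _ = 1 := by rw [hA, hB, hC, hD]; simp

lemma gramE_mul_gramG {k : ℕ} (hk : 2 ≤ k) : gramE k * gramG k = gramF k := by
  rw [gramE, mul_assoc, gramInv_mul_gramG hk, mul_one]

/-- The symbol `(1 + z)^k (1 + w)^k / (1 + z + w)^{k²}` of `gramG`. -/
def gramSymbol (k : ℕ) : Ser2 := (1 + varZ) ^ k * (1 + varW) ^ k * symS ^ (k ^ 2)

/-- The order is that of the pole at `s = 0`: the quotients contribute nothing, and the remaining
`k² - 2k + 1` zeta factors contribute one each. -/
lemma hasSymbol_gramG {k : ℕ} (hk : 2 ≤ k) :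
    HasSymbol (k ^ 2 - 2 * k + 1) (gramG k) (gramSymbol k) := by
  have h := (((hasSymbol_quotZ.pow k).mul (hasSymbol_quotW.pow k)).mul
    (hasSymbol_twist_wtZW_zeta.pow (k ^ 2 - 2 * k))).mul hasSymbol_twist_wt0_zeta
  have e : ((1 + varZ) * symS) ^ k * ((1 + varW) * symS) ^ k * symS ^ (k ^ 2 - 2 * k) * 1 =
      gramSymbol k := by
    obtain ⟨n, hn⟩ := Nat.exists_eq_add_of_le (two_mul_le_sq hk)
    rw [gramSymbol, hn, Nat.add_sub_cancel_left, mul_pow, mul_pow]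
    ring
  rw [e] at h
  simpa [gramG] using h

lemma isMultiplicative_gramInv (k : ℕ) : (gramInv k).IsMultiplicative :=
  (((isMultiplicative_pow (isMultiplicative_twist wtZW_one wtZW_mul
      (isMultiplicative_moebius_cast _)) _).mul
    (isMultiplicative_pow (isMultiplicative_twist wtZ_one wtZ_mul
      (isMultiplicative_zeta_cast _)) _)).mul
    (isMultiplicative_pow (isMultiplicative_twist wtW_one wtW_mul
      (isMultiplicative_zeta_cast _)) _)).mul
    (isMultiplicative_twist wt0_one wt0_mul (isMultiplicative_moebius_cast _))

lemma isMultiplicative_gramE (k : ℕ) : (gramE k).IsMultiplicative :=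
  (isMultiplicative_gramF k).mul (isMultiplicative_gramInv k)

lemma mul_apply_prime {R : Type*} [CommRing R] {F G : ArithmeticFunction R} (hF : F 1 = 1)
    (hG : G 1 = 1) {p : ℕ} (hp : p.Prime) : (F * G) p = F p + G p := by
  have := mul_apply_prime_pow F G hp 1
  rw [pow_one, Finset.Nat.sum_antidiagonal_succ] at this
  rw [this]
  simp [hF, hG, add_comm]

lemma pow_apply_one {R : Type*} [CommRing R] {F : ArithmeticFunction R} (hF : F 1 = 1) (n : ℕ) :
    (F ^ n) 1 = 1 := by
  induction n with
  | zero => simp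
  | succ n ih => rw [pow_succ]; simp [ArithmeticFunction.mul_apply, ih, hF]

lemma pow_apply_prime {R : Type*} [CommRing R] {F : ArithmeticFunction R} (hF : F 1 = 1) {p : ℕ}
    (hp : p.Prime) (n : ℕ) : (F ^ n) p = n * F p := by
  induction n with
  | zero => simp [ArithmeticFunction.one_apply_ne hp.ne_one]
  | succ n ih =>
    rw [pow_succ, mul_apply_prime (pow_apply_one hF n) hF hp, ih]
    push_cast; ring

lemma gramInv_apply_prime (k : ℕ) {p : ℕ} (hp : p.Prime) : gramInv k p =
    -(inC (invN p) * ((k * inZ (pw p) - 1) * (k * inW (pw p) - 1))) := by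
  have one1 : ∀ φ : ℕ → Ser2, φ 1 = 1 → twist φ (μ : ArithmeticFunction Ser2) 1 = 1 :=
    fun φ h => by simp [h]
  have one2 : ∀ φ : ℕ → Ser2, φ 1 = 1 → twist φ (ζ : ArithmeticFunction Ser2) 1 = 1 :=
    fun φ h => by simp [h]
  have mu1 : ∀ φ : ℕ → Ser2, twist φ (μ : ArithmeticFunction Ser2) p = -φ p :=
    fun φ => by simp [ArithmeticFunction.moebius_apply_prime hp]
  have ze1 : ∀ φ : ℕ → Ser2, twist φ (ζ : ArithmeticFunction Ser2) p = φ p :=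
    fun φ => by simp [hp.ne_zero]
  have i1 := pow_apply_one (one1 _ wtZW_one) (k ^ 2)
  have i2 := pow_apply_one (one2 _ wtZ_one) k
  have i3 := pow_apply_one (one2 _ wtW_one) k
  have mul1 : ∀ F G : ArithmeticFunction Ser2, F 1 = 1 → G 1 = 1 → (F * G) 1 = 1 :=
    fun F G h h' => by simp [ArithmeticFunction.mul_apply, h, h']
  rw [gramInv, mul_apply_prime (mul1 _ _ (mul1 _ _ i1 i2) i3) (one1 _ wt0_one) hp,
    mul_apply_prime (mul1 _ _ i1 i2) i3 hp, mul_apply_prime i1 i2 hp,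
    pow_apply_prime (one1 _ wtZW_one) hp, pow_apply_prime (one2 _ wtZ_one) hp,
    pow_apply_prime (one2 _ wtW_one) hp, mu1, mu1, ze1, ze1, wtZW, wtZ, wtW, wt0]
  push_cast
  ring

/-! ### Bounds at the primes -/

section Bounds

variable (M : ℕ) {p : ℕ}

lemma rpow_sixteenth (hp : p.Prime) : ∃ t : ℝ, 1 ≤ t ∧ (p : ℝ) = t ^ 16 ∧
    (p : ℝ) ^ (1 / 16 : ℝ) = t ∧ (p : ℝ) ^ (-(7 / 8) : ℝ) = (t ^ 14)⁻¹ ∧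
    (p : ℝ) ^ (-(7 / 4) : ℝ) = (t ^ 28)⁻¹ := by
  have h1 : (1 : ℝ) ≤ p := by exact_mod_cast hp.one_le
  have h0 : (0 : ℝ) ≤ p := by linarith
  refine ⟨(p : ℝ) ^ (1 / 16 : ℝ), Real.one_le_rpow h1 (by norm_num), ?_, rfl, ?_, ?_⟩
  · rw [← Real.rpow_natCast, ← Real.rpow_mul h0]; norm_num
  · rw [Real.rpow_neg h0, ← Real.rpow_natCast, ← Real.rpow_mul h0]; norm_num
  · rw [Real.rpow_neg h0, ← Real.rpow_natCast, ← Real.rpow_mul h0]; norm_num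

lemma nrm1_C_mul_pw_le (hp : p.Prime) {t : ℝ} (ht : 1 ≤ t) (h16 : (p : ℝ) = t ^ 16)
    (hpt : (p : ℝ) ^ (1 / 16 : ℝ) = t) :
    nrm1 M (PowerSeries.C (invN p) * pw p) ≤ (t ^ 15)⁻¹ := by
  have h0 : 0 < t := by linarith
  refine ((isSubNorm_nrm1 M).mul_le _ _).trans ?_
  rw [nrm1_C]
  calc _ ≤ |invN p| * t := by
        gcongr
        rw [← hpt]; exact nrm1_pw_le M hp.one_le
    _ = _ := by
      rw [invN, h16, abs_of_pos (by positivity)]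
      field_simp

lemma nrm1_hloc_le (k : ℕ) (hp : p.Prime) (ν : ℕ) :
    nrm1 M (hloc k p ν) ≤ ((k + 1) * 2 ^ k) * ((ν : ℝ) + 1) ^ k * ((p : ℝ) ^ (1 / 16 : ℝ)) ^ ν := by
  have h := isSubNorm_nrm1 M
  obtain ⟨t, ht, h16, hpt, -, -⟩ := rpow_sixteenth hp
  have hy := nrm1_C_mul_pw_le M hp ht h16 hpt
  have ht0 : 0 < t := by linarith
  have hy1 : (t ^ 15)⁻¹ ≤ 1 := inv_le_one_of_one_le₀ (one_le_pow₀ ht)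
  have hP : nrm1 M (pw p) ≤ t := by rw [← hpt]; exact nrm1_pw_le M hp.one_le
  rw [hloc, hpt]
  calc _ ≤ nrm1 M (pw p ^ ν) * nrm1 M (lpoly k ν (PowerSeries.C (invN p) * pw p)) := h.mul_le _ _
    _ ≤ t ^ ν * ((k + 1) * 2 ^ k * ((ν : ℝ) + 1) ^ k) :=
        mul_le_mul ((h.pow_le _ _).trans (pow_le_pow_left₀ (h.nonneg _) hP ν))
          (lpoly_norm_le h k ν (hy.trans hy1)) (h.nonneg _) (by positivity)
    _ = _ := mul_comm _ _

lemma nrm1_hMu_le (k : ℕ) (hp : p.Prime) (ν : ℕ) : nrm1 M (hMu k (p ^ ν)) ≤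
    (2 * ((k + 1) * 2 ^ k)) * ((ν : ℝ) + 1) ^ k * ((p : ℝ) ^ (1 / 16 : ℝ)) ^ ν := by
  have h := isSubNorm_nrm1 M
  have hA : (1 : ℝ) ≤ (k + 1) * 2 ^ k := by
    have : (1 : ℝ) ≤ 2 ^ k := one_le_pow₀ (by norm_num)
    nlinarith [(Nat.cast_nonneg k : (0 : ℝ) ≤ k)]
  have hp1 : (1 : ℝ) ≤ (p : ℝ) ^ (1 / 16 : ℝ) :=
    Real.one_le_rpow (by exact_mod_cast hp.one_le) (by norm_num)
  rcases ν with _ | ν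
  · rw [pow_zero, (isMultiplicative_hMu k).map_one]
    refine h.one.trans ?_
    simp
    linarith
  · rw [hMu, mul_moebius_prime_pow _ hp, hSer_prime_pow k hp, hSer_prime_pow k hp]
    refine (h.sub_le _ _).trans ?_
    have h1 := nrm1_hloc_le M k hp (ν + 1)
    have h2 : nrm1 M (hloc k p ν) ≤ ((k + 1) * 2 ^ k) * (((ν + 1 : ℕ) : ℝ) + 1) ^ k *
        ((p : ℝ) ^ (1 / 16 : ℝ)) ^ (ν + 1) := by
      refine (nrm1_hloc_le M k hp ν).trans ?_
      gcongr
      · simp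
      · omega
    linarith

lemma inv_totient_prime_pow_le (hp : p.Prime) (ν : ℕ) :
    ((Nat.totient (p ^ ν) : ℕ) : ℝ)⁻¹ ≤ 2 * ((p : ℝ)⁻¹) ^ ν := by
  have hp2 : (2 : ℝ) ≤ p := by exact_mod_cast hp.two_le
  rcases ν with _ | ν
  · simp
  · rw [Nat.totient_prime_pow_succ hp]
    push_cast [Nat.cast_sub hp.one_le]
    rw [inv_pow, pow_succ, mul_inv, mul_inv, ← mul_assoc, mul_comm (2 : ℝ), mul_assoc]
    gcongr
    rw [← div_eq_mul_inv, inv_eq_one_div, div_le_div_iff₀ (by linarith) (by linarith)]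
    linarith

/-- The bound `p^{-7ν/8}` is `1/φ(p^ν)` against two factors of size `p^{ν/16}`. -/
lemma locBd_gramF (k : ℕ) : LocBd (nrm2 M) (gramF k) := by
  have h := isSubNorm_nrm2 M
  have h1 := isSubNorm_nrm1 M
  set A : ℝ := 2 * ((k + 1) * 2 ^ k) with hA
  refine ⟨2 * A ^ 2, by positivity, 2 * k, fun p hp ν => ?_⟩
  obtain ⟨t, ht, h16, hpt, h78, -⟩ := rpow_sixteenth hp
  have ht0 : 0 < t := by linarith
  have hb := nrm1_hMu_le M k hp ν
  rw [hpt] at hb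
  rw [gramF_apply, h78]
  calc _ ≤ nrm2 M (inC ((Nat.totient (p ^ ν) : ℝ)⁻¹)) *
        (nrm2 M (inZ (hMu k (p ^ ν))) * nrm2 M (inW (hMu k (p ^ ν)))) :=
        (h.mul_le _ _).trans (mul_le_mul_of_nonneg_left (h.mul_le _ _) (h.nonneg _))
    _ ≤ (2 * ((p : ℝ)⁻¹) ^ ν) * ((A * ((ν : ℝ) + 1) ^ k * t ^ ν) *
          (A * ((ν : ℝ) + 1) ^ k * t ^ ν)) := by
        rw [nrm2_inZ, nrm2_inW, nrm2_inC, abs_of_nonneg (by positivity)]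
        have := h1.nonneg (hMu k (p ^ ν))
        have := inv_totient_prime_pow_le hp ν
        gcongr
    _ = 2 * A ^ 2 * ((ν : ℝ) + 1) ^ (2 * k) * (((p : ℝ)⁻¹) * t ^ 2) ^ ν := by
        rw [mul_pow _ (t ^ 2), ← pow_mul, mul_comm 2 ν, pow_mul t]; ring
    _ = _ := by
        congr 2
        rw [h16]; field_simp

lemma nrm2_wt_le (hp : p.Prime) : nrm2 M (wt0 p) ≤ (p : ℝ) ^ (-(7 / 8) : ℝ) ∧
    nrm2 M (wtZ p) ≤ (p : ℝ) ^ (-(7 / 8) : ℝ) ∧ nrm2 M (wtW p) ≤ (p : ℝ) ^ (-(7 / 8) : ℝ) ∧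
    nrm2 M (wtZW p) ≤ (p : ℝ) ^ (-(7 / 8) : ℝ) := by
  have h := isSubNorm_nrm2 M
  obtain ⟨t, ht, h16, hpt, h78, -⟩ := rpow_sixteenth hp
  have ht0 : 0 < t := by linarith
  have hP : nrm1 M (pw p) ≤ t := by rw [← hpt]; exact nrm1_pw_le M hp.one_le
  have hP0 := (isSubNorm_nrm1 M).nonneg (pw p)
  have hi : |invN p| = (t ^ 16)⁻¹ := by rw [invN, h16, abs_of_pos (by positivity)]
  have e : (t ^ 16)⁻¹ * t ^ 2 = (t ^ 14)⁻¹ := by field_simp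
  have h1 : t ≤ t ^ 2 := by nlinarith
  have h2 : 1 ≤ t ^ 2 := by nlinarith
  rw [h78, ← e]
  refine ⟨?_, ?_, ?_, ?_⟩
  · rw [wt0, nrm2_inC, hi]
    exact le_mul_of_one_le_right (by positivity) h2
  · refine (h.mul_le _ _).trans ?_
    rw [nrm2_inC, nrm2_inZ, hi]
    gcongr
    exact hP.trans h1
  · refine (h.mul_le _ _).trans ?_
    rw [nrm2_inC, nrm2_inW, hi]
    gcongr
    exact hP.trans h1
  · refine (h.mul_le _ _).trans ?_
    rw [nrm2_inC, hi]
    gcongr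
    refine (h.mul_le _ _).trans ?_
    rw [nrm2_inZ, nrm2_inW, pow_two]
    gcongr

lemma locBd_gramE (k : ℕ) : LocBd (nrm2 M) (gramE k) := by
  have h := isSubNorm_nrm2 M
  refine (locBd_gramF M k).mul h ?_
  refine LocBd.mul h (LocBd.mul h (LocBd.mul h ?_ ?_) ?_) ?_
  · exact (LocBd.twist_moebius h wtZW_one fun p hp => (nrm2_wt_le M hp).2.2.2).pow h _
  · exact (LocBd.twist_zeta h wtZ_mul wtZ_one fun p hp => (nrm2_wt_le M hp).2.1).pow h _
  · exact (LocBd.twist_zeta h wtW_mul wtW_one fun p hp => (nrm2_wt_le M hp).2.2.1).pow h _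
  · exact LocBd.twist_moebius h wt0_one fun p hp => (nrm2_wt_le M hp).1

lemma one_sub_pow_sub_one_le {R : Type*} [CommRing R] {N : R → ℝ} (h : IsSubNorm N) {y : R}
    (hy : N y ≤ 1) (i : ℕ) : N ((1 - y) ^ i - 1) ≤ (2 ^ i - 1) * N y := by
  induction i with
  | zero => simp [h.zero]
  | succ i ih =>
    have e : (1 - y) ^ (i + 1) - 1 = ((1 - y) ^ i - 1) * (1 - y) - y := by ring
    rw [e]
    have h1 : N (1 - y) ≤ 2 := (h.sub_le _ _).trans (by linarith [h.one])
    have h2 : N (((1 - y) ^ i - 1) * (1 - y)) ≤ ((2 ^ i - 1) * N y) * 2 :=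
      (h.mul_le _ _).trans (mul_le_mul ih h1 (h.nonneg _) ((h.nonneg _).trans ih))
    refine (h.sub_le _ _).trans ?_
    rw [pow_succ]
    linarith

/-- At a prime, `H(p) - 1 = k p^{-z} - 1` up to a small error. -/
lemma exists_hMu_apply_prime (k : ℕ) (hp : p.Prime) {t : ℝ} (ht : 1 ≤ t) (h16 : (p : ℝ) = t ^ 16)
    (hpt : (p : ℝ) ^ (1 / 16 : ℝ) = t) : ∃ e : PowerSeries ℝ,
      hMu k p = (k * pw p - 1) + e ∧ nrm1 M e ≤ k * 2 ^ k * (t ^ 14)⁻¹ := by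
  have h := isSubNorm_nrm1 M
  set y := PowerSeries.C (invN p) * pw p with hy
  have hyb : nrm1 M y ≤ (t ^ 15)⁻¹ := nrm1_C_mul_pw_le M hp ht h16 hpt
  have ht0 : 0 < t := by linarith
  have hy1 : (t ^ 15)⁻¹ ≤ 1 := inv_le_one_of_one_le₀ (one_le_pow₀ ht)
  have hP : nrm1 M (pw p) ≤ t := by rw [← hpt]; exact nrm1_pw_le M hp.one_le
  refine ⟨pw p * ∑ i ∈ Finset.range k, ((1 - y) ^ i - 1), ?_, ?_⟩
  · have := mul_moebius_prime_pow (hSer k) hp 0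
    rw [zero_add, pow_one, pow_zero, (isMultiplicative_hSer k).map_one] at this
    rw [hMu, this, ← pow_one p, hSer_prime_pow k hp, pow_one, hloc, pow_one, lpoly,
      if_neg one_ne_zero, ← hy]
    simp only [Nat.sub_self, Nat.multichoose_zero_right, Nat.cast_one, one_mul,
      Finset.sum_sub_distrib, Finset.sum_const, Finset.card_range, nsmul_eq_mul, mul_one]
    ring
  · have hs : nrm1 M (∑ i ∈ Finset.range k, ((1 - y) ^ i - 1)) ≤ k * (2 ^ k * (t ^ 15)⁻¹) := by
      refine (h.sum_le _ _).trans ((Finset.sum_le_card_nsmul _ _ (2 ^ k * (t ^ 15)⁻¹)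
        fun i hi => ?_).trans (by simp))
      have hi' : i < k := by simpa using hi
      refine (one_sub_pow_sub_one_le h (hyb.trans hy1) i).trans ?_
      have e1 : (2 : ℝ) ^ i ≤ 2 ^ k := pow_le_pow_right₀ (by norm_num) hi'.le
      have := h.nonneg y
      calc _ ≤ 2 ^ k * nrm1 M y := by gcongr; linarith
        _ ≤ _ := by gcongr
    calc _ ≤ nrm1 M (pw p) * nrm1 M (∑ i ∈ Finset.range k, ((1 - y) ^ i - 1)) := h.mul_le _ _
      _ ≤ t * (k * (2 ^ k * (t ^ 15)⁻¹)) := mul_le_mul hP hs (h.nonneg _) ht0.le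
      _ = _ := by field_simp

/-- `gramG` is chosen such that the terms of order `1/p` of `gramF` and `gramInv` at `p` cancel. -/
lemma nrm2_gramE_prime_le (k : ℕ) : ∃ C : ℝ, ∀ p : ℕ, p.Prime →
    nrm2 M (gramE k p) ≤ C * (p : ℝ) ^ (-(7 / 4) : ℝ) := by
  have h := isSubNorm_nrm2 M
  have h1 := isSubNorm_nrm1 M
  set K : ℝ := k + 1 + k * 2 ^ k with hK
  refine ⟨4 * K ^ 2, fun p hp => ?_⟩
  obtain ⟨t, ht, h16, hpt, -, h74⟩ := rpow_sixteenth hp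
  have ht0 : 0 < t := by linarith
  obtain ⟨e, he, heb⟩ := exists_hMu_apply_prime M k hp ht h16 hpt
  have hP : nrm1 M (pw p) ≤ t := by rw [← hpt]; exact nrm1_pw_le M hp.one_le
  have hp2 : (2 : ℝ) ≤ p := by exact_mod_cast hp.two_le
  have hk0 : (0 : ℝ) ≤ k := Nat.cast_nonneg k
  have hkk : (0 : ℝ) ≤ k * 2 ^ k := by positivity
  have hK0 : 0 ≤ K := by positivity
  set a := hMu k p with ha
  set b : PowerSeries ℝ := k * pw p - 1 with hb
  have hbn : nrm1 M b ≤ (k + 1) * t := by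
    refine (h1.sub_le _ _).trans ?_
    have := (h1.natCast_mul_le k (pw p)).trans (mul_le_mul_of_nonneg_left hP hk0)
    linarith [h1.one]
  have hen : nrm1 M e ≤ K * (t ^ 14)⁻¹ := heb.trans (by gcongr; linarith)
  have han : nrm1 M a ≤ K * t := by
    rw [he]
    refine (h1.add_le _ _).trans ?_
    have : k * 2 ^ k * (t ^ 14)⁻¹ ≤ k * 2 ^ k * t := by
      gcongr
      exact (inv_le_one_of_one_le₀ (one_le_pow₀ ht)).trans ht
    rw [hK, add_mul]
    linarith
  have hbn' : nrm1 M b ≤ K * t := hbn.trans (by gcongr; linarith)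
  have hE : gramE k p = inC (((p : ℝ) - 1)⁻¹ - (p : ℝ)⁻¹) * (inZ a * inW a) +
      inC (invN p) * (inZ e * inW a + inZ b * inW e) := by
    rw [gramE, mul_apply_prime (isMultiplicative_gramF k).map_one
      (isMultiplicative_gramInv k).map_one hp, gramInv_apply_prime k hp, gramF_apply, ← ha,
      Nat.totient_prime hp, Nat.cast_sub hp.one_le, map_sub]
    have e1 : inZ a = (k * inZ (pw p) - 1) + inZ e := by rw [he, hb]; simp
    have e2 : inW a = (k * inW (pw p) - 1) + inW e := by rw [he, hb]; simp
    have e3 : inZ b = k * inZ (pw p) - 1 := by rw [hb]; simp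
    rw [e1, e2, e3, invN, Nat.cast_one]
    ring
  have hd : |((p : ℝ) - 1)⁻¹ - (p : ℝ)⁻¹| ≤ 2 * (t ^ 32)⁻¹ := by
    have e : ((p : ℝ) - 1)⁻¹ - (p : ℝ)⁻¹ = 1 / ((p - 1) * p) := by
      have : (p : ℝ) - 1 ≠ 0 := by linarith
      have : (p : ℝ) ≠ 0 := by linarith
      field_simp
      ring
    rw [e, abs_of_pos (by have : (0 : ℝ) < p - 1 := by linarith
                          positivity)]
    have e2 : 2 * (t ^ 32)⁻¹ = 2 / ((p : ℝ) * p) := by rw [h16, div_eq_mul_inv]; ring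
    rw [e2, div_le_div_iff₀ (by have : (0 : ℝ) < p - 1 := by linarith
                                positivity) (by positivity)]
    nlinarith
  have hab : ∀ c d : PowerSeries ℝ, ∀ x y : ℝ, 0 ≤ x → nrm1 M c ≤ x → nrm1 M d ≤ y →
      nrm2 M (inZ c * inW d) ≤ x * y := by
    intro c d x y hx hc hd
    refine (h.mul_le _ _).trans ?_
    rw [nrm2_inZ, nrm2_inW]
    exact mul_le_mul hc hd (h1.nonneg _) hx
  have hmul : ∀ (r : ℝ) (F : Ser2) (x y : ℝ), 0 ≤ x → |r| ≤ x → nrm2 M F ≤ y →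
      nrm2 M (inC r * F) ≤ x * y := by
    intro r F x y hx hr hF
    refine (h.mul_le _ _).trans ?_
    rw [nrm2_inC]
    exact mul_le_mul hr hF (h.nonneg _) hx
  have hip : |invN p| ≤ (t ^ 16)⁻¹ := by rw [invN, h16, abs_of_pos (by positivity)]
  rw [hE, h74]
  have b1 := hmul _ _ _ _ (by positivity) hd (hab a a _ _ (by positivity) han han)
  have b2 := hmul _ _ _ _ (by positivity) hip ((h.add_le _ _).trans
    (add_le_add (hab e a _ _ (by positivity) hen han) (hab b e _ _ (by positivity) hbn' hen)))
  refine (h.add_le _ _).trans ((add_le_add b1 b2).trans ?_)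
  have e30 : (t ^ 30)⁻¹ ≤ (t ^ 28)⁻¹ := by exact inv_anti₀ (by positivity) (pow_le_pow_right₀ ht (by norm_num))
  have e29 : (t ^ 29)⁻¹ ≤ (t ^ 28)⁻¹ := by exact inv_anti₀ (by positivity) (pow_le_pow_right₀ ht (by norm_num))
  calc _ = 2 * K ^ 2 * (t ^ 30)⁻¹ + 2 * K ^ 2 * (t ^ 29)⁻¹ := by field_simp; ring
    _ ≤ 2 * K ^ 2 * (t ^ 28)⁻¹ + 2 * K ^ 2 * (t ^ 28)⁻¹ := by gcongr
    _ = _ := by ring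

/-- The factor `gramE` converges absolutely, with room for powers of the logarithm. -/
lemma summable_nrm2_gramE (k : ℕ) :
    Summable fun n : ℕ => nrm2 M (gramE k n) * (n : ℝ) ^ (1 / 8 : ℝ) := by
  obtain ⟨C, hC⟩ := nrm2_gramE_prime_le M k
  exact summable_of_locBd (isSubNorm_nrm2 M) (isMultiplicative_gramE k) (locBd_gramE M k) hC

end Bounds

lemma summable_cf_gramE (k : ℕ) (K : Ser2) (i j : ℕ) :
    Summable fun n : ℕ => |cf i j (K * gramE k n)| * (1 + Real.log n) := by
  set M := max i j
  have h := isSubNorm_nrm2 M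
  refine Summable.of_nonneg_of_le (fun n => ?_) (fun n => ?_)
    ((summable_nrm2_gramE M k).mul_left (16 ^ i * 16 ^ j * nrm2 M K * 9))
  · have := Real.log_natCast_nonneg n
    positivity
  · rcases Nat.eq_zero_or_pos n with rfl | hn
    · simp
    have hn1 : (1 : ℝ) ≤ n := by exact_mod_cast hn
    have hl : 1 + Real.log n ≤ 9 * (n : ℝ) ^ (1 / 8 : ℝ) := by
      have h1 := Real.log_le_rpow_div (x := (n : ℝ)) (by positivity) (by norm_num : (0 : ℝ) < 1 / 8)
      have h2 := Real.one_le_rpow hn1 (by norm_num : (0 : ℝ) ≤ 1 / 8)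
      linarith
    have h3 : |cf i j (K * gramE k n)| ≤ 16 ^ i * 16 ^ j * (nrm2 M K * nrm2 M (gramE k n)) :=
      (abs_cf_le_nrm2 (le_max_left i j) (le_max_right i j) _).trans (by
        gcongr; exact h.mul_le _ _)
    have := Real.log_nonneg hn1
    calc _ ≤ (16 ^ i * 16 ^ j * (nrm2 M K * nrm2 M (gramE k n))) * (9 * (n : ℝ) ^ (1 / 8 : ℝ)) := by
          have := h.nonneg K
          have := h.nonneg (gramE k n)
          gcongr
      _ = _ := by ring

/-! ### The constant of the quadratic form -/

/-- The coefficients at the powers of `p` are absolutely summable with sum `s`. -/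
def BellSum (F : ArithmeticFunction ℝ) (p : ℕ) (s : ℝ) : Prop :=
  (Summable fun ν : ℕ => ‖F (p ^ ν)‖) ∧ ∑' ν : ℕ, F (p ^ ν) = s

lemma BellSum.mul {F G : ArithmeticFunction ℝ} {p : ℕ} (hp : p.Prime) {s t : ℝ}
    (hF : BellSum F p s) (hG : BellSum G p t) : BellSum (F * G) p (s * t) := by
  refine ⟨(summable_norm_sum_mul_antidiagonal_of_summable_norm hF.1 hG.1).congr fun ν => ?_, ?_⟩
  · rw [mul_apply_prime_pow F G hp]
  · rw [← hF.2, ← hG.2, tsum_mul_tsum_eq_tsum_sum_antidiagonal_of_summable_norm hF.1 hG.1]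
    exact tsum_congr fun ν => mul_apply_prime_pow F G hp ν

lemma BellSum.one {p : ℕ} (hp : p.Prime) : BellSum 1 p 1 := by
  have h : ∀ ν : ℕ, ν ≠ 0 → (1 : ArithmeticFunction ℝ) (p ^ ν) = 0 := fun ν hν =>
    ArithmeticFunction.one_apply_ne (Nat.one_lt_pow hν hp.one_lt).ne'
  refine ⟨summable_of_ne_finset_zero (s := {0}) fun ν hν => ?_, ?_⟩
  · rw [h ν (by simpa using hν), norm_zero]
  · rw [tsum_eq_single 0 h]; simp

lemma BellSum.pow {F : ArithmeticFunction ℝ} {p : ℕ} (hp : p.Prime) {s : ℝ}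
    (hF : BellSum F p s) (k : ℕ) : BellSum (F ^ k) p (s ^ k) := by
  induction k with
  | zero => simpa using BellSum.one hp
  | succ k ih => rw [pow_succ, pow_succ]; exact ih.mul hp hF

lemma invN_prime_pos {p : ℕ} (hp : p.Prime) : 0 < invN p ∧ invN p < 1 := by
  have h2 : (1 : ℝ) < p := by exact_mod_cast hp.one_lt
  exact ⟨inv_pos.mpr (by linarith), inv_lt_one_of_one_lt₀ h2⟩

lemma invN_pow (p ν : ℕ) : invN (p ^ ν) = invN p ^ ν := by simp [invN]

lemma bellSum_twist_zeta {p : ℕ} (hp : p.Prime) :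
    BellSum (twist invN (ζ : ArithmeticFunction ℝ)) p (1 - invN p)⁻¹ := by
  obtain ⟨h0, h1⟩ := invN_prime_pos hp
  have e : ∀ ν : ℕ, twist invN (ζ : ArithmeticFunction ℝ) (p ^ ν) = invN p ^ ν := fun ν => by
    simp [invN_pow, hp.ne_zero]
  refine ⟨(summable_geometric_of_lt_one h0.le h1).congr fun ν => ?_, ?_⟩
  · rw [e, Real.norm_of_nonneg (by positivity)]
  · simp_rw [e]; exact tsum_geometric_of_lt_one h0.le h1

lemma bellSum_twist_moebius {p : ℕ} (hp : p.Prime) :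
    BellSum (twist invN (μ : ArithmeticFunction ℝ)) p (1 - invN p) := by
  have h : ∀ ν ∉ Finset.range 2, twist invN (μ : ArithmeticFunction ℝ) (p ^ ν) = 0 := by
    intro ν hν
    have : 1 < ν := by simpa using hν
    rw [twist_apply, ArithmeticFunction.intCoe_apply,
      ArithmeticFunction.moebius_apply_prime_pow hp (by omega), if_neg (by omega)]
    simp
  refine ⟨summable_of_ne_finset_zero (s := Finset.range 2) fun ν hν => ?_, ?_⟩
  · rw [h ν hν, norm_zero]
  · rw [tsum_eq_sum h, Finset.sum_range_succ, Finset.sum_range_one]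
    simp [ArithmeticFunction.moebius_apply_prime hp]
    ring

section Variance

variable (k : ℕ) {x : ℝ}

lemma summable_multichoose_sq (hx0 : 0 ≤ x) (hx1 : x < 1) (ν : ℕ) :
    Summable fun m : ℕ => (Nat.multichoose k (m + ν) : ℝ) ^ 2 * x ^ m := by
  refine Summable.of_nonneg_of_le (fun m => by positivity) (fun m => ?_)
    ((summable_poly_mul_geometric (k * 2) hx0 hx1).mul_left ((Nat.multichoose k ν : ℝ) ^ 2))
  have h : (Nat.multichoose k (m + ν) : ℝ) ≤ ((m : ℝ) + 1) ^ k * Nat.multichoose k ν := by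
    exact_mod_cast (multichoose_add_le k m ν).trans
      (Nat.mul_le_mul_right _ (multichoose_le_pow k m))
  calc _ ≤ (((m : ℝ) + 1) ^ k * Nat.multichoose k ν) ^ 2 * x ^ m := by gcongr
    _ = _ := by rw [mul_pow, ← pow_mul]; ring

/-- The variance of the geometric distribution: the tail variances
`V_ν = (1-x) ∑ a_{m+ν}² x^m - ((1-x) ∑ a_{m+ν} x^m)²` satisfy a recursion, which gives the sum of
the squares of the differences of the tail means. -/
lemma hasSum_sq_sub_tail (hx0 : 0 ≤ x) (hx1 : x < 1) :
    HasSum (fun ν : ℕ => x ^ (ν + 1) * (1 - x) *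
      ((∑' m : ℕ, (Nat.multichoose k (m + (ν + 1)) : ℝ) * x ^ m) -
        ∑' m : ℕ, (Nat.multichoose k (m + ν) : ℝ) * x ^ m) ^ 2)
      ((1 - x) * (∑' m : ℕ, (Nat.multichoose k m : ℝ) ^ 2 * x ^ m) -
        ((1 - x) * ∑' m : ℕ, (Nat.multichoose k m : ℝ) * x ^ m) ^ 2) := by
  set S : ℕ → ℝ := fun ν => ∑' m : ℕ, (Nat.multichoose k (m + ν) : ℝ) * x ^ m with hS
  set Q : ℕ → ℝ := fun ν => ∑' m : ℕ, (Nat.multichoose k (m + ν) : ℝ) ^ 2 * x ^ m with hQ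
  have hx1' : ‖x‖ < 1 := by rwa [Real.norm_of_nonneg hx0]
  have hSs : ∀ ν, Summable fun m : ℕ => (Nat.multichoose k (m + ν) : ℝ) * x ^ m :=
    fun ν => summable_multichoose_mul_pow k ν hx1'
  have hQs := summable_multichoose_sq k hx0 hx1
  have recS : ∀ ν, S ν = Nat.multichoose k ν + x * S (ν + 1) := by
    intro ν
    simp only [hS]
    rw [(hSs ν).tsum_eq_zero_add, ← tsum_mul_left]
    simp only [zero_add, pow_zero, mul_one]
    congr 1
    refine tsum_congr fun m => ?_
    rw [show m + 1 + ν = m + (ν + 1) by ring, pow_succ]; ring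
  have recQ : ∀ ν, Q ν = (Nat.multichoose k ν : ℝ) ^ 2 + x * Q (ν + 1) := by
    intro ν
    simp only [hQ]
    rw [(hQs ν).tsum_eq_zero_add, ← tsum_mul_left]
    simp only [zero_add, pow_zero, mul_one]
    congr 1
    refine tsum_congr fun m => ?_
    rw [show m + 1 + ν = m + (ν + 1) by ring, pow_succ]; ring
  set V : ℕ → ℝ := fun ν => (1 - x) * Q ν - ((1 - x) * S ν) ^ 2 with hV
  have recV : ∀ ν, V ν = x * V (ν + 1) + x * (1 - x) * (S (ν + 1) - S ν) ^ 2 := by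
    intro ν
    simp only [hV]
    rw [recS ν, recQ ν]
    ring
  have hpart : ∀ N : ℕ, ∑ ν ∈ Finset.range N, x ^ (ν + 1) * (1 - x) * (S (ν + 1) - S ν) ^ 2 =
      V 0 - x ^ N * V N := by
    intro N
    induction N with
    | zero => simp
    | succ N ih =>
      rw [Finset.sum_range_succ, ih, recV N]
      ring
  have hlim : Filter.Tendsto (fun N : ℕ => x ^ N * V N) Filter.atTop (𝓝 0) := by
    have hz := ((hQs 0).mul_left ((1 - x) * Q 0 + (1 - x) ^ 2 * S 0 ^ 2)).tendsto_atTop_zero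
    refine squeeze_zero_norm (fun N => ?_) hz
    have hS1 : S N ≤ Nat.multichoose k N * S 0 := by
      simp only [hS]
      rw [← tsum_mul_left]
      refine (hSs N).tsum_le_tsum (fun m => ?_) ((hSs 0).mul_left _)
      rw [← mul_assoc]
      gcongr
      rw [mul_comm]
      exact_mod_cast multichoose_add_le k m N
    have hQ1 : Q N ≤ (Nat.multichoose k N : ℝ) ^ 2 * Q 0 := by
      simp only [hQ]
      rw [← tsum_mul_left]
      refine (hQs N).tsum_le_tsum (fun m => ?_) ((hQs 0).mul_left _)
      rw [← mul_assoc, ← mul_pow]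
      gcongr
      rw [mul_comm]
      exact_mod_cast multichoose_add_le k m N
    have hS0 : ∀ ν, 0 ≤ S ν := fun ν => tsum_nonneg fun m => by positivity
    have hQ0 : ∀ ν, 0 ≤ Q ν := fun ν => tsum_nonneg fun m => by positivity
    have h1x : 0 ≤ 1 - x := by linarith
    have hVb : |V N| ≤ (Nat.multichoose k N : ℝ) ^ 2 * ((1 - x) * Q 0 + (1 - x) ^ 2 * S 0 ^ 2) := by
      have a1 : (1 - x) * Q N ≤ (1 - x) * ((Nat.multichoose k N : ℝ) ^ 2 * Q 0) := by gcongr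
      have a2 : ((1 - x) * S N) ^ 2 ≤ ((1 - x) * (Nat.multichoose k N * S 0)) ^ 2 := by
        have := hS0 N
        gcongr
      have a3 : 0 ≤ (1 - x) * Q N := mul_nonneg h1x (hQ0 N)
      have a4 := sq_nonneg ((1 - x) * S N)
      have e : ((1 - x) * (Nat.multichoose k N * S 0)) ^ 2 =
        (Nat.multichoose k N : ℝ) ^ 2 * ((1 - x) ^ 2 * S 0 ^ 2) := by ring
      have a5 : 0 ≤ (1 - x) * ((Nat.multichoose k N : ℝ) ^ 2 * Q 0) := a3.trans a1
      rw [abs_le]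
      constructor <;> simp only [hV] <;> nlinarith
    rw [Real.norm_eq_abs, abs_mul, abs_of_nonneg (by positivity), add_zero]
    calc _ ≤ x ^ N * ((Nat.multichoose k N : ℝ) ^ 2 *
          ((1 - x) * Q 0 + (1 - x) ^ 2 * S 0 ^ 2)) := by gcongr
      _ = _ := by ring
  rw [hasSum_iff_tendsto_nat_of_nonneg (fun ν => by
    have : 0 ≤ 1 - x := by linarith
    positivity)]
  have := (tendsto_const_nhds (x := V 0)).sub hlim
  rw [sub_zero] at this
  refine this.congr fun N => ?_
  exact (hpart N).symm

end Variance

/-- The constant coefficient of a series in two variables. -/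
def constC2 : Ser2 →+* ℝ := (PowerSeries.constantCoeff (R := ℝ)).comp PowerSeries.constantCoeff

lemma cf_zero_zero (F : Ser2) : cf 0 0 F = constC2 F := by
  simp [cf, constC2, PowerSeries.coeff_zero_eq_constantCoeff]

lemma constC2_inC (r : ℝ) : constC2 (inC r) = r := by simp [constC2, inC]

lemma constC2_inZ (a : PowerSeries ℝ) : constC2 (inZ a) = PowerSeries.constantCoeff a := by
  simp [constC2, inZ]

lemma constC2_inW (a : PowerSeries ℝ) : constC2 (inW a) = PowerSeries.constantCoeff a := by
  have : inW a = PowerSeries.map (PowerSeries.C) a := rfl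
  rw [this, constC2, RingHom.comp_apply,
    ← PowerSeries.coeff_zero_eq_constantCoeff_apply (PowerSeries.map _ a), PowerSeries.coeff_map]
  simp

lemma constantCoeff_pw (n : ℕ) : PowerSeries.constantCoeff (pw n) = 1 := by
  rw [← PowerSeries.coeff_zero_eq_constantCoeff_apply, coeff_pw]; simp

lemma mapA_constC2_twist {φ : ℕ → Ser2} (hφ : ∀ n, constC2 (φ n) = invN n)
    (f : ArithmeticFunction Ser2) (g : ArithmeticFunction ℝ) (hfg : mapA constC2 f = g) :
    mapA constC2 (twist φ f) = twist invN g := by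
  subst hfg
  ext n
  simp [hφ]

lemma mapA_constC2_gramInv (k : ℕ) : mapA constC2 (gramInv k) =
    twist invN (μ : ArithmeticFunction ℝ) ^ (k ^ 2) * twist invN (ζ : ArithmeticFunction ℝ) ^ k *
      twist invN (ζ : ArithmeticFunction ℝ) ^ k * twist invN (μ : ArithmeticFunction ℝ) := by
  have h0 : ∀ n, constC2 (wt0 n) = invN n := fun n => constC2_inC _
  have hZ : ∀ n, constC2 (wtZ n) = invN n := fun n => by
    rw [wtZ, map_mul, constC2_inC, constC2_inZ, constantCoeff_pw, mul_one]
  have hW : ∀ n, constC2 (wtW n) = invN n := fun n => by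
    rw [wtW, map_mul, constC2_inC, constC2_inW, constantCoeff_pw, mul_one]
  have hZW : ∀ n, constC2 (wtZW n) = invN n := fun n => by
    rw [wtZW, map_mul, map_mul, constC2_inC, constC2_inZ, constC2_inW, constantCoeff_pw, mul_one,
      mul_one]
  rw [gramInv, mapA_mul, mapA_mul, mapA_mul, mapA_pow, mapA_pow, mapA_pow,
    mapA_constC2_twist hZW _ _ (mapA_moebius _), mapA_constC2_twist hZ _ _ (mapA_zeta _),
    mapA_constC2_twist hW _ _ (mapA_zeta _), mapA_constC2_twist h0 _ _ (mapA_moebius _)]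

lemma constantCoeff_hloc (k p ν : ℕ) :
    PowerSeries.constantCoeff (hloc k p ν) = lpoly k ν (invN p) := by
  rw [hloc, map_mul, map_pow, constantCoeff_pw, one_pow, one_mul,
    map_lpoly, map_mul, constantCoeff_pw, mul_one]
  simp

/-- The Euler factor of `gramF` at `z = w = 0`. At `p^ν` the value of `H * μ` is a difference of
consecutive tail means, so the sum is given by the variance identity `hasSum_sq_sub_tail`. -/
lemma bellSum_gramF (k : ℕ) {p : ℕ} (hp : p.Prime) : BellSum (mapA constC2 (gramF (k + 1))) p
    ((1 - invN p) ^ (2 * k + 1) *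
      ∑' m : ℕ, (Nat.multichoose (k + 1) m : ℝ) ^ 2 * invN p ^ m) := by
  obtain ⟨h0, h1⟩ := invN_prime_pos hp
  set x := invN p with hx
  have h1x : 0 < 1 - x := by linarith
  have hx1' : ‖x‖ < 1 := by rwa [Real.norm_of_nonneg h0.le]
  have hp1 : (p : ℝ) ≠ 0 := by exact_mod_cast hp.ne_zero
  set S : ℕ → ℝ := fun ν => ∑' m : ℕ, (Nat.multichoose (k + 1) (m + ν) : ℝ) * x ^ m with hS
  have hlp : ∀ ν, lpoly (k + 1) ν x = (1 - x) ^ (k + 1) * S ν := fun ν =>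
    (lpoly_eq_tsum (k + 1) ν hx1').symm
  set F := mapA constC2 (gramF (k + 1)) with hF
  have hF0 : F (p ^ 0) = 1 := by
    rw [hF, mapA_apply, pow_zero, (isMultiplicative_gramF _).map_one, map_one]
  have hFs : ∀ ν : ℕ, F (p ^ (ν + 1)) =
      (1 - x) ^ (2 * k) * (x ^ (ν + 1) * (1 - x) * (S (ν + 1) - S ν) ^ 2) := by
    intro ν
    rw [hF, mapA_apply, gramF_apply, map_mul, map_mul, constC2_inC, constC2_inZ, constC2_inW, hMu,
      mul_moebius_prime_pow _ hp, hSer_prime_pow _ hp, hSer_prime_pow _ hp, map_sub,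
      constantCoeff_hloc, constantCoeff_hloc, ← hx, hlp, hlp, Nat.totient_prime_pow_succ hp]
    push_cast [Nat.cast_sub hp.one_le]
    have e : ((p : ℝ) ^ ν * (p - 1))⁻¹ * (1 - x) = x ^ (ν + 1) := by
      have h3 : (p : ℝ) - 1 ≠ 0 := by
        have : (1 : ℝ) < p := by exact_mod_cast hp.one_lt
        linarith
      rw [hx, invN, inv_pow]
      field_simp
      ring
    rw [← e]
    ring
  have hsum := (hasSum_sq_sub_tail (k + 1) h0.le h1).mul_left ((1 - x) ^ (2 * k))
  have hs1 : HasSum (fun ν : ℕ => F (p ^ (ν + 1))) ((1 - x) ^ (2 * k) *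
      ((1 - x) * (∑' m : ℕ, (Nat.multichoose (k + 1) m : ℝ) ^ 2 * x ^ m) -
        ((1 - x) * ∑' m : ℕ, (Nat.multichoose (k + 1) m : ℝ) * x ^ m) ^ 2)) := by
    rw [funext hFs]; exact hsum
  have hnn : ∀ ν, 0 ≤ F (p ^ ν) := by
    rintro (_ | ν)
    · rw [hF0]; exact zero_le_one
    · rw [hFs]; positivity
  have hsF : Summable fun ν : ℕ => F (p ^ ν) := (summable_nat_add_iff 1).mp hs1.summable
  refine ⟨hsF.congr fun ν => (Real.norm_of_nonneg (hnn ν)).symm, ?_⟩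
  rw [hsF.tsum_eq_zero_add, hF0, hs1.tsum_eq]
  have hl0 := hlp 0
  rw [lpoly, if_pos rfl] at hl0
  simp only [hS, add_zero] at hl0
  linear_combination -((1 : ℝ) + (1 - x) ^ (k + 1) * ∑' m : ℕ, (Nat.multichoose (k + 1) m : ℝ) * x ^ m) * -hl0

lemma localFactor_eq (k : ℕ) {p : ℕ} (hp : p.Prime) : localFactor k p =
    (1 - invN p) ^ (k ^ 2) * ∑' m : ℕ, (Nat.multichoose k m : ℝ) ^ 2 * invN p ^ m := by
  rw [localFactor, invN, one_div]
  congr 1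
  refine tsum_congr fun ν => ?_
  rw [tau_prime_pow k hp, inv_pow, div_eq_mul_inv]

lemma bellSum_gramE {k : ℕ} (hk : 2 ≤ k) {p : ℕ} (hp : p.Prime) :
    BellSum (mapA constC2 (gramE k)) p (localFactor k p) := by
  obtain ⟨m, rfl⟩ : ∃ m, k = m + 1 := ⟨k - 1, by omega⟩
  have hz := bellSum_twist_zeta hp
  have hm := bellSum_twist_moebius hp
  have h := (bellSum_gramF m hp).mul hp
    ((((hm.pow hp ((m + 1) ^ 2)).mul hp (hz.pow hp (m + 1))).mul hp (hz.pow hp (m + 1))).mul hp hm)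
  rw [gramE, mapA_mul, mapA_constC2_gramInv, localFactor_eq _ hp]
  convert h using 1
  have h1x : 1 - invN p ≠ 0 := by linarith [(invN_prime_pos hp).2]
  have e : (1 - invN p) ^ (2 * m + 1) * (1 - invN p) * ((1 - invN p)⁻¹) ^ (m + 1) *
      ((1 - invN p)⁻¹) ^ (m + 1) = 1 := by
    rw [inv_pow]
    field_simp
    ring
  linear_combination -(1 - invN p) ^ ((m + 1) ^ 2) *
    (∑' n : ℕ, (Nat.multichoose (m + 1) n : ℝ) ^ 2 * invN p ^ n) * e

lemma summable_norm_gramE (k : ℕ) : Summable fun n : ℕ => ‖mapA constC2 (gramE k) n‖ := by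
  refine Summable.of_nonneg_of_le (fun n => norm_nonneg _) (fun n => ?_)
    (summable_cf_gramE k 1 0 0)
  rw [one_mul, cf_zero_zero, Real.norm_eq_abs, mapA_apply]
  have := Real.log_natCast_nonneg n
  exact le_mul_of_one_le_right (abs_nonneg _) (by linarith)

lemma hasProd_localFactor {k : ℕ} (hk : 2 ≤ k) :
    HasProd (fun p : Nat.Primes => localFactor k p) (∑' n, cf 0 0 (gramE k n)) := by
  have hm := isMultiplicative_gramE k
  have := EulerProduct.eulerProduct_hasProd (f := fun n => mapA constC2 (gramE k) n)
    (by simp [hm.map_one]) (fun {m n} h => by simp [hm.map_mul_of_coprime h])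
    (summable_norm_gramE k) (by simp)
  have e : ∑' n, cf 0 0 (gramE k n) = ∑' n, mapA constC2 (gramE k) n :=
    tsum_congr fun n => cf_zero_zero _
  have e2 : (fun p : Nat.Primes => localFactor k p) =
      fun p : Nat.Primes => ∑' ν : ℕ, mapA constC2 (gramE k) ((p : ℕ) ^ ν) :=
    funext fun p => (bellSum_gramE hk p.2).2.symm
  rw [e, e2]
  exact this

/-- At `z = w = 0` the absolutely convergent factor has the sum `C_k`. -/
lemma tsum_gramE {k : ℕ} (hk : 2 ≤ k) : ∑' n, cf 0 0 (gramE k n) = constC k :=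
  (hasProd_localFactor hk).tprod_eq.symm

lemma localFactor_pos (k : ℕ) {p : ℕ} (hp : p.Prime) : 0 < localFactor k p := by
  obtain ⟨h0, h1⟩ := invN_prime_pos hp
  rw [localFactor_eq k hp]
  have h1x : 0 < 1 - invN p := by linarith
  have hs := summable_multichoose_sq k h0.le h1 0
  have : 0 < ∑' m : ℕ, (Nat.multichoose k m : ℝ) ^ 2 * invN p ^ m :=
    hs.tsum_pos (fun m => by positivity) 0 (by simp)
  positivity

/-- The product `C_k` converges absolutely and has positive factors. In particular the infinite
product in its definition is not a default value. -/
lemma constC_pos {k : ℕ} (hk : 2 ≤ k) : 0 < constC k := by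
  set f : ℕ → ℝ := fun n => mapA constC2 (gramE k) n with hf
  have hinj : Function.Injective fun q : Nat.Primes × ℕ => (q.1 : ℕ) ^ (q.2 + 1) := by
    rintro ⟨p, a⟩ ⟨q, b⟩ h
    simp only at h
    have hpq : p = q := Nat.Primes.coe_nat_injective (Nat.Prime.pow_inj' p.2 q.2 (by omega) (by omega) h).1
    subst hpq
    have := (Nat.pow_right_injective p.2.two_le).eq_iff.mp h
    simp at this
    simp [this]
  have h0 : Summable fun n => ‖f n‖ := summable_norm_gramE k
  have h1 : Summable fun q : Nat.Primes × ℕ => ‖f ((q.1 : ℕ) ^ (q.2 + 1))‖ :=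
    h0.comp_injective hinj
  have h2 : Summable fun p : Nat.Primes => ∑' a : ℕ, ‖f ((p : ℕ) ^ (a + 1))‖ := h1.prod
  have h3 : Summable fun p : Nat.Primes => localFactor k p - 1 := by
    refine Summable.of_norm_bounded h2 fun p => ?_
    have hb := bellSum_gramE hk p.2
    have hs : Summable fun ν : ℕ => f ((p : ℕ) ^ ν) := hb.1.of_norm
    have e : localFactor k p - 1 = ∑' a : ℕ, f ((p : ℕ) ^ (a + 1)) := by
      rw [← hb.2, hs.tsum_eq_zero_add]
      simp [hf, (isMultiplicative_gramE k).map_one]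
    rw [e]
    exact norm_tsum_le_tsum_norm
      ((summable_nat_add_iff (f := fun ν : ℕ => ‖f ((p : ℕ) ^ ν)‖) 1).mpr hb.1)
  have h4 := Real.summable_log_one_add_of_summable h3
  rw [constC, ← Real.rexp_tsum_eq_tprod (fun p => localFactor_pos k p.2)
    (h4.congr fun p => by rw [add_sub_cancel])]
  exact Real.exp_pos _

/-- The coefficients of the quadratic form: for `H` multiplied by a fixed series with constant
coefficient `1`, the sum of the coefficients of `z^i w^j` is asymptotically a power of the
logarithm. -/
theorem isType_gram {k : ℕ} (hk : 2 ≤ k) {Zr : PowerSeries ℝ}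
    (hZ : PowerSeries.constantCoeff Zr = 1) (i j : ℕ) :
    ∃ a : ArithmeticFunction ℝ, (∀ n, a n = PowerSeries.coeff i (Zr * hMu k n) *
      PowerSeries.coeff j (Zr * hMu k n) / (n.totient : ℝ)) ∧
      IsType ((k - 1) ^ 2 + i + j) (cf i j (gramSymbol k) * constC k) a := by
  set K : Ser2 := inZ Zr * inW Zr with hK
  set E : ArithmeticFunction Ser2 := ⟨fun n => K * gramE k n, by simp⟩ with hE
  have hEa : ∀ n, E n = K * gramE k n := fun n => rfl
  have h := (hasSymbol_gramG hk).isType_mul_summable (E := E)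
    (fun i j => summable_cf_gramE k K i j) i j
  have e1 : ∑' n, cf 0 0 (E n) = constC k := by
    rw [← tsum_gramE hk]
    refine tsum_congr fun n => ?_
    rw [hEa, cf_zero_zero, map_mul, hK, map_mul, constC2_inZ, constC2_inW, hZ, cf_zero_zero]
    ring
  have e2 : k ^ 2 - 2 * k + 1 = (k - 1) ^ 2 := by
    obtain ⟨m, rfl⟩ : ∃ m, k = m + 2 := ⟨k - 2, by omega⟩
    have : (m + 2) ^ 2 = 2 * (m + 2) + (m ^ 2 + 2 * m) := by ring
    rw [this, Nat.add_sub_cancel_left]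
    simp
    ring
  rw [e1, e2] at h
  refine ⟨_, fun n => ?_, h⟩
  rw [cfA_apply]
  have e3 : (E * gramG k) n = inC ((n.totient : ℝ)⁻¹) *
      (inZ (Zr * hMu k n) * inW (Zr * hMu k n)) := by
    have : (E * gramG k) n = K * (gramE k * gramG k) n := by
      rw [ArithmeticFunction.mul_apply, ArithmeticFunction.mul_apply, Finset.mul_sum]
      exact Finset.sum_congr rfl fun q _ => by rw [hEa, mul_assoc]
    rw [this, gramE_mul_gramG hk, gramF_apply, hK, map_mul, map_mul]
    ring
  rw [e3, cf_inC_mul, cf_inZ_mul_inW]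
  ring

/-! ### Polynomials in the logarithm as coefficients of power series -/

/-- The power series `exp(L X)`. -/
def pexp (L : ℝ) : PowerSeries ℝ := PowerSeries.rescale L (PowerSeries.exp ℝ)

lemma coeff_pexp (L : ℝ) (i : ℕ) : PowerSeries.coeff i (pexp L) = L ^ i / i.factorial := by
  simp [pexp, PowerSeries.coeff_rescale, PowerSeries.coeff_exp, div_eq_mul_inv]

lemma pexp_add (a b : ℝ) : pexp (a + b) = pexp a * pexp b := by
  rw [pexp, pexp, pexp, PowerSeries.exp_mul_exp_eq_exp_add]

lemma pexp_zero : pexp 0 = 1 := by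
  ext i
  rw [coeff_pexp, PowerSeries.coeff_one]
  split_ifs with h <;> simp [h]

lemma pw_eq_pexp (n : ℕ) : pw n = pexp (-Real.log n) := rfl

/-- The polynomial `∑_{i ≤ m} b_{m-i} L^i / i!` in `L`, where `B = ∑ b_i X^i`: the coefficient of
`X^m` in `B exp(L X)`. In this form, translations of `L` are multiplications of `B`. -/
def ev (m : ℕ) (B : PowerSeries ℝ) (L : ℝ) : ℝ := PowerSeries.coeff m (B * pexp L)

lemma ev_eq_sum (m : ℕ) (B : PowerSeries ℝ) (L : ℝ) : ev m B L =
    ∑ q ∈ Finset.HasAntidiagonal.antidiagonal m,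
      PowerSeries.coeff q.1 B * (L ^ q.2 / q.2.factorial) := by
  rw [ev, PowerSeries.coeff_mul]
  simp_rw [coeff_pexp]

lemma ev_add_right (m : ℕ) (B : PowerSeries ℝ) (L s : ℝ) :
    ev m B (L + s) = ev m (B * pexp s) L := by
  rw [ev, ev, pexp_add]; congr 1; ring

lemma ev_zero_right (m : ℕ) (B : PowerSeries ℝ) : ev m B 0 = PowerSeries.coeff m B := by
  rw [ev, pexp_zero, mul_one]

lemma ev_add (m : ℕ) (A B : PowerSeries ℝ) (L : ℝ) : ev m (A + B) L = ev m A L + ev m B L := by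
  rw [ev, add_mul, map_add, ev, ev]

lemma ev_sub (m : ℕ) (A B : PowerSeries ℝ) (L : ℝ) : ev m (A - B) L = ev m A L - ev m B L := by
  rw [ev, sub_mul, map_sub, ev, ev]

lemma ev_C_mul (m : ℕ) (c : ℝ) (B : PowerSeries ℝ) (L : ℝ) :
    ev m (PowerSeries.C c * B) L = c * ev m B L := by
  rw [ev, mul_assoc, PowerSeries.coeff_C_mul, ev]

lemma ev_succ_X_mul (m : ℕ) (B : PowerSeries ℝ) (L : ℝ) :
    ev (m + 1) (PowerSeries.X * B) L = ev m B L := by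
  rw [ev, mul_assoc, PowerSeries.coeff_succ_X_mul, ev]

lemma ev_X_pow (m : ℕ) (L : ℝ) : ev m (PowerSeries.X ^ m) L = 1 := by
  rw [ev]
  have := PowerSeries.coeff_X_pow_mul (pexp L) m 0
  rw [zero_add] at this
  rw [this, coeff_pexp]; simp

lemma hasDerivAt_coeff_pexp (i : ℕ) (L : ℝ) :
    HasDerivAt (fun L => PowerSeries.coeff i (pexp L))
      (PowerSeries.coeff i (PowerSeries.X * pexp L)) L := by
  simp_rw [coeff_pexp]
  rcases i with _ | i
  · simpa using hasDerivAt_const L (1 : ℝ)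
  · rw [PowerSeries.coeff_succ_X_mul, coeff_pexp]
    refine ((hasDerivAt_pow (i + 1) L).div_const _).congr_deriv ?_
    rw [Nat.factorial_succ]
    have : ((i.factorial : ℕ) : ℝ) ≠ 0 := by positivity
    push_cast
    field_simp

lemma hasDerivAt_ev (m : ℕ) (B : PowerSeries ℝ) (L : ℝ) :
    HasDerivAt (ev m B) (ev m (PowerSeries.X * B) L) L := by
  have h : HasDerivAt (fun L => ∑ q ∈ Finset.HasAntidiagonal.antidiagonal m,
      PowerSeries.coeff q.1 B * PowerSeries.coeff q.2 (pexp L))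
      (∑ q ∈ Finset.HasAntidiagonal.antidiagonal m,
        PowerSeries.coeff q.1 B * PowerSeries.coeff q.2 (PowerSeries.X * pexp L)) L :=
    HasDerivAt.fun_sum fun q _ => (hasDerivAt_coeff_pexp q.2 L).const_mul _
  refine (h.congr_deriv ?_).congr_of_eventuallyEq (Filter.Eventually.of_forall fun L => ?_)
  · rw [← PowerSeries.coeff_mul, ev]; congr 1; ring
  · rw [ev, PowerSeries.coeff_mul]

lemma continuous_ev (m : ℕ) (B : PowerSeries ℝ) : Continuous (ev m B) :=
  continuous_iff_continuousAt.mpr fun L => (hasDerivAt_ev m B L).continuousAt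

lemma exists_abs_ev_le (m : ℕ) (B : PowerSeries ℝ) :
    ∃ C : ℝ, 0 ≤ C ∧ ∀ L : ℝ, |ev m B L| ≤ C * (1 + |L|) ^ m := by
  refine ⟨∑ q ∈ Finset.HasAntidiagonal.antidiagonal m, |PowerSeries.coeff q.1 B|,
    Finset.sum_nonneg fun _ _ => abs_nonneg _, fun L => ?_⟩
  rw [ev_eq_sum, Finset.sum_mul]
  refine (Finset.abs_sum_le_sum_abs _ _).trans (Finset.sum_le_sum fun q hq => ?_)
  rw [abs_mul]
  gcongr
  have hq' := Finset.HasAntidiagonal.mem_antidiagonal.mp hq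
  rw [abs_div, abs_pow, abs_of_nonneg (by positivity : (0 : ℝ) ≤ q.2.factorial)]
  have h1 : (1 : ℝ) ≤ q.2.factorial := by exact_mod_cast Nat.one_le_iff_ne_zero.mpr (Nat.factorial_ne_zero _)
  calc _ ≤ |L| ^ q.2 := div_le_self (by positivity) h1
    _ ≤ (1 + |L|) ^ q.2 := by gcongr; linarith
    _ ≤ _ := pow_le_pow_right₀ (by linarith [abs_nonneg L]) (by omega)

/-! ### Elementary estimates -/

lemma exists_one_add_log_pow_le (m : ℕ) {ε : ℝ} (hε : 0 < ε) :
    ∃ C : ℝ, 0 ≤ C ∧ ∀ x : ℝ, 1 ≤ x → (1 + Real.log x) ^ m ≤ C * x ^ ε := by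
  rcases Nat.eq_zero_or_pos m with rfl | hm
  · exact ⟨1, zero_le_one, fun x hx => by simpa using Real.one_le_rpow hx hε.le⟩
  have hm' : (0 : ℝ) < m := by exact_mod_cast hm
  set e := ε / m with he
  have he0 : 0 < e := by positivity
  refine ⟨(1 + 1 / e) ^ m, by positivity, fun x hx => ?_⟩
  have h0 : (0 : ℝ) ≤ x := by linarith
  have h1 := Real.log_le_rpow_div h0 he0
  have h2 := Real.one_le_rpow hx he0.le
  have h3 := Real.log_nonneg hx
  have h4 : 1 + Real.log x ≤ (1 + 1 / e) * x ^ e := by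
    rw [add_mul, one_mul, one_div_mul_eq_div]; linarith
  calc _ ≤ ((1 + 1 / e) * x ^ e) ^ m := by gcongr
    _ = _ := by
      rw [mul_pow, ← Real.rpow_natCast (x ^ e), ← Real.rpow_mul h0, he, div_mul_cancel₀ _ hm'.ne']

lemma exists_log_pow_mul_rpow_le (m : ℕ) {a b : ℝ} (hab : a < b) :
    ∃ C : ℝ, 0 ≤ C ∧ ∀ x : ℝ, 1 ≤ x → (1 + Real.log x) ^ m * x ^ a ≤ C * x ^ b := by
  obtain ⟨C, hC, h⟩ := exists_one_add_log_pow_le m (sub_pos.mpr hab)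
  refine ⟨C, hC, fun x hx => ?_⟩
  have h0 : (0 : ℝ) < x := by linarith
  calc _ ≤ C * x ^ (b - a) * x ^ a := mul_le_mul_of_nonneg_right (h x hx) (by positivity)
    _ = _ := by rw [mul_assoc, ← Real.rpow_add h0, sub_add_cancel]

/-- Abel summation against a continuously differentiable weight. -/
lemma psum_mul_eq_sub_integral (c : ℕ → ℝ) {f f' : ℝ → ℝ} {b : ℝ} (hb : 1 ≤ b)
    (hf : ∀ t ∈ Set.Icc 1 b, HasDerivAt f (f' t) t) (hf' : ContinuousOn f' (Set.Icc 1 b)) :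
    psum (fun n => f n * c n) b = f b * psum c b - ∫ t in (1 : ℝ)..b, f' t * psum c t := by
  set c' : ℕ → ℝ := fun n => if n = 0 then 0 else c n with hc'
  have e : ∀ (g : ℕ → ℝ) (N : ℕ),
      ∑ n ∈ Finset.Icc 0 N, g n * c' n = ∑ n ∈ Finset.Icc 1 N, g n * c n := by
    intro g N
    rw [← Finset.sum_subset (Finset.Icc_subset_Icc_left (Nat.zero_le 1))]
    · refine Finset.sum_congr rfl fun n hn => ?_
      rw [hc']
      simp only
      rw [if_neg (by have := (Finset.mem_Icc.mp hn).1; omega)]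
    · intro n h0 h1
      have : n = 0 := by
        rw [Finset.mem_Icc] at h0 h1
        omega
      simp [hc', this]
  have e1 : ∀ t : ℝ, ∑ n ∈ Finset.Icc 0 ⌊t⌋₊, c' n = psum c t := by
    intro t
    have := e (fun _ => 1) ⌊t⌋₊
    rw [psum]
    simpa using this
  have h := sum_mul_eq_sub_integral_mul₀ (f := f) c' (by simp [hc']) b
    (fun t ht => (hf t ht).differentiableAt)
    ((hf'.integrableOn_Icc).congr_fun (fun t ht => ((hf t ht).deriv).symm) measurableSet_Icc)
  rw [e (fun n => f n), e1] at h
  rw [psum, h, intervalIntegral.integral_of_le hb]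
  congr 1
  refine MeasureTheory.setIntegral_congr_fun measurableSet_Ioc fun t ht => ?_
  rw [e1, (hf t ⟨ht.1.le, ht.2⟩).deriv]

lemma measurable_psum (c : ℕ → ℝ) : Measurable (psum c) :=
  (measurable_from_nat (f := fun N : ℕ => ∑ n ∈ Finset.Icc 1 N, c n)).comp Nat.measurable_floor

/-- The integral of a function of size `t^{-1-δ}` converges with a power saving. -/
lemma exists_integral_sub_le {G : ℝ → ℝ} {C δ : ℝ} (hδ : 0 < δ)
    (hG : ∀ t, 1 ≤ t → |G t| ≤ C * t ^ (-1 - δ))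
    (hm : MeasureTheory.AEStronglyMeasurable G
      (MeasureTheory.volume.restrict (Set.Ioi (1 : ℝ)))) :
    ∃ κ : ℝ, ∀ Z : ℝ, 1 ≤ Z → |(∫ t in (1 : ℝ)..Z, G t) - κ| ≤ C / δ * Z ^ (-δ) := by
  have hint1 := (integrableOn_Ioi_rpow_of_lt (by linarith : -1 - δ < -1) one_pos).const_mul C
  have hint : MeasureTheory.IntegrableOn G (Set.Ioi 1) := by
    refine MeasureTheory.Integrable.mono' hint1 hm ?_
    filter_upwards [MeasureTheory.ae_restrict_mem measurableSet_Ioi] with t ht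
    exact hG t (le_of_lt ht)
  refine ⟨∫ t in Set.Ioi 1, G t, fun Z hZ => ?_⟩
  have hZ0 : 0 < Z := by linarith
  have hintZ : MeasureTheory.IntegrableOn G (Set.Ioi Z) := hint.mono_set (Set.Ioi_subset_Ioi hZ)
  have e : (∫ t in (1 : ℝ)..Z, G t) - ∫ t in Set.Ioi 1, G t = -∫ t in Set.Ioi Z, G t := by
    rw [← intervalIntegral.integral_Ioi_sub_Ioi hint hZ]; ring
  rw [e, abs_neg, ← Real.norm_eq_abs]
  refine (MeasureTheory.norm_integral_le_of_norm_le
    ((integrableOn_Ioi_rpow_of_lt (by linarith : -1 - δ < -1) hZ0).const_mul C) ?_).trans ?_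
  · filter_upwards [MeasureTheory.ae_restrict_mem measurableSet_Ioi] with t ht
    exact hG t (hZ.trans (le_of_lt ht))
  · rw [MeasureTheory.integral_const_mul, integral_Ioi_rpow_of_lt (by linarith) hZ0]
    have : -1 - δ + 1 = -δ := by ring
    rw [this, neg_div_neg_eq, div_mul_eq_mul_div, mul_div_assoc]

lemma psum_one (x : ℝ) : psum (fun _ => (1 : ℝ)) x = ⌊x⌋₊ := by simp [psum]

/-- The sums `∑_{n ≤ Y} n^{-1-z}`, coefficientwise in `z`. -/
lemma exists_psum_coeff_pw_sub_le (l : ℕ) : ∃ γ C : ℝ, 0 ≤ C ∧ ∀ Y : ℝ, 1 ≤ Y →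
    |psum (fun n => PowerSeries.coeff l (pw n) / n) Y -
      (PowerSeries.coeff (l + 1) (1 - pexp (-Real.log Y)) + γ)| ≤ C * Y ^ (-(1 / 2) : ℝ) := by
  set f : ℝ → ℝ := fun t => ev l 1 (-Real.log t) / t with hf
  set f' : ℝ → ℝ := fun t => -ev l (1 + PowerSeries.X) (-Real.log t) / t ^ 2 with hf'
  set F : ℝ → ℝ := fun t => 1 * t * f t - -ev (l + 1) 1 (-Real.log t) with hF
  have hlog : ∀ t : ℝ, 1 ≤ t → HasDerivAt (fun t => -Real.log t) (-t⁻¹) t := fun t ht =>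
    (Real.hasDerivAt_log (by linarith)).neg
  have hev : ∀ (i : ℕ) (t : ℝ), 1 ≤ t → HasDerivAt (fun t => ev i 1 (-Real.log t))
      (ev i PowerSeries.X (-Real.log t) * -t⁻¹) t := fun i t ht => by
    have := (hasDerivAt_ev i 1 (-Real.log t)).comp t (hlog t ht)
    rw [mul_one] at this
    exact this
  have hd : ∀ t : ℝ, 1 ≤ t → HasDerivAt f (f' t) t := by
    intro t ht
    have ht0 : t ≠ 0 := by linarith
    refine ((hev l t ht).div (hasDerivAt_id t) ht0).congr_deriv ?_
    simp only [hf', id]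
    rw [ev_add]
    field_simp
    ring
  have hdF : ∀ t : ℝ, 1 ≤ t → HasDerivAt F (f' t * t) t := by
    intro t ht
    have ht0 : t ≠ 0 := by linarith
    refine ((((hasDerivAt_id t).const_mul 1).mul (hd t ht)).sub (hev (l + 1) t ht).neg).congr_deriv ?_
    have e : ev (l + 1) PowerSeries.X (-Real.log t) = ev l 1 (-Real.log t) := by
      have := ev_succ_X_mul l 1 (-Real.log t)
      rwa [mul_one] at this
    simp only [hf, id]
    rw [e]
    field_simp
    ring
  have hc' : ContinuousOn f' (Set.Ici 1) := by
    intro t ht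
    have ht0 : t ≠ 0 := (lt_of_lt_of_le one_pos ht).ne'
    have h1 : ContinuousAt (fun t => ev l (1 + PowerSeries.X) (-Real.log t)) t :=
      (continuous_ev _ _).continuousAt.comp (Real.continuousAt_log ht0).neg
    exact (h1.neg.div (continuousAt_id.pow 2) (pow_ne_zero 2 ht0)).continuousWithinAt
  obtain ⟨C₁, hC₁, hb₁⟩ := exists_abs_ev_le l (1 + PowerSeries.X)
  obtain ⟨C₂, hC₂, hb₂⟩ := exists_abs_ev_le l 1
  obtain ⟨C₃, hC₃, hb₃⟩ := exists_one_add_log_pow_le l (by norm_num : (0 : ℝ) < 1 / 2)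
  have hG : ∀ t, 1 ≤ t → |f' t * (t - ⌊t⌋₊)| ≤ (C₁ * C₃) * t ^ (-1 - 1 / 2 : ℝ) := by
    intro t ht
    have ht0 : 0 < t := by linarith
    have hl := Real.log_nonneg ht
    have h1 : |t - ⌊t⌋₊| ≤ 1 := by
      rw [abs_le]
      constructor <;> linarith [Nat.floor_le ht0.le, Nat.lt_floor_add_one t]
    have h2 := hb₁ (-Real.log t)
    rw [abs_neg, abs_of_nonneg hl] at h2
    have e : t ^ (-1 - 1 / 2 : ℝ) = t ^ (1 / 2 : ℝ) / t ^ 2 := by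
      rw [← Real.rpow_natCast t 2, ← Real.rpow_sub ht0]; norm_num
    rw [abs_mul, hf', e]
    simp only
    rw [abs_div, abs_neg, abs_of_pos (by positivity : (0 : ℝ) < t ^ 2)]
    calc _ ≤ C₁ * (C₃ * t ^ (1 / 2 : ℝ)) / t ^ 2 * 1 := by
          gcongr
          exact h2.trans (by gcongr; exact hb₃ t ht)
      _ = _ := by ring
  obtain ⟨κ, hκ⟩ := exists_integral_sub_le (by norm_num : (0 : ℝ) < 1 / 2) hG
    ((hc'.mono fun t ht => le_of_lt ht).aestronglyMeasurable measurableSet_Ioi |>.mul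
      ((measurable_id.sub ((measurable_from_nat (f := fun n : ℕ => (n : ℝ))).comp
        Nat.measurable_floor)).aestronglyMeasurable))
  refine ⟨f 1 + κ, C₂ * C₃ + C₁ * C₃ / (1 / 2), by positivity, fun Y hY => ?_⟩
  have hY0 : 0 < Y := by linarith
  have hab := psum_mul_eq_sub_integral (fun _ => 1) hY (fun t ht => hd t ht.1)
    (hc'.mono fun t ht => ht.1)
  have hI1 : ∫ t in (1 : ℝ)..Y, f' t * t = F Y - F 1 := by
    refine intervalIntegral.integral_eq_sub_of_hasDerivAt (fun t ht => ?_) ?_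
    · rw [Set.uIcc_of_le hY] at ht
      exact hdF t ht.1
    · refine ContinuousOn.intervalIntegrable ?_
      rw [Set.uIcc_of_le hY]
      exact (hc'.mono fun t ht => ht.1).mul continuousOn_id
  have hint1 : IntervalIntegrable (fun t => f' t * t) MeasureTheory.volume 1 Y := by
    refine ContinuousOn.intervalIntegrable ?_
    rw [Set.uIcc_of_le hY]
    exact (hc'.mono fun t ht => ht.1).mul continuousOn_id
  have hint2 : IntervalIntegrable (fun t => f' t * (⌊t⌋₊ : ℝ)) MeasureTheory.volume 1 Y := by
    refine (IntervalIntegrable.continuousOn_mul (g := f') (f := fun t : ℝ => (⌊t⌋₊ : ℝ)) ?_ ?_)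
    · exact (Monotone.intervalIntegrable fun a b hab => by
        exact_mod_cast Nat.floor_le_floor hab)
    · rw [Set.uIcc_of_le hY]
      exact hc'.mono fun t ht => ht.1
  have hI2 : ∫ t in (1 : ℝ)..Y, f' t * (⌊t⌋₊ : ℝ) =
      (F Y - F 1) - ∫ t in (1 : ℝ)..Y, f' t * (t - ⌊t⌋₊) := by
    rw [← hI1, ← intervalIntegral.integral_sub hint1]
    · exact intervalIntegral.integral_congr fun t _ => by ring
    · refine (hint1.sub hint2).congr fun t _ => ?_
      ring
  have hsum : psum (fun n => PowerSeries.coeff l (pw n) / n) Y = psum (fun n => f n * 1) Y := by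
    refine psum_congr fun n _ _ => ?_
    simp only [hf]
    rw [mul_one, ev, one_mul, pw_eq_pexp]
  have h1 : |f Y * (Y - ⌊Y⌋₊)| ≤ C₂ * C₃ * Y ^ (-(1 / 2) : ℝ) := by
    have hl := Real.log_nonneg hY
    have h1 : |Y - ⌊Y⌋₊| ≤ 1 := by
      rw [abs_le]
      constructor <;> linarith [Nat.floor_le hY0.le, Nat.lt_floor_add_one Y]
    have h2 := hb₂ (-Real.log Y)
    rw [abs_neg, abs_of_nonneg hl] at h2
    have e : Y ^ (-(1 / 2) : ℝ) = Y ^ (1 / 2 : ℝ) / Y := by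
      rw [← Real.rpow_sub_one hY0.ne']; norm_num
    rw [abs_mul, hf, e]
    simp only
    rw [abs_div, abs_of_pos hY0]
    calc _ ≤ C₂ * (C₃ * Y ^ (1 / 2 : ℝ)) / Y * 1 := by
          gcongr
          exact h2.trans (by gcongr; exact hb₃ Y hY)
      _ = _ := by ring
  have hF1 : F 1 = f 1 := by
    simp only [hF, Real.log_one, neg_zero, ev_zero_right, PowerSeries.coeff_one]
    simp
  have hcoef : PowerSeries.coeff (l + 1) (1 - pexp (-Real.log Y)) = -ev (l + 1) 1 (-Real.log Y) := by
    rw [map_sub, PowerSeries.coeff_one, if_neg (by omega), zero_sub, ev, one_mul]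
  have hmain : psum (fun n => PowerSeries.coeff l (pw n) / n) Y -
      (PowerSeries.coeff (l + 1) (1 - pexp (-Real.log Y)) + (f 1 + κ)) =
      -(f Y * (Y - ⌊Y⌋₊)) + ((∫ t in (1 : ℝ)..Y, f' t * (t - ⌊t⌋₊)) - κ) := by
    rw [hsum, hab, hcoef, psum_one]
    simp_rw [psum_one]
    rw [hI2, hF1]
    simp only [hF]
    ring
  rw [hmain]
  refine (abs_add_le _ _).trans ?_
  rw [abs_neg, add_mul]
  exact add_le_add h1 (hκ Y hY)

/-! ### The divisor problem with a power saving -/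

lemma psum_psum_div (a : ℕ → ℝ) (x Y : ℝ) :
    psum (fun n => psum a (x / n)) Y = psum (fun m => a m * (min ⌊Y⌋₊ ⌊x / m⌋₊ : ℕ)) x := by
  simp only [psum, Nat.floor_div_natCast]
  set N := ⌊x⌋₊
  rw [Finset.sum_comm' (t' := Finset.Icc 1 N) (s' := fun m => Finset.Icc 1 (min ⌊Y⌋₊ (N / m)))]
  · refine Finset.sum_congr rfl fun m _ => ?_
    rw [Finset.sum_const, Nat.card_Icc, nsmul_eq_mul, mul_comm, Nat.add_sub_cancel]
  · intro n m
    simp only [Finset.mem_Icc, le_min_iff]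
    constructor
    · rintro ⟨⟨h1, h2⟩, h3, h4⟩
      have h5 := (Nat.le_div_iff_mul_le h1).mp h4
      refine ⟨⟨h1, h2, (Nat.le_div_iff_mul_le h3).mpr (by rwa [mul_comm])⟩, h3, ?_⟩
      exact (Nat.le_mul_of_pos_right m h1).trans h5
    · rintro ⟨⟨h1, h2, h3⟩, h4, h5⟩
      have h6 := (Nat.le_div_iff_mul_le h4).mp h3
      exact ⟨⟨h1, h2⟩, h4, (Nat.le_div_iff_mul_le h1).mpr (by rwa [mul_comm])⟩

/-- Dirichlet's hyperbola method for a convolution with the constant function `1`. -/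
lemma psum_mul_zeta_hyperbola (a : ArithmeticFunction ℝ) {x Y Z : ℝ} (hY : 1 ≤ Y) (hZ : 1 ≤ Z)
    (h : Y * Z = x) :
    psum ((a * (ζ : ArithmeticFunction ℝ) : ArithmeticFunction ℝ) : ℕ → ℝ) x =
      psum (fun n => psum a (x / n)) Y +
        psum (fun m => a m * ((⌊x / m⌋₊ : ℝ) - ⌊Y⌋₊)) Z := by
  have hZx : Z ≤ x := by rw [← h]; exact le_mul_of_one_le_left (by linarith) hY
  rw [psum_mul, psum_psum_div]
  simp_rw [psum_zeta]
  have hB : psum (fun m => a m * ((⌊x / m⌋₊ : ℝ) - ⌊Y⌋₊)) Z =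
      psum (fun m => a m * ((⌊x / m⌋₊ : ℝ) - (min ⌊Y⌋₊ ⌊x / m⌋₊ : ℕ))) x := by
    rw [psum, psum, ← Finset.sum_subset (Finset.Icc_subset_Icc_right (Nat.floor_le_floor hZx))]
    · refine Finset.sum_congr rfl fun m hm => ?_
      obtain ⟨h1, h2⟩ := mem_Icc_floor hm
      have : Y ≤ x / m := by
        rw [le_div_iff₀ (by linarith), ← h]
        gcongr
      rw [min_eq_left (Nat.floor_le_floor this)]
    · intro m hm hm'
      obtain ⟨h1, h2⟩ := mem_Icc_floor hm
      have h3 : Z < m := by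
        by_contra hcon
        exact hm' (mem_Icc_floor_iff.mpr ⟨by exact_mod_cast h1, not_lt.mp hcon⟩)
      have : x / m ≤ Y := by
        rw [div_le_iff₀ (by linarith), ← h]
        gcongr
      rw [min_eq_right (Nat.floor_le_floor this), sub_self, mul_zero]
  rw [hB, ← psum_add]
  exact psum_congr fun n _ _ => by ring

/-- The sum of `p(L - log n)/n` over `n ≤ Y`, for the polynomial `p = ev m B`. The coefficients of
`Γ` are, up to constants, the Stieltjes constants; `Γ` does not depend on `B` or `m`. -/
lemma exists_stieltjes : ∃ Γ : PowerSeries ℝ, ∀ (m : ℕ) (B : PowerSeries ℝ), ∃ C : ℝ, 0 ≤ C ∧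
    ∀ Y L : ℝ, 1 ≤ Y → 0 ≤ L →
      |psum (fun n => ev m B (L - Real.log n) / n) Y -
        (ev (m + 1) B L - ev (m + 1) B (L - Real.log Y) + ev m (B * Γ) L)| ≤
          C * (1 + L) ^ m * Y ^ (-(1 / 2) : ℝ) := by
  choose γ C hC h using exists_psum_coeff_pw_sub_le
  refine ⟨PowerSeries.mk γ, fun m B => ?_⟩
  choose D hD hB using fun i => exists_abs_ev_le i B
  refine ⟨∑ q ∈ Finset.HasAntidiagonal.antidiagonal m, D q.1 * C q.2,
    Finset.sum_nonneg fun q _ => mul_nonneg (hD _) (hC _), fun Y L hY hL => ?_⟩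
  have e1 : psum (fun n => ev m B (L - Real.log n) / n) Y =
      ∑ q ∈ Finset.HasAntidiagonal.antidiagonal m, ev q.1 B L *
        psum (fun n => PowerSeries.coeff q.2 (pw n) / n) Y := by
    simp_rw [← psum_const_mul, psum]
    rw [Finset.sum_comm]
    refine Finset.sum_congr rfl fun n _ => ?_
    rw [sub_eq_add_neg, ev, pexp_add, ← pw_eq_pexp, ← mul_assoc, PowerSeries.coeff_mul,
      Finset.sum_div]
    exact Finset.sum_congr rfl fun q _ => by rw [ev, mul_div_assoc]
  have e2 : ev (m + 1) B L - ev (m + 1) B (L - Real.log Y) =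
      ∑ q ∈ Finset.HasAntidiagonal.antidiagonal m, ev q.1 B L *
        PowerSeries.coeff (q.2 + 1) (1 - pexp (-Real.log Y)) := by
    rw [sub_eq_add_neg L, ev, ev, pexp_add, ← map_sub, ← mul_assoc]
    have : B * pexp L - B * pexp L * pexp (-Real.log Y) =
        B * pexp L * (1 - pexp (-Real.log Y)) := by ring
    rw [this, PowerSeries.coeff_mul]
    refine (Finset.Nat.sum_antidiagonal_succ' (f := fun q : ℕ × ℕ =>
      PowerSeries.coeff q.1 (B * pexp L) * PowerSeries.coeff q.2 (1 - pexp (-Real.log Y)))).trans ?_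
    have h0 : PowerSeries.coeff 0 (1 - pexp (-Real.log Y)) = 0 := by
      rw [map_sub, PowerSeries.coeff_one, coeff_pexp]; simp
    simp only
    rw [h0, mul_zero, zero_add]
    rfl
  have e3 : ev m (B * PowerSeries.mk γ) L =
      ∑ q ∈ Finset.HasAntidiagonal.antidiagonal m, ev q.1 B L * γ q.2 := by
    have : B * PowerSeries.mk γ * pexp L = B * pexp L * PowerSeries.mk γ := by ring
    rw [ev, this, PowerSeries.coeff_mul]
    exact Finset.sum_congr rfl fun q _ => by rw [PowerSeries.coeff_mk, ev]
  rw [e1, e2, e3, ← Finset.sum_add_distrib, ← Finset.sum_sub_distrib, Finset.sum_mul,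
    Finset.sum_mul]
  refine (Finset.abs_sum_le_sum_abs _ _).trans (Finset.sum_le_sum fun q hq => ?_)
  have hq' := Finset.HasAntidiagonal.mem_antidiagonal.mp hq
  rw [← mul_add, ← mul_sub, abs_mul]
  have h1 := hB q.1 L
  rw [abs_of_nonneg hL] at h1
  have h2 : (1 + L) ^ q.1 ≤ (1 + L) ^ m := pow_le_pow_right₀ (by linarith) (by omega)
  have h3 : |ev q.1 B L| ≤ D q.1 * (1 + L) ^ m :=
    h1.trans (mul_le_mul_of_nonneg_left h2 (hD _))
  calc _ ≤ (D q.1 * (1 + L) ^ m) * (C q.2 * Y ^ (-(1 / 2) : ℝ)) :=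
        mul_le_mul h3 (h q.2 Y hY) (abs_nonneg _) ((abs_nonneg _).trans h3)
    _ = _ := by ring

/-- `D(x)` is `x` times a polynomial in `log x`, with error `O(x^{1-δ})`. -/
def PowerAsymp (D : ℝ → ℝ) (m : ℕ) (B : PowerSeries ℝ) (δ : ℝ) : Prop :=
  ∃ K : ℝ, ∀ x : ℝ, 1 ≤ x → |D x - x * ev m B (Real.log x)| ≤ K * x ^ (1 - δ)

lemma PowerAsymp.mono {D : ℝ → ℝ} {m : ℕ} {B : PowerSeries ℝ} {δ δ' : ℝ}
    (h : PowerAsymp D m B δ) (hδ : δ' ≤ δ) : PowerAsymp D m B δ' := by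
  obtain ⟨K, hK⟩ := h
  refine ⟨K, fun x hx => (hK x hx).trans ?_⟩
  have h1 := (abs_nonneg _).trans (hK 1 le_rfl)
  rw [Real.one_rpow, mul_one] at h1
  exact mul_le_mul_of_nonneg_left (Real.rpow_le_rpow_of_exponent_le hx (by linarith)) h1

lemma PowerAsymp.exists_nonneg {D : ℝ → ℝ} {m : ℕ} {B : PowerSeries ℝ} {δ : ℝ}
    (h : PowerAsymp D m B δ) : ∃ K : ℝ, 0 ≤ K ∧
      ∀ x : ℝ, 1 ≤ x → |D x - x * ev m B (Real.log x)| ≤ K * x ^ (1 - δ) := by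
  obtain ⟨K, hK⟩ := h
  refine ⟨K, ?_, hK⟩
  have h1 := (abs_nonneg _).trans (hK 1 le_rfl)
  rwa [Real.one_rpow, mul_one] at h1

lemma integral_ev_log_div (m : ℕ) (B : PowerSeries ℝ) {Z : ℝ} (hZ : 1 ≤ Z) :
    IntervalIntegrable (fun t => ev m B (Real.log t) / t) MeasureTheory.volume 1 Z ∧
    ∫ t in (1 : ℝ)..Z, ev m B (Real.log t) / t =
      ev (m + 1) B (Real.log Z) - PowerSeries.coeff (m + 1) B := by
  have hint : IntervalIntegrable (fun t => ev m B (Real.log t) / t)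
      MeasureTheory.volume 1 Z := by
    refine ContinuousOn.intervalIntegrable ?_
    rw [Set.uIcc_of_le hZ]
    intro t ht
    have ht0 : t ≠ 0 := (lt_of_lt_of_le one_pos ht.1).ne'
    exact (((continuous_ev m B).continuousAt.comp (Real.continuousAt_log ht0)).div
      continuousAt_id ht0).continuousWithinAt
  refine ⟨hint, ?_⟩
  rw [← ev_zero_right, ← Real.log_one]
  refine intervalIntegral.integral_eq_sub_of_hasDerivAt
    (f := fun t => ev (m + 1) B (Real.log t)) (fun t ht => ?_) hint
  rw [Set.uIcc_of_le hZ] at ht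
  have ht0 : t ≠ 0 := (lt_of_lt_of_le one_pos ht.1).ne'
  refine ((hasDerivAt_ev (m + 1) B (Real.log t)).comp t (Real.hasDerivAt_log ht0)).congr_deriv ?_
  rw [ev_succ_X_mul, div_eq_mul_inv]

/-- The sum on the left is the integral of `psum a t / t²` over `[1, Z]`. The main term integrates
to `ev (m + 1) B (log Z)` up to a constant, and the error integral converges with a power saving. -/
lemma PowerAsymp.exists_integral {a : ℕ → ℝ} {m : ℕ} {B : PowerSeries ℝ} {δ : ℝ} (hδ : 0 < δ)
    (h : PowerAsymp (psum a) m B δ) : ∃ κ C : ℝ, 0 ≤ C ∧ ∀ Z : ℝ, 1 ≤ Z →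
      |psum (fun n => a n * (1 / n - 1 / Z)) Z - (ev (m + 1) B (Real.log Z) + κ)| ≤
        C * Z ^ (-δ) := by
  obtain ⟨K, hK0, hK⟩ := h.exists_nonneg
  set G : ℝ → ℝ := fun t => (psum a t - t * ev m B (Real.log t)) / t ^ 2 with hG
  have hGb : ∀ t, 1 ≤ t → |G t| ≤ K * t ^ (-1 - δ) := by
    intro t ht
    have ht0 : 0 < t := by linarith
    have e : t ^ (-1 - δ) = t ^ (1 - δ) / t ^ 2 := by
      rw [← Real.rpow_natCast t 2, ← Real.rpow_sub ht0]; congr 1; push_cast; ring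
    rw [hG]
    simp only
    rw [abs_div, abs_of_pos (by positivity : (0 : ℝ) < t ^ 2), e, ← mul_div_assoc]
    gcongr
    exact hK t ht
  have hmeas : Measurable G := by
    refine ((measurable_psum a).sub (measurable_id.mul
      ((continuous_ev m B).measurable.comp Real.measurable_log))).div (measurable_id.pow_const 2)
  obtain ⟨κ, hκ⟩ := exists_integral_sub_le hδ hGb hmeas.aestronglyMeasurable
  refine ⟨κ - PowerSeries.coeff (m + 1) B, K / δ, by positivity, fun Z hZ => ?_⟩
  have hZ0 : 0 < Z := by linarith
  have hcont : ContinuousOn (fun t : ℝ => -(t ^ 2)⁻¹) (Set.Icc 1 Z) := by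
    intro t ht
    have ht0 : t ≠ 0 := (lt_of_lt_of_le one_pos ht.1).ne'
    exact ((continuousAt_id.pow 2).inv₀ (pow_ne_zero 2 ht0)).neg.continuousWithinAt
  have hab := psum_mul_eq_sub_integral a hZ (f := fun t => t⁻¹) (f' := fun t => -(t ^ 2)⁻¹)
    (fun t ht => hasDerivAt_inv (lt_of_lt_of_le one_pos ht.1).ne') hcont
  have hs : psum (fun n => a n * (1 / n - 1 / Z)) Z = ∫ t in (1 : ℝ)..Z, psum a t / t ^ 2 := by
    have e1 : psum (fun n => a n * (1 / n - 1 / Z)) Z =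
        psum (fun n => (n : ℝ)⁻¹ * a n) Z - Z⁻¹ * psum a Z := by
      rw [← psum_const_mul, ← psum_sub]
      exact psum_congr fun n _ _ => by ring
    rw [e1, hab, sub_sub_cancel_left, ← intervalIntegral.integral_neg]
    exact intervalIntegral.integral_congr fun t _ => by ring
  obtain ⟨hint, hval⟩ := integral_ev_log_div m B hZ
  have hint2 : IntervalIntegrable (fun t => psum a t / t ^ 2) MeasureTheory.volume 1 Z := by
    have h0 : IntervalIntegrable (fun t => jsum 0 a t / t) MeasureTheory.volume 1 Z :=
      intervalIntegrable_jsum_div 0 a hZ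
    have h1 : ContinuousOn (fun t : ℝ => t⁻¹) (Set.uIcc 1 Z) := by
      rw [Set.uIcc_of_le hZ]
      intro t ht
      exact (continuousAt_id.inv₀ (lt_of_lt_of_le one_pos ht.1).ne').continuousWithinAt
    refine (h0.mul_continuousOn h1).congr fun t _ => ?_
    rw [jsum_zero]
    ring
  have hI : ∫ t in (1 : ℝ)..Z, psum a t / t ^ 2 =
      (∫ t in (1 : ℝ)..Z, G t) + ∫ t in (1 : ℝ)..Z, ev m B (Real.log t) / t := by
    have hGe : ∀ t ∈ Set.uIcc 1 Z, G t = psum a t / t ^ 2 - ev m B (Real.log t) / t := by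
      intro t ht
      rw [Set.uIcc_of_le hZ] at ht
      have ht0 : t ≠ 0 := (lt_of_lt_of_le one_pos ht.1).ne'
      simp only [hG]
      field_simp
    rw [intervalIntegral.integral_congr hGe, intervalIntegral.integral_sub hint2 hint]
    ring
  rw [hs, hI, hval]
  convert hκ Z hZ using 2
  ring

lemma psum_rpow_le {δ : ℝ} (hδ : 0 < δ) {Y : ℝ} (hY : 1 ≤ Y) :
    psum (fun n => (n : ℝ) ^ (δ - 1)) Y ≤ Y ^ δ * (1 + Real.log Y) := by
  have h1 : psum (fun n => (n : ℝ) ^ (δ - 1)) Y ≤ psum (fun n => Y ^ δ * (n : ℝ)⁻¹) Y := by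
    refine psum_le_psum fun n h1 h2 => ?_
    have hn : (0 : ℝ) < n := by exact_mod_cast h1
    rw [Real.rpow_sub_one hn.ne', div_eq_mul_inv]
    gcongr
  refine h1.trans ?_
  rw [psum_const_mul]
  gcongr
  have : psum (fun n => (n : ℝ)⁻¹) Y = harmonic ⌊Y⌋₊ := by
    rw [psum, harmonic_eq_sum_Icc]; push_cast; rfl
  rw [this]
  exact harmonic_floor_le_one_add_log Y hY

/-- Convolution with the constant function `1` preserves power savings. -/
lemma PowerAsymp.mul_zeta {a : ArithmeticFunction ℝ} (ha : ∀ n, 0 ≤ a n) {m : ℕ}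
    {B : PowerSeries ℝ} {δ η δ' : ℝ} (hδ : 0 < δ) (hη : 0 < η) (hη1 : η < 1)
    (h1 : δ' < δ * (1 - η)) (h2 : δ' < η / 2) (h : PowerAsymp (psum a) m B δ) :
    ∃ B' : PowerSeries ℝ, PowerSeries.constantCoeff B' = PowerSeries.constantCoeff B ∧ PowerAsymp
      (psum ((a * (ζ : ArithmeticFunction ℝ) : ArithmeticFunction ℝ) : ℕ → ℝ)) (m + 1) B' δ' := by
  obtain ⟨Γ, hΓ⟩ := exists_stieltjes
  obtain ⟨C₁, hC₁, hst⟩ := hΓ m B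
  obtain ⟨κ, C₂, hC₂, hint⟩ := h.exists_integral hδ
  obtain ⟨K, hK0, hK⟩ := h.exists_nonneg
  obtain ⟨C₃, hC₃, hev⟩ := exists_abs_ev_le m B
  obtain ⟨D₁, hD₁, hl₁⟩ := exists_log_pow_mul_rpow_le 1 (by linarith : 1 - δ * (1 - η) < 1 - δ')
  obtain ⟨D₂, hD₂, hl₂⟩ := exists_log_pow_mul_rpow_le m (by linarith : 1 - η / 2 < 1 - δ')
  obtain ⟨D₃, hD₃, hl₃⟩ := exists_log_pow_mul_rpow_le m (by linarith : 1 - η < 1 - δ')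
  refine ⟨B + PowerSeries.X * (B * Γ) + PowerSeries.C κ * PowerSeries.X ^ (m + 1), by simp,
    K * D₁ + C₁ * D₂ + C₂ * D₁ + (C₃ + K) * D₃, fun x hx => ?_⟩
  have hx0 : 0 < x := by linarith
  set L := Real.log x with hL
  have hL0 : 0 ≤ L := Real.log_nonneg hx
  set Y := x ^ η with hY
  set Z := x ^ (1 - η) with hZ
  have hY1 : 1 ≤ Y := Real.one_le_rpow hx hη.le
  have hZ1 : 1 ≤ Z := Real.one_le_rpow hx (by linarith)
  have hY0 : 0 < Y := by linarith
  have hZ0 : 0 < Z := by linarith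
  have hYZ : Y * Z = x := by rw [hY, hZ, ← Real.rpow_add hx0]; simp
  have hlY : Real.log Y = η * L := Real.log_rpow hx0 η
  have hlZ : Real.log Z = (1 - η) * L := Real.log_rpow hx0 _
  have hlY1 : Real.log Y ≤ L := by rw [hlY]; nlinarith
  have hlZ1 : Real.log Z ≤ L := by rw [hlZ]; nlinarith
  have hlZ' : Real.log Z = L - Real.log Y := by rw [hlZ, hlY]; ring
  -- the sum over small `n`
  have b1 : |psum (fun n => psum a (x / n)) Y -
      x * psum (fun n => ev m B (L - Real.log n) / n) Y| ≤ K * D₁ * x ^ (1 - δ') := by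
    rw [← psum_const_mul, ← psum_sub]
    refine (abs_psum_le _ _).trans ?_
    have : psum (fun n => |psum a (x / n) - x * (ev m B (L - Real.log n) / n)|) Y ≤
        psum (fun n => K * x ^ (1 - δ) * (n : ℝ) ^ (δ - 1)) Y := by
      refine psum_le_psum fun n h1 h2 => ?_
      have hn : (0 : ℝ) < n := by exact_mod_cast h1
      have hnx : (n : ℝ) ≤ x := by
        refine h2.trans ?_
        rw [← hYZ]
        exact le_mul_of_one_le_right hY0.le hZ1
      have := hK (x / n) (one_le_div_of_mem h1 hnx)
      rw [Real.log_div hx0.ne' hn.ne'] at this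
      calc _ = |psum a (x / n) - x / n * ev m B (L - Real.log n)| := by congr 1; ring
        _ ≤ K * (x / n) ^ (1 - δ) := this
        _ = _ := by
          rw [Real.div_rpow hx0.le hn.le, div_eq_mul_inv, ← Real.rpow_neg hn.le, neg_sub, mul_assoc]
    refine this.trans ?_
    rw [psum_const_mul]
    have e : x ^ (1 - δ) * Y ^ δ = x ^ (1 - δ * (1 - η)) := by
      rw [hY, ← Real.rpow_mul hx0.le, ← Real.rpow_add hx0]; congr 1; ring
    calc _ ≤ K * x ^ (1 - δ) * (Y ^ δ * (1 + Real.log Y)) := by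
          gcongr; exact psum_rpow_le hδ hY1
      _ ≤ K * x ^ (1 - δ) * (Y ^ δ * (1 + L)) := by gcongr
      _ = K * ((1 + L) ^ 1 * (x ^ (1 - δ) * Y ^ δ)) := by ring
      _ ≤ K * (D₁ * x ^ (1 - δ')) := by rw [e]; exact mul_le_mul_of_nonneg_left (hl₁ x hx) hK0
      _ = _ := by ring
  have b2 : |x * psum (fun n => ev m B (L - Real.log n) / n) Y -
      x * (ev (m + 1) B L - ev (m + 1) B (L - Real.log Y) + ev m (B * Γ) L)| ≤
        C₁ * D₂ * x ^ (1 - δ') := by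
    rw [← mul_sub, abs_mul, abs_of_pos hx0]
    have e : x * Y ^ (-(1 / 2) : ℝ) = x ^ (1 - η / 2) := by
      rw [hY, ← Real.rpow_mul hx0.le]
      nth_rewrite 1 [← Real.rpow_one x]
      rw [← Real.rpow_add hx0]; congr 1; ring
    calc _ ≤ x * (C₁ * (1 + L) ^ m * Y ^ (-(1 / 2) : ℝ)) := by gcongr; exact hst Y L hY1 hL0
      _ = C₁ * ((1 + L) ^ m * (x * Y ^ (-(1 / 2) : ℝ))) := by ring
      _ ≤ C₁ * (D₂ * x ^ (1 - δ')) := by rw [e]; exact mul_le_mul_of_nonneg_left (hl₂ x hx) hC₁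
      _ = _ := by ring
  -- the remaining sum
  have b3 : |x * psum (fun n => a n * (1 / n - 1 / Z)) Z -
      x * (ev (m + 1) B (Real.log Z) + κ)| ≤ C₂ * D₁ * x ^ (1 - δ') := by
    rw [← mul_sub, abs_mul, abs_of_pos hx0]
    have e : x * Z ^ (-δ) = x ^ (1 - δ * (1 - η)) := by
      rw [hZ, ← Real.rpow_mul hx0.le]
      nth_rewrite 1 [← Real.rpow_one x]
      rw [← Real.rpow_add hx0]; congr 1; ring
    calc _ ≤ x * (C₂ * Z ^ (-δ)) := by gcongr; exact hint Z hZ1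
      _ = C₂ * (1 * (x * Z ^ (-δ))) := by ring
      _ ≤ C₂ * ((1 + L) ^ 1 * (x * Z ^ (-δ))) := by gcongr; linarith
      _ ≤ C₂ * (D₁ * x ^ (1 - δ')) := by rw [e]; exact mul_le_mul_of_nonneg_left (hl₁ x hx) hC₂
      _ = _ := by ring
  have b4 : |psum (fun n => a n * ((⌊x / n⌋₊ : ℝ) - ⌊Y⌋₊)) Z -
      x * psum (fun n => a n * (1 / n - 1 / Z)) Z| ≤ (C₃ + K) * D₃ * x ^ (1 - δ') := by
    rw [← psum_const_mul, ← psum_sub]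
    refine (abs_psum_le _ _).trans ?_
    have hxZ : x / Z = Y := by rw [← hYZ]; field_simp
    have h3 : psum (fun n => |a n * ((⌊x / n⌋₊ : ℝ) - ⌊Y⌋₊) - x * (a n * (1 / n - 1 / Z))|) Z ≤
        psum a Z := by
      refine psum_le_psum fun n h1 h2 => ?_
      have e : a n * ((⌊x / n⌋₊ : ℝ) - ⌊Y⌋₊) - x * (a n * (1 / n - 1 / Z)) =
          a n * (((⌊x / n⌋₊ : ℝ) - x / n) - (⌊Y⌋₊ - Y)) := by
        rw [← hxZ]; ring
      rw [e, abs_mul, abs_of_nonneg (ha n)]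
      refine mul_le_of_le_one_right (ha n) ?_
      have hxn : 0 ≤ x / n := by positivity
      rw [abs_le]
      constructor <;> linarith [Nat.floor_le hxn, Nat.lt_floor_add_one (x / n),
        Nat.floor_le hY0.le, Nat.lt_floor_add_one Y]
    refine h3.trans ?_
    have h4 := (abs_le.mp (hK Z hZ1)).2
    have h5 := (le_abs_self _).trans (hev (Real.log Z))
    rw [abs_of_nonneg (Real.log_nonneg hZ1)] at h5
    have h6 : (1 + Real.log Z) ^ m ≤ (1 + L) ^ m := by
      have := Real.log_nonneg hZ1
      gcongr
    have h7 : Z ^ (1 - δ) ≤ Z := by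
      nth_rewrite 2 [← Real.rpow_one Z]
      exact Real.rpow_le_rpow_of_exponent_le hZ1 (by linarith)
    have h8 : (1 : ℝ) ≤ (1 + L) ^ m := one_le_pow₀ (by linarith)
    calc _ ≤ Z * ev m B (Real.log Z) + K * Z ^ (1 - δ) := by linarith
      _ ≤ Z * (C₃ * (1 + L) ^ m) + K * (Z * (1 + L) ^ m) := by
          gcongr
          · exact h5.trans (by gcongr)
          · exact h7.trans (le_mul_of_one_le_right hZ0.le h8)
      _ = (C₃ + K) * ((1 + L) ^ m * Z) := by ring
      _ ≤ (C₃ + K) * (D₃ * x ^ (1 - δ')) := by exact mul_le_mul_of_nonneg_left (hl₃ x hx) (by positivity)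
      _ = _ := by ring
  have hB' : ev (m + 1) (B + PowerSeries.X * (B * Γ) +
      PowerSeries.C κ * PowerSeries.X ^ (m + 1)) L = ev (m + 1) B L + ev m (B * Γ) L + κ := by
    rw [ev_add, ev_add, ev_succ_X_mul, ev_C_mul, ev_X_pow, mul_one]
  rw [psum_mul_zeta_hyperbola a hY1 hZ1 hYZ, hB']
  rw [← hlZ'] at b2
  rw [abs_le] at b1 b2 b3 b4 ⊢
  constructor <;> linarith [b1.1, b1.2, b2.1, b2.2, b3.1, b3.2, b4.1, b4.2]

/-- `τ_k` as a real-valued arithmetic function. -/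
def tauR (k : ℕ) : ArithmeticFunction ℝ := (ζ : ArithmeticFunction ℝ) ^ k

lemma tauR_eq_mapA (k : ℕ) : tauR k = mapA (Nat.castRingHom ℝ) (tau k) := by
  rw [tau, mapA_pow, tauR]
  congr 1

lemma tauR_apply (k n : ℕ) : tauR k n = (tau k n : ℝ) := by
  rw [tauR_eq_mapA, mapA_apply]
  rfl

lemma tauR_nonneg (k n : ℕ) : 0 ≤ tauR k n := by rw [tauR_apply]; positivity

/-- The divisor problem: the summatory function of `τ_{k+1}` with a power saving `1/(4(k+1))`. -/
lemma exists_powerAsymp_tauR (k : ℕ) :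
    ∃ B : PowerSeries ℝ, PowerSeries.constantCoeff B = 1 ∧
      PowerAsymp (psum (tauR (k + 1))) k B (1 / (4 * ((k : ℝ) + 1))) := by
  induction k with
  | zero =>
    refine ⟨1, map_one _, 1, fun x hx => ?_⟩
    have hx0 : 0 ≤ x := by linarith
    rw [zero_add, tauR, pow_one, psum_zeta, ev, one_mul, coeff_pexp]
    have h1 : (1 : ℝ) ≤ x ^ (1 - 1 / (4 * (((0 : ℕ) : ℝ) + 1))) :=
      Real.one_le_rpow hx (by norm_num)
    simp only [pow_zero, Nat.factorial_zero, Nat.cast_one, div_one, mul_one, one_mul] at h1 ⊢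
    refine le_trans ?_ h1
    rw [abs_le]
    constructor <;> linarith [Nat.floor_le hx0, Nat.lt_floor_add_one x]
  | succ k ih =>
    obtain ⟨B, hB0, hB⟩ := ih
    have hk : (0 : ℝ) < (k : ℝ) + 1 := by positivity
    have hk2 : (0 : ℝ) < (k : ℝ) + 1 + 1 := by positivity
    rw [tauR, pow_succ, ← tauR]
    push_cast
    suffices h : ∃ B' : PowerSeries ℝ,
        PowerSeries.constantCoeff B' = PowerSeries.constantCoeff B ∧ PowerAsymp
        (psum ((tauR (k + 1) * (ζ : ArithmeticFunction ℝ) : ArithmeticFunction ℝ) : ℕ → ℝ))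
        (k + 1) B' (1 / (4 * ((k : ℝ) + 1 + 1))) by
      obtain ⟨B', h0, h⟩ := h
      exact ⟨B', h0.trans hB0, h⟩
    -- any `η` strictly between `1/(2(k+2))` and `1/(k+2)` is admissible
    refine hB.mul_zeta (tauR_nonneg _) (η := 3 / (4 * ((k : ℝ) + 1 + 1))) (by positivity)
      (by positivity) ?_ ?_ ?_
    · rw [div_lt_one (by positivity)]; linarith
    · rw [one_sub_div (by positivity), div_mul_div_comm, div_lt_div_iff₀ (by positivity)
        (by positivity)]
      nlinarith
    · rw [div_div, div_lt_div_iff₀ (by positivity) (by positivity)]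
      nlinarith

/-! ### The divisor function along multiples -/

/-- The asymptotics of `PowerAsymp` with an explicit constant, on all of `(0, ∞)`. In this form it
is invariant under the dilations `x ↦ x / q`. -/
def GlobalAsymp (D : ℝ → ℝ) (m : ℕ) (B : PowerSeries ℝ) (δ K : ℝ) : Prop :=
  ∀ x : ℝ, 0 < x → |D x - x * ev m B (Real.log x)| ≤ K * x ^ (1 - δ)

lemma PowerAsymp.globalAsymp {a : ℕ → ℝ} {m : ℕ} {B : PowerSeries ℝ} {δ : ℝ} (hδ : 0 < δ)
    (h : PowerAsymp (psum a) m B δ) : ∃ K : ℝ, 0 ≤ K ∧ GlobalAsymp (psum a) m B δ K := by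
  obtain ⟨K, hK0, hK⟩ := h.exists_nonneg
  obtain ⟨C, hC, hev⟩ := exists_abs_ev_le m B
  obtain ⟨D, hD, hl⟩ := exists_one_add_log_pow_le m hδ
  refine ⟨K + C * D, by positivity, fun x hx => ?_⟩
  have hp : 0 ≤ x ^ (1 - δ) := by positivity
  rcases le_or_gt 1 x with h1 | h1
  · refine (hK x h1).trans ?_
    gcongr
    have : 0 ≤ C * D := by positivity
    linarith
  · rw [psum_of_lt_one a h1, zero_sub, abs_neg, abs_mul, abs_of_pos hx]
    have h2 := hl x⁻¹ ((one_le_inv₀ hx).mpr h1.le)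
    have h3 := hev (Real.log x)
    rw [abs_of_nonpos (Real.log_nonpos hx.le h1.le), ← Real.log_inv] at h3
    have e : x * x⁻¹ ^ δ = x ^ (1 - δ) := by
      rw [Real.inv_rpow hx.le, ← Real.rpow_neg hx.le, sub_eq_add_neg, Real.rpow_add hx,
        Real.rpow_one]
    calc _ ≤ x * (C * (D * x⁻¹ ^ δ)) := by
          gcongr
          exact h3.trans (mul_le_mul_of_nonneg_left h2 hC)
      _ = C * D * x ^ (1 - δ) := by rw [← e]; ring
      _ ≤ _ := by
        gcongr
        linarith

lemma mul_mk_multichoose (k ν : ℕ) :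
    (1 - PowerSeries.X : PowerSeries ℝ) ^ k *
      PowerSeries.mk (fun m => (Nat.multichoose k (m + ν) : ℝ)) =
        lpoly k ν (PowerSeries.X : PowerSeries ℝ) := by
  induction k with
  | zero =>
    rw [pow_zero, one_mul, lpoly]
    ext n
    rw [PowerSeries.coeff_mk]
    rcases ν with _ | ν
    · rcases n with _ | n
      · simp
      · simp [PowerSeries.coeff_one]
    · simp [← add_assoc]
  | succ k ih =>
    have h4 : (1 - PowerSeries.X : PowerSeries ℝ) *
        PowerSeries.mk (fun m => (Nat.multichoose (k + 1) (m + ν) : ℝ)) =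
        PowerSeries.mk (fun m => (Nat.multichoose k (m + ν) : ℝ)) +
          PowerSeries.C (if ν = 0 then 0 else (Nat.multichoose (k + 1) (ν - 1) : ℝ)) := by
      ext n
      rw [sub_mul, one_mul, map_sub, map_add, PowerSeries.coeff_mk, PowerSeries.coeff_mk,
        PowerSeries.coeff_C]
      rcases n with _ | n
      · rcases ν with _ | ν
        · simp
        · simp [Nat.multichoose_succ_succ]
      · rw [PowerSeries.coeff_succ_X_mul, PowerSeries.coeff_mk, if_neg (by omega),
          show n + 1 + ν = (n + ν) + 1 by ring, Nat.multichoose_succ_succ]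
        push_cast
        ring
    rw [pow_succ, mul_assoc, h4, mul_add, ih, lpoly_succ]
    congr 1
    split_ifs
    · simp
    · simp [mul_comm]

/-- The coefficients of the local polynomial express `τ_k(p^{ν+j})` through the `τ_k(p^{j-i})`. -/
lemma multichoose_add_eq_sum (k ν j : ℕ) : (Nat.multichoose k (j + ν) : ℝ) =
    ∑ q ∈ Finset.HasAntidiagonal.antidiagonal j,
      PowerSeries.coeff q.1 (lpoly k ν (PowerSeries.X : PowerSeries ℝ)) *
        (Nat.multichoose k q.2 : ℝ) := by
  have h0 := mul_mk_multichoose k 0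
  have h1 := mul_mk_multichoose k ν
  rw [show lpoly k 0 (PowerSeries.X : PowerSeries ℝ) = 1 by simp [lpoly]] at h0
  simp only [add_zero] at h0
  have h2 : lpoly k ν (PowerSeries.X : PowerSeries ℝ) *
      PowerSeries.mk (fun m => (Nat.multichoose k m : ℝ)) =
      PowerSeries.mk (fun m => (Nat.multichoose k (m + ν) : ℝ)) := by
    rw [← h1]
    linear_combination (PowerSeries.mk (fun m => (Nat.multichoose k (m + ν) : ℝ))) * h0
  have := congrArg (PowerSeries.coeff j) h2
  rw [PowerSeries.coeff_mul, PowerSeries.coeff_mk] at this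
  rw [← this]
  exact Finset.sum_congr rfl fun q _ => by rw [PowerSeries.coeff_mk]

/-- The coefficient of `x^i` in the local polynomial, which has degree less than `k` for `k > 0`. -/
def lcoeff (k ν i : ℕ) : ℝ := (lpoly k ν (Polynomial.X : Polynomial ℝ)).coeff i

lemma lcoeff_eq (k ν i : ℕ) :
    lcoeff k ν i = PowerSeries.coeff i (lpoly k ν (PowerSeries.X : PowerSeries ℝ)) := by
  have : lpoly k ν (PowerSeries.X : PowerSeries ℝ) =
      ((lpoly k ν (Polynomial.X : Polynomial ℝ) : Polynomial ℝ) : PowerSeries ℝ) := by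
    have := map_lpoly (Polynomial.coeToPowerSeries.ringHom (R := ℝ)) k ν Polynomial.X
    simpa using this.symm
  rw [this, Polynomial.coeff_coe, lcoeff]

lemma natDegree_lpoly_lt {k : ℕ} (hk : 0 < k) (ν : ℕ) :
    (lpoly k ν (Polynomial.X : Polynomial ℝ)).natDegree < k := by
  unfold lpoly
  split_ifs
  · simpa using hk
  · refine Nat.lt_of_le_pred hk (Polynomial.natDegree_sum_le_of_forall_le _ _ fun i hi => ?_)
    have hi' : i ≤ k - 1 := by have := Finset.mem_range.mp hi; omega
    have hX : (1 - Polynomial.X : Polynomial ℝ).natDegree ≤ 1 :=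
      (Polynomial.natDegree_sub_le _ _).trans (by simp)
    calc _ ≤ ((1 - Polynomial.X : Polynomial ℝ) ^ i).natDegree := by
          rw [← map_natCast Polynomial.C]
          exact Polynomial.natDegree_C_mul_le _ _
      _ ≤ i * 1 := (Polynomial.natDegree_pow_le).trans (Nat.mul_le_mul_left _ hX)
      _ ≤ _ := by rw [Nat.pred_eq_sub_one, mul_one]; exact hi'

lemma sum_lcoeff_mul_pow {k : ℕ} (hk : 0 < k) (ν : ℕ) (y : PowerSeries ℝ) :
    ∑ i ∈ Finset.range k, PowerSeries.C (lcoeff k ν i) * y ^ i = lpoly k ν y := by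
  have h := map_lpoly (Polynomial.eval₂RingHom (PowerSeries.C (R := ℝ)) y) k ν Polynomial.X
  rw [Polynomial.coe_eval₂RingHom, Polynomial.eval₂_X,
    Polynomial.eval₂_eq_sum_range' _ (natDegree_lpoly_lt hk ν)] at h
  exact h

lemma sum_abs_lcoeff_le {k : ℕ} (hk : 0 < k) (ν : ℕ) :
    ∑ i ∈ Finset.range k, |lcoeff k ν i| ≤ (k + 1) * 2 ^ k * ((ν : ℝ) + 1) ^ k := by
  have hN := isSubNorm_wnorm isSubNorm_abs (zero_le_one) k
  have hX : wnorm (fun a : ℝ => |a|) 1 k PowerSeries.X ≤ 1 := by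
    rw [wnorm, Finset.sum_eq_single_of_mem 1 (by simpa using hk)]
    · simp
    · intro j _ hj
      simp [PowerSeries.coeff_X, hj]
  refine le_trans ?_ (lpoly_norm_le hN k ν hX)
  rw [wnorm, Finset.sum_range_succ]
  have : ∀ i, |lcoeff k ν i| =
      |PowerSeries.coeff i (lpoly k ν (PowerSeries.X : PowerSeries ℝ))| * 1 ^ i := fun i => by
    rw [lcoeff_eq, one_pow, mul_one]
  simp_rw [← this]
  have := abs_nonneg (lcoeff k ν k)
  linarith

/-- Summation over the multiples of `q`, with the substitution `n = q m`. -/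
lemma psum_dvd (f : ℕ → ℝ) {q : ℕ} (hq : 0 < q) (x : ℝ) :
    psum (fun n => if q ∣ n then f (n / q) else 0) x = psum f (x / q) := by
  rw [psum, psum, ← Finset.sum_filter]
  have hq' : (0 : ℝ) < q := by exact_mod_cast hq
  refine Finset.sum_nbij' (fun n => n / q) (fun m => q * m) ?_ ?_ ?_ ?_ ?_
  · intro n hn
    rw [Finset.mem_filter, mem_Icc_floor_iff] at hn
    obtain ⟨⟨h1, h2⟩, m, rfl⟩ := hn
    rw [Nat.mul_div_cancel_left _ hq, mem_Icc_floor_iff, le_div_iff₀ hq']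
    push_cast at h2
    refine ⟨Nat.pos_of_mul_pos_left h1, by linarith⟩
  · intro m hm
    rw [mem_Icc_floor_iff, le_div_iff₀ hq'] at hm
    rw [Finset.mem_filter, mem_Icc_floor_iff]
    push_cast
    exact ⟨⟨Nat.mul_pos hq hm.1, by linarith⟩, dvd_mul_right _ _⟩
  · intro n hn
    exact Nat.mul_div_cancel' (Finset.mem_filter.mp hn).2
  · intro m _
    exact Nat.mul_div_cancel_left _ hq
  · intro n _
    rfl

/-- The values `τ_k(p^ν a n)` as a combination of the `τ_k(a n / p^i)`, `i < k`, with coefficients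
that do not depend on `n`. -/
lemma tau_prime_pow_mul_eq_sum (k : ℕ) {p a : ℕ} (hp : p.Prime) (ha : ¬p ∣ a) (ν : ℕ) {n : ℕ}
    (hn : n ≠ 0) (hk : 0 < k) : tauR k (p ^ ν * a * n) =
      ∑ i ∈ Finset.range k, lcoeff k ν i *
        (if p ^ i ∣ n then tauR k (a * (n / p ^ i)) else 0) := by
  obtain ⟨j, b, hb, rfl⟩ : ∃ j b, ¬p ∣ b ∧ n = p ^ j * b :=
    Nat.exists_eq_pow_mul_and_not_dvd hn p hp.ne_one
  have hab : ¬p ∣ a * b := fun h => (hp.dvd_mul.mp h).elim ha hb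
  have hcop : ∀ i, Nat.Coprime (p ^ i) (a * b) := fun i =>
    Nat.Coprime.pow_left i ((Nat.Prime.coprime_iff_not_dvd hp).mpr hab)
  have hval : ∀ i, tauR k (p ^ i * (a * b)) = Nat.multichoose k i * tauR k (a * b) := by
    intro i
    rw [tauR_apply, tauR_apply, (isMultiplicative_tau k).map_mul_of_coprime (hcop i),
      tau_prime_pow k hp]
    push_cast; ring
  have e1 : p ^ ν * a * (p ^ j * b) = p ^ (j + ν) * (a * b) := by rw [pow_add]; ring
  rw [e1, hval, multichoose_add_eq_sum, Finset.sum_mul]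
  have hdvd : ∀ i, p ^ i ∣ p ^ j * b ↔ i ≤ j := by
    intro i
    constructor
    · intro h
      have h2 : p ^ i ∣ p ^ j := (Nat.Coprime.pow_left i
        ((Nat.Prime.coprime_iff_not_dvd hp).mpr hb)).dvd_of_dvd_mul_right h
      exact (Nat.pow_dvd_pow_iff_le_right hp.one_lt).mp h2
    · intro h
      exact (pow_dvd_pow p h).trans (dvd_mul_right _ _)
  refine (Finset.Nat.sum_antidiagonal_eq_sum_range_succ (fun i l =>
    PowerSeries.coeff i (lpoly k ν (PowerSeries.X : PowerSeries ℝ)) *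
        (Nat.multichoose k l : ℝ) * tauR k (a * b)) j).trans ?_
  have e2 : ∀ i, i ≤ j → lcoeff k ν i *
      (if p ^ i ∣ p ^ j * b then tauR k (a * (p ^ j * b / p ^ i)) else 0) =
      PowerSeries.coeff i (lpoly k ν (PowerSeries.X : PowerSeries ℝ)) *
        (Nat.multichoose k (j - i) : ℝ) * tauR k (a * b) := by
    intro i hi
    rw [if_pos ((hdvd i).mpr hi), ← lcoeff_eq]
    have : p ^ j * b / p ^ i = p ^ (j - i) * b := by
      rw [← Nat.pow_div hi hp.pos, Nat.div_mul_right_comm (pow_dvd_pow p hi)]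
    rw [this, show a * (p ^ (j - i) * b) = p ^ (j - i) * (a * b) by ring, hval]
    ring
  set g : ℕ → ℝ := fun i => lcoeff k ν i *
      (if p ^ i ∣ p ^ j * b then tauR k (a * (p ^ j * b / p ^ i)) else 0) with hg
  have e3 : ∑ i ∈ Finset.range k, g i = ∑ i ∈ Finset.range (max k (j + 1)), g i := by
    refine Finset.sum_subset (Finset.range_subset_range.mpr (le_max_left _ _)) fun i _ hi => ?_
    have : lcoeff k ν i = 0 := Polynomial.coeff_eq_zero_of_natDegree_lt
      ((natDegree_lpoly_lt hk ν).trans_le (by simpa using hi))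
    rw [hg]; simp only; rw [this, zero_mul]
  have e4 : ∑ i ∈ Finset.range (j + 1), g i = ∑ i ∈ Finset.range (max k (j + 1)), g i := by
    refine Finset.sum_subset (Finset.range_subset_range.mpr (le_max_right _ _)) fun i _ hi => ?_
    have : ¬i ≤ j := by simpa using hi
    rw [hg]; simp only; rw [if_neg (fun h => this ((hdvd i).mp h)), mul_zero]
  rw [e3, ← e4]
  exact Finset.sum_congr rfl fun i hi => (e2 i (by simpa [Nat.lt_succ_iff] using hi)).symm

/-- The summatory function of `n ↦ τ_k(dn)`. -/
def tauSum (k d : ℕ) (x : ℝ) : ℝ := psum (fun n => tauR k (d * n)) x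

/-- The preceding recursion, summed over `n`. -/
lemma tauSum_prime_pow_mul (k : ℕ) {p a : ℕ} (hp : p.Prime) (ha : ¬p ∣ a) (ν : ℕ) (hk : 0 < k)
    (x : ℝ) : tauSum k (p ^ ν * a) x =
      ∑ i ∈ Finset.range k, lcoeff k ν i * tauSum k a (x / (p ^ i : ℕ)) := by
  have : tauSum k (p ^ ν * a) x = psum (fun n => ∑ i ∈ Finset.range k, lcoeff k ν i *
        (if p ^ i ∣ n then tauR k (a * (n / p ^ i)) else 0)) x :=
    psum_congr fun n h _ => tau_prime_pow_mul_eq_sum k hp ha ν (by omega) hk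
  rw [this, psum, Finset.sum_comm]
  refine Finset.sum_congr rfl fun i _ => ?_
  rw [← Finset.mul_sum]
  congr 1
  exact psum_dvd (fun n => tauR k (a * n)) (pow_pos hp.pos i) x

/-- The product of the local polynomials at the primes dividing `d`. -/
def lprod (k d : ℕ) : PowerSeries ℝ :=
  ∏ p ∈ d.primeFactors, lpoly k (d.factorization p) (PowerSeries.C (invN p) * pw p)

lemma prod_primeFactors_prime_pow_mul {M : Type*} [CommMonoid M] (g : ℕ → ℕ → M) {p a n : ℕ}
    (hp : p.Prime) (ha : ¬p ∣ a) (hn : 0 < n) :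
    ∏ q ∈ (p ^ n * a).primeFactors, g q ((p ^ n * a).factorization q) =
      g p n * ∏ q ∈ a.primeFactors, g q (a.factorization q) := by
  rw [prod_primeFactors_mul_of_coprime g
    (Nat.Coprime.pow_left n ((Nat.Prime.coprime_iff_not_dvd hp).mpr ha)),
    Nat.primeFactors_prime_pow hn.ne' hp, Finset.prod_singleton]
  simp [hp.factorization]

/-- Induction over the prime powers dividing `d`: each one multiplies the series in the main term by
its local polynomial, and the error by the sum of the absolute values of the coefficients of that
polynomial. -/
lemma globalAsymp_tauSum {k m : ℕ} (hk : 0 < k) {B : PowerSeries ℝ} {δ K : ℝ} (hδ : δ ≤ 1)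
    (hK : 0 ≤ K) (h : GlobalAsymp (psum (tauR k)) m B δ K) {d : ℕ} (hd : d ≠ 0) :
    GlobalAsymp (tauSum k d) m (B * lprod k d) δ
      (K * ∏ p ∈ d.primeFactors, (k + 1) * 2 ^ k * ((d.factorization p : ℝ) + 1) ^ k) := by
  induction d using Nat.recOnPrimePow with
  | zero => exact absurd rfl hd
  | one =>
    have : tauSum k 1 = psum (tauR k) := by
      ext x
      rw [tauSum]; simp
    simpa [this, lprod] using h
  | prime_pow_mul a p n hp ha hn ih =>
    have ha0 : a ≠ 0 := by rintro rfl; simp at ha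
    have ih' := ih ha0
    set B' := B * lprod k a with hB'
    set K' := K * ∏ q ∈ a.primeFactors, ((k : ℝ) + 1) * 2 ^ k * ((a.factorization q : ℝ) + 1) ^ k
      with hK'
    have hK'0 : 0 ≤ K' := mul_nonneg hK (Finset.prod_nonneg fun q _ => by positivity)
    have eB : B * lprod k (p ^ n * a) = B' * lpoly k n (PowerSeries.C (invN p) * pw p) := by
      rw [lprod, prod_primeFactors_prime_pow_mul
        (fun q v => lpoly k v (PowerSeries.C (invN q) * pw q)) hp ha hn, hB', lprod]
      ring
    have eK : K * ∏ q ∈ (p ^ n * a).primeFactors,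
        ((k : ℝ) + 1) * 2 ^ k * (((p ^ n * a).factorization q : ℝ) + 1) ^ k =
        ((k + 1) * 2 ^ k * ((n : ℝ) + 1) ^ k) * K' := by
      rw [prod_primeFactors_prime_pow_mul
        (fun _ v => ((k : ℝ) + 1) * 2 ^ k * ((v : ℝ) + 1) ^ k) hp ha hn, hK']
      ring
    rw [eB, eK]
    intro x hx
    have hp0 : (0 : ℝ) < p := by exact_mod_cast hp.pos
    have hp1 : (1 : ℝ) ≤ p := by exact_mod_cast hp.one_le
    have e2 : x * ev m (B' * lpoly k n (PowerSeries.C (invN p) * pw p)) (Real.log x) =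
        ∑ i ∈ Finset.range k, lcoeff k n i *
          (x / (p ^ i : ℕ) * ev m B' (Real.log (x / (p ^ i : ℕ)))) := by
      rw [← sum_lcoeff_mul_pow hk, Finset.mul_sum, ev, Finset.sum_mul, map_sum, Finset.mul_sum]
      refine Finset.sum_congr rfl fun i _ => ?_
      have hpi : ((p ^ i : ℕ) : ℝ) ≠ 0 := Nat.cast_ne_zero.mpr (pow_ne_zero i hp.ne_zero)
      rw [Real.log_div hx.ne' hpi, sub_eq_add_neg, ev_add_right, ← pw_eq_pexp,
        apply_prime_pow_of_mul (φ := pw) (fun a b h h' => pw_mul h h') pw_one hp.ne_zero]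
      have : B' * (PowerSeries.C (lcoeff k n i) * (PowerSeries.C (invN p) * pw p) ^ i) *
          pexp (Real.log x) =
          PowerSeries.C (lcoeff k n i * invN p ^ i) * (B' * pw p ^ i * pexp (Real.log x)) := by
        rw [mul_pow, map_mul, map_pow]; ring
      rw [this, PowerSeries.coeff_C_mul, ← ev, invN]
      push_cast
      rw [inv_pow, div_eq_mul_inv]
      ring
    rw [tauSum_prime_pow_mul k hp ha n hk, e2, ← Finset.sum_sub_distrib]
    calc _ ≤ ∑ i ∈ Finset.range k, |lcoeff k n i| * (K' * x ^ (1 - δ)) := by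
          refine (Finset.abs_sum_le_sum_abs _ _).trans (Finset.sum_le_sum fun i _ => ?_)
          rw [← mul_sub, abs_mul]
          have hpi : (1 : ℝ) ≤ (p ^ i : ℕ) := by
            push_cast
            exact one_le_pow₀ hp1
          have hpi0 : (0 : ℝ) < (p ^ i : ℕ) := by linarith
          gcongr
          refine (ih' _ (div_pos hx hpi0)).trans ?_
          gcongr
          exact div_le_self hx.le hpi
      _ = (∑ i ∈ Finset.range k, |lcoeff k n i|) * (K' * x ^ (1 - δ)) := by rw [Finset.sum_mul]
      _ ≤ ((k + 1) * 2 ^ k * ((n : ℝ) + 1) ^ k) * (K' * x ^ (1 - δ)) := by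
          gcongr
          exact sum_abs_lcoeff_le hk n
      _ = _ := by ring

/-- A product of local factors of polynomial growth in the exponents is at most linear. -/
lemma exists_prod_primeFactors_le {A : ℝ} (hA : 0 ≤ A) (k : ℕ) : ∃ C : ℝ, 0 ≤ C ∧
    ∀ d : ℕ, d ≠ 0 →
      ∏ p ∈ d.primeFactors, A * ((d.factorization p : ℝ) + 1) ^ k ≤ C * d := by
  have hs := (summable_poly_mul_geometric k (by norm_num : (0 : ℝ) ≤ 1 / 2) (by norm_num)).mul_left A
  set W : ℝ := 1 + ∑' ν : ℕ, A * (((ν : ℝ) + 1) ^ k * (1 / 2) ^ ν) with hW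
  have hW1 : 1 ≤ W := by
    have : 0 ≤ ∑' ν : ℕ, A * (((ν : ℝ) + 1) ^ k * (1 / 2) ^ ν) :=
      tsum_nonneg fun ν => by positivity
    linarith
  have hb : ∀ ν : ℕ, A * ((ν : ℝ) + 1) ^ k ≤ W * 2 ^ ν := by
    intro ν
    have h1 := hs.le_tsum ν fun j _ => by positivity
    have h2 : A * (((ν : ℝ) + 1) ^ k * (1 / 2) ^ ν) ≤ W := by linarith
    calc _ = A * (((ν : ℝ) + 1) ^ k * (1 / 2) ^ ν) * 2 ^ ν := by
          rw [mul_assoc, mul_assoc, ← mul_pow]; norm_num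
      _ ≤ _ := by gcongr
  set N : ℕ := ⌈2 * W⌉₊ with hN
  refine ⟨W ^ N, by positivity, fun d hd => ?_⟩
  have hterm : ∀ p ∈ d.primeFactors, A * ((d.factorization p : ℝ) + 1) ^ k ≤
      (if p ∈ Finset.range N then W else 1) * (p : ℝ) ^ d.factorization p := by
    intro p hp
    have hpp := Nat.prime_of_mem_primeFactors hp
    have hp2 : (2 : ℝ) ≤ p := by exact_mod_cast hpp.two_le
    have hν : d.factorization p ≠ 0 :=
      (hpp.factorization_pos_of_dvd hd (Nat.dvd_of_mem_primeFactors hp)).ne'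
    refine (hb _).trans ?_
    split_ifs with h
    · gcongr
    · rw [Finset.mem_range, not_lt] at h
      have h1 : 2 * W ≤ p := (Nat.le_ceil _).trans (by exact_mod_cast h)
      have h2 : W ≤ ((p : ℝ) / 2) ^ d.factorization p :=
        (by linarith : W ≤ (p : ℝ) / 2).trans (le_self_pow₀ (by linarith) hν)
      calc _ ≤ ((p : ℝ) / 2) ^ d.factorization p * 2 ^ d.factorization p := by gcongr
        _ = _ := by rw [← mul_pow]; simp
  refine (Finset.prod_le_prod (fun p _ => by positivity) hterm).trans ?_
  rw [Finset.prod_mul_distrib]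
  have e : ∏ p ∈ d.primeFactors, (p : ℝ) ^ d.factorization p = d := by
    have := Nat.prod_factorization_pow_eq_self hd
    rw [Finsupp.prod, Nat.support_factorization] at this
    exact_mod_cast congrArg (Nat.cast (R := ℝ)) this
  rw [e]
  gcongr
  rw [Finset.prod_ite, Finset.prod_const_one, mul_one, Finset.prod_const]
  refine pow_le_pow_right₀ hW1 ?_
  calc _ ≤ (Finset.range N).card := Finset.card_le_card fun p hp => (Finset.mem_filter.mp hp).2
    _ = N := Finset.card_range N

/-- The factor `d^{-z}` of `H(d)` separates from the Euler product. -/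
lemma hSer_eq_pw_mul_lprod (k : ℕ) {d : ℕ} (hd : d ≠ 0) : hSer k d = lprod k d * pw d := by
  induction d using Nat.recOnPrimePow with
  | zero => exact absurd rfl hd
  | one => simp [lprod, pw_one, (isMultiplicative_hSer k).map_one]
  | prime_pow_mul a p n hp ha hn ih =>
    have ha0 : a ≠ 0 := by rintro rfl; simp at ha
    have hcop : Nat.Coprime (p ^ n) a :=
      Nat.Coprime.pow_left n ((Nat.Prime.coprime_iff_not_dvd hp).mpr ha)
    rw [(isMultiplicative_hSer k).map_mul_of_coprime hcop, ih ha0, hSer_prime_pow k hp,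
      pw_mul (pow_ne_zero n hp.ne_zero) ha0, show lprod k (p ^ n * a) = _ * lprod k a from
        prod_primeFactors_prime_pow_mul
          (fun q v => lpoly k v (PowerSeries.C (invN q) * pw q)) hp ha hn, hloc,
        apply_prime_pow_of_mul (φ := pw) (fun a b h h' => pw_mul h h') pw_one hp.ne_zero]
    ring

/-- The sums of `τ_k` over the multiples of `d`, with polynomial dependence on `d`. -/
lemma exists_psum_dvd_tauR_sub_le {k m : ℕ} (hk : 0 < k) {B : PowerSeries ℝ} {δ : ℝ}
    (hδ0 : 0 < δ) (hδ : δ ≤ 1) (h : PowerAsymp (psum (tauR k)) m B δ) : ∃ K : ℝ, 0 ≤ K ∧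
    ∀ d : ℕ, d ≠ 0 → ∀ x : ℝ, 0 < x →
      |psum (fun n => if d ∣ n then tauR k n else 0) x -
        x / d * ev m (B * hSer k d) (Real.log x)| ≤ K * d * x ^ (1 - δ) := by
  obtain ⟨K, hK, hg⟩ := h.globalAsymp hδ0
  obtain ⟨C, hC, hC'⟩ := exists_prod_primeFactors_le
    (by positivity : (0 : ℝ) ≤ (k + 1) * 2 ^ k) k
  refine ⟨K * C, by positivity, fun d hd x hx => ?_⟩
  have hd1 : (1 : ℝ) ≤ d := by exact_mod_cast Nat.one_le_iff_ne_zero.mpr hd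
  have e1 : psum (fun n => if d ∣ n then tauR k n else 0) x = tauSum k d (x / d) := by
    rw [tauSum, ← psum_dvd _ (Nat.pos_of_ne_zero hd)]
    refine psum_congr fun n _ _ => ?_
    split_ifs with h
    · rw [Nat.mul_div_cancel' h]
    · rfl
  have e2 : ev m (B * hSer k d) (Real.log x) = ev m (B * lprod k d) (Real.log (x / d)) := by
    rw [Real.log_div hx.ne' (by linarith), sub_eq_add_neg, ev_add_right, ← pw_eq_pexp,
      hSer_eq_pw_mul_lprod k hd, mul_assoc]
  rw [e1, e2]
  refine (globalAsymp_tauSum hk hδ hK hg hd (x / d) (by positivity)).trans ?_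
  calc _ ≤ K * (C * d) * x ^ (1 - δ) := by
        gcongr
        · exact hC' d hd
        · exact div_le_self hx.le hd1
    _ = _ := by ring

/-! ### The 2-norm of the divisor function -/

/-- Convolution with an absolutely convergent Dirichlet series. -/
lemma GlobalAsymp.mul_summable {g b : ArithmeticFunction ℝ} {m : ℕ} {B : PowerSeries ℝ}
    {δ K : ℝ} (hδ : 0 < δ) (h : GlobalAsymp (psum b) m B δ K)
    (hg : Summable fun n : ℕ => |g n| * (n : ℝ) ^ (δ - 1)) :
    ∃ (Γ : PowerSeries ℝ) (K' : ℝ), PowerSeries.constantCoeff Γ = ∑' n, twist invN g n ∧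
      GlobalAsymp (psum ((g * b : ArithmeticFunction ℝ) : ℕ → ℝ)) m (B * Γ) δ K' := by
  have hsl : ∀ l, Summable fun n : ℕ => g n / n * PowerSeries.coeff l (pw n) := by
    intro l
    obtain ⟨C, hC, hl⟩ := exists_one_add_log_pow_le l hδ
    refine Summable.of_norm_bounded (hg.mul_left C) fun n => ?_
    rcases Nat.eq_zero_or_pos n with rfl | hn
    · simp
    have hn1 : (1 : ℝ) ≤ n := by exact_mod_cast hn
    have hn0 : (0 : ℝ) < n := by linarith
    have h1 : |PowerSeries.coeff l (pw n)| ≤ C * (n : ℝ) ^ δ := by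
      refine le_trans ?_ (hl n hn1)
      have hL := Real.log_nonneg hn1
      rw [coeff_pw, abs_div, abs_pow, abs_neg, abs_of_nonneg hL,
        abs_of_nonneg (by positivity : (0 : ℝ) ≤ l.factorial)]
      have h1 : (1 : ℝ) ≤ l.factorial := by
        exact_mod_cast Nat.one_le_iff_ne_zero.mpr (Nat.factorial_ne_zero _)
      calc _ ≤ Real.log n ^ l := div_le_self (by positivity) h1
        _ ≤ _ := by gcongr; linarith
    rw [Real.norm_eq_abs, abs_mul, abs_div, abs_of_pos hn0, Real.rpow_sub_one hn0.ne']
    calc _ ≤ |g n| / n * (C * (n : ℝ) ^ δ) := by gcongr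
      _ = _ := by ring
  refine ⟨PowerSeries.mk fun l => ∑' n : ℕ, g n / n * PowerSeries.coeff l (pw n),
    K * ∑' n : ℕ, |g n| * (n : ℝ) ^ (δ - 1), ?_, fun x hx => ?_⟩
  · rw [← PowerSeries.coeff_zero_eq_constantCoeff_apply, PowerSeries.coeff_mk]
    refine tsum_congr fun n => ?_
    rw [PowerSeries.coeff_zero_eq_constantCoeff_apply, constantCoeff_pw, twist_apply, invN]
    ring
  set Γ : PowerSeries ℝ := PowerSeries.mk fun l => ∑' n : ℕ, g n / n * PowerSeries.coeff l (pw n)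
    with hΓ
  have hmain : HasSum (fun n : ℕ => g n * (x / n * ev m B (Real.log (x / n))))
      (x * ev m (B * Γ) (Real.log x)) := by
    have e1 : ev m (B * Γ) (Real.log x) = ∑ q ∈ Finset.HasAntidiagonal.antidiagonal m,
        ev q.1 B (Real.log x) * ∑' n : ℕ, g n / n * PowerSeries.coeff q.2 (pw n) := by
      have : B * Γ * pexp (Real.log x) = B * pexp (Real.log x) * Γ := by ring
      rw [ev, this, PowerSeries.coeff_mul]
      exact Finset.sum_congr rfl fun q _ => by rw [hΓ, PowerSeries.coeff_mk, ev]
    rw [e1]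
    have := (hasSum_sum (s := Finset.HasAntidiagonal.antidiagonal m) fun q _ =>
      ((hsl q.2).hasSum.mul_left (ev q.1 B (Real.log x)))).mul_left x
    refine this.congr_fun fun n => ?_
    rcases Nat.eq_zero_or_pos n with rfl | hn
    · simp
    have hn0 : (n : ℝ) ≠ 0 := by positivity
    have e2 : ev m B (Real.log (x / n)) = ∑ q ∈ Finset.HasAntidiagonal.antidiagonal m,
        ev q.1 B (Real.log x) * PowerSeries.coeff q.2 (pw n) := by
      rw [Real.log_div hx.ne' hn0, sub_eq_add_neg, ev, pexp_add, ← mul_assoc,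
        PowerSeries.coeff_mul]
      rfl
    rw [e2, Finset.mul_sum, Finset.mul_sum, Finset.mul_sum]
    exact Finset.sum_congr rfl fun q _ => by ring
  have hpart : HasSum (fun n : ℕ => g n * psum b (x / n))
      (psum ((g * b : ArithmeticFunction ℝ) : ℕ → ℝ) x) := by
    rw [psum_mul, psum]
    refine hasSum_sum_of_ne_finset_zero fun n hn => ?_
    rcases Nat.eq_zero_or_pos n with rfl | hn0
    · simp
    have h2 : x < n := by
      by_contra hcon
      exact hn (mem_Icc_floor_iff.mpr ⟨hn0, not_lt.mp hcon⟩)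
    rw [psum_of_lt_one _ ((div_lt_one (by positivity)).mpr h2), mul_zero]
  have hdiff := hpart.sub hmain
  have hK' : HasSum (fun n : ℕ => K * x ^ (1 - δ) * (|g n| * (n : ℝ) ^ (δ - 1)))
      (K * x ^ (1 - δ) * ∑' n : ℕ, |g n| * (n : ℝ) ^ (δ - 1)) := hg.hasSum.mul_left _
  have hle : ∀ n : ℕ, ‖g n * psum b (x / n) - g n * (x / n * ev m B (Real.log (x / n)))‖ ≤
      K * x ^ (1 - δ) * (|g n| * (n : ℝ) ^ (δ - 1)) := by
    intro n
    rcases Nat.eq_zero_or_pos n with rfl | hn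
    · simp
    have hn0 : (0 : ℝ) < n := by exact_mod_cast hn
    rw [← mul_sub, Real.norm_eq_abs, abs_mul]
    calc _ ≤ |g n| * (K * (x / n) ^ (1 - δ)) := by
          gcongr
          exact h (x / n) (by positivity)
      _ = _ := by
        rw [Real.div_rpow hx.le hn0.le, div_eq_mul_inv, ← Real.rpow_neg hn0.le, neg_sub]; ring
  have := hdiff.norm_le_of_bounded hK' hle
  rw [Real.norm_eq_abs] at this
  refine this.trans (le_of_eq ?_)
  ring

/-- The square of the divisor function. -/
def tauSq (k : ℕ) : ArithmeticFunction ℝ := ⟨fun n => tauR k n ^ 2, by simp⟩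

lemma tauSq_apply (k n : ℕ) : tauSq k n = tauR k n ^ 2 := rfl

lemma isMultiplicative_tauR (k : ℕ) : (tauR k).IsMultiplicative :=
  isMultiplicative_pow (isMultiplicative_zeta_cast _) k

lemma isMultiplicative_tauSq (k : ℕ) : (tauSq k).IsMultiplicative := by
  refine ⟨by simp [tauSq_apply, (isMultiplicative_tauR k).map_one], fun {m n} hmn => ?_⟩
  rw [tauSq_apply, tauSq_apply, tauSq_apply, (isMultiplicative_tauR k).map_mul_of_coprime hmn]
  ring

lemma tauSq_prime_pow (k : ℕ) {p : ℕ} (hp : p.Prime) (ν : ℕ) :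
    tauSq k (p ^ ν) = (Nat.multichoose k ν : ℝ) ^ 2 := by
  rw [tauSq_apply, tauR_apply, tau_prime_pow k hp]

/-- The quotient of `τ_k²` by `τ_{k²}`. -/
def tauSqQuot (k : ℕ) : ArithmeticFunction ℝ := tauSq k * (μ : ArithmeticFunction ℝ) ^ (k ^ 2)

lemma tauSqQuot_mul (k : ℕ) : tauSqQuot k * tauR (k ^ 2) = tauSq k := by
  rw [tauSqQuot, tauR, mul_assoc, ← mul_pow, mul_comm (μ : ArithmeticFunction ℝ),
    ArithmeticFunction.coe_zeta_mul_coe_moebius, one_pow, mul_one]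

lemma twist_pow {R : Type*} [CommSemiring R] {φ : ℕ → R} (h1 : φ 1 = 1)
    (hφ : ∀ a b, a ≠ 0 → b ≠ 0 → φ (a * b) = φ a * φ b) (f : ArithmeticFunction R) (k : ℕ) :
    twist φ (f ^ k) = twist φ f ^ k := by
  induction k with
  | zero => rw [pow_zero, pow_zero, twist_one h1]
  | succ k ih => rw [pow_succ, pow_succ, twist_mul hφ, ih]

lemma twist_tauSqQuot (k : ℕ) : twist invN (tauSqQuot k) =
    twist invN (tauSq k) * twist invN (μ : ArithmeticFunction ℝ) ^ (k ^ 2) := by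
  have hm : ∀ a b : ℕ, a ≠ 0 → b ≠ 0 → invN (a * b) = invN a * invN b :=
    fun a b _ _ => invN_mul a b
  rw [tauSqQuot, twist_mul hm, twist_pow invN_one hm]

lemma isMultiplicative_twist_tauSqQuot (k : ℕ) : (twist invN (tauSqQuot k)).IsMultiplicative :=
  isMultiplicative_twist invN_one (fun a b _ _ => invN_mul a b)
    ((isMultiplicative_tauSq k).mul (isMultiplicative_pow (isMultiplicative_moebius_cast _) _))

lemma invN_le_rpow {p : ℕ} (hp : p.Prime) : |invN p| ≤ (p : ℝ) ^ (-(7 / 8) : ℝ) := by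
  have h1 : (1 : ℝ) ≤ p := by exact_mod_cast hp.one_le
  rw [abs_of_pos (invN_prime_pos hp).1, invN, ← Real.rpow_neg_one]
  exact Real.rpow_le_rpow_of_exponent_le h1 (by norm_num)

lemma summable_tauSqQuot (k : ℕ) :
    Summable fun n : ℕ => |twist invN (tauSqQuot k) n| * (n : ℝ) ^ (1 / 8 : ℝ) := by
  have h := isSubNorm_abs
  refine summable_of_locBd h (isMultiplicative_twist_tauSqQuot k) ?_ (C₀ := 0) ?_
  · rw [twist_tauSqQuot]
    refine LocBd.mul h ?_ ((LocBd.twist_moebius h invN_one fun p hp => invN_le_rpow hp).pow h _)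
    refine ⟨1, zero_le_one, k * 2, fun p hp ν => ?_⟩
    simp only
    rw [twist_apply, tauSq_prime_pow k hp, invN_pow, abs_mul, abs_pow, one_mul, mul_comm,
      abs_of_nonneg (by positivity : (0 : ℝ) ≤ (Nat.multichoose k ν : ℝ) ^ 2), pow_mul]
    gcongr
    · exact_mod_cast multichoose_le_pow k ν
    · exact invN_le_rpow hp
  · intro p hp
    have h1 : twist invN (μ : ArithmeticFunction ℝ) 1 = 1 := by simp
    have h2 : twist invN (tauSq k) 1 = 1 := by simp [(isMultiplicative_tauSq k).map_one]
    have h3 : tauSq k p = (k : ℝ) ^ 2 := by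
      have := tauSq_prime_pow k hp 1
      rw [pow_one] at this
      rw [this, Nat.multichoose_one_right]
    rw [twist_tauSqQuot, mul_apply_prime h2 (pow_apply_one h1 _) hp, pow_apply_prime h1 hp,
      twist_apply, twist_apply, h3, ArithmeticFunction.intCoe_apply,
      ArithmeticFunction.moebius_apply_prime hp]
    push_cast
    have : invN p * (k : ℝ) ^ 2 + (k : ℝ) ^ 2 * (invN p * -1) = 0 := by ring
    rw [this, abs_zero, zero_mul]

lemma tsum_tauSqQuot (k : ℕ) : ∑' n, twist invN (tauSqQuot k) n = constC k := by
  have hm := isMultiplicative_twist_tauSqQuot k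
  have hs : Summable fun n => ‖twist invN (tauSqQuot k) n‖ := by
    refine Summable.of_nonneg_of_le (fun _ => norm_nonneg _) (fun n => ?_) (summable_tauSqQuot k)
    rcases Nat.eq_zero_or_pos n with rfl | hn
    · simp
    · rw [Real.norm_eq_abs]
      exact le_mul_of_one_le_right (abs_nonneg _)
        (Real.one_le_rpow (by exact_mod_cast hn) (by norm_num))
  have h := EulerProduct.eulerProduct_hasProd (f := fun n => twist invN (tauSqQuot k) n)
    hm.map_one (fun {m n} h => hm.map_mul_of_coprime h) hs (by simp)
  rw [← h.tprod_eq, constC]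
  refine tprod_congr fun p => ?_
  obtain ⟨h0, h1⟩ := invN_prime_pos p.2
  have e : ∀ ν : ℕ, twist invN (tauSq k) ((p : ℕ) ^ ν) =
      (Nat.multichoose k ν : ℝ) ^ 2 * invN p ^ ν := fun ν => by
    rw [twist_apply, tauSq_prime_pow k p.2, invN_pow, mul_comm]
  have hb : BellSum (twist invN (tauSq k)) p
      (∑' m : ℕ, (Nat.multichoose k m : ℝ) ^ 2 * invN p ^ m) := by
    refine ⟨(summable_multichoose_sq k h0.le h1 0).congr fun ν => ?_, tsum_congr e⟩
    rw [e, Real.norm_of_nonneg (by positivity), add_zero]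
  have := (hb.mul p.2 ((bellSum_twist_moebius p.2).pow p.2 (k ^ 2))).2
  rw [← twist_tauSqQuot] at this
  rw [this, localFactor_eq k p.2, mul_comm]

/-- The 2-norm of `τ_k` with a power saving. -/
lemma exists_powerAsymp_tauSq {k : ℕ} (hk : 2 ≤ k) : ∃ (B : PowerSeries ℝ) (δ : ℝ), 0 < δ ∧
    PowerSeries.constantCoeff B = constC k ∧ PowerAsymp (psum (tauSq k)) (k ^ 2 - 1) B δ := by
  have hk2 : 1 ≤ k ^ 2 := Nat.one_le_iff_ne_zero.mpr (pow_ne_zero _ (by omega))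
  obtain ⟨B, hB0, hB⟩ := exists_powerAsymp_tauR (k ^ 2 - 1)
  rw [Nat.sub_add_cancel hk2] at hB
  set δ : ℝ := min (1 / 8) (1 / (4 * (((k ^ 2 - 1 : ℕ) : ℝ) + 1))) with hδ
  have hδ0 : 0 < δ := lt_min (by norm_num) (by positivity)
  obtain ⟨K, hK, hg⟩ := (hB.mono (min_le_right _ _)).globalAsymp hδ0
  obtain ⟨Γ, K', hΓ, h⟩ := hg.mul_summable (g := tauSqQuot k) hδ0 (by
    refine Summable.of_nonneg_of_le (fun n => by positivity) (fun n => ?_) (summable_tauSqQuot k)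
    rcases Nat.eq_zero_or_pos n with rfl | hn
    · simp
    have hn1 : (1 : ℝ) ≤ n := by exact_mod_cast hn
    have hn0 : (0 : ℝ) < n := by linarith
    rw [twist_apply, abs_mul, invN, abs_of_pos (inv_pos.mpr hn0), Real.rpow_sub_one hn0.ne']
    calc _ ≤ |tauSqQuot k n| * ((n : ℝ) ^ (1 / 8 : ℝ) / n) := by
          gcongr
          exact min_le_left _ _
      _ = _ := by ring)
  rw [tauSqQuot_mul] at h
  refine ⟨B * Γ, δ, hδ0, ?_, K', fun x hx => h x (by linarith)⟩
  rw [map_mul, hB0, hΓ, one_mul, tsum_tauSqQuot]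

lemma exists_polynomial_ev {m : ℕ} (hm : 1 ≤ m) {B : PowerSeries ℝ} {c : ℝ} (hc : c ≠ 0)
    (hB : PowerSeries.constantCoeff B = c) : ∃ Q : Polynomial ℝ, Q.natDegree ≤ m - 1 ∧
      ∀ L : ℝ, L ≠ 0 → ev m B L =
        c * (L ^ m / (m.factorial : ℝ)) * (1 + 1 / L * Q.eval (1 / L)) := by
  obtain ⟨m, rfl⟩ : ∃ n, m = n + 1 := ⟨m - 1, by omega⟩
  refine ⟨∑ q ∈ Finset.HasAntidiagonal.antidiagonal m, Polynomial.monomial q.1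
    (PowerSeries.coeff (q.1 + 1) B * (m + 1).factorial / (c * q.2.factorial)), ?_, fun L hL => ?_⟩
  · refine Polynomial.natDegree_sum_le_of_forall_le _ _ fun q hq => ?_
    have hq' := Finset.HasAntidiagonal.mem_antidiagonal.mp hq
    exact (Polynomial.natDegree_monomial_le _).trans (by omega)
  · have hf : ∀ n : ℕ, (n.factorial : ℝ) ≠ 0 := fun n => by positivity
    have e := Finset.Nat.sum_antidiagonal_succ (n := m) (f := fun q : ℕ × ℕ =>
      PowerSeries.coeff q.1 B * (L ^ q.2 / q.2.factorial))
    rw [ev_eq_sum]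
    refine e.trans ?_
    rw [PowerSeries.coeff_zero_eq_constantCoeff_apply, hB, mul_add, mul_one,
      Polynomial.eval_finsetSum, Finset.mul_sum, Finset.mul_sum]
    congr 1
    refine Finset.sum_congr rfl fun q hq => ?_
    have hq' := Finset.HasAntidiagonal.mem_antidiagonal.mp hq
    rw [Polynomial.eval_monomial, ← hq']
    have h1 := hf (q.1 + q.2 + 1)
    have h2 := hf q.2
    rw [one_div, inv_pow]
    field_simp
    ring

lemma normSq_tau_eq (k : ℕ) (x : ℝ) :
    normSq (fun n => ((tau k n : ℕ) : ℝ)) x = psum (tauSq k) x :=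
  Finset.sum_congr rfl fun n _ => by rw [tauSq_apply, tauR_apply]

/-- The powers of `1 / log x` come from dividing the polynomial in `log x` of the main term by its
leading term, whose coefficient `C_k` does not vanish. -/
lemma exists_isPolyQ {k : ℕ} (hk : 2 ≤ k) : ∃ Q : Polynomial ℝ, IsPolyQ k Q := by
  obtain ⟨B, δ, hδ, hB0, K, hK⟩ := exists_powerAsymp_tauSq hk
  have hk2 : 2 ≤ k ^ 2 := by nlinarith
  obtain ⟨Q, hQd, hQ⟩ := exists_polynomial_ev (by omega : 1 ≤ k ^ 2 - 1) (constC_pos hk).ne' hB0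
  refine ⟨Q, by omega, δ, hδ, K, fun x hx => ?_⟩
  have hL : Real.log x ≠ 0 := (Real.log_pos (by linarith)).ne'
  rw [normSq_tau_eq]
  convert hK x (by linarith) using 3
  rw [hQ _ hL]
  ring

/-! ### Taylor series at `s = 1` -/

/-- The Taylor series of a function at `1`. -/
def tay (f : ℂ → ℂ) : PowerSeries ℂ :=
  PowerSeries.mk fun j => iteratedDeriv j f 1 / j.factorial

lemma coeff_tay (f : ℂ → ℂ) (j : ℕ) :
    PowerSeries.coeff j (tay f) = iteratedDeriv j f 1 / j.factorial := PowerSeries.coeff_mk _ _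

lemma tay_congr {f g : ℂ → ℂ} (h : f =ᶠ[𝓝 1] g) : tay f = tay g := by
  ext j
  rw [coeff_tay, coeff_tay, h.iteratedDeriv_eq]

lemma tay_mul {f g : ℂ → ℂ} (hf : AnalyticAt ℂ f 1) (hg : AnalyticAt ℂ g 1) :
    tay (f * g) = tay f * tay g := by
  ext n
  rw [coeff_tay, PowerSeries.coeff_mul, iteratedDeriv_mul hf.contDiffAt hg.contDiffAt,
    Finset.sum_div]
  refine Eq.trans ?_ (Finset.Nat.sum_antidiagonal_eq_sum_range_succ
    (fun i j => PowerSeries.coeff i (tay f) * PowerSeries.coeff j (tay g)) n).symm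
  refine Finset.sum_congr rfl fun i hi => ?_
  have hi' : i ≤ n := by simpa [Nat.lt_succ_iff] using hi
  rw [coeff_tay, coeff_tay, Nat.cast_choose ℂ hi']
  have h1 : ∀ m : ℕ, (m.factorial : ℂ) ≠ 0 := fun m => by exact_mod_cast m.factorial_ne_zero
  have := h1 n
  have := h1 i
  have := h1 (n - i)
  field_simp

lemma tay_add {f g : ℂ → ℂ} (hf : AnalyticAt ℂ f 1) (hg : AnalyticAt ℂ g 1) :
    tay (f + g) = tay f + tay g := by
  ext n
  rw [map_add, coeff_tay, coeff_tay, coeff_tay, iteratedDeriv_add hf.contDiffAt hg.contDiffAt,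
    add_div]

lemma tay_const (c : ℂ) : tay (fun _ => c) = PowerSeries.C c := by
  ext n
  rw [coeff_tay, iteratedDeriv_const, PowerSeries.coeff_C]
  split_ifs with h
  · simp [h]
  · simp

/-- The functions that are analytic at `1`. -/
def anaRing : Subring (ℂ → ℂ) where
  carrier := {f | AnalyticAt ℂ f 1}
  mul_mem' hf hg := hf.mul hg
  one_mem' := analyticAt_const
  add_mem' hf hg := hf.add hg
  zero_mem' := analyticAt_const
  neg_mem' hf := hf.neg

/-- Taylor expansion at `1` as a ring homomorphism. -/
def tayHom : anaRing →+* PowerSeries ℂ where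
  toFun f := tay f
  map_one' := by
    change tay (fun _ => 1) = 1
    rw [tay_const, map_one]
  map_mul' f g := tay_mul f.2 g.2
  map_zero' := by
    change tay (fun _ => 0) = 0
    rw [tay_const, map_zero]
  map_add' f g := tay_add f.2 g.2

lemma tayHom_apply (f : anaRing) : tayHom f = tay f := rfl

/-- Evaluation of the functions that are analytic at `1`. -/
def anaEval (s : ℂ) : anaRing →+* ℂ := (Pi.evalRingHom (fun _ : ℂ => ℂ) s).comp anaRing.subtype

lemma tay_id : tay (fun s => s) = 1 + PowerSeries.X := by
  ext n
  rw [coeff_tay, map_add, PowerSeries.coeff_one, PowerSeries.coeff_X]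
  rcases n with _ | _ | n
  · simp
  · simp [iteratedDeriv_one]
  · have : iteratedDeriv (n + 2) (fun s : ℂ => s) = fun _ => 0 := by
      rw [iteratedDeriv_succ', deriv_id'', iteratedDeriv_succ', deriv_const']
      ext s
      simp
    rw [this]
    simp

lemma iteratedDeriv_exp_neg_log (n j : ℕ) :
    iteratedDeriv j (fun s : ℂ => Complex.exp (-(Real.log n : ℂ) * (s - 1))) 1 =
      (-(Real.log n : ℂ)) ^ j := by
  have := iteratedDeriv_comp_sub_const j (fun s : ℂ => Complex.exp (-(Real.log n : ℂ) * s)) 1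
  rw [this, iteratedDeriv_cexp_const_mul]
  simp

/-- The Taylor series of `n^{-(s-1)}`. -/
lemma tay_natCast_cpow {n : ℕ} (hn : n ≠ 0) :
    tay (fun s : ℂ => (n : ℂ) ^ (-(s - 1))) = (pw n).map Complex.ofRealHom := by
  ext j
  have e : (fun s : ℂ => (n : ℂ) ^ (-(s - 1))) =
      fun s : ℂ => Complex.exp (-(Real.log n : ℂ) * (s - 1)) := by
    ext s
    rw [Complex.cpow_def_of_ne_zero (by exact_mod_cast hn), Complex.natCast_log]
    congr 1; ring
  rw [coeff_tay, e, iteratedDeriv_exp_neg_log, PowerSeries.coeff_map, coeff_pw]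
  simp

lemma analyticAt_natCast_cpow {n : ℕ} (hn : n ≠ 0) :
    AnalyticAt ℂ (fun s : ℂ => (n : ℂ) ^ (-(s - 1))) 1 := by
  have : Differentiable ℂ (fun s : ℂ => (n : ℂ) ^ (-(s - 1))) := fun s =>
    ((differentiableAt_id.sub_const 1).neg).const_cpow (Or.inl (by exact_mod_cast hn))
  exact this.analyticAt 1

lemma continuousAt_zetaReg : ContinuousAt zetaReg 1 := by
  rw [zetaReg, continuousAt_update_same]
  exact riemannZeta_residue_one

lemma zetaReg_one : zetaReg 1 = 1 := by simp [zetaReg]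

lemma zetaReg_of_ne {s : ℂ} (hs : s ≠ 1) : zetaReg s = (s - 1) * riemannZeta s := by
  simp [zetaReg, hs]

lemma analyticAt_zetaReg : AnalyticAt ℂ zetaReg 1 := by
  refine Complex.analyticAt_of_differentiable_on_punctured_nhds_of_continuousAt ?_
    continuousAt_zetaReg
  filter_upwards [self_mem_nhdsWithin] with s hs
  have hs1 : s ≠ 1 := hs
  have h1 : DifferentiableAt ℂ (fun s : ℂ => (s - 1) * riemannZeta s) s :=
    (differentiableAt_id.sub_const 1).mul (differentiableAt_riemannZeta hs1)
  refine h1.congr_of_eventuallyEq ?_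
  filter_upwards [isOpen_ne.mem_nhds hs1] with t ht
  exact zetaReg_of_ne ht

/-- The real part of the Taylor series at `s = 1` of `((s - 1) ζ(s))^k`. -/
def zetaSer (k : ℕ) : PowerSeries ℝ :=
  PowerSeries.mk fun j => (PowerSeries.coeff j (tay (zetaReg ^ k))).re

lemma constantCoeff_zetaSer (k : ℕ) : PowerSeries.constantCoeff (zetaSer k) = 1 := by
  rw [← PowerSeries.coeff_zero_eq_constantCoeff_apply, zetaSer, PowerSeries.coeff_mk, coeff_tay]
  simp [zetaReg_one]

lemma re_coeff_mul_map (A : PowerSeries ℂ) (B : PowerSeries ℝ) (j : ℕ) :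
    (PowerSeries.coeff j (A * B.map Complex.ofRealHom)).re =
      PowerSeries.coeff j (PowerSeries.mk (fun i => (PowerSeries.coeff i A).re) * B) := by
  rw [PowerSeries.coeff_mul, PowerSeries.coeff_mul, Complex.re_sum]
  refine Finset.sum_congr rfl fun q _ => ?_
  rw [PowerSeries.coeff_map, PowerSeries.coeff_mk, Complex.ofRealHom_eq_coe, Complex.re_mul_ofReal]

lemma norm_natCast_cpow_neg_lt_one {p : ℕ} (hp : p.Prime) {s : ℂ} (hs : 0 < s.re) :
    ‖(p : ℂ) ^ (-s)‖ < 1 := by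
  have h1 : (1 : ℝ) < p := by exact_mod_cast hp.one_lt
  have := Complex.norm_natCast_cpow_of_pos hp.pos (-s)
  rw [this]
  exact Real.rpow_lt_one_of_one_lt_of_neg h1 (by simpa using hs)

lemma multichoose_ne_zero {k : ℕ} (hk : 0 < k) (v : ℕ) : Nat.multichoose k v ≠ 0 := by
  obtain ⟨n, rfl⟩ : ∃ n, k = n + 1 := ⟨k - 1, by omega⟩
  have h1 := sum_range_multichoose n v
  have h2 : Nat.multichoose n 0 ≤ ∑ i ∈ Finset.range (v + 1), Nat.multichoose n i :=
    Finset.single_le_sum (f := fun i => Nat.multichoose n i) (fun _ _ => Nat.zero_le _) (by simp)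
  rw [Nat.multichoose_zero_right] at h2
  omega

/-- The factor at `p` of `τ_k(d) G_{d,k}(s)`, for `p^v ∥ d`, is a local polynomial in `p^{-s}`. -/
lemma eulerG_factor {k : ℕ} (hk : 0 < k) {p : ℕ} (hp : p.Prime) (v : ℕ) {s : ℂ} (hs : 0 < s.re) :
    ((tau k (p ^ v) : ℕ) : ℂ) * ((1 - 1 / (p : ℂ) ^ s) ^ k *
    (1 + ∑' m : ℕ, ((tau k (p ^ ((m + 1) + v)) : ℕ) : ℂ) /
      (((tau k (p ^ v) : ℕ) : ℂ) * (p : ℂ) ^ (((m + 1 : ℕ) : ℂ) * s)))) =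
      lpoly k v ((p : ℂ) ^ (-s)) := by
  set x : ℂ := (p : ℂ) ^ (-s) with hx
  have hx1 : ‖x‖ < 1 := norm_natCast_cpow_neg_lt_one hp hs
  have hp0 : (p : ℂ) ≠ 0 := by exact_mod_cast hp.ne_zero
  have hmc : (Nat.multichoose k v : ℂ) ≠ 0 := by exact_mod_cast multichoose_ne_zero hk v
  have e1 : 1 / (p : ℂ) ^ s = x := by rw [hx, Complex.cpow_neg, one_div]
  have e2 : ∀ m : ℕ, (p : ℂ) ^ ((m : ℂ) * s) = (x ^ m)⁻¹ := by
    intro m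
    rw [Complex.cpow_nat_mul, hx, Complex.cpow_neg, inv_pow, inv_inv]
  have hsum := summable_multichoose_mul_pow k v hx1
  rw [← lpoly_eq_tsum k v hx1, e1, mul_left_comm]
  congr 1
  rw [hsum.tsum_eq_zero_add, mul_add, ← tsum_mul_left]
  simp only [tau_prime_pow k hp, zero_add, pow_zero, mul_one]
  congr 1
  refine tsum_congr fun m => ?_
  rw [e2]
  field_simp

lemma tau_eq_prod (k : ℕ) {d : ℕ} (hd : d ≠ 0) :
    tau k d = ∏ p ∈ d.primeFactors, tau k (p ^ d.factorization p) := by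
  rw [(isMultiplicative_tau k).multiplicative_factorization _ hd]
  rfl

lemma tau_mul_eulerG {k : ℕ} (hk : 0 < k) {d : ℕ} (hd : d ≠ 0) {s : ℂ} (hs : 0 < s.re) :
    ((tau k d : ℕ) : ℂ) * eulerG k d s =
      ∏ p ∈ d.primeFactors, lpoly k (d.factorization p) ((p : ℂ) ^ (-s)) := by
  rw [tau_eq_prod k hd, eulerG, Nat.cast_prod, ← Finset.prod_mul_distrib]
  refine Finset.prod_congr rfl fun p hp => ?_
  have hpp := Nat.prime_of_mem_primeFactors hp
  have : padicValNat p d = d.factorization p := (Nat.factorization_def d hpp).symm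
  rw [this, eulerG_factor hk hpp _ hs]

/-- The Taylor series defining `h_{j,k}(d)`, as a product of the series of its factors. -/
lemma tay_coeffB {k : ℕ} (hk : 0 < k) {d : ℕ} (hd : d ≠ 0) :
    PowerSeries.C ((tau k d : ℕ) : ℂ) * ((1 + PowerSeries.X) *
      tay (fun s : ℂ => zetaReg s ^ k * eulerG k d s / (s * (d : ℂ) ^ (s - 1)))) =
      tay (zetaReg ^ k) * (hSer k d).map Complex.ofRealHom := by
  have hT : ((tau k d : ℕ) : ℂ) ≠ 0 := by
    have h1 := tau_eq_prod k hd
    have : tau k d ≠ 0 := by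
      rw [h1, Finset.prod_ne_zero_iff]
      intro p hp
      have hpp := Nat.prime_of_mem_primeFactors hp
      rw [tau_prime_pow k hpp]
      exact multichoose_ne_zero hk _
    exact_mod_cast this
  have hd0 : (d : ℂ) ≠ 0 := by exact_mod_cast hd
  set Z : anaRing := ⟨zetaReg, analyticAt_zetaReg⟩ with hZ
  set W : ℕ → anaRing := fun n => if hn : n ≠ 0 then ⟨_, analyticAt_natCast_cpow hn⟩ else 0 with hW
  have hWe : ∀ n, n ≠ 0 → ∀ s, anaEval s (W n) = (n : ℂ) ^ (-(s - 1)) := by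
    intro n hn s
    rw [hW]; simp only; rw [dif_pos hn]; rfl
  have hWt : ∀ n, n ≠ 0 → tayHom (W n) = (pw n).map Complex.ofRealHom := by
    intro n hn
    rw [hW]; simp only; rw [dif_pos hn, tayHom_apply]
    exact tay_natCast_cpow hn
  set c : ℂ → anaRing := fun z => ⟨fun _ => z, analyticAt_const⟩ with hc
  have hct : ∀ z, tayHom (c z) = PowerSeries.C z := fun z => tay_const z
  have hce : ∀ z s, anaEval s (c z) = z := fun z s => rfl
  set I : anaRing := ⟨fun s => s⁻¹, analyticAt_id.inv one_ne_zero⟩ with hI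
  set J : anaRing := ⟨fun s => s, analyticAt_id⟩ with hJ
  set P : anaRing := ∏ p ∈ d.primeFactors,
    lpoly k (d.factorization p) (c (invN p : ℂ) * W p) with hP
  have hPt : tayHom P = (lprod k d).map Complex.ofRealHom := by
    rw [hP, map_prod, lprod, map_prod]
    refine Finset.prod_congr rfl fun p hp => ?_
    have hpp := Nat.prime_of_mem_primeFactors hp
    rw [map_lpoly, map_lpoly, map_mul, map_mul, hct, hWt p hpp.ne_zero]
    simp
  have hPe : ∀ s : ℂ, 0 < s.re → anaEval s P = ((tau k d : ℕ) : ℂ) * eulerG k d s := by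
    intro s hs
    rw [tau_mul_eulerG hk hd hs, hP, map_prod]
    refine Finset.prod_congr rfl fun p hp => ?_
    have hpp := Nat.prime_of_mem_primeFactors hp
    have hp0 : (p : ℂ) ≠ 0 := by exact_mod_cast hpp.ne_zero
    rw [map_lpoly, map_mul, hce, hWe p hpp.ne_zero, neg_sub, Complex.cpow_sub _ _ hp0,
      Complex.cpow_one, Complex.cpow_neg, invN]
    congr 1
    push_cast
    field_simp
  set F : anaRing := c (((tau k d : ℕ) : ℂ)⁻¹) * (Z ^ k * P * I * W d) with hF
  have hnhds : ∀ᶠ s : ℂ in 𝓝 1, 0 < s.re :=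
    (Complex.continuous_re.isOpen_preimage _ isOpen_Ioi).mem_nhds (by simp)
  have hf : tay (fun s : ℂ => zetaReg s ^ k * eulerG k d s / (s * (d : ℂ) ^ (s - 1))) =
      tayHom F := by
    rw [tayHom_apply]
    refine tay_congr ?_
    filter_upwards [hnhds] with s hs
    have e : (F : ℂ → ℂ) s = anaEval s F := rfl
    have e1 : anaEval s Z = zetaReg s := rfl
    have e2 : anaEval s I = s⁻¹ := rfl
    rw [e, hF, map_mul, map_mul, map_mul, map_mul, map_pow, hce, e1, e2, hPe s hs, hWe d hd,
      Complex.cpow_neg]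
    field_simp
  have hJI : tayHom J * tayHom I = 1 := by
    rw [← map_mul, ← map_one tayHom, tayHom_apply, tayHom_apply]
    refine tay_congr ?_
    filter_upwards [hnhds] with s hs
    have : s ≠ 0 := by rintro rfl; simp at hs
    exact mul_inv_cancel₀ this
  have hJt : tayHom J = 1 + PowerSeries.X := tay_id
  have hZt : tayHom (Z ^ k) = tay (zetaReg ^ k) := rfl
  rw [hf, hF, ← hJt, map_mul, map_mul, map_mul, map_mul, hct, hPt, hWt d hd, hZt,
    hSer_eq_pw_mul_lprod k hd, map_mul]
  have hCC : PowerSeries.C ((tau k d : ℕ) : ℂ) * PowerSeries.C ((tau k d : ℕ) : ℂ)⁻¹ = 1 := by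
    rw [← map_mul, mul_inv_cancel₀ hT, map_one]
  calc _ = (PowerSeries.C ((tau k d : ℕ) : ℂ) * PowerSeries.C ((tau k d : ℕ) : ℂ)⁻¹) *
        (tayHom J * tayHom I) * (tay (zetaReg ^ k) *
          ((lprod k d).map Complex.ofRealHom * (pw d).map Complex.ofRealHom)) := by ring
    _ = _ := by rw [hCC, hJI, one_mul, one_mul]

/-- The functions `h_{j,k}` are coefficients of the series `H(d)`. -/
lemma hFun_eq {k : ℕ} (hk : 0 < k) (j d : ℕ) :
    hFun k j d = PowerSeries.coeff j (zetaSer k * hSer k d) := by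
  rcases eq_or_ne d 0 with rfl | hd
  · simp
  have h := congrArg (fun F => (PowerSeries.coeff j F).re) (tay_coeffB hk hd)
  rw [re_coeff_mul_map, ← zetaSer, PowerSeries.coeff_C_mul, add_mul, one_mul, map_add] at h
  rw [← h]
  set T := tay (fun s : ℂ => zetaReg s ^ k * eulerG k d s / (s * (d : ℂ) ^ (s - 1))) with hT
  have hco : ∀ i, (PowerSeries.coeff i T).re = coeffB k i d / (i.factorial : ℝ) := by
    intro i
    rw [hT, coeff_tay, coeffB, Complex.div_natCast_re]
  have h0 : hFun k j d = ((tau k d : ℕ) : ℝ) *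
    (coeffB k j d / (j.factorial : ℝ) +
      (if j = 0 then 0 else coeffB k (j - 1) d / ((j - 1).factorial : ℝ))) := rfl
  rw [h0, ← Complex.ofReal_natCast, Complex.re_ofReal_mul, Complex.add_re, hco]
  congr 2
  rcases j with _ | j
  · simp
  · rw [PowerSeries.coeff_succ_X_mul, hco]
    simp

lemma hFun_mul_moebius {k : ℕ} (hk : 0 < k) (j n : ℕ) :
    (hFun k j * (μ : ArithmeticFunction ℝ)) n = PowerSeries.coeff j (zetaSer k * hMu k n) := by
  rw [hMu, ArithmeticFunction.mul_apply, ArithmeticFunction.mul_apply, Finset.mul_sum, map_sum]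
  refine Finset.sum_congr rfl fun q _ => ?_
  rw [hFun_eq hk, ArithmeticFunction.intCoe_apply, ArithmeticFunction.intCoe_apply, ← mul_assoc,
    ← map_intCast (PowerSeries.C (R := ℝ)), mul_comm _ (PowerSeries.C _), PowerSeries.coeff_C_mul,
    mul_comm]

/-! ### Identification of the main term of `∑ τ_k(n)` -/

/-- The series `∑ c^{-i-1} X^i`, inverse to `c - X`. -/
def geomSer (c : ℝ) : PowerSeries ℝ := PowerSeries.mk fun i => (c⁻¹) ^ (i + 1)

lemma geomSer_mul {c : ℝ} (hc : c ≠ 0) :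
    PowerSeries.C c * geomSer c - PowerSeries.X * geomSer c = 1 := by
  ext n
  rw [map_sub, PowerSeries.coeff_C_mul]
  rcases n with _ | n
  · simp [geomSer, hc]
  · rw [PowerSeries.coeff_succ_X_mul, geomSer, PowerSeries.coeff_mk, PowerSeries.coeff_mk,
      PowerSeries.coeff_one, if_neg (Nat.succ_ne_zero n), pow_succ' _ (n + 1), ← mul_assoc,
      mul_inv_cancel₀ hc, one_mul, sub_self]

lemma hasDerivAt_rpow_mul_ev {c t : ℝ} (ht : 0 < t) (m : ℕ) (A : PowerSeries ℝ) :
    HasDerivAt (fun t => t ^ (-c) * ev m A (Real.log t))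
      (-(t ^ (-1 - c) * ev m (PowerSeries.C c * A - PowerSeries.X * A) (Real.log t))) t := by
  have h1 := Real.hasDerivAt_rpow_const (x := t) (p := -c) (Or.inl ht.ne')
  have h2 := (hasDerivAt_ev m A (Real.log t)).comp t (Real.hasDerivAt_log ht.ne')
  refine (h1.mul h2).congr_deriv ?_
  have e1 : t ^ (-c - 1) = t ^ (-1 - c) := by congr 1; ring
  have e2 : t ^ (-c) * t⁻¹ = t ^ (-1 - c) := by
    rw [← Real.rpow_neg_one t, ← Real.rpow_add ht]; congr 1; ring
  rw [ev_sub, ev_C_mul]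
  simp only [Function.comp]
  rw [e1, mul_comm (ev m (PowerSeries.X * A) (Real.log t)), ← mul_assoc, e2]
  ring

lemma exists_rpow_mul_ev_le {a b : ℝ} (hab : a < b) (m : ℕ) (B : PowerSeries ℝ) :
    ∃ C : ℝ, 0 ≤ C ∧ ∀ t : ℝ, 1 ≤ t → |t ^ a * ev m B (Real.log t)| ≤ C * t ^ b := by
  obtain ⟨C₁, hC₁, h₁⟩ := exists_abs_ev_le m B
  obtain ⟨C₂, hC₂, h₂⟩ := exists_log_pow_mul_rpow_le m hab
  refine ⟨C₁ * C₂, by positivity, fun t ht => ?_⟩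
  have h3 := h₁ (Real.log t)
  have h0 : 0 ≤ t ^ a := Real.rpow_nonneg (by linarith) _
  rw [abs_of_nonneg (Real.log_nonneg ht)] at h3
  rw [abs_mul, abs_of_nonneg h0]
  calc t ^ a * |ev m B (Real.log t)| ≤ t ^ a * (C₁ * (1 + Real.log t) ^ m) := by gcongr
    _ = C₁ * ((1 + Real.log t) ^ m * t ^ a) := by ring
    _ ≤ C₁ * (C₂ * t ^ b) := mul_le_mul_of_nonneg_left (h₂ t ht) hC₁
    _ = _ := by ring

lemma integrableOn_rpow_mul_ev {c : ℝ} (hc : 0 < c) (m : ℕ) (B : PowerSeries ℝ) :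
    MeasureTheory.IntegrableOn (fun t : ℝ => t ^ (-1 - c) * ev m B (Real.log t)) (Set.Ioi 1) := by
  obtain ⟨C, hC, h⟩ := exists_rpow_mul_ev_le (a := -1 - c) (b := -1 - c / 2) (by linarith) m B
  have hg : MeasureTheory.IntegrableOn (fun t : ℝ => C * t ^ (-1 - c / 2)) (Set.Ioi 1) :=
    (integrableOn_Ioi_rpow_of_lt (by linarith) one_pos).const_mul C
  refine hg.mono' ?_ ?_
  · refine Measurable.aestronglyMeasurable ?_
    exact (measurable_id.pow_const _).mul ((continuous_ev m B).measurable.comp Real.measurable_log)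
  · refine (MeasureTheory.ae_restrict_iff' measurableSet_Ioi).mpr (Filter.Eventually.of_forall ?_)
    intro t ht
    exact h t (le_of_lt ht)

/-- The Mellin transform of a polynomial in `log t`. -/
lemma integral_rpow_mul_ev {c : ℝ} (hc : 0 < c) (m : ℕ) (B : PowerSeries ℝ) :
    ∫ t in Set.Ioi (1 : ℝ), t ^ (-1 - c) * ev m B (Real.log t) =
      PowerSeries.coeff m (B * geomSer c) := by
  have hA : PowerSeries.C c * (B * geomSer c) - PowerSeries.X * (B * geomSer c) = B := by
    linear_combination B * geomSer_mul hc.ne'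
  have h1 := MeasureTheory.integral_Ioi_of_hasDerivAt_of_tendsto' (a := (1 : ℝ)) (m := (0 : ℝ))
    (f := fun t => t ^ (-c) * ev m (B * geomSer c) (Real.log t))
    (f' := fun t => -(t ^ (-1 - c) * ev m B (Real.log t))) ?_ ?_ ?_
  · rw [MeasureTheory.integral_neg] at h1
    simp only [Real.one_rpow, Real.log_one, ev_zero_right, one_mul, zero_sub, neg_inj] at h1
    exact h1
  · intro t ht
    have := hasDerivAt_rpow_mul_ev (c := c) (t := t) (lt_of_lt_of_le one_pos ht) m (B * geomSer c)
    rwa [hA] at this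
  · exact (integrableOn_rpow_mul_ev hc m B).neg
  · obtain ⟨C, hC, h⟩ :=
      exists_rpow_mul_ev_le (a := -c) (b := -(c / 2)) (by linarith) m (B * geomSer c)
    have h0 : Filter.Tendsto (fun t : ℝ => C * t ^ (-(c / 2))) Filter.atTop (𝓝 0) := by
      simpa using (tendsto_rpow_neg_atTop (half_pos hc)).const_mul C
    refine squeeze_zero_norm' ?_ h0
    filter_upwards [Filter.eventually_ge_atTop 1] with t ht
    exact h t ht

/-- An Abelian estimate: up to a bounded error as `c → 0+`, the Mellin transform of `D` is that of
its main term, a polynomial in `1/c`. -/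
lemma PowerAsymp.exists_abs_sub_le {D : ℝ → ℝ} {m : ℕ} {B : PowerSeries ℝ} {δ : ℝ}
    (hδ : 0 < δ) (hD : Measurable D) (h : PowerAsymp D m B δ) :
    ∃ M : ℝ, ∀ c : ℝ, 0 < c →
      MeasureTheory.IntegrableOn (fun t : ℝ => D t * t ^ (-2 - c)) (Set.Ioi 1) ∧
      |(∫ t in Set.Ioi (1 : ℝ), D t * t ^ (-2 - c)) - PowerSeries.coeff m (B * geomSer c)| ≤ M := by
  obtain ⟨K, hK, h⟩ := h.exists_nonneg
  refine ⟨∫ t in Set.Ioi (1 : ℝ), K * t ^ (-1 - δ), fun c hc => ?_⟩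
  have hg : MeasureTheory.IntegrableOn (fun t : ℝ => K * t ^ (-1 - δ)) (Set.Ioi 1) :=
    (integrableOn_Ioi_rpow_of_lt (by linarith) one_pos).const_mul K
  have hb : ∀ t ∈ Set.Ioi (1 : ℝ),
      ‖D t * t ^ (-2 - c) - t ^ (-1 - c) * ev m B (Real.log t)‖ ≤ K * t ^ (-1 - δ) := by
    intro t ht
    have ht1 : (1 : ℝ) ≤ t := le_of_lt ht
    have ht0 : (0 : ℝ) < t := by linarith
    have e1 : t ^ (-1 - c) = t * t ^ (-2 - c) := by
      rw [← Real.rpow_one_add' ht0.le (by linarith)]; congr 1; ring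
    have e2 : t ^ (1 - δ) * t ^ (-2 - c) = t ^ (-1 - δ - c) := by
      rw [← Real.rpow_add ht0]; congr 1; ring
    have h0 : 0 ≤ t ^ (-2 - c) := Real.rpow_nonneg ht0.le _
    rw [e1, show D t * t ^ (-2 - c) - t * t ^ (-2 - c) * ev m B (Real.log t) =
      (D t - t * ev m B (Real.log t)) * t ^ (-2 - c) by ring, Real.norm_eq_abs, abs_mul,
      abs_of_nonneg h0]
    calc |D t - t * ev m B (Real.log t)| * t ^ (-2 - c) ≤ (K * t ^ (1 - δ)) * t ^ (-2 - c) :=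
          mul_le_mul_of_nonneg_right (h t ht1) h0
      _ = K * t ^ (-1 - δ - c) := by rw [mul_assoc, e2]
      _ ≤ K * t ^ (-1 - δ) := mul_le_mul_of_nonneg_left
          (Real.rpow_le_rpow_of_exponent_le ht1 (by linarith)) hK
  have hae : ∀ᵐ t ∂MeasureTheory.volume.restrict (Set.Ioi (1 : ℝ)),
      ‖D t * t ^ (-2 - c) - t ^ (-1 - c) * ev m B (Real.log t)‖ ≤ K * t ^ (-1 - δ) :=
    (MeasureTheory.ae_restrict_iff' measurableSet_Ioi).mpr (Filter.Eventually.of_forall hb)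
  have hi : MeasureTheory.IntegrableOn
      (fun t : ℝ => D t * t ^ (-2 - c) - t ^ (-1 - c) * ev m B (Real.log t)) (Set.Ioi 1) := by
    refine hg.mono' (Measurable.aestronglyMeasurable ?_) hae
    exact (hD.mul (measurable_id.pow_const _)).sub
      ((measurable_id.pow_const _).mul ((continuous_ev m B).measurable.comp Real.measurable_log))
  have hi2 := integrableOn_rpow_mul_ev hc m B
  have hi1 : MeasureTheory.IntegrableOn (fun t : ℝ => D t * t ^ (-2 - c)) (Set.Ioi 1) := by
    refine (hi.add hi2).congr (Filter.Eventually.of_forall fun t => ?_)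
    simp
  refine ⟨hi1, ?_⟩
  rw [← integral_rpow_mul_ev hc, ← MeasureTheory.integral_sub hi1 hi2]
  exact MeasureTheory.norm_integral_le_of_norm_le hg hae

lemma PowerAsymp.isBigO {D : ℝ → ℝ} {m : ℕ} {B : PowerSeries ℝ} {δ r : ℝ}
    (hδ : 0 < δ) (h : PowerAsymp D m B δ) (hr : 1 < r) :
    D =O[Filter.atTop] fun t => t ^ r := by
  obtain ⟨K, hK, h⟩ := h.exists_nonneg
  obtain ⟨C, hC, h'⟩ := exists_rpow_mul_ev_le hr m B
  refine Asymptotics.IsBigO.of_bound (K + C) ?_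
  filter_upwards [Filter.eventually_ge_atTop 1] with t ht
  have h1 := h t ht
  have h2 := h' t ht
  rw [Real.rpow_one] at h2
  have h3 : t ^ (1 - δ) ≤ t ^ r := Real.rpow_le_rpow_of_exponent_le ht (by linarith)
  have h4 : 0 ≤ t ^ r := Real.rpow_nonneg (by linarith) _
  rw [Real.norm_eq_abs, Real.norm_eq_abs, abs_of_nonneg h4]
  calc |D t| ≤ |D t - t * ev m B (Real.log t)| + |t * ev m B (Real.log t)| := by
        have := abs_add_le (D t - t * ev m B (Real.log t)) (t * ev m B (Real.log t))
        simpa using this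
    _ ≤ K * t ^ r + C * t ^ r := add_le_add (h1.trans (mul_le_mul_of_nonneg_left h3 hK)) h2
    _ = _ := by ring

/-- The Dirichlet series of `τ_{k+1}` is `ζ^{k+1}`. -/
lemma LSeries_tauR (k : ℕ) {s : ℂ} (hs : 1 < s.re) :
    LSeriesSummable (fun n => ((tauR (k + 1) n : ℝ) : ℂ)) s ∧
      LSeries (fun n => ((tauR (k + 1) n : ℝ) : ℂ)) s = riemannZeta s ^ (k + 1) := by
  have hz : (ζ : ArithmeticFunction ℂ) = mapA Complex.ofRealHom (ζ : ArithmeticFunction ℝ) := by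
    ext n
    simp [mapA_apply]
  have key : ∀ j, mapA Complex.ofRealHom (tauR j) = (ζ : ArithmeticFunction ℂ) ^ j := by
    intro j
    rw [tauR, mapA_pow, hz]
  have h1 : LSeriesSummable (fun n => (ζ : ArithmeticFunction ℂ) n) s ∧
      LSeries (fun n => (ζ : ArithmeticFunction ℂ) n) s = riemannZeta s := by
    constructor
    · have := ArithmeticFunction.LSeriesSummable_zeta_iff.mpr hs
      simpa using this
    · have := ArithmeticFunction.LSeries_zeta_eq_riemannZeta hs
      simpa using this
  have hmain : ∀ j : ℕ, LSeriesSummable (fun n => ((ζ : ArithmeticFunction ℂ) ^ (j + 1)) n) s ∧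
      LSeries (fun n => ((ζ : ArithmeticFunction ℂ) ^ (j + 1)) n) s = riemannZeta s ^ (j + 1) := by
    intro j
    induction j with
    | zero => simpa using h1
    | succ j ih =>
      rw [pow_succ _ (j + 1), pow_succ _ (j + 1), ArithmeticFunction.LSeries_mul' ih.1 h1.1, ih.2,
        h1.2]
      exact ⟨ArithmeticFunction.LSeriesSummable_mul ih.1 h1.1, rfl⟩
  have e : (fun n => ((tauR (k + 1) n : ℝ) : ℂ)) =
      fun n => ((ζ : ArithmeticFunction ℂ) ^ (k + 1)) n := by
    funext n
    rw [← key, mapA_apply]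
    rfl
  rw [e]
  exact hmain k

/-- `ζ^{k+1}` at `1 + c` as a Mellin transform of the summatory function of `τ_{k+1}`. -/
lemma riemannZeta_pow_eq_integral {k m : ℕ} {B : PowerSeries ℝ} {δ : ℝ} (hδ : 0 < δ)
    (h : PowerAsymp (psum (tauR (k + 1))) m B δ) {c : ℝ} (hc : 0 < c) :
    riemannZeta (1 + c) ^ (k + 1) = (1 + c) *
      ((∫ t in Set.Ioi (1 : ℝ), psum (tauR (k + 1)) t * t ^ (-2 - c) : ℝ) : ℂ) := by
  have hre : (1 + (c : ℂ)).re = 1 + c := by simp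
  rw [← (LSeries_tauR k (s := 1 + c) (by rw [hre]; linarith)).2,
    LSeries_eq_mul_integral_of_nonneg (fun n => tauR (k + 1) n) (r := 1 + c / 2) (by positivity)
      (by rw [hre]; linarith) ?_ (fun n => tauR_nonneg _ n)]
  · have e := @integral_ofReal ℝ _ (MeasureTheory.volume.restrict (Set.Ioi (1 : ℝ))) ℂ _
      (fun t => psum (tauR (k + 1)) t * t ^ (-2 - c))
    refine congrArg ((1 + (c : ℂ)) * ·) (Eq.trans ?_ e)
    refine MeasureTheory.setIntegral_congr_fun measurableSet_Ioi fun t ht => ?_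
    have ht0 : (0 : ℝ) ≤ t := by have : (1 : ℝ) < t := ht; linarith
    simp only [psum, RCLike.ofReal_mul]
    push_cast
    congr 1
    have : ((t ^ (-2 - c) : ℝ) : ℂ) = (t : ℂ) ^ ((-2 - c : ℝ) : ℂ) := Complex.ofReal_cpow ht0 _
    change _ = ((t ^ (-2 - c) : ℝ) : ℂ)
    rw [this]
    congr 1
    push_cast
    ring
  · have := (h.isBigO hδ (r := 1 + c / 2) (by linarith)).comp_tendsto tendsto_natCast_atTop_atTop
    refine this.congr_left fun n => ?_
    simp [psum]

/-- A polynomial of degree less than `k` that is `O(c^k)` as `c → 0+` vanishes. -/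
lemma eq_zero_of_sum_mul_pow_le : ∀ (k : ℕ) (a : ℕ → ℝ) (M η : ℝ), 0 < η →
    (∀ c : ℝ, 0 < c → c < η → |∑ j ∈ Finset.range k, a j * c ^ j| ≤ M * c ^ k) →
    ∀ j < k, a j = 0 := by
  intro k
  induction k with
  | zero => intro a M η _ _ j hj; omega
  | succ k ih =>
    intro a M η hη h
    have h0 : a 0 = 0 := by
      have ht : Filter.Tendsto (fun c : ℝ => |∑ j ∈ Finset.range (k + 1), a j * c ^ j|)
          (𝓝[>] 0) (𝓝 |∑ j ∈ Finset.range (k + 1), a j * (0 : ℝ) ^ j|) :=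
        ((by fun_prop : Continuous fun c : ℝ =>
          |∑ j ∈ Finset.range (k + 1), a j * c ^ j|).tendsto 0).mono_left nhdsWithin_le_nhds
      have ht' : Filter.Tendsto (fun c : ℝ => M * c ^ (k + 1)) (𝓝[>] 0)
          (𝓝 (M * (0 : ℝ) ^ (k + 1))) :=
        ((by fun_prop : Continuous fun c : ℝ => M * c ^ (k + 1)).tendsto 0).mono_left
          nhdsWithin_le_nhds
      have := le_of_tendsto_of_tendsto ht ht' (by
        filter_upwards [Ioo_mem_nhdsGT hη] with c hc
        exact h c hc.1 hc.2)
      rw [Finset.sum_range_succ'] at this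
      simpa using this
    have h1 := ih (fun j => a (j + 1)) M η hη (fun c hc hc' => by
      have h2 := h c hc hc'
      rw [Finset.sum_range_succ', h0, zero_mul, add_zero] at h2
      have e : ∑ j ∈ Finset.range k, a (j + 1) * c ^ (j + 1) =
          (∑ j ∈ Finset.range k, a (j + 1) * c ^ j) * c := by
        rw [Finset.sum_mul]
        exact Finset.sum_congr rfl fun j _ => by ring
      rw [e, abs_mul, abs_of_pos hc, pow_succ, ← mul_assoc] at h2
      exact le_of_mul_le_mul_right h2 hc)
    rintro (_ | j) hj
    · exact h0
    · exact h1 j (by omega)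

/-- Taylor approximation at `s = 1`, along the real axis from the right. -/
lemma exists_tay_remainder {f : ℂ → ℂ} (hf : AnalyticAt ℂ f 1) (k : ℕ) :
    ∃ M η : ℝ, 0 < η ∧ ∀ c : ℝ, 0 < c → c < η →
      |(f (1 + c)).re - ∑ j ∈ Finset.range k, (PowerSeries.coeff j (tay f)).re * c ^ j| ≤
        M * c ^ k := by
  obtain ⟨M, hM⟩ := (hf.hasFPowerSeriesAt.isBigO_sub_partialSum_pow k).bound
  obtain ⟨η, hη, h⟩ := Metric.eventually_nhds_iff.mp hM
  refine ⟨M, η, hη, fun c hc hc' => ?_⟩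
  have h1 := h (y := (c : ℂ)) (by simpa [abs_of_pos hc] using hc')
  rw [Complex.norm_real, norm_pow, norm_norm, Real.norm_eq_abs, abs_of_pos hc] at h1
  refine le_trans (le_of_eq ?_) ((Complex.abs_re_le_norm _).trans h1)
  congr 1
  rw [Complex.sub_re, FormalMultilinearSeries.partialSum, Complex.re_sum]
  congr 1
  refine Finset.sum_congr rfl fun j _ => ?_
  rw [FormalMultilinearSeries.ofScalars_apply_eq, smul_eq_mul, ← Complex.ofReal_pow,
    Complex.re_mul_ofReal, coeff_tay]

/-- The main term of `∑_{n ≤ x} τ_k(n)` is the residue of `ζ(s)^k x^s / s` at `s = 1`. -/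
lemma coeff_one_add_X_mul_eq {k : ℕ} {B : PowerSeries ℝ} {δ : ℝ} (hδ : 0 < δ)
    (h : PowerAsymp (psum (tauR (k + 1))) k B δ) {j : ℕ} (hj : j < k + 1) :
    PowerSeries.coeff j ((1 + PowerSeries.X) * B) = PowerSeries.coeff j (zetaSer (k + 1)) := by
  have hI : AnalyticAt ℂ (fun s : ℂ => s⁻¹) 1 := analyticAt_id.inv one_ne_zero
  have hZ : AnalyticAt ℂ (zetaReg ^ (k + 1)) 1 := analyticAt_zetaReg.pow _
  set f : ℂ → ℂ := zetaReg ^ (k + 1) * fun s => s⁻¹ with hf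
  have hfa : AnalyticAt ℂ f 1 := hZ.mul hI
  have hmul : (1 + PowerSeries.X) * tay f = tay (zetaReg ^ (k + 1)) := by
    rw [← tay_id, ← tay_mul (f := fun s => s) analyticAt_id hfa]
    refine tay_congr ?_
    filter_upwards [isOpen_ne.mem_nhds (one_ne_zero : (1 : ℂ) ≠ 0)] with s hs
    simp only [Pi.mul_apply, hf]
    field_simp
  -- `c^{k+1} ζ(1+c)^{k+1} / (1+c)` is given up to `O(c^{k+1})` both by its Taylor polynomial and,
  -- through the Mellin transform, by the coefficients of `B`
  obtain ⟨M₁, η, hη, h1⟩ := exists_tay_remainder hfa (k + 1)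
  obtain ⟨M₂, h2⟩ := h.exists_abs_sub_le hδ (measurable_psum _)
  have hval : ∀ c : ℝ, 0 < c → (f (1 + c)).re = c ^ (k + 1) *
      ∫ t in Set.Ioi (1 : ℝ), psum (tauR (k + 1)) t * t ^ (-2 - c) := by
    intro c hc
    have hne : (1 + (c : ℂ)) ≠ 1 := by simpa using hc.ne'
    have hne' : (1 + (c : ℂ)) ≠ 0 := by
      intro h0
      have := congrArg Complex.re h0
      simp at this
      linarith
    have : f (1 + c) = ((c ^ (k + 1) *
      ∫ t in Set.Ioi (1 : ℝ), psum (tauR (k + 1)) t * t ^ (-2 - c) : ℝ) : ℂ) := by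
      simp only [hf, Pi.mul_apply, Pi.pow_apply]
      rw [zetaReg_of_ne hne, mul_pow, riemannZeta_pow_eq_integral hδ h hc, add_sub_cancel_left]
      push_cast
      field_simp
    rw [this, Complex.ofReal_re]
  have hgeo : ∀ c : ℝ, 0 < c → c ^ (k + 1) * PowerSeries.coeff k (B * geomSer c) =
      ∑ j ∈ Finset.range (k + 1), PowerSeries.coeff j B * c ^ j := by
    intro c hc
    rw [PowerSeries.coeff_mul, Finset.Nat.sum_antidiagonal_eq_sum_range_succ
      (fun i j => PowerSeries.coeff i B * PowerSeries.coeff j (geomSer c)), Finset.mul_sum]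
    refine Finset.sum_congr rfl fun i hi => ?_
    have hi' : i ≤ k := by simpa [Nat.lt_succ_iff] using hi
    have : c ^ (k + 1) = c ^ i * c ^ (k - i + 1) := by rw [← pow_add]; congr 1; omega
    rw [geomSer, PowerSeries.coeff_mk, this, inv_pow]
    field_simp
  have hz := eq_zero_of_sum_mul_pow_le (k + 1)
    (fun j => (PowerSeries.coeff j (tay f)).re - PowerSeries.coeff j B) (M₁ + M₂) η hη ?_
  · have hcoef : ∀ i < k + 1, (PowerSeries.coeff i (tay f)).re = PowerSeries.coeff i B :=
      fun i hi => sub_eq_zero.mp (hz i hi)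
    rw [zetaSer, PowerSeries.coeff_mk, ← hmul, add_mul, add_mul, one_mul, one_mul, map_add, map_add,
      Complex.add_re, hcoef j hj]
    congr 1
    rcases j with _ | j
    · simp
    · rw [PowerSeries.coeff_succ_X_mul, PowerSeries.coeff_succ_X_mul, hcoef j (by omega)]
  · intro c hc hc'
    have h3 := h1 c hc hc'
    have h4 := (h2 c hc).2
    have h5 : |c ^ (k + 1) * (∫ t in Set.Ioi (1 : ℝ), psum (tauR (k + 1)) t * t ^ (-2 - c)) -
        c ^ (k + 1) * PowerSeries.coeff k (B * geomSer c)| ≤ M₂ * c ^ (k + 1) := by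
      rw [← mul_sub, abs_mul, abs_of_pos (pow_pos hc _), mul_comm]
      exact mul_le_mul_of_nonneg_right h4 (pow_pos hc _).le
    rw [hval c hc] at h3
    rw [hgeo c hc] at h5
    have e : ∑ j ∈ Finset.range (k + 1),
        ((PowerSeries.coeff j (tay f)).re - PowerSeries.coeff j B) * c ^ j =
        ∑ j ∈ Finset.range (k + 1), (PowerSeries.coeff j (tay f)).re * c ^ j -
        ∑ j ∈ Finset.range (k + 1), PowerSeries.coeff j B * c ^ j := by
      rw [← Finset.sum_sub_distrib]
      exact Finset.sum_congr rfl fun j _ => by ring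
    rw [e, add_mul]
    rw [abs_le] at h3 h5 ⊢
    constructor <;> linarith [h3.1, h3.2, h5.1, h5.2]

/-! ### Ramanujan sums and Möbius inversion -/

/-- The function `d ↦ d · 1_{d ∣ n}`, whose convolution with `μ` is `r ↦ c_r(n)`, the Ramanujan
sum. -/
def dvdId (n : ℕ) : ArithmeticFunction ℝ := ⟨fun d => if d ∣ n then (d : ℝ) else 0, by simp⟩

lemma dvdId_apply (n d : ℕ) : dvdId n d = if d ∣ n then (d : ℝ) else 0 := rfl

lemma isMultiplicative_dvdId (n : ℕ) : (dvdId n).IsMultiplicative := by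
  refine ⟨by simp [dvdId_apply], fun {a b} hab => ?_⟩
  simp only [dvdId_apply]
  by_cases ha : a ∣ n
  · by_cases hb : b ∣ n
    · rw [if_pos (hab.mul_dvd_of_dvd_of_dvd ha hb), if_pos ha, if_pos hb, Nat.cast_mul]
    · rw [if_neg fun h => hb (dvd_trans (dvd_mul_left b a) h), if_neg hb, mul_zero]
  · rw [if_neg fun h => ha (dvd_trans (dvd_mul_right a b) h), if_neg ha, zero_mul]

/-- The function `r ↦ φ(r) μ(r/(r,n)) / φ(r/(r,n))`, von Sterneck's form of the Ramanujan sum. -/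
def sterneck (n : ℕ) : ArithmeticFunction ℝ :=
  ⟨fun r => (r.totient : ℝ) * (((μ (r / Nat.gcd r n) : ℤ) : ℝ) / (Nat.totient (r / Nat.gcd r n) : ℝ)),
    by simp⟩

lemma sterneck_apply (n r : ℕ) : sterneck n r =
    (r.totient : ℝ) * (((μ (r / Nat.gcd r n) : ℤ) : ℝ) / (Nat.totient (r / Nat.gcd r n) : ℝ)) := rfl

lemma isMultiplicative_sterneck (n : ℕ) : (sterneck n).IsMultiplicative := by
  refine ⟨by simp [sterneck_apply], fun {a b} hab => ?_⟩
  have hg : Nat.gcd (a * b) n = Nat.gcd a n * Nat.gcd b n := by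
    rw [Nat.gcd_comm, Nat.Coprime.gcd_mul n hab, Nat.gcd_comm n a, Nat.gcd_comm n b]
  have hq : a * b / (Nat.gcd a n * Nat.gcd b n) = a / Nat.gcd a n * (b / Nat.gcd b n) :=
    Nat.mul_div_mul_comm (Nat.gcd_dvd_left a n) (Nat.gcd_dvd_left b n)
  have hc : Nat.Coprime (a / Nat.gcd a n) (b / Nat.gcd b n) :=
    (hab.coprime_dvd_left (Nat.div_dvd_of_dvd (Nat.gcd_dvd_left a n))).coprime_dvd_right
      (Nat.div_dvd_of_dvd (Nat.gcd_dvd_left b n))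
  rw [sterneck_apply, sterneck_apply, sterneck_apply, hg, hq,
    ArithmeticFunction.isMultiplicative_moebius.map_mul_of_coprime hc, Nat.totient_mul hc,
    Nat.totient_mul hab]
  push_cast
  rw [mul_div_mul_comm]
  ring

/-- The evaluation of the Ramanujan sums: both sides are multiplicative in `r`, so it suffices to
compare them at prime powers. -/
lemma dvdId_mul_moebius_eq_sterneck (n : ℕ) :
    dvdId n * (μ : ArithmeticFunction ℝ) = sterneck n := by
  refine (ArithmeticFunction.IsMultiplicative.eq_iff_eq_on_prime_powers _
    ((isMultiplicative_dvdId n).mul ArithmeticFunction.isMultiplicative_moebius.intCast) _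
    (isMultiplicative_sterneck n)).mpr fun p a hp => ?_
  rcases a with _ | a
  · rw [pow_zero, ((isMultiplicative_dvdId n).mul
      ArithmeticFunction.isMultiplicative_moebius.intCast).map_one,
      (isMultiplicative_sterneck n).map_one]
  refine (mul_moebius_prime_pow (dvdId n) hp a).trans ?_
  rw [dvdId_apply, dvdId_apply, sterneck_apply]
  obtain ⟨i, hi, hg⟩ := (Nat.dvd_prime_pow hp).mp (Nat.gcd_dvd_left (p ^ (a + 1)) n)
  have hdiv : ∀ j ≤ a + 1, (p ^ j ∣ n ↔ j ≤ i) := by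
    intro j hj
    rw [← Nat.pow_dvd_pow_iff_le_right hp.one_lt, ← hg, Nat.dvd_gcd_iff]
    exact ⟨fun h => ⟨pow_dvd_pow p hj, h⟩, fun h => h.2⟩
  have hp1 : (1 : ℝ) < p := by exact_mod_cast hp.one_lt
  simp only [hdiv (a + 1) le_rfl, hdiv a (Nat.le_succ a)]
  rw [hg, Nat.pow_div hi hp.pos, Nat.totient_prime_pow_succ hp]
  push_cast [Nat.cast_sub hp.one_le]
  rcases Nat.lt_or_ge i a with h1 | h1
  · rw [if_neg (by omega), if_neg (by omega),
      ArithmeticFunction.moebius_apply_prime_pow hp (by omega), if_neg (by omega)]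
    simp
  · rcases Nat.lt_or_ge i (a + 1) with h2 | h2
    · have : a + 1 - i = 1 := by omega
      rw [if_neg (by omega), if_pos h1, this, pow_one, ArithmeticFunction.moebius_apply_prime hp,
        Nat.totient_prime hp]
      push_cast [Nat.cast_sub hp.one_le]
      have : (p : ℝ) - 1 ≠ 0 := by linarith
      field_simp
      ring
    · have : a + 1 - i = 0 := by omega
      rw [if_pos h2, if_pos h1, this]
      simp
      ring

/-- The indicator function of the multiples of `e`. -/
def indDvd (e : ℕ) : ArithmeticFunction ℝ :=
  ⟨fun d => if d = 0 then 0 else if e ∣ d then 1 else 0, by simp⟩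

/-- Möbius inversion for the indicator function of the multiples of `e`. -/
lemma indDvd_mul_moebius {e r : ℕ} (he : e ≠ 0) :
    (indDvd e * (μ : ArithmeticFunction ℝ)) r = if r = e then 1 else 0 := by
  set δ : ArithmeticFunction ℝ := ⟨fun d => if d = e then 1 else 0, by simp [Ne.symm he]⟩ with hδ
  have h1 : δ * (ζ : ArithmeticFunction ℝ) = indDvd e := by
    ext d
    rw [ArithmeticFunction.coe_mul_zeta_apply]
    change ∑ i ∈ d.divisors, (if i = e then (1 : ℝ) else 0) = if d = 0 then 0 else _
    rw [Finset.sum_ite_eq']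
    by_cases hd : d = 0
    · simp [hd]
    · simp [hd]
  rw [← h1, mul_assoc, ArithmeticFunction.coe_zeta_mul_coe_moebius, mul_one]
  rfl

lemma sum_divisors_eq_sum_Icc {N r : ℕ} (h1 : 1 ≤ r) (hN : r ≤ N) (f : ℕ → ℝ) :
    ∑ d ∈ r.divisors, f d = ∑ d ∈ Finset.Icc 1 N, if d ∣ r then f d else 0 := by
  rw [← Finset.sum_filter]
  refine Finset.sum_congr ?_ fun _ _ => rfl
  ext d
  simp only [Nat.mem_divisors, Finset.mem_filter, Finset.mem_Icc]
  constructor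
  · rintro ⟨h, -⟩
    have := Nat.le_of_dvd h1 h
    exact ⟨⟨Nat.pos_of_dvd_of_pos h h1, by omega⟩, h⟩
  · rintro ⟨-, h⟩
    exact ⟨h, by omega⟩

lemma mul_moebius_eq_sum_Icc (f : ArithmeticFunction ℝ) {N r : ℕ} (h1 : 1 ≤ r) (hN : r ≤ N) :
    (f * (μ : ArithmeticFunction ℝ)) r =
      ∑ d ∈ Finset.Icc 1 N, if d ∣ r then f d * ((μ (r / d) : ℤ) : ℝ) else 0 := by
  rw [ArithmeticFunction.mul_apply, Nat.sum_divisorsAntidiagonal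
    (fun i j => f i * (μ : ArithmeticFunction ℝ) j),
    ← sum_divisors_eq_sum_Icc h1 hN (fun d => f d * ((μ (r / d) : ℤ) : ℝ))]
  rfl

/-- The coefficients `v(d) = ∑_{r ≤ N, d ∣ r} a(r) μ(r/d)`, dual to `a`. -/
def dualCoeff (N : ℕ) (a : ℕ → ℝ) (d : ℕ) : ℝ :=
  ∑ r ∈ Finset.Icc 1 N, if d ∣ r then a r * ((μ (r / d) : ℤ) : ℝ) else 0

/-- A combination of Ramanujan sums, written as a divisor sum. -/
lemma sum_mul_dvdId_mul_moebius (N : ℕ) (a : ℕ → ℝ) (n : ℕ) :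
    ∑ r ∈ Finset.Icc 1 N, a r * (dvdId n * (μ : ArithmeticFunction ℝ)) r =
      ∑ d ∈ Finset.Icc 1 N, (d * dualCoeff N a d) * if d ∣ n then 1 else 0 := by
  simp only [dualCoeff, Finset.mul_sum, Finset.sum_mul]
  rw [Finset.sum_comm]
  refine Finset.sum_congr rfl fun r hr => ?_
  rw [Finset.mem_Icc] at hr
  rw [mul_moebius_eq_sum_Icc _ hr.1 hr.2, Finset.mul_sum]
  refine Finset.sum_congr rfl fun d _ => ?_
  rw [dvdId_apply]
  split_ifs <;> ring

/-- Möbius inversion over the multiples of `e`: `∑_{e ∣ d} v(d) = a(e)`. -/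
lemma sum_dualCoeff_dvd {N : ℕ} (a : ℕ → ℝ) {e : ℕ} (he : e ∈ Finset.Icc 1 N) :
    ∑ d ∈ Finset.Icc 1 N, (if e ∣ d then dualCoeff N a d else 0) = a e := by
  have he0 : e ≠ 0 := by rw [Finset.mem_Icc] at he; omega
  have h1 : ∀ r ∈ Finset.Icc 1 N, ∑ d ∈ Finset.Icc 1 N,
      (if e ∣ d then (if d ∣ r then a r * ((μ (r / d) : ℤ) : ℝ) else 0) else 0) =
      a r * if r = e then 1 else 0 := by
    intro r hr
    rw [Finset.mem_Icc] at hr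
    rw [← indDvd_mul_moebius he0, mul_moebius_eq_sum_Icc _ hr.1 hr.2, Finset.mul_sum]
    refine Finset.sum_congr rfl fun d hd => ?_
    rw [Finset.mem_Icc] at hd
    have : indDvd e d = if e ∣ d then 1 else 0 := by
      change (if d = 0 then (0 : ℝ) else _) = _
      rw [if_neg (by omega)]
    rw [this]
    split_ifs <;> ring
  calc _ = ∑ d ∈ Finset.Icc 1 N, ∑ r ∈ Finset.Icc 1 N,
      (if e ∣ d then (if d ∣ r then a r * ((μ (r / d) : ℤ) : ℝ) else 0) else 0) := by
        refine Finset.sum_congr rfl fun d _ => ?_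
        rw [dualCoeff]
        split_ifs with h
        · rfl
        · simp
    _ = ∑ r ∈ Finset.Icc 1 N, a r * if r = e then 1 else 0 := by
        rw [Finset.sum_comm]
        exact Finset.sum_congr rfl h1
    _ = a e := by simp [Finset.mem_Icc.mp he]

/-- Pairing with the dual coefficients undoes summation over divisors. -/
lemma sum_dualCoeff_mul (N : ℕ) (a g : ℕ → ℝ) :
    ∑ d ∈ Finset.Icc 1 N, dualCoeff N a d * ∑ e ∈ Finset.Icc 1 N, (if e ∣ d then g e else 0) =
      ∑ e ∈ Finset.Icc 1 N, a e * g e := by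
  simp only [Finset.mul_sum]
  rw [Finset.sum_comm]
  refine Finset.sum_congr rfl fun e he => ?_
  rw [← sum_dualCoeff_dvd a he, Finset.sum_mul]
  exact Finset.sum_congr rfl fun d _ => by split_ifs <;> ring

/-- The Ramanujan sums `c_r` are orthogonal, with mean square `φ(r)`: the divisor sums with weights
`d v(d)` and `d' v'(d')` correlate through `d d' / [d,d'] = (d,d')`, and `(d,d')` is the sum of `φ`
over the common divisors. -/
lemma sum_dualCoeff_mul_gcd (N : ℕ) (a b : ℕ → ℝ) :
    ∑ d ∈ Finset.Icc 1 N, ∑ d' ∈ Finset.Icc 1 N,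
      dualCoeff N a d * dualCoeff N b d' * (Nat.gcd d d' : ℝ) =
      ∑ e ∈ Finset.Icc 1 N, a e * b e * (e.totient : ℝ) := by
  have h1 : ∀ d ∈ Finset.Icc 1 N, ∑ d' ∈ Finset.Icc 1 N,
      dualCoeff N a d * dualCoeff N b d' * (Nat.gcd d d' : ℝ) =
      dualCoeff N a d * ∑ e ∈ Finset.Icc 1 N, (if e ∣ d then b e * (e.totient : ℝ) else 0) := by
    intro d hd
    rw [Finset.mem_Icc] at hd
    have h2 : ∀ d' ∈ Finset.Icc 1 N, (Nat.gcd d d' : ℝ) =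
        ∑ e ∈ Finset.Icc 1 N, if e ∣ d then (if e ∣ d' then (e.totient : ℝ) else 0) else 0 := by
      intro d' hd'
      rw [Finset.mem_Icc] at hd'
      have h3 : 1 ≤ Nat.gcd d d' := Nat.gcd_pos_of_pos_left _ (by omega)
      have h4 : Nat.gcd d d' ≤ N := (Nat.gcd_le_left _ (by omega)).trans hd.2
      have h5 : (Nat.gcd d d' : ℝ) = ∑ e ∈ (Nat.gcd d d').divisors, (e.totient : ℝ) := by
        rw [← Nat.cast_sum, Nat.sum_totient]
      rw [h5, sum_divisors_eq_sum_Icc h3 h4]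
      refine Finset.sum_congr rfl fun e _ => ?_
      by_cases h6 : e ∣ d <;> by_cases h7 : e ∣ d' <;> simp [Nat.dvd_gcd_iff, h6, h7]
    calc _ = ∑ d' ∈ Finset.Icc 1 N, ∑ e ∈ Finset.Icc 1 N, dualCoeff N a d * (if e ∣ d then
          (if e ∣ d' then dualCoeff N b d' else 0) * (e.totient : ℝ) else 0) := by
          refine Finset.sum_congr rfl fun d' hd' => ?_
          rw [h2 d' hd', Finset.mul_sum]
          exact Finset.sum_congr rfl fun e _ => by split_ifs <;> ring
      _ = _ := by
          rw [Finset.sum_comm, Finset.mul_sum]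
          refine Finset.sum_congr rfl fun e he => ?_
          rw [← Finset.mul_sum]
          congr 1
          split_ifs with h
          · rw [← Finset.sum_mul, sum_dualCoeff_dvd b he]
          · simp
  rw [Finset.sum_congr rfl h1, sum_dualCoeff_mul]
  exact Finset.sum_congr rfl fun e _ => by ring

/-! ### Partial summation against powers of the logarithm -/

/-- Partial summation of a sequence `c ≥ 0` with main term `M` and error `E`. No power of `log x` is
lost beyond the size of the weight, since the weight is monotone. -/
lemma abs_psum_log_pow_mul_sub_le {c : ℕ → ℝ} (hc : ∀ n, 0 ≤ c n) (m : ℕ) {M M' : ℝ → ℝ}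
    {E x : ℝ} (hx : 1 ≤ x) (hM : ∀ t ∈ Set.Icc 1 x, HasDerivAt M (M' t) t)
    (hM' : ContinuousOn M' (Set.Icc 1 x)) (hE : ∀ t ∈ Set.Icc 1 x, |psum c t - M t| ≤ E) :
    |psum (fun n => Real.log n ^ m * c n) x - ∫ t in (1 : ℝ)..x, Real.log t ^ m * M' t| ≤
      (3 * E + c 1) * Real.log x ^ m := by
  set u : ℝ → ℝ := fun t => Real.log t ^ m with hu
  set u' : ℝ → ℝ := fun t => m * Real.log t ^ (m - 1) * t⁻¹ with hu'
  have huI : Set.uIcc 1 x = Set.Icc 1 x := Set.uIcc_of_le hx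
  have hpos : ∀ t ∈ Set.Icc 1 x, 0 < t := fun t ht => lt_of_lt_of_le one_pos ht.1
  have hud : ∀ t ∈ Set.Icc 1 x, HasDerivAt u (u' t) t := fun t ht =>
    (Real.hasDerivAt_log (hpos t ht).ne').pow m
  have hlc : ContinuousOn Real.log (Set.Icc 1 x) :=
    Real.continuousOn_log.mono fun t ht => (hpos t ht).ne'
  have huc : ContinuousOn u' (Set.Icc 1 x) :=
    (continuousOn_const.mul (hlc.pow _)).mul
      (continuousOn_id.inv₀ fun t ht => (hpos t ht).ne')
  have hu0 : ∀ t ∈ Set.Icc 1 x, 0 ≤ u' t := fun t ht => by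
    have := Real.log_nonneg ht.1
    have := hpos t ht
    positivity
  have hMc : ContinuousOn M (Set.Icc 1 x) := fun t ht => (hM t ht).continuousAt.continuousWithinAt
  have hmono : Monotone (psum c) := fun s t hst =>
    Finset.sum_le_sum_of_subset_of_nonneg
      (Finset.Icc_subset_Icc_right (Nat.floor_le_floor hst)) fun n _ _ => hc n
  have hi1 : IntervalIntegrable (fun t => u' t * psum c t) MeasureTheory.volume 1 x :=
    (hmono.intervalIntegrable).continuousOn_mul (by rwa [huI])
  have hi2 : IntervalIntegrable (fun t => u' t * M t) MeasureTheory.volume 1 x :=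
    ContinuousOn.intervalIntegrable (by rw [huI]; exact huc.mul hMc)
  have hiu : IntervalIntegrable u' MeasureTheory.volume 1 x :=
    ContinuousOn.intervalIntegrable (by rwa [huI])
  have h1 := psum_mul_eq_sub_integral c hx hud huc
  have h2 := intervalIntegral.integral_mul_deriv_eq_deriv_mul (u := u) (v := M)
    (fun t ht => hud t (by rwa [huI] at ht)) (fun t ht => hM t (by rwa [huI] at ht)) hiu
    (ContinuousOn.intervalIntegrable (by rwa [huI]))
  have h3 : ∫ t in (1 : ℝ)..x, u' t = u x - u 1 :=
    intervalIntegral.integral_eq_sub_of_hasDerivAt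
      (fun t ht => hud t (by rwa [huI] at ht)) hiu
  have h4 : |(∫ t in (1 : ℝ)..x, u' t * psum c t) - ∫ t in (1 : ℝ)..x, u' t * M t| ≤
      E * (u x - u 1) := by
    rw [← intervalIntegral.integral_sub hi1 hi2, ← h3, ← intervalIntegral.integral_const_mul]
    refine intervalIntegral.norm_integral_le_of_norm_le (E := ℝ) (g := fun t => E * u' t) hx
      (Filter.Eventually.of_forall fun t ht => ?_) (hiu.const_mul E)
    have ht' : t ∈ Set.Icc 1 x := Set.Ioc_subset_Icc_self ht
    rw [← mul_sub, Real.norm_eq_abs, abs_mul, abs_of_nonneg (hu0 t ht'), mul_comm]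
    exact mul_le_mul_of_nonneg_right (hE t ht') (hu0 t ht')
  have h5 := hE 1 ⟨le_rfl, hx⟩
  have h6 := hE x ⟨hx, le_rfl⟩
  have hE0 : 0 ≤ E := (abs_nonneg _).trans h5
  have hu1 : 0 ≤ u 1 := by simp only [hu, Real.log_one]; positivity
  have hux : u 1 ≤ u x := by
    simp only [hu]
    exact pow_le_pow_left₀ (by simp) (Real.log_le_log one_pos hx) m
  have h7 : |M 1| ≤ E + c 1 := by
    have : psum c 1 = c 1 := by simp [psum]
    rw [this] at h5
    have := abs_sub_abs_le_abs_sub (M 1) (c 1)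
    rw [abs_sub_comm] at this
    rw [abs_of_nonneg (hc 1)] at this
    linarith
  have e : psum (fun n => Real.log n ^ m * c n) x - ∫ t in (1 : ℝ)..x, Real.log t ^ m * M' t =
      u x * (psum c x - M x) + u 1 * M 1 -
      ((∫ t in (1 : ℝ)..x, u' t * psum c t) - ∫ t in (1 : ℝ)..x, u' t * M t) := by
    change psum (fun n => u n * c n) x - ∫ t in (1 : ℝ)..x, u t * M' t = _
    rw [h1, h2]
    ring
  have a1 : |u x * (psum c x - M x)| ≤ u x * E := by
    rw [abs_mul, abs_of_nonneg (hu1.trans hux)]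
    exact mul_le_mul_of_nonneg_left h6 (hu1.trans hux)
  have a2 : |u 1 * M 1| ≤ u x * (E + c 1) := by
    rw [abs_mul, abs_of_nonneg hu1]
    exact mul_le_mul hux h7 (abs_nonneg _) (hu1.trans hux)
  rw [e]
  change _ ≤ (3 * E + c 1) * u x
  calc _ ≤ |u x * (psum c x - M x)| + |u 1 * M 1| + E * (u x - u 1) := by
        refine (abs_sub _ _).trans (add_le_add (abs_add_le _ _) h4)
    _ ≤ u x * E + u x * (E + c 1) + E * u x := by
        have : 0 ≤ E * u 1 := mul_nonneg hE0 hu1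
        linarith
    _ = _ := by ring

/-! ### Bounds for `h_{j,k}` -/

/-- The Taylor coefficients of the local densities grow polynomially in `d`, with an exponent that
does not depend on `k`; the exponent in the range of `R` depends on this. -/
lemma exists_nrm1_hSer_le (M k : ℕ) : ∃ C : ℝ, 0 ≤ C ∧ ∀ d : ℕ, d ≠ 0 →
    nrm1 M (hSer k d) ≤ C * (d : ℝ) ^ 2 := by
  obtain ⟨C, hC, h⟩ := exists_prod_primeFactors_le (by positivity : (0 : ℝ) ≤ (k + 1) * 2 ^ k) k
  have hN := isSubNorm_nrm1 M
  have key : ∀ d : ℕ, d ≠ 0 → nrm1 M (hSer k d) ≤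
      (∏ p ∈ d.primeFactors, ((k + 1) * 2 ^ k) * ((d.factorization p : ℝ) + 1) ^ k) * d := by
    intro d
    induction d using Nat.recOnPrimePow with
    | zero => exact fun hd => absurd rfl hd
    | one => intro _; simpa [(isMultiplicative_hSer k).map_one] using hN.one
    | prime_pow_mul a p n hp ha hn ih =>
      intro _
      have ha0 : a ≠ 0 := by rintro rfl; simp at ha
      have hcop : Nat.Coprime (p ^ n) a :=
        Nat.Coprime.pow_left n ((Nat.Prime.coprime_iff_not_dvd hp).mpr ha)
      have hp1 : (1 : ℝ) ≤ p := by exact_mod_cast hp.one_le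
      have h1 : (p : ℝ) ^ (1 / 16 : ℝ) ≤ p := by
        calc (p : ℝ) ^ (1 / 16 : ℝ) ≤ (p : ℝ) ^ (1 : ℝ) :=
              Real.rpow_le_rpow_of_exponent_le hp1 (by norm_num)
          _ = p := Real.rpow_one _
      rw [(isMultiplicative_hSer k).map_mul_of_coprime hcop, hSer_prime_pow k hp,
        prod_primeFactors_prime_pow_mul
          (fun _ v => ((k : ℝ) + 1) * 2 ^ k * ((v : ℝ) + 1) ^ k) hp ha hn]
      calc _ ≤ nrm1 M (hloc k p n) * nrm1 M (hSer k a) := hN.mul_le _ _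
        _ ≤ (((k + 1) * 2 ^ k) * ((n : ℝ) + 1) ^ k * ((p : ℝ) ^ (1 / 16 : ℝ)) ^ n) *
            ((∏ q ∈ a.primeFactors, ((k + 1) * 2 ^ k) * ((a.factorization q : ℝ) + 1) ^ k) * a) :=
          mul_le_mul (nrm1_hloc_le (M := M) k hp n) (ih ha0) (hN.nonneg _) (by positivity)
        _ ≤ (((k + 1) * 2 ^ k) * ((n : ℝ) + 1) ^ k * (p : ℝ) ^ n) *
            ((∏ q ∈ a.primeFactors, ((k + 1) * 2 ^ k) * ((a.factorization q : ℝ) + 1) ^ k) * a) := by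
          gcongr
        _ = _ := by push_cast; ring
  refine ⟨C, hC, fun d hd => (key d hd).trans ?_⟩
  calc _ ≤ (C * d) * d := mul_le_mul_of_nonneg_right (h d hd) (by positivity)
    _ = _ := by ring

lemma exists_abs_hFun_le {k : ℕ} (hk : 0 < k) (j : ℕ) : ∃ C : ℝ, 0 ≤ C ∧ ∀ d : ℕ,
    |hFun k j d| ≤ C * (d : ℝ) ^ 2 := by
  obtain ⟨C, hC, h⟩ := exists_nrm1_hSer_le j k
  have hN := isSubNorm_nrm1 j
  have h0 := hN.nonneg (zetaSer k)
  refine ⟨16 ^ j * (nrm1 j (zetaSer k) * C), by positivity, fun d => ?_⟩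
  rcases eq_or_ne d 0 with rfl | hd
  · simp
  rw [hFun_eq hk]
  calc _ ≤ 16 ^ j * nrm1 j (zetaSer k * hSer k d) := abs_coeff_le_nrm1 le_rfl _
    _ ≤ 16 ^ j * (nrm1 j (zetaSer k) * (C * (d : ℝ) ^ 2)) := by
        have := (hN.mul_le (zetaSer k) (hSer k d)).trans (mul_le_mul_of_nonneg_left (h d hd) h0)
        gcongr
    _ = _ := by ring

lemma exists_abs_hFun_mul_moebius_le {k : ℕ} (hk : 0 < k) (j : ℕ) : ∃ C : ℝ, 0 ≤ C ∧
    ∀ r : ℕ, |(hFun k j * (μ : ArithmeticFunction ℝ)) r| ≤ C * (r : ℝ) ^ 3 := by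
  obtain ⟨C, hC, h⟩ := exists_abs_hFun_le hk j
  refine ⟨C, hC, fun r => ?_⟩
  rcases Nat.eq_zero_or_pos r with rfl | hr
  · simp
  rw [mul_moebius_eq_sum_Icc _ hr le_rfl]
  calc _ ≤ ∑ d ∈ Finset.Icc 1 r, |if d ∣ r then hFun k j d * ((μ (r / d) : ℤ) : ℝ) else 0| :=
        Finset.abs_sum_le_sum_abs _ _
    _ ≤ ∑ d ∈ Finset.Icc 1 r, C * (r : ℝ) ^ 2 := by
        refine Finset.sum_le_sum fun d hd => ?_
        have hdr : (d : ℝ) ≤ r := by exact_mod_cast (Finset.mem_Icc.mp hd).2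
        have hm : |((μ (r / d) : ℤ) : ℝ)| ≤ 1 := by
          exact_mod_cast ArithmeticFunction.abs_moebius_le_one
        split_ifs
        · rw [abs_mul]
          calc _ ≤ (C * (d : ℝ) ^ 2) * 1 := mul_le_mul (h d) hm (abs_nonneg _) (by positivity)
            _ ≤ _ := by rw [mul_one]; gcongr
        · simp only [abs_zero]; positivity
    _ = _ := by simp; ring

/-! ### The quadratic form of the major arcs approximation -/

/-- Finitely many bounds with the same shape add up. -/
lemma exists_abs_sum_le {ι α : Type*} (s : Finset ι) {f : ι → α → ℝ} {b : α → ℝ} {P : α → Prop}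
    (h : ∀ i ∈ s, ∃ C : ℝ, 0 ≤ C ∧ ∀ y, P y → |f i y| ≤ C * b y) :
    ∃ C : ℝ, 0 ≤ C ∧ ∀ y, P y → |∑ i ∈ s, f i y| ≤ C * b y := by
  choose! C hC h using h
  refine ⟨∑ i ∈ s, C i, Finset.sum_nonneg hC, fun y hy => ?_⟩
  rw [Finset.sum_mul]
  exact (Finset.abs_sum_le_sum_abs _ _).trans (Finset.sum_le_sum fun i hi => h i hi y hy)

/-- The coefficients `(h_{j,k} * μ)(r) / φ(r)` of the Ramanujan sums in `F_R`. -/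
def ramCoeff (k j r : ℕ) : ℝ := (hFun k j * (μ : ArithmeticFunction ℝ)) r / (r.totient : ℝ)

/-- The coefficients of the divisor sums in `F_R`. -/
def divCoeff (k N j d : ℕ) : ℝ := dualCoeff N (ramCoeff k j) d

/-- The sum `∑_{r ≤ N} (h_{j,k} * μ)(r) (h_{j',k} * μ)(r) / φ(r)`. -/
def gramSum (k j j' N : ℕ) : ℝ := ∑ r ∈ Finset.Icc 1 N,
  (hFun k j * (μ : ArithmeticFunction ℝ)) r * (hFun k j' * (μ : ArithmeticFunction ℝ)) r /
    (r.totient : ℝ)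

/-- The integral `∫_1^x u_{j,k}(t) u_{j',k}(t) dt`. -/
def uInt (k j j' : ℕ) (x : ℝ) : ℝ := ∫ t in (1 : ℝ)..x, uFun k j t * uFun k j' t

/-- `F_R(n)` as a combination of the `u_{j,k}(n)` with divisor sums as coefficients. -/
lemma majorArc_eq (k : ℕ) (R : ℝ) (n : ℕ) : majorArc k R n =
    ∑ j ∈ Finset.range k, uFun k j n * ∑ d ∈ Finset.Icc 1 ⌊R⌋₊,
      (d * divCoeff k ⌊R⌋₊ j d) * if d ∣ n then 1 else 0 := by
  rw [majorArc]
  refine Finset.sum_congr rfl fun j _ => ?_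
  congr 1
  simp only [divCoeff]
  rw [← sum_mul_dvdId_mul_moebius]
  refine Finset.sum_congr rfl fun r hr => ?_
  have hr1 : (r.totient : ℝ) ≠ 0 := by
    have := Nat.totient_pos.mpr (Finset.mem_Icc.mp hr).1
    exact_mod_cast this.ne'
  rw [dvdId_mul_moebius_eq_sterneck, sterneck_apply, ramCoeff]
  have e : (((ArithmeticFunction.moebius : ArithmeticFunction ℤ) : ArithmeticFunction ℝ)) =
    (μ : ArithmeticFunction ℝ) := rfl
  field_simp

lemma psum_finset_sum {ι : Type*} (s : Finset ι) (f : ι → ℕ → ℝ) (x : ℝ) :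
    psum (fun n => ∑ i ∈ s, f i n) x = ∑ i ∈ s, psum (f i) x := by
  simp only [psum]
  exact Finset.sum_comm

/-- The correlation of `τ_k` with the `j`-th part of `F_R`. -/
def crossSum (k N j : ℕ) (x : ℝ) : ℝ := ∑ d ∈ Finset.Icc 1 N, (d * divCoeff k N j d) *
  psum (fun n => uFun k j n * if d ∣ n then tauR k n else 0) x

/-- The correlation of the `j`-th and `j'`-th parts of `F_R`. -/
def partSum (k N j j' : ℕ) (x : ℝ) : ℝ := ∑ d ∈ Finset.Icc 1 N, ∑ d' ∈ Finset.Icc 1 N,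
  (d * divCoeff k N j d) * (d' * divCoeff k N j' d') *
    psum (fun n => uFun k j n * uFun k j' n * if Nat.lcm d d' ∣ n then 1 else 0) x

/-- The expansion of the square. -/
lemma normSq_Delta (k : ℕ) (R x : ℝ) : normSq (Delta k R) x =
    normSq (fun n => ((tau k n : ℕ) : ℝ)) x - 2 * ∑ j ∈ Finset.range k, crossSum k ⌊R⌋₊ j x +
      ∑ j ∈ Finset.range k, ∑ j' ∈ Finset.range k, partSum k ⌊R⌋₊ j j' x := by
  set N := ⌊R⌋₊ with hN
  have e1 : ∑ j ∈ Finset.range k, crossSum k N j x =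
      psum (fun n => (tau k n : ℝ) * majorArc k R n) x := by
    simp only [crossSum, ← psum_const_mul]
    simp only [← psum_finset_sum]
    refine psum_congr fun n _ _ => ?_
    rw [majorArc_eq, Finset.mul_sum, ← hN]
    refine Finset.sum_congr rfl fun j _ => ?_
    rw [Finset.mul_sum, Finset.mul_sum]
    refine Finset.sum_congr rfl fun d _ => ?_
    rw [← tauR_apply]
    split_ifs <;> ring
  have e2 : ∑ j ∈ Finset.range k, ∑ j' ∈ Finset.range k, partSum k N j j' x =
      psum (fun n => majorArc k R n ^ 2) x := by
    simp only [partSum, ← psum_const_mul]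
    simp only [← psum_finset_sum]
    refine psum_congr fun n _ _ => ?_
    rw [majorArc_eq, ← hN, pow_two, Finset.sum_mul_sum]
    refine Finset.sum_congr rfl fun j _ => Finset.sum_congr rfl fun j' _ => ?_
    rw [mul_mul_mul_comm, Finset.sum_mul_sum, Finset.mul_sum]
    refine Finset.sum_congr rfl fun d _ => ?_
    rw [Finset.mul_sum]
    refine Finset.sum_congr rfl fun d' _ => ?_
    by_cases h1 : d ∣ n <;> by_cases h2 : d' ∣ n <;> (simp [Nat.lcm_dvd_iff, h1, h2]; try ring)
  rw [e1, e2]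
  simp only [normSq, psum]
  rw [Finset.mul_sum, ← Finset.sum_sub_distrib, ← Finset.sum_add_distrib]
  refine Finset.sum_congr rfl fun n _ => ?_
  rw [Delta]
  ring

/-! ### Size of the coefficients -/

lemma exists_abs_ramCoeff_le {k : ℕ} (hk : 0 < k) (j : ℕ) : ∃ C : ℝ, 0 ≤ C ∧
    ∀ r : ℕ, |ramCoeff k j r| ≤ C * (r : ℝ) ^ 3 := by
  obtain ⟨C, hC, h⟩ := exists_abs_hFun_mul_moebius_le hk j
  refine ⟨C, hC, fun r => ?_⟩
  rcases Nat.eq_zero_or_pos r with rfl | hr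
  · simp [ramCoeff]
  have h1 : (1 : ℝ) ≤ (r.totient : ℝ) := by exact_mod_cast Nat.totient_pos.mpr hr
  rw [ramCoeff, abs_div, abs_of_nonneg (by linarith : (0 : ℝ) ≤ (r.totient : ℝ))]
  exact (div_le_self (abs_nonneg _) h1).trans (h r)

lemma exists_abs_divCoeff_le {k : ℕ} (hk : 0 < k) (j : ℕ) : ∃ C : ℝ, 0 ≤ C ∧
    ∀ N d : ℕ, |divCoeff k N j d| ≤ C * (N : ℝ) ^ 4 := by
  obtain ⟨C, hC, h⟩ := exists_abs_ramCoeff_le hk j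
  refine ⟨C, hC, fun N d => ?_⟩
  rw [divCoeff, dualCoeff]
  calc _ ≤ ∑ r ∈ Finset.Icc 1 N, |if d ∣ r then ramCoeff k j r * ((μ (r / d) : ℤ) : ℝ) else 0| :=
        Finset.abs_sum_le_sum_abs _ _
    _ ≤ ∑ r ∈ Finset.Icc 1 N, C * (N : ℝ) ^ 3 := by
        refine Finset.sum_le_sum fun r hr => ?_
        have hdr : (r : ℝ) ≤ N := by exact_mod_cast (Finset.mem_Icc.mp hr).2
        have hm : |((μ (r / d) : ℤ) : ℝ)| ≤ 1 := by
          exact_mod_cast ArithmeticFunction.abs_moebius_le_one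
        split_ifs
        · rw [abs_mul]
          calc _ ≤ (C * (r : ℝ) ^ 3) * 1 := mul_le_mul (h r) hm (abs_nonneg _) (by positivity)
            _ ≤ _ := by rw [mul_one]; gcongr
        · simp only [abs_zero]; positivity
    _ = _ := by simp; ring

lemma exists_abs_mul_divCoeff_le {k : ℕ} (hk : 0 < k) (j : ℕ) : ∃ C : ℝ, 0 ≤ C ∧
    ∀ N : ℕ, ∀ d ∈ Finset.Icc 1 N, |d * divCoeff k N j d| ≤ C * (N : ℝ) ^ 5 := by
  obtain ⟨C, hC, h⟩ := exists_abs_divCoeff_le hk j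
  refine ⟨C, hC, fun N d hd => ?_⟩
  have hdN : (d : ℝ) ≤ N := by exact_mod_cast (Finset.mem_Icc.mp hd).2
  rw [abs_mul, Nat.abs_cast]
  calc _ ≤ (N : ℝ) * (C * (N : ℝ) ^ 4) :=
        mul_le_mul hdN (h N d) (abs_nonneg _) (by positivity)
    _ = _ := by ring

/-- The main term of the correlation of `τ_k` with `F_R`: since `h = (h * μ) * 1`, Möbius inversion
yields the same sums as the norm of `F_R` does. -/
lemma sum_divCoeff_mul_hFun (k N j j' : ℕ) :
    ∑ d ∈ Finset.Icc 1 N, divCoeff k N j d * hFun k j' d = gramSum k j j' N := by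
  have h : ∀ d ∈ Finset.Icc 1 N, divCoeff k N j d * hFun k j' d = dualCoeff N (ramCoeff k j) d *
      ∑ e ∈ Finset.Icc 1 N,
        (if e ∣ d then (hFun k j' * (μ : ArithmeticFunction ℝ)) e else 0) := by
    intro d hd
    rw [Finset.mem_Icc] at hd
    rw [← sum_divisors_eq_sum_Icc hd.1 hd.2, ← ArithmeticFunction.coe_mul_zeta_apply, mul_assoc,
      ArithmeticFunction.coe_moebius_mul_coe_zeta, mul_one, divCoeff]
  rw [Finset.sum_congr rfl h, sum_dualCoeff_mul, gramSum]
  exact Finset.sum_congr rfl fun e _ => by rw [ramCoeff]; ring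

/-- The main term of the norm of `F_R`: the common multiples of two integers have density `1/lcm`,
and the Ramanujan sums are orthogonal. -/
lemma sum_divCoeff_mul_div_lcm (k N j j' : ℕ) :
    ∑ d ∈ Finset.Icc 1 N, ∑ d' ∈ Finset.Icc 1 N,
      (d * divCoeff k N j d) * (d' * divCoeff k N j' d') * ((Nat.lcm d d' : ℕ) : ℝ)⁻¹ =
      gramSum k j j' N := by
  have h : ∀ d ∈ Finset.Icc 1 N, ∀ d' ∈ Finset.Icc 1 N,
      (d * divCoeff k N j d) * (d' * divCoeff k N j' d') * ((Nat.lcm d d' : ℕ) : ℝ)⁻¹ =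
      dualCoeff N (ramCoeff k j) d * dualCoeff N (ramCoeff k j') d' * (Nat.gcd d d' : ℝ) := by
    intro d hd d' hd'
    have h1 : (d : ℝ) * d' = (Nat.gcd d d' : ℝ) * ((Nat.lcm d d' : ℕ) : ℝ) := by
      exact_mod_cast (Nat.gcd_mul_lcm d d').symm
    have h2 : ((Nat.lcm d d' : ℕ) : ℝ) ≠ 0 := by
      have := Nat.lcm_pos (Finset.mem_Icc.mp hd).1 (Finset.mem_Icc.mp hd').1
      exact_mod_cast this.ne'
    rw [divCoeff, divCoeff, mul_mul_mul_comm, h1]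
    field_simp
  rw [Finset.sum_congr rfl fun d hd => Finset.sum_congr rfl (h d hd), sum_dualCoeff_mul_gcd,
    gramSum]
  refine Finset.sum_congr rfl fun e he => ?_
  have hr1 : (e.totient : ℝ) ≠ 0 := by
    have := Nat.totient_pos.mpr (Finset.mem_Icc.mp he).1
    exact_mod_cast this.ne'
  rw [ramCoeff, ramCoeff]
  field_simp

/-! ### Evaluation of the correlations -/

lemma uFun_eq (k j : ℕ) (t : ℝ) :
    uFun k j t = ((k - 1 - j).factorial : ℝ)⁻¹ * Real.log t ^ (k - 1 - j) := by
  rw [uFun]; ring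

lemma uFun_mul_uFun (k j j' : ℕ) (t : ℝ) : uFun k j t * uFun k j' t =
    (((k - 1 - j).factorial : ℝ)⁻¹ * ((k - 1 - j').factorial : ℝ)⁻¹) *
      Real.log t ^ ((k - 1 - j) + (k - 1 - j')) := by
  rw [uFun_eq, uFun_eq, pow_add]; ring

lemma log_pow_le_one_add_log_pow {x : ℝ} (hx : 1 ≤ x) {m n : ℕ} (hmn : m ≤ n) :
    Real.log x ^ m ≤ (1 + Real.log x) ^ n := by
  have h0 := Real.log_nonneg hx
  calc Real.log x ^ m ≤ (1 + Real.log x) ^ m := pow_le_pow_left₀ h0 (by linarith) m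
    _ ≤ (1 + Real.log x) ^ n := pow_le_pow_right₀ (by linarith) hmn

lemma intervalIntegrable_uFun_mul (k j j' : ℕ) {x : ℝ} (hx : 1 ≤ x) :
    IntervalIntegrable (fun t => uFun k j t * uFun k j' t) MeasureTheory.volume 1 x := by
  refine ContinuousOn.intervalIntegrable ?_
  rw [Set.uIcc_of_le hx]
  have hl : ContinuousOn Real.log (Set.Icc 1 x) :=
    Real.continuousOn_log.mono fun t ht => (lt_of_lt_of_le one_pos ht.1).ne'
  exact ((hl.pow _).div_const _).mul ((hl.pow _).div_const _)

lemma inv_factorial_le_one (n : ℕ) : ((n.factorial : ℝ))⁻¹ ≤ 1 :=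
  inv_le_one_of_one_le₀ (by exact_mod_cast n.factorial_pos)

/-- The sums of `u_{j,k} u_{j',k}` over the multiples of `q`, by partial summation. -/
lemma abs_psum_uFun_mul_dvd_sub_le (k j j' : ℕ) {q : ℕ} (hq : 0 < q) {x : ℝ} (hx : 1 ≤ x) :
    |psum (fun n => uFun k j n * uFun k j' n * if q ∣ n then 1 else 0) x -
      (q : ℝ)⁻¹ * uInt k j j' x| ≤ 4 * (1 + Real.log x) ^ (2 * k) := by
  set A : ℝ := ((k - 1 - j).factorial : ℝ)⁻¹ * ((k - 1 - j').factorial : ℝ)⁻¹ with hA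
  set m := (k - 1 - j) + (k - 1 - j') with hm
  have hA0 : 0 ≤ A := by positivity
  have hA1 : A ≤ 1 := mul_le_one₀ (inv_factorial_le_one _) (by positivity) (inv_factorial_le_one _)
  have hq1 : (1 : ℝ) ≤ q := by exact_mod_cast hq
  have h := abs_psum_log_pow_mul_sub_le (c := fun n => if q ∣ n then (1 : ℝ) else 0)
    (fun n => by split_ifs <;> norm_num) m (M := fun t => t * (q : ℝ)⁻¹)
    (M' := fun _ => (q : ℝ)⁻¹) (E := 1) hx
    (fun t _ => by simpa using (hasDerivAt_id t).mul_const (q : ℝ)⁻¹) continuousOn_const ?_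
  · have e1 : psum (fun n => uFun k j n * uFun k j' n * if q ∣ n then 1 else 0) x =
        A * psum (fun n => Real.log n ^ m * if q ∣ n then (1 : ℝ) else 0) x := by
      rw [← psum_const_mul]
      exact psum_congr fun n _ _ => by rw [uFun_mul_uFun]; ring
    have e2 : (q : ℝ)⁻¹ * uInt k j j' x =
        A * ∫ t in (1 : ℝ)..x, Real.log t ^ m * (q : ℝ)⁻¹ := by
      rw [uInt, ← intervalIntegral.integral_const_mul, ← intervalIntegral.integral_const_mul]
      refine intervalIntegral.integral_congr fun t _ => ?_
      simp only [uFun_mul_uFun]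
      ring
    have hc1 : (if q ∣ 1 then (1 : ℝ) else 0) ≤ 1 := by split_ifs <;> norm_num
    have hl0 : 0 ≤ Real.log x ^ m := pow_nonneg (Real.log_nonneg hx) m
    have hl1 : Real.log x ^ m ≤ (1 + Real.log x) ^ (2 * k) :=
      log_pow_le_one_add_log_pow hx (by omega)
    rw [e1, e2, ← mul_sub, abs_mul, abs_of_nonneg hA0]
    calc _ ≤ 1 * ((3 * 1 + if q ∣ 1 then (1 : ℝ) else 0) * Real.log x ^ m) :=
          mul_le_mul hA1 h (abs_nonneg _) zero_le_one
      _ ≤ 1 * ((3 * 1 + 1) * (1 + Real.log x) ^ (2 * k)) := by gcongr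
      _ = _ := by ring
  · intro t ht
    have ht0 : 0 ≤ t / q := by have := ht.1; positivity
    have e := psum_dvd (fun _ => (1 : ℝ)) hq t
    rw [psum_one] at e
    have h1 := Nat.floor_le ht0
    have h2 := Nat.lt_floor_add_one (t / q)
    rw [e, ← div_eq_mul_inv, abs_le]
    constructor <;> linarith

/-- The norm of `F_R`. There are `N²` pairs of divisors, each with a weight `O(N^{10})`. -/
lemma exists_abs_partSum_sub_le {k : ℕ} (hk : 0 < k) (j j' : ℕ) : ∃ C : ℝ, 0 ≤ C ∧
    ∀ y : ℝ × ℕ, 1 ≤ y.1 → |partSum k y.2 j j' y.1 - uInt k j j' y.1 * gramSum k j j' y.2| ≤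
      C * ((y.2 : ℝ) ^ 12 * (1 + Real.log y.1) ^ (2 * k)) := by
  obtain ⟨C, hC, h⟩ := exists_abs_mul_divCoeff_le hk j
  obtain ⟨C', hC', h'⟩ := exists_abs_mul_divCoeff_le hk j'
  refine ⟨4 * (C * C'), by positivity, ?_⟩
  rintro ⟨x, N⟩ (hx : 1 ≤ x)
  change |partSum k N j j' x - uInt k j j' x * gramSum k j j' N| ≤
    4 * (C * C') * ((N : ℝ) ^ 12 * (1 + Real.log x) ^ (2 * k))
  have hl := Real.log_nonneg hx
  rw [← sum_divCoeff_mul_div_lcm, partSum, Finset.mul_sum, ← Finset.sum_sub_distrib]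
  calc _ ≤ ∑ d ∈ Finset.Icc 1 N, ∑ d' ∈ Finset.Icc 1 N,
        (C * (N : ℝ) ^ 5) * (C' * (N : ℝ) ^ 5) * (4 * (1 + Real.log x) ^ (2 * k)) := by
        refine (Finset.abs_sum_le_sum_abs _ _).trans (Finset.sum_le_sum fun d hd => ?_)
        rw [Finset.mul_sum, ← Finset.sum_sub_distrib]
        refine (Finset.abs_sum_le_sum_abs _ _).trans (Finset.sum_le_sum fun d' hd' => ?_)
        have hq := Nat.lcm_pos (Finset.mem_Icc.mp hd).1 (Finset.mem_Icc.mp hd').1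
        have h1 := abs_psum_uFun_mul_dvd_sub_le k j j' hq hx
        rw [mul_comm (uInt k j j' x), mul_assoc _ _ (uInt k j j' x), ← mul_sub, abs_mul, abs_mul]
        exact mul_le_mul (mul_le_mul (h N d hd) (h' N d' hd') (abs_nonneg _) (by positivity)) h1
          (abs_nonneg _) (by positivity)
    _ = _ := by simp; ring

lemma coeff_mul_congr {A A' : PowerSeries ℝ} {k : ℕ}
    (h : ∀ j < k, PowerSeries.coeff j A = PowerSeries.coeff j A') (F : PowerSeries ℝ) {j : ℕ}
    (hj : j < k) : PowerSeries.coeff j (A * F) = PowerSeries.coeff j (A' * F) := by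
  rw [PowerSeries.coeff_mul, PowerSeries.coeff_mul]
  refine Finset.sum_congr rfl fun q hq => ?_
  have := Finset.HasAntidiagonal.mem_antidiagonal.mp hq
  rw [h q.1 (by omega)]

/-- The main term of `∑_{n ≤ t, d ∣ n} τ_k(n)` has derivative `d⁻¹ ∑_j u_{j,k}(t) h_{j,k}(d)`. -/
lemma ev_eq_sum_uFun_mul_hFun {k : ℕ} {B : PowerSeries ℝ}
    (hB : ∀ j < k + 1, PowerSeries.coeff j ((1 + PowerSeries.X) * B) =
      PowerSeries.coeff j (zetaSer (k + 1))) (d : ℕ) (t : ℝ) :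
    ev k ((1 + PowerSeries.X) * (B * hSer (k + 1) d)) (Real.log t) =
      ∑ j ∈ Finset.range (k + 1), uFun (k + 1) j t * hFun (k + 1) j d := by
  rw [ev_eq_sum, Finset.Nat.sum_antidiagonal_eq_sum_range_succ
    (fun i l => PowerSeries.coeff i ((1 + PowerSeries.X) * (B * hSer (k + 1) d)) *
      (Real.log t ^ l / l.factorial))]
  refine Finset.sum_congr rfl fun j hj => ?_
  rw [← mul_assoc, coeff_mul_congr hB _ (Finset.mem_range.mp hj), ← hFun_eq (Nat.succ_pos k), uFun,
    mul_comm, Nat.add_sub_cancel]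

/-- The sums of `u_{j,k} τ_k` over the multiples of `d`, by partial summation. -/
lemma exists_abs_psum_uFun_mul_tauR_sub_le (k : ℕ) {δ : ℝ} (hδ0 : 0 < δ) (hδ : δ ≤ 1)
    {B : PowerSeries ℝ} (hP : PowerAsymp (psum (tauR (k + 1))) k B δ) (j : ℕ) :
    ∃ C : ℝ, 0 ≤ C ∧ ∀ d : ℕ, 0 < d → ∀ x : ℝ, 1 ≤ x →
      |psum (fun n => uFun (k + 1) j n * if d ∣ n then tauR (k + 1) n else 0) x -
        (d : ℝ)⁻¹ * ∑ j' ∈ Finset.range (k + 1), hFun (k + 1) j' d * uInt (k + 1) j j' x| ≤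
        C * (d * (x ^ (1 - δ) * (1 + Real.log x) ^ (2 * (k + 1)))) := by
  obtain ⟨K, hK, h⟩ := exists_psum_dvd_tauR_sub_le (Nat.succ_pos k) hδ0 hδ hP
  have hB := fun j (hj : j < k + 1) => coeff_one_add_X_mul_eq hδ0 hP hj
  refine ⟨3 * K + 1, by positivity, fun d hd x hx => ?_⟩
  set A : ℝ := ((k + 1 - 1 - j).factorial : ℝ)⁻¹ with hA
  set m := k + 1 - 1 - j with hm
  have hA0 : 0 ≤ A := by positivity
  have hd1 : (1 : ℝ) ≤ d := by exact_mod_cast hd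
  have hlc : ∀ s : Set ℝ, s ⊆ Set.Ici 1 → ContinuousOn Real.log s := fun s hs =>
    Real.continuousOn_log.mono fun t ht => (lt_of_lt_of_le one_pos (hs ht)).ne'
  have hτ1 : tauR (k + 1) 1 = 1 := (isMultiplicative_tauR (k + 1)).map_one
  have hxδ : 1 ≤ x ^ (1 - δ) := Real.one_le_rpow hx (by linarith)
  have h1 := abs_psum_log_pow_mul_sub_le (c := fun n => if d ∣ n then tauR (k + 1) n else 0)
    (fun n => by split_ifs; exacts [tauR_nonneg _ _, le_rfl]) m
    (M := fun t => t / d * ev k (B * hSer (k + 1) d) (Real.log t))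
    (M' := fun t => (d : ℝ)⁻¹ *
      ∑ j' ∈ Finset.range (k + 1), uFun (k + 1) j' t * hFun (k + 1) j' d)
    (E := K * d * x ^ (1 - δ)) hx ?_ ?_ ?_
  · have e1 : psum (fun n => uFun (k + 1) j n * if d ∣ n then tauR (k + 1) n else 0) x =
        A * psum (fun n => Real.log n ^ m * if d ∣ n then tauR (k + 1) n else 0) x := by
      rw [← psum_const_mul]
      exact psum_congr fun n _ _ => by rw [uFun_eq]; ring
    have e2 : (d : ℝ)⁻¹ * ∑ j' ∈ Finset.range (k + 1), hFun (k + 1) j' d * uInt (k + 1) j j' x =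
        A * ∫ t in (1 : ℝ)..x, Real.log t ^ m * ((d : ℝ)⁻¹ *
          ∑ j' ∈ Finset.range (k + 1), uFun (k + 1) j' t * hFun (k + 1) j' d) := by
      simp only [uInt, ← intervalIntegral.integral_const_mul]
      rw [← intervalIntegral.integral_finsetSum (fun j' _ =>
        (intervalIntegrable_uFun_mul (k + 1) j j' hx).const_mul _),
        ← intervalIntegral.integral_const_mul]
      refine intervalIntegral.integral_congr fun t _ => ?_
      simp only [Finset.mul_sum]
      refine Finset.sum_congr rfl fun j' _ => ?_
      rw [uFun_eq _ j]
      ring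
    have hc1 : (if d ∣ 1 then tauR (k + 1) 1 else 0) ≤ 1 := by
      rw [hτ1]; split_ifs <;> norm_num
    have hc0 : 0 ≤ (if d ∣ 1 then tauR (k + 1) 1 else 0) := by
      rw [hτ1]; split_ifs <;> norm_num
    have hl0 : 0 ≤ Real.log x ^ m := pow_nonneg (Real.log_nonneg hx) m
    have hl1 : Real.log x ^ m ≤ (1 + Real.log x) ^ (2 * (k + 1)) :=
      log_pow_le_one_add_log_pow hx (by omega)
    have hdx : 1 ≤ d * x ^ (1 - δ) := one_le_mul_of_one_le_of_one_le hd1 hxδ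
    rw [e1, e2, ← mul_sub, abs_mul, abs_of_nonneg hA0]
    calc _ ≤ 1 * ((3 * (K * d * x ^ (1 - δ)) + if d ∣ 1 then tauR (k + 1) 1 else 0) *
          Real.log x ^ m) := mul_le_mul (inv_factorial_le_one _) h1 (abs_nonneg _) zero_le_one
      _ ≤ 1 * ((3 * (K * d * x ^ (1 - δ)) + d * x ^ (1 - δ)) *
          (1 + Real.log x) ^ (2 * (k + 1))) := by
          have : 0 ≤ K * d * x ^ (1 - δ) := by positivity
          gcongr
          linarith
      _ = _ := by ring
  · intro t ht
    have ht0 : (0 : ℝ) < t := lt_of_lt_of_le one_pos ht.1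
    rw [← ev_eq_sum_uFun_mul_hFun hB, add_mul, one_mul, ev_add]
    have h2 := (hasDerivAt_ev k (B * hSer (k + 1) d) (Real.log t)).comp t
      (Real.hasDerivAt_log ht0.ne')
    refine (((hasDerivAt_id t).div_const (d : ℝ)).mul h2).congr_deriv ?_
    simp only [Function.comp, id]
    field_simp
  · refine continuousOn_const.mul (continuousOn_finsetSum _ fun j' _ => ?_)
    exact ((((hlc _ fun t ht => ht.1).pow _).div_const _)).mul continuousOn_const
  · intro t ht
    have ht0 : (0 : ℝ) < t := lt_of_lt_of_le one_pos ht.1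
    refine (h d hd.ne' t ht0).trans ?_
    exact mul_le_mul_of_nonneg_left (Real.rpow_le_rpow ht0.le ht.2 (by linarith)) (by positivity)

/-- The correlation of `τ_k` with `F_R`. There are `N` divisors, each with a weight `O(N^5)`, and
the error for the multiples of `d` is linear in `d`. -/
lemma exists_abs_crossSum_sub_le (k : ℕ) {δ : ℝ} (hδ0 : 0 < δ) (hδ : δ ≤ 1)
    {B : PowerSeries ℝ} (hP : PowerAsymp (psum (tauR (k + 1))) k B δ) (j : ℕ) :
    ∃ C : ℝ, 0 ≤ C ∧ ∀ y : ℝ × ℕ, 1 ≤ y.1 → |crossSum (k + 1) y.2 j y.1 -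
      ∑ j' ∈ Finset.range (k + 1), uInt (k + 1) j j' y.1 * gramSum (k + 1) j j' y.2| ≤
      C * ((y.2 : ℝ) ^ 7 * (y.1 ^ (1 - δ) * (1 + Real.log y.1) ^ (2 * (k + 1)))) := by
  obtain ⟨C, hC, h⟩ := exists_abs_psum_uFun_mul_tauR_sub_le k hδ0 hδ hP j
  obtain ⟨C', hC', h'⟩ := exists_abs_mul_divCoeff_le (Nat.succ_pos k) j
  refine ⟨C' * C, by positivity, ?_⟩
  rintro ⟨x, N⟩ (hx : 1 ≤ x)
  change |crossSum (k + 1) N j x -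
      ∑ j' ∈ Finset.range (k + 1), uInt (k + 1) j j' x * gramSum (k + 1) j j' N| ≤
      C' * C * ((N : ℝ) ^ 7 * (x ^ (1 - δ) * (1 + Real.log x) ^ (2 * (k + 1))))
  have hl := Real.log_nonneg hx
  have e : ∑ j' ∈ Finset.range (k + 1), uInt (k + 1) j j' x * gramSum (k + 1) j j' N =
      ∑ d ∈ Finset.Icc 1 N, (d * divCoeff (k + 1) N j d) *
        ((d : ℝ)⁻¹ * ∑ j' ∈ Finset.range (k + 1), hFun (k + 1) j' d * uInt (k + 1) j j' x) := by
    simp only [← sum_divCoeff_mul_hFun, Finset.mul_sum]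
    rw [Finset.sum_comm]
    refine Finset.sum_congr rfl fun d hd => Finset.sum_congr rfl fun j' _ => ?_
    have : (d : ℝ) ≠ 0 := by
      have := (Finset.mem_Icc.mp hd).1
      exact_mod_cast (by omega : d ≠ 0)
    field_simp
  rw [e, crossSum, ← Finset.sum_sub_distrib]
  calc _ ≤ ∑ d ∈ Finset.Icc 1 N, (C' * (N : ℝ) ^ 5) *
        (C * (N * (x ^ (1 - δ) * (1 + Real.log x) ^ (2 * (k + 1))))) := by
        refine (Finset.abs_sum_le_sum_abs _ _).trans (Finset.sum_le_sum fun d hd => ?_)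
        have hdN : (d : ℝ) ≤ N := by exact_mod_cast (Finset.mem_Icc.mp hd).2
        have hx0 : 0 ≤ x ^ (1 - δ) := Real.rpow_nonneg (by linarith) _
        rw [← mul_sub, abs_mul]
        refine mul_le_mul (h' N d hd) ((h d (Finset.mem_Icc.mp hd).1 x hx).trans ?_)
          (abs_nonneg _) (by positivity)
        gcongr
    _ = _ := by simp; ring

/-- The norm of `Δ_R` is that of `τ_k` minus that of the diagonal form of `F_R`, up to a power
saving. -/
lemma exists_abs_normSq_Delta_sub_le {k : ℕ} (hk : 0 < k) : ∃ C : ℝ, 0 ≤ C ∧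
    ∀ y : ℝ × ℝ, (1 ≤ y.1 ∧ 1 ≤ y.2) → |normSq (Delta k y.2) y.1 -
      (normSq (fun n => ((tau k n : ℕ) : ℝ)) y.1 -
        ∑ j ∈ Finset.range k, ∑ j' ∈ Finset.range k, uInt k j j' y.1 * gramSum k j j' ⌊y.2⌋₊)| ≤
      C * (y.2 ^ 12 * (y.1 ^ (1 - 1 / (4 * (k : ℝ))) * (1 + Real.log y.1) ^ (2 * k))) := by
  obtain ⟨k, rfl⟩ : ∃ n, k = n + 1 := ⟨k - 1, by omega⟩
  obtain ⟨B, -, hP⟩ := exists_powerAsymp_tauR k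
  set δ : ℝ := 1 / (4 * ((k : ℝ) + 1)) with hδ
  have hk1 : (1 : ℝ) ≤ (k : ℝ) + 1 := by have : (0 : ℝ) ≤ k := k.cast_nonneg; linarith
  have hδ0 : 0 < δ := by positivity
  have hδ1 : δ ≤ 1 := by rw [hδ, div_le_one (by positivity)]; linarith
  obtain ⟨C₁, hC₁, h₁⟩ := exists_abs_sum_le (Finset.range (k + 1)) (P := fun y : ℝ × ℕ => 1 ≤ y.1)
    fun j _ => exists_abs_crossSum_sub_le k hδ0 hδ1 hP j
  obtain ⟨C₂, hC₂, h₂⟩ := exists_abs_sum_le (Finset.range (k + 1) ×ˢ Finset.range (k + 1))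
    (P := fun y : ℝ × ℕ => 1 ≤ y.1) fun q _ => exists_abs_partSum_sub_le (Nat.succ_pos k) q.1 q.2
  refine ⟨2 * C₁ + C₂, by positivity, ?_⟩
  rintro ⟨x, R⟩ ⟨hx, hR⟩
  simp only at hx hR
  have a₁ := h₁ (x, ⌊R⌋₊) hx
  have a₂ := h₂ (x, ⌊R⌋₊) hx
  simp only at a₁ a₂
  push_cast
  rw [← hδ, normSq_Delta]
  rw [Finset.sum_sub_distrib] at a₁
  rw [Finset.sum_product, Finset.sum_congr rfl (fun _ _ => Finset.sum_sub_distrib _ _),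
    Finset.sum_sub_distrib] at a₂
  have hfl : ((⌊R⌋₊ : ℕ) : ℝ) ≤ R := Nat.floor_le (by linarith)
  have hl := Real.log_nonneg hx
  have hxδ : 1 ≤ x ^ (1 - δ) := Real.one_le_rpow hx (by linarith)
  set X := x ^ (1 - δ) with hX
  set L := (1 + Real.log x) ^ (2 * (k + 1)) with hL
  have hL0 : 0 ≤ L := by positivity
  -- both errors are bounded by the same expression
  have b₁ : (⌊R⌋₊ : ℝ) ^ 7 * (X * L) ≤ R ^ 12 * (X * L) := by
    have : (⌊R⌋₊ : ℝ) ^ 7 ≤ R ^ 12 := by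
      calc (⌊R⌋₊ : ℝ) ^ 7 ≤ R ^ 7 := by gcongr
        _ ≤ R ^ 12 := pow_le_pow_right₀ hR (by norm_num)
    gcongr
  have b₂ : (⌊R⌋₊ : ℝ) ^ 12 * L ≤ R ^ 12 * (X * L) := by
    have : L ≤ X * L := le_mul_of_one_le_left hL0 hxδ
    gcongr
  set S := ∑ j ∈ Finset.range (k + 1), ∑ j' ∈ Finset.range (k + 1),
    uInt (k + 1) j j' x * gramSum (k + 1) j j' ⌊R⌋₊ with hS
  have c₁ := a₁.trans (mul_le_mul_of_nonneg_left b₁ hC₁)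
  have c₂ := a₂.trans (mul_le_mul_of_nonneg_left b₂ hC₂)
  rw [abs_le] at c₁ c₂ ⊢
  constructor <;> linarith [c₁.1, c₁.2, c₂.1, c₂.2]

/-! ### Coefficients of negative powers -/

/-- The series `1/(1 + X)` with integer coefficients. -/
def altSer : PowerSeries ℤ := PowerSeries.rescale (-1) (PowerSeries.mk 1)

/-- The binomial coefficient `[X^b] (1 + X)^{-N}`. -/
def negChoose (N b : ℕ) : ℤ := PowerSeries.coeff b (altSer ^ N)

lemma one_add_X_mul_altSer : (1 + PowerSeries.X) * altSer = 1 := by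
  have h := congrArg (PowerSeries.rescale (-1 : ℤ)) (PowerSeries.mk_one_mul_one_sub_eq_one ℤ)
  rw [map_mul, map_sub, map_one, PowerSeries.rescale_X] at h
  have e : 1 + PowerSeries.X = 1 - PowerSeries.C (-1 : ℤ) * PowerSeries.X := by
    rw [map_neg, map_one]; ring
  rw [altSer, mul_comm, e, h]

lemma negChoose_succ_ne_zero (N b : ℕ) : negChoose (N + 1) b ≠ 0 := by
  rw [negChoose, altSer, ← map_pow, PowerSeries.mk_one_pow_eq_mk_choose_add,
    PowerSeries.coeff_rescale, PowerSeries.coeff_mk]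
  refine mul_ne_zero (pow_ne_zero _ (by norm_num)) ?_
  have := Nat.choose_pos (Nat.le_add_right N b)
  exact_mod_cast this.ne'

/-- The coefficients of `(c + X)^{-N}`, for a unit `c` with inverse `y`. -/
lemma coeff_inverse_pow {R : Type*} [CommRing R] {c y : R} (h : c * y = 1) {I : PowerSeries R}
    (hI : (PowerSeries.C c + PowerSeries.X) * I = 1) (N b : ℕ) :
    PowerSeries.coeff b (I ^ N) = (negChoose N b : R) * y ^ (N + b) := by
  set Y : PowerSeries R := PowerSeries.rescale y (altSer.map (Int.castRingHom R)) with hY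
  have h1 : (1 + PowerSeries.C y * PowerSeries.X) * Y = 1 := by
    have h2 := congrArg (fun F => PowerSeries.rescale y (PowerSeries.map (Int.castRingHom R) F))
      one_add_X_mul_altSer
    simpa only [map_mul, map_add, map_one, PowerSeries.map_X, PowerSeries.rescale_X] using h2
  have hC : PowerSeries.C c * PowerSeries.C y = (1 : PowerSeries R) := by
    rw [← map_mul, h, map_one]
  have h3 : (PowerSeries.C c + PowerSeries.X) * (PowerSeries.C y * Y) = 1 := by
    linear_combination h1 + Y * hC
  have h4 : I = PowerSeries.C y * Y := by
    calc I = I * ((PowerSeries.C c + PowerSeries.X) * (PowerSeries.C y * Y)) := by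
          rw [h3, mul_one]
      _ = ((PowerSeries.C c + PowerSeries.X) * I) * (PowerSeries.C y * Y) := by ring
      _ = _ := by rw [hI, one_mul]
  rw [h4, mul_pow, ← map_pow, PowerSeries.coeff_C_mul, hY, ← map_pow, ← map_pow,
    PowerSeries.coeff_rescale, PowerSeries.coeff_map, ← negChoose, pow_add]
  simp only [eq_intCast]
  ring

lemma coeff_C_add_X_pow {R : Type*} [CommRing R] (c : R) (k a : ℕ) :
    PowerSeries.coeff a ((PowerSeries.C c + PowerSeries.X) ^ k) =
      c ^ (k - a) * (k.choose a : R) := by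
  have : (PowerSeries.C c + PowerSeries.X) ^ k =
      (((Polynomial.X + Polynomial.C c) ^ k : Polynomial R) : PowerSeries R) := by
    rw [add_comm]; simp
  rw [this, Polynomial.coeff_coe, Polynomial.coeff_X_add_C_pow]

/-- The coefficient of `z^j w^{j'}` in `(1 + z)^k (1 + w)^k / (1 + z + w)^{k²}`. -/
def symCoeff (k j j' : ℕ) : ℤ := ∑ q ∈ Finset.HasAntidiagonal.antidiagonal j',
  (k.choose q.1 : ℤ) * negChoose (k ^ 2) q.2 * negChoose (k ^ 2 - k + q.2) j

lemma le_sq_self (k : ℕ) : k ≤ k ^ 2 := by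
  rw [pow_two]; exact Nat.le_mul_self k

/-- The symbol is expanded in `w` over the ring of power series in `z`, where `1 + z` is a unit. -/
lemma cf_gramSymbol (k j j' : ℕ) : cf j j' (gramSymbol k) = symCoeff k j j' := by
  have hZ : varZ = PowerSeries.C PowerSeries.X := rfl
  set y : PowerSeries ℝ := altSer.map (Int.castRingHom ℝ) with hy
  have hy1 : (1 + PowerSeries.X) * y = 1 := by
    have := congrArg (PowerSeries.map (Int.castRingHom ℝ)) one_add_X_mul_altSer
    simpa only [map_mul, map_add, map_one, PowerSeries.map_X] using this
  have hS : (PowerSeries.C (1 + PowerSeries.X) + PowerSeries.X) * symS = 1 := by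
    rw [← one_add_varZ_add_varW_mul_symS, hZ, map_add, map_one]; rfl
  have hyp : ∀ N b, PowerSeries.coeff b (y ^ N) = (negChoose N b : ℝ) := by
    intro N b
    rw [coeff_inverse_pow (c := (1 : ℝ)) (y := 1) (mul_one 1) (by rw [map_one]; exact hy1)]
    simp
  have e : gramSymbol k = PowerSeries.C ((1 + PowerSeries.X) ^ k) *
      ((PowerSeries.C 1 + PowerSeries.X) ^ k * symS ^ (k ^ 2)) := by
    rw [gramSymbol, hZ, map_one, map_pow, map_add, map_one, mul_assoc]; rfl
  have e3 := PowerSeries.coeff_mul j' ((PowerSeries.C (1 : PowerSeries ℝ) + PowerSeries.X) ^ k)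
    (symS ^ (k ^ 2))
  rw [cf, e, PowerSeries.coeff_C_mul, e3, Finset.mul_sum, map_sum, symCoeff, Int.cast_sum]
  refine Finset.sum_congr rfl fun q _ => ?_
  rw [coeff_C_add_X_pow, coeff_inverse_pow hy1 hS, one_pow, one_mul]
  have hexp : k ^ 2 + q.2 = k + (k ^ 2 - k + q.2) := by have := le_sq_self k; omega
  have e2 : (1 + PowerSeries.X) ^ k * (((k.choose q.1 : ℕ) : PowerSeries ℝ) *
      (((negChoose (k ^ 2) q.2 : ℤ) : PowerSeries ℝ) * y ^ (k ^ 2 + q.2))) =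
      PowerSeries.C (((k.choose q.1 : ℤ) * negChoose (k ^ 2) q.2 : ℤ) : ℝ) *
        y ^ (k ^ 2 - k + q.2) := by
    rw [hexp, pow_add]
    have h1 : (1 + PowerSeries.X) ^ k * y ^ k = 1 := by rw [← mul_pow, hy1, one_pow]
    rw [map_intCast]
    push_cast
    linear_combination (((k.choose q.1 : ℕ) : PowerSeries ℝ) *
      ((negChoose (k ^ 2) q.2 : ℤ) : PowerSeries ℝ) * y ^ (k ^ 2 - k + q.2)) * h1
  rw [e2, PowerSeries.coeff_C_mul, hyp]
  push_cast
  ring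

/-! ### Positivity of the diagonal coefficients -/

/-- The diagonal coefficients of the symbol are positive: since
`1 + z + w = (1 + z)(1 + w)(1 - t)` with `t = zw / ((1 + z)(1 + w))`, the symbol is a power of
`1 / ((1 + z)(1 + w))` times a power series in `t` with nonnegative coefficients, and each
term contributes a square. -/
lemma symCoeff_pos {k : ℕ} (hk : 2 ≤ k) (j : ℕ) : 0 < symCoeff k j j := by
  set y : PowerSeries ℝ := altSer.map (Int.castRingHom ℝ) with hy
  have hy1 : (1 + PowerSeries.X) * y = 1 := by
    have := congrArg (PowerSeries.map (Int.castRingHom ℝ)) one_add_X_mul_altSer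
    simpa only [map_mul, map_add, map_one, PowerSeries.map_X] using this
  have hyp : ∀ N b, PowerSeries.coeff b (y ^ N) = (negChoose N b : ℝ) := by
    intro N b
    rw [coeff_inverse_pow (c := (1 : ℝ)) (y := 1) (mul_one 1) (by rw [map_one]; exact hy1)]
    simp
  have hW : varW = inW PowerSeries.X := by rw [varW, inW, PowerSeries.map_X]
  set t : Ser2 := inZ (PowerSeries.X * y) * inW (PowerSeries.X * y) with ht
  set U : Ser2 := (1 + varZ) * (1 + varW) * symS with hU
  set S : Ser2 := inZ y * inW y with hS
  have hz : (1 + varZ) * inZ y = 1 := by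
    rw [varZ, ← map_one inZ, ← map_add, ← map_mul, hy1]
  have hw : (1 + varW) * inW y = 1 := by
    rw [hW, ← map_one inW, ← map_add, ← map_mul, hy1]
  have ht' : t = varZ * inZ y * (varW * inW y) := by rw [ht, map_mul, map_mul, hW]; rfl
  have hSU : S * ((1 + varZ) * (1 + varW)) = 1 := by
    rw [hS]; linear_combination hw + (1 + varW) * inW y * hz
  have htU : (1 - t) * U = 1 := by
    have h1 : S * (1 + varZ + varW) = 1 - t := by
      rw [hS, ht']; linear_combination hw + (1 + varW) * inW y * hz
    rw [← h1, hU]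
    linear_combination hSU + S * ((1 + varZ) * (1 + varW)) * one_add_varZ_add_varW_mul_symS
  have hM : k ^ 2 - k + k = k ^ 2 := Nat.sub_add_cancel (le_sq_self k)
  have hsym : gramSymbol k = S ^ (k ^ 2 - k) * U ^ (k ^ 2) := by
    have h1 : (S * ((1 + varZ) * (1 + varW))) ^ (k ^ 2 - k) = 1 := by rw [hSU, one_pow]
    rw [mul_pow] at h1
    have h2 : U ^ (k ^ 2) = ((1 + varZ) * (1 + varW)) ^ (k ^ 2 - k) *
        ((1 + varZ) * (1 + varW)) ^ k * symS ^ (k ^ 2) := by rw [← pow_add, hM, hU, mul_pow]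
    rw [h2, gramSymbol, mul_pow _ _ k]
    linear_combination (-((1 + varZ) ^ k * (1 + varW) ^ k * symS ^ (k ^ 2))) * h1
  -- modulo `w^{j+1}`, the geometric series `U = 1 / (1 - t)` may be truncated
  set G : Polynomial ℕ := (∑ m ∈ Finset.range (j + 1), Polynomial.X ^ m) ^ (k ^ 2) with hG
  have hG0 : G.coeff 0 = 1 := by
    rw [hG, Polynomial.coeff_zero_eq_eval_zero, Polynomial.eval_pow, Polynomial.eval_finsetSum,
      Finset.sum_range_succ']
    simp
  have hdiff : PowerSeries.X ^ (j + 1) ∣ gramSymbol k - S ^ (k ^ 2 - k) * Polynomial.eval₂ (Nat.castRingHom Ser2) t G := by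
    set Q : Ser2 := ∑ m ∈ Finset.range (j + 1), t ^ m with hQ
    have h1 : Q * (1 - t) = 1 - t ^ (j + 1) := by
      have := geom_sum_mul t (j + 1)
      linear_combination -this
    have h2 : U - Q = t ^ (j + 1) * U := by
      linear_combination (-U) * h1 + Q * htU
    have h3 : Polynomial.eval₂ (Nat.castRingHom Ser2) t G = Q ^ (k ^ 2) := by
      rw [hG, Polynomial.eval₂_pow, Polynomial.eval₂_finsetSum]; simp [hQ]
    have h4 : PowerSeries.X ^ (j + 1) ∣ t ^ (j + 1) := by
      rw [ht']
      exact pow_dvd_pow_of_dvd ((Dvd.intro _ rfl : varW ∣ varW * inW y).mul_left _) _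
    rw [h3, hsym, ← mul_sub]
    refine Dvd.dvd.mul_left (dvd_trans ?_ (sub_dvd_pow_sub_pow U Q (k ^ 2))) _
    rw [h2]
    exact h4.mul_right _
  have hcf : cf j j (gramSymbol k) = cf j j (S ^ (k ^ 2 - k) * Polynomial.eval₂ (Nat.castRingHom Ser2) t G) := by
    have := PowerSeries.X_pow_dvd_iff.mp hdiff j (Nat.lt_succ_self j)
    rw [map_sub, sub_eq_zero] at this
    rw [cf, this, cf]
  have hsum : cf j j (S ^ (k ^ 2 - k) * Polynomial.eval₂ (Nat.castRingHom Ser2) t G) =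
      ∑ i ∈ Finset.range (G.natDegree + 1), (G.coeff i : ℝ) *
        PowerSeries.coeff j (y ^ (k ^ 2 - k) * (PowerSeries.X * y) ^ i) ^ 2 := by
    rw [Polynomial.eval₂_eq_sum_range, Finset.mul_sum, cf, map_sum, map_sum]
    refine Finset.sum_congr rfl fun i _ => ?_
    have : S ^ (k ^ 2 - k) * (Nat.castRingHom Ser2 (G.coeff i) * t ^ i) = inC (G.coeff i : ℝ) *
        (inZ (y ^ (k ^ 2 - k) * (PowerSeries.X * y) ^ i) *
          inW (y ^ (k ^ 2 - k) * (PowerSeries.X * y) ^ i)) := by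
      rw [eq_natCast, map_natCast, hS, ht]
      simp only [map_mul, map_pow]
      ring
    rw [this, ← cf, cf_inC_mul, cf_inZ_mul_inW]
    ring
  have hpos : 0 < cf j j (gramSymbol k) := by
    rw [hcf, hsum]
    -- the term `i = 0` alone is positive, since the coefficients of `(1 + z)^{-N}` do not vanish
    refine lt_of_lt_of_le ?_ (Finset.single_le_sum
      (f := fun i => (G.coeff i : ℝ) *
        PowerSeries.coeff j (y ^ (k ^ 2 - k) * (PowerSeries.X * y) ^ i) ^ 2)
      (fun i _ => by positivity) (Finset.mem_range.mpr (Nat.succ_pos _)))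
    have hk1 : k ^ 2 - k = (k ^ 2 - k - 1) + 1 := by
      have : k * 2 ≤ k ^ 2 := by rw [pow_two]; exact Nat.mul_le_mul_left k hk
      omega
    have := negChoose_succ_ne_zero (k ^ 2 - k - 1) j
    rw [← hk1] at this
    simp only [hG0, pow_zero, mul_one, hyp, Nat.cast_one, one_mul]
    positivity
  rw [cf_gramSymbol] at hpos
  exact_mod_cast hpos

/-! ### The residues -/

/-- The Taylor series of a function at `0`. -/
def tayZero (f : ℂ → ℂ) : PowerSeries ℂ := tay fun s => f (s - 1)

lemma analyticAt_comp_sub_one {f : ℂ → ℂ} (hf : AnalyticAt ℂ f 0) :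
    AnalyticAt ℂ (fun s => f (s - 1)) 1 := by
  refine AnalyticAt.fun_comp (by simpa using hf) ?_
  exact analyticAt_id.sub analyticAt_const

lemma tayZero_mul {f g : ℂ → ℂ} (hf : AnalyticAt ℂ f 0) (hg : AnalyticAt ℂ g 0) :
    tayZero (fun z => f z * g z) = tayZero f * tayZero g :=
  tay_mul (analyticAt_comp_sub_one hf) (analyticAt_comp_sub_one hg)

lemma tayZero_const (c : ℂ) : tayZero (fun _ => c) = PowerSeries.C c := tay_const c

lemma tayZero_pow {f : ℂ → ℂ} (hf : AnalyticAt ℂ f 0) (n : ℕ) :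
    tayZero (fun z => f z ^ n) = tayZero f ^ n := by
  induction n with
  | zero => simpa using tayZero_const 1
  | succ n ih =>
    rw [pow_succ, ← ih, ← tayZero_mul (f := fun z => f z ^ n) (hf.pow n) hf]
    simp only [pow_succ]

lemma tayZero_const_add (c : ℂ) :
    tayZero (fun z => c + z) = PowerSeries.C c + PowerSeries.X := by
  have e : (fun s : ℂ => c + (s - 1)) = (fun _ => c - 1) + fun s => s := by
    funext s; simp; ring
  rw [tayZero, e, tay_add (f := fun _ => c - 1) (g := fun s => s) analyticAt_const
    analyticAt_id, tay_const, tay_id, map_sub, map_one]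
  ring

lemma analyticAt_const_add_inv {c : ℂ} (hc : c ≠ 0) : AnalyticAt ℂ (fun z => (c + z)⁻¹) 0 :=
  (analyticAt_const.add analyticAt_id).inv (by simpa using hc)

lemma mul_tayZero_inv {c : ℂ} (hc : c ≠ 0) :
    (PowerSeries.C c + PowerSeries.X) * tayZero (fun z => (c + z)⁻¹) = 1 := by
  rw [← tayZero_const_add, ← tayZero_mul (f := fun z => c + z)
    (analyticAt_const.add analyticAt_id)
    (analyticAt_const_add_inv hc), ← map_one PowerSeries.C, ← tayZero_const]
  refine tay_congr ?_
  have : ∀ᶠ s : ℂ in 𝓝 1, c + (s - 1) ≠ 0 := by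
    refine ContinuousAt.eventually_ne (by fun_prop) ?_
    simpa using hc
  filter_upwards [this] with s hs
  exact mul_inv_cancel₀ hs

lemma residue_congr {f g : ℂ → ℂ} {a : ℂ} (h : ∀ᶠ z in 𝓝[≠] a, f z = g z) :
    residue f a = residue g a := by
  rw [residue, residue, Filter.limUnder, Filter.limUnder]
  congr 1
  refine Filter.map_congr ?_
  obtain ⟨r, hr, hr'⟩ := Metric.eventually_nhds_iff.mp (eventually_nhdsWithin_iff.mp h)
  filter_upwards [Ioo_mem_nhdsGT hr] with ρ hρ
  congr 1
  refine circleIntegral.integral_congr hρ.1.le fun z hz => ?_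
  have hz' : dist z a = ρ := hz
  refine hr' (by rw [hz']; exact hρ.2) ?_
  rintro rfl
  rw [dist_self] at hz'
  exact hρ.1.ne hz'

/-- The residue at a pole is a Taylor coefficient. -/
lemma residue_div_pow {f g : ℂ → ℂ} (hg : AnalyticAt ℂ g 0) (n : ℕ)
    (h : ∀ᶠ z in 𝓝[≠] (0 : ℂ), f z = g z / z ^ (n + 1)) :
    residue f 0 = PowerSeries.coeff n (tayZero g) := by
  have hval : PowerSeries.coeff n (tayZero g) = iteratedDeriv n g 0 / n.factorial := by
    have h0 := congrFun (iteratedDeriv_comp_sub_const n g 1) 1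
    simp only [sub_self] at h0
    rw [tayZero, coeff_tay, h0]
  rw [residue_congr h, hval, residue]
  refine Filter.Tendsto.limUnder_eq (tendsto_const_nhds.congr' ?_)
  obtain ⟨r, hr, hr'⟩ := Metric.eventually_nhds_iff_ball.mp hg.eventually_analyticAt
  filter_upwards [Ioo_mem_nhdsGT hr] with ρ hρ
  have hd : DifferentiableOn ℂ g (Metric.ball 0 r) := fun z hz =>
    (hr' z hz).differentiableAt.differentiableWithinAt
  have hc := (hd.diffContOnCl_ball
    (Metric.closedBall_subset_ball hρ.2)).circleIntegral_one_div_sub_center_pow_smul hρ.1 n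
  have e : (∮ z in C(0, ρ), g z / z ^ (n + 1)) = ∮ z in C(0, ρ), (1 / (z - 0) ^ (n + 1)) • g z := by
    congr 1
    funext z
    rw [sub_zero, smul_eq_mul]
    ring
  rw [e, hc, smul_eq_mul]
  have h2 : (2 * (Real.pi : ℂ) * Complex.I) ≠ 0 := by
    simp [Real.pi_ne_zero]
  field_simp

/-- The residue in `s₂`, for fixed `s` and `s₁`. -/
lemma residue_inner {k j' : ℕ} {s s₁ : ℂ} (hc : s + s₁ ≠ 0) (A : ℂ) :
    residue (fun s₂ : ℂ => A * (s + s₂) ^ k /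
      (s₂ ^ (j' + 1) * (s + s₁ + s₂) ^ (k ^ 2))) 0 =
      A * ∑ q ∈ Finset.HasAntidiagonal.antidiagonal j', (s ^ (k - q.1) * (k.choose q.1 : ℂ)) *
        ((negChoose (k ^ 2) q.2 : ℂ) * ((s + s₁)⁻¹) ^ (k ^ 2 + q.2)) := by
  have h1 : AnalyticAt ℂ (fun z : ℂ => (s + z) ^ k) 0 := (analyticAt_const.add analyticAt_id).pow k
  have h2 : AnalyticAt ℂ (fun z : ℂ => ((s + s₁ + z)⁻¹) ^ (k ^ 2)) 0 :=
    (analyticAt_const_add_inv hc).pow _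
  rw [residue_div_pow (g := fun z => A * ((s + z) ^ k * ((s + s₁ + z)⁻¹) ^ (k ^ 2)))
    (analyticAt_const.mul (h1.mul h2)) j' (Filter.Eventually.of_forall fun z => by
      simp only [div_eq_mul_inv, mul_inv, inv_pow]; ring)]
  rw [tayZero_mul (f := fun _ => A)
    (g := fun z => (s + z) ^ k * ((s + s₁ + z)⁻¹) ^ (k ^ 2)) analyticAt_const (h1.mul h2), tayZero_const,
    PowerSeries.coeff_C_mul, tayZero_mul h1 h2,
    tayZero_pow (f := fun z => s + z) (analyticAt_const.add analyticAt_id),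
    tayZero_pow (analyticAt_const_add_inv hc), tayZero_const_add, PowerSeries.coeff_mul]
  congr 1
  refine Finset.sum_congr rfl fun q _ => ?_
  rw [coeff_C_add_X_pow, coeff_inverse_pow (mul_inv_cancel₀ hc) (mul_tayZero_inv hc)]

lemma tay_finset_sum {ι : Type*} (t : Finset ι) {f : ι → ℂ → ℂ} (hf : ∀ i, AnalyticAt ℂ (f i) 0) :
    tayZero (fun z => ∑ i ∈ t, f i z) = ∑ i ∈ t, tayZero (f i) := by
  classical
  induction t using Finset.induction_on with
  | empty => simpa using tayZero_const 0
  | insert i t hi ih =>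
    rw [Finset.sum_insert hi, ← ih]
    simp only [Finset.sum_insert hi]
    exact tay_add (analyticAt_comp_sub_one (hf i))
      (analyticAt_comp_sub_one (Finset.analyticAt_fun_sum t fun i _ => hf i))

/-- The residue in `s₁` of the residue in `s₂`. By homogeneity it is a coefficient of the symbol
times a power of `s`. -/
lemma residue_middle {k j j' : ℕ} (hj' : j' < k) {s : ℂ} (hs : s ≠ 0) :
    residue (fun s₁ : ℂ => residue (fun s₂ : ℂ =>
      Complex.exp s * (s + s₁) ^ k * (s + s₂) ^ k /
        (s₁ ^ (j + 1) * s₂ ^ (j' + 1) * s ^ 2 * (s + s₁ + s₂) ^ (k ^ 2))) 0) 0 =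
      Complex.exp s * (symCoeff k j j' : ℂ) / s ^ ((k - 1) ^ 2 + j + j' + 1) := by
  set f : ℕ × ℕ → ℂ → ℂ := fun q s₁ => (Complex.exp s / s ^ 2 * (s ^ (k - q.1) *
    (k.choose q.1 : ℂ)) * (negChoose (k ^ 2) q.2 : ℂ)) *
      ((s + s₁)⁻¹) ^ (k ^ 2 - k + q.2) with hf
  have hfa : ∀ q, AnalyticAt ℂ (f q) 0 := fun q =>
    analyticAt_const.mul ((analyticAt_const_add_inv hs).pow _)
  rw [residue_div_pow (g := fun s₁ => ∑ q ∈ Finset.HasAntidiagonal.antidiagonal j', f q s₁)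
    (Finset.analyticAt_fun_sum _ fun q _ => hfa q) j]
  · rw [tay_finset_sum _ hfa, map_sum, symCoeff, Int.cast_sum, Finset.mul_sum, Finset.sum_div]
    refine Finset.sum_congr rfl fun q hq => ?_
    have hq' := Finset.HasAntidiagonal.mem_antidiagonal.mp hq
    simp only [hf]
    rw [tayZero_mul (f := fun _ => _) (g := fun z => ((s + z)⁻¹) ^ (k ^ 2 - k + q.2))
      analyticAt_const ((analyticAt_const_add_inv hs).pow _),
      tayZero_const, PowerSeries.coeff_C_mul, tayZero_pow (analyticAt_const_add_inv hs),
      coeff_inverse_pow (mul_inv_cancel₀ hs) (mul_tayZero_inv hs)]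
    have hexp : k ^ 2 - k + q.2 + j + 2 = (k - q.1) + ((k - 1) ^ 2 + j + j' + 1) := by
      obtain ⟨n, rfl⟩ : ∃ n, k = n + 1 := ⟨k - 1, by omega⟩
      have : (n + 1) ^ 2 - (n + 1) = n ^ 2 + n := by
        rw [show (n + 1) ^ 2 = n ^ 2 + n + (n + 1) by ring, Nat.add_sub_cancel]
      rw [this, Nat.add_sub_cancel]
      omega
    have e1 : s ^ (k - q.1) * s ^ ((k - 1) ^ 2 + j + j' + 1) =
        s ^ (k ^ 2 - k + q.2 + j) * s ^ 2 := by rw [← pow_add, ← pow_add, hexp]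
    push_cast
    rw [inv_pow, eq_div_iff (pow_ne_zero _ hs)]
    field_simp
    linear_combination ((k.choose q.1 : ℂ) * (negChoose (k ^ 2) q.2 : ℂ) *
      (negChoose (k ^ 2 - k + q.2) j : ℂ)) * e1
  · have hne : ∀ᶠ s₁ : ℂ in 𝓝[≠] 0, s + s₁ ≠ 0 := by
      refine Filter.Eventually.filter_mono nhdsWithin_le_nhds ?_
      exact ContinuousAt.eventually_ne (by fun_prop) (by simpa using hs)
    filter_upwards [hne] with s₁ h1
    have e : (fun s₂ : ℂ => Complex.exp s * (s + s₁) ^ k * (s + s₂) ^ k /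
        (s₁ ^ (j + 1) * s₂ ^ (j' + 1) * s ^ 2 * (s + s₁ + s₂) ^ (k ^ 2))) = fun s₂ : ℂ =>
        (Complex.exp s * (s + s₁) ^ k / (s₁ ^ (j + 1) * s ^ 2)) * (s + s₂) ^ k /
          (s₂ ^ (j' + 1) * (s + s₁ + s₂) ^ (k ^ 2)) := by
      funext s₂
      simp only [div_eq_mul_inv, mul_inv]
      ring
    rw [e, residue_inner h1, Finset.mul_sum, Finset.sum_div]
    refine Finset.sum_congr rfl fun q _ => ?_
    have hexp : k ^ 2 + q.2 = k + (k ^ 2 - k + q.2) := by have := le_sq_self k; omega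
    have e2 : (s + s₁) ^ k * ((s + s₁)⁻¹) ^ k = 1 := by
      rw [← mul_pow, mul_inv_cancel₀ h1, one_pow]
    rw [hexp, pow_add]
    simp only [hf, div_eq_mul_inv, mul_inv]
    linear_combination (Complex.exp s * (s₁ ^ (j + 1))⁻¹ * (s ^ 2)⁻¹ * (s ^ (k - q.1) *
      (k.choose q.1 : ℂ)) * (negChoose (k ^ 2) q.2 : ℂ) *
        ((s + s₁)⁻¹) ^ (k ^ 2 - k + q.2)) * e2

/-- The iterated residue `c_{j,j'}` is a coefficient of the symbol, divided by a factorial. -/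
lemma coeffC_eq {k j j' : ℕ} (hj' : j' < k) :
    coeffC k j j' = cf j j' (gramSymbol k) / (((k - 1) ^ 2 + j + j').factorial : ℝ) := by
  have hexp : AnalyticAt ℂ (fun s : ℂ => Complex.exp s * (symCoeff k j j' : ℂ)) 0 := by fun_prop
  rw [coeffC, residue_div_pow hexp ((k - 1) ^ 2 + j + j')]
  · rw [tayZero, coeff_tay]
    have h1 : iteratedDeriv ((k - 1) ^ 2 + j + j')
        (fun s : ℂ => Complex.exp (s - 1) * (symCoeff k j j' : ℂ)) 1 = (symCoeff k j j' : ℂ) := by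
      have := iteratedDeriv_comp_sub_const ((k - 1) ^ 2 + j + j')
        (fun s => Complex.exp s * (symCoeff k j j' : ℂ)) 1
      have h2 := congrFun this 1
      rw [h2]
      have h3 : (fun s => Complex.exp s * (symCoeff k j j' : ℂ)) =
          fun s => (symCoeff k j j' : ℂ) * Complex.exp s := by funext s; ring
      rw [h3, iteratedDeriv_const_mul_field, iteratedDeriv_eq_iterate, Complex.iter_deriv_exp]
      simp
    rw [h1, cf_gramSymbol, Complex.div_natCast_re, Complex.intCast_re]
  · filter_upwards [self_mem_nhdsWithin] with s hs
    exact residue_middle hj' hs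

/-- Only `j = j' = k - 1` contributes to the coefficient of `v^{2k-2}`, which is therefore a
positive multiple of the diagonal coefficient `symCoeff k (k - 1) (k - 1)`. -/
lemma natDegree_polyP {k : ℕ} (hk : 2 ≤ k) : (polyP k).natDegree = 2 * k - 2 := by
  refine Polynomial.natDegree_eq_of_le_of_coeff_ne_zero ?_ ?_
  · refine Polynomial.natDegree_sum_le_of_forall_le _ _ fun j hj =>
      Polynomial.natDegree_sum_le_of_forall_le _ _ fun j' hj' =>
        (Polynomial.natDegree_monomial_le _).trans ?_
    rw [Finset.mem_range] at hj hj'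
    omega
  · have hk1 : k - 1 ∈ Finset.range k := by rw [Finset.mem_range]; omega
    rw [polyP, Polynomial.finsetSum_coeff, Finset.sum_eq_single_of_mem (k - 1) hk1,
      Polynomial.finsetSum_coeff, Finset.sum_eq_single_of_mem (k - 1) hk1,
      Polynomial.coeff_monomial, if_pos (by omega), coeffC_eq (by omega), cf_gramSymbol]
    · have h1 : (0 : ℝ) < symCoeff k (k - 1) (k - 1) := by exact_mod_cast symCoeff_pos hk (k - 1)
      positivity
    · intro j' hj' hne
      rw [Finset.mem_range] at hj'
      rw [Polynomial.coeff_monomial, if_neg (by omega)]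
    · intro j hj hne
      rw [Polynomial.finsetSum_coeff]
      refine Finset.sum_eq_zero fun j' hj' => ?_
      rw [Finset.mem_range] at hj hj'
      rw [Polynomial.coeff_monomial, if_neg (by omega)]

/-! ### The main term -/

/-- The integral of `(log t)^m` over `[1, x]` is `x (log x)^m` up to a factor `1 + O(1 / log x)`. -/
lemma abs_integral_log_pow_sub_le (m : ℕ) {x : ℝ} (hx : 1 ≤ x) (hL : 1 ≤ Real.log x) :
    |(∫ t in (1 : ℝ)..x, Real.log t ^ m) - x * Real.log x ^ m| ≤
      (m + 1) * (x * Real.log x ^ m / Real.log x) := by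
  have hL0 : 0 < Real.log x := by linarith
  have hx0 : 0 < x := by linarith
  have hpos : ∀ t ∈ Set.uIcc 1 x, 0 < t := fun t ht => by
    rw [Set.uIcc_of_le hx] at ht
    exact lt_of_lt_of_le one_pos ht.1
  have hlc : ContinuousOn Real.log (Set.uIcc 1 x) :=
    Real.continuousOn_log.mono fun t ht => (hpos t ht).ne'
  rcases m with _ | m
  · have h1 : Real.log x ≤ x := (Real.log_le_sub_one_of_pos hx0).trans (by linarith)
    have h2 : 1 ≤ x / Real.log x := by rwa [le_div_iff₀ hL0, one_mul]
    simpa using h2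
  · have hd : ∀ t ∈ Set.uIcc 1 x, HasDerivAt (fun t => t * Real.log t ^ (m + 1))
        (Real.log t ^ (m + 1) + (m + 1) * Real.log t ^ m) t := by
      intro t ht
      have h1 := (hasDerivAt_id t).mul ((Real.hasDerivAt_log (hpos t ht).ne').pow (m + 1))
      refine h1.congr_deriv ?_
      have := (hpos t ht).ne'
      simp only [id, Nat.add_sub_cancel, Pi.pow_apply]
      push_cast
      field_simp
    have hi : ∀ n : ℕ, IntervalIntegrable (fun t => Real.log t ^ n) MeasureTheory.volume 1 x :=
      fun n => (hlc.pow n).intervalIntegrable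
    have h1 := intervalIntegral.integral_eq_sub_of_hasDerivAt hd
      ((hi (m + 1)).add ((hi m).const_mul _))
    rw [intervalIntegral.integral_add (hi (m + 1)) ((hi m).const_mul _),
      intervalIntegral.integral_const_mul, Real.log_one, zero_pow (Nat.succ_ne_zero m), mul_zero,
      sub_zero] at h1
    have h2 : ∫ t in (1 : ℝ)..x, Real.log t ^ m ≤ x * Real.log x ^ m := by
      have h3 := intervalIntegral.integral_mono_on hx (hi m)
        (intervalIntegrable_const (c := Real.log x ^ m)) (fun t ht =>
          pow_le_pow_left₀ (Real.log_nonneg ht.1)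
            (Real.log_le_log (lt_of_lt_of_le one_pos ht.1) ht.2) m)
      rw [intervalIntegral.integral_const, smul_eq_mul] at h3
      exact h3.trans (mul_le_mul_of_nonneg_right (by linarith) (by positivity))
    have h3 : 0 ≤ ∫ t in (1 : ℝ)..x, Real.log t ^ m :=
      intervalIntegral.integral_nonneg hx fun t ht => pow_nonneg (Real.log_nonneg ht.1) m
    have e : x * Real.log x ^ (m + 1) / Real.log x = x * Real.log x ^ m := by
      rw [pow_succ]; field_simp
    have h4 : (∫ t in (1 : ℝ)..x, Real.log t ^ (m + 1)) - x * Real.log x ^ (m + 1) =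
        -((m + 1) * ∫ t in (1 : ℝ)..x, Real.log t ^ m) := by linarith
    rw [h4, abs_neg, abs_of_nonneg (by positivity), e]
    push_cast
    have : 0 ≤ x * Real.log x ^ m := by positivity
    calc _ ≤ ((m : ℝ) + 1) * (x * Real.log x ^ m) := mul_le_mul_of_nonneg_left h2 (by positivity)
      _ ≤ _ := by gcongr; linarith

/-- The range of the parameters `(x, R)` in which `R` is at most a small power of `x`. -/
def InRange (k : ℕ) (y : ℝ × ℝ) : Prop :=
  1 ≤ y.1 ∧ 2 ≤ y.2 ∧ y.2 ≤ y.1 ^ ((1 / 96 : ℝ) / (k : ℝ))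

/-- The order of magnitude of the error term. -/
def errTerm (k : ℕ) (y : ℝ × ℝ) : ℝ :=
  y.1 * Real.log y.1 ^ (2 * k - 2) * Real.log y.2 ^ (k ^ 2 - 2 * k)

/-- The condition `2 ≤ R ≤ x^{1/(96k)}` forces `x` to be large, so that no logarithm is small. -/
lemma InRange.log_le {k : ℕ} (hk : 2 ≤ k) {y : ℝ × ℝ} (h : InRange k y) :
    1 ≤ 2 * Real.log y.2 ∧ 1 ≤ Real.log y.1 ∧ Real.log y.2 ≤ Real.log y.1 := by
  obtain ⟨hx, hR, hRx⟩ := h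
  have hk' : (2 : ℝ) ≤ k := by exact_mod_cast hk
  have h1 : Real.log 2 ≤ Real.log y.2 := Real.log_le_log (by norm_num) hR
  have h2 : Real.log y.2 ≤ (1 / 96 : ℝ) / (k : ℝ) * Real.log y.1 := by
    rw [← Real.log_rpow (by linarith)]
    exact Real.log_le_log (by linarith) hRx
  have h3 : (1 / 96 : ℝ) / (k : ℝ) ≤ 1 / 96 := div_le_self (by norm_num) (by linarith)
  have h4 : (1 / 96 : ℝ) / (k : ℝ) * Real.log y.1 ≤ 1 / 96 * Real.log y.1 :=
    mul_le_mul_of_nonneg_right h3 (Real.log_nonneg hx)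
  have h5 := Real.log_two_gt_d9
  refine ⟨?_, ?_, ?_⟩ <;> linarith

/-- The error term is at least of order `x`, because `log R ≥ 1/2` and `log x ≥ 1`. -/
lemma InRange.fst_le {k : ℕ} (hk : 2 ≤ k) {y : ℝ × ℝ} (h : InRange k y) :
    y.1 ≤ 2 ^ (k ^ 2 - 2 * k) * errTerm k y := by
  obtain ⟨h1, h2, -⟩ := h.log_le hk
  have hx : 0 ≤ y.1 := by linarith [h.1]
  have h3 : 1 ≤ Real.log y.1 ^ (2 * k - 2) := one_le_pow₀ h2
  have h4 : 1 ≤ (2 * Real.log y.2) ^ (k ^ 2 - 2 * k) := one_le_pow₀ h1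
  have e : 2 ^ (k ^ 2 - 2 * k) * errTerm k y =
      y.1 * (Real.log y.1 ^ (2 * k - 2) * (2 * Real.log y.2) ^ (k ^ 2 - 2 * k)) := by
    rw [errTerm, mul_pow]; ring
  rw [e]
  exact le_mul_of_one_le_right hx (one_le_mul_of_one_le_of_one_le h3 h4)

lemma sub_one_sq {k : ℕ} (hk : 2 ≤ k) : (k - 1) ^ 2 = k ^ 2 - 2 * k + 1 := by
  obtain ⟨n, rfl⟩ : ∃ n, k = n + 2 := ⟨k - 2, by omega⟩
  rw [show (n + 2) ^ 2 = n ^ 2 + 2 * n + 2 * (n + 2) by ring, Nat.add_sub_cancel,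
    show n + 2 - 1 = n + 1 by omega]
  ring

/-- The sums over `r`. For `R ≥ 2` the factor `1 + log R` in the error is `O(log R)`. -/
lemma exists_abs_gramSum_sub_le {k : ℕ} (hk : 2 ≤ k) (j j' : ℕ) : ∃ C : ℝ, 0 ≤ C ∧
    ∀ y : ℝ × ℝ, InRange k y → |gramSum k j j' ⌊y.2⌋₊ - cf j j' (gramSymbol k) * constC k *
      Real.log y.2 ^ ((k - 1) ^ 2 + j + j') / ((k - 1) ^ 2 + j + j').factorial| ≤
      C * Real.log y.2 ^ (k ^ 2 - 2 * k + j + j') := by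
  obtain ⟨a, ha, hT⟩ := isType_gram hk (constantCoeff_zetaSer k) j j'
  have hexp : (k - 1) ^ 2 + j + j' = k ^ 2 - 2 * k + j + j' + 1 := by
    rw [sub_one_sq hk]; ring
  rw [hexp] at hT ⊢
  obtain ⟨C, hC⟩ := hT
  refine ⟨|C| * 3 ^ (k ^ 2 - 2 * k + j + j'), by positivity, fun y hy => ?_⟩
  obtain ⟨h1, -, -⟩ := hy.log_le hk
  have e : gramSum k j j' ⌊y.2⌋₊ = psum a y.2 := by
    refine Finset.sum_congr rfl fun r _ => ?_
    rw [ha, hFun_mul_moebius (by omega), hFun_mul_moebius (by omega)]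
  rw [e]
  refine ((hC y.2 (by linarith [hy.2.1])).1).trans ?_
  have h2 : (1 + Real.log y.2) ^ (k ^ 2 - 2 * k + j + j') ≤
      (3 * Real.log y.2) ^ (k ^ 2 - 2 * k + j + j') :=
    pow_le_pow_left₀ (by linarith) (by linarith) _
  calc _ ≤ |C| * (3 * Real.log y.2) ^ (k ^ 2 - 2 * k + j + j') :=
        mul_le_mul (le_abs_self C) h2 (pow_nonneg (by linarith) _) (abs_nonneg C)
    _ = _ := by rw [mul_pow]; ring

/-- The main term of `∫ u_{j,k} u_{j',k} · ∑_r (h_{j,k} * μ)(h_{j',k} * μ)(r)/φ(r)`. -/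
def mainTerm (k j j' : ℕ) (y : ℝ × ℝ) : ℝ :=
  ((k - 1 - j).factorial : ℝ)⁻¹ * ((k - 1 - j').factorial : ℝ)⁻¹ *
    (y.1 * Real.log y.1 ^ ((k - 1 - j) + (k - 1 - j'))) *
    (cf j j' (gramSymbol k) * constC k *
      Real.log y.2 ^ ((k - 1) ^ 2 + j + j') / ((k - 1) ^ 2 + j + j').factorial)

/-- The error of either factor loses one logarithm. A loss of `log x` is at least as good as one of
`log R`, and excess powers of `log R` are at most powers of `log x`. -/
lemma exists_abs_uInt_mul_gramSum_sub_le {k : ℕ} (hk : 2 ≤ k) {j j' : ℕ} (hj : j < k)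
    (hj' : j' < k) : ∃ C : ℝ, 0 ≤ C ∧ ∀ y : ℝ × ℝ, InRange k y →
      |uInt k j j' y.1 * gramSum k j j' ⌊y.2⌋₊ - mainTerm k j j' y| ≤ C * errTerm k y := by
  obtain ⟨C, hC, h⟩ := exists_abs_gramSum_sub_le hk j j'
  set A : ℝ := ((k - 1 - j).factorial : ℝ)⁻¹ * ((k - 1 - j').factorial : ℝ)⁻¹ with hA
  have hA0 : 0 ≤ A := by positivity
  set m := (k - 1 - j) + (k - 1 - j') with hm
  set e := k ^ 2 - 2 * k + j + j' with he
  have hκ : (k - 1) ^ 2 + j + j' = e + 1 := by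
    rw [he, sub_one_sq hk]; ring
  set s : ℝ := cf j j' (gramSymbol k) * constC k / (e + 1).factorial with hs
  refine ⟨A * ((m + 1) * (|s| + 2 * C) + C), by positivity, fun y hy => ?_⟩
  obtain ⟨h1, h2, h3⟩ := hy.log_le hk
  have hx := hy.1
  have hS := h y hy
  have hI := abs_integral_log_pow_sub_le m hx h2
  rw [mainTerm, ← hA, ← hm]
  rw [hκ] at hS ⊢
  set x := y.1 with hxdef
  set L := Real.log x with hL
  set l := Real.log y.2 with hl
  set S := gramSum k j j' ⌊y.2⌋₊ with hSdef
  have hs' : cf j j' (gramSymbol k) * constC k * l ^ (e + 1) / (e + 1).factorial =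
      s * l ^ (e + 1) := by rw [hs]; ring
  rw [hs'] at hS ⊢
  have hu : uInt k j j' x = A * ∫ t in (1 : ℝ)..x, Real.log t ^ m := by
    rw [uInt, ← intervalIntegral.integral_const_mul]
    exact intervalIntegral.integral_congr fun t _ => uFun_mul_uFun k j j' t
  rw [hu]
  set I := ∫ t in (1 : ℝ)..x, Real.log t ^ m with hIdef
  have hl0 : 0 < l := by linarith
  have hL0 : 0 < L := by linarith
  have hx0 : 0 < x := by linarith
  have hle : l ^ e ≤ 2 * l ^ (e + 1) := by
    rw [pow_succ]
    have : 0 ≤ l ^ e := by positivity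
    nlinarith
  have hSb : |S| ≤ (|s| + 2 * C) * l ^ (e + 1) := by
    have h4 := abs_sub_abs_le_abs_sub S (s * l ^ (e + 1))
    rw [abs_mul, abs_of_pos (pow_pos hl0 _)] at h4
    have h5 : C * l ^ e ≤ C * (2 * l ^ (e + 1)) := mul_le_mul_of_nonneg_left hle hC
    linarith
  have hdec : A * I * S - A * (x * L ^ m) * (s * l ^ (e + 1)) =
      A * ((I - x * L ^ m) * S + x * L ^ m * (S - s * l ^ (e + 1))) := by ring
  have hlL : l ^ (e + 1) / L ≤ l ^ e := by
    rw [div_le_iff₀ hL0, pow_succ]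
    exact mul_le_mul_of_nonneg_left h3 (by positivity)
  have hE : x * L ^ m * l ^ e ≤ errTerm k y := by
    rw [errTerm, ← hxdef, ← hL, ← hl, he]
    have e1 : 2 * k - 2 = m + (j + j') := by omega
    have e2 : k ^ 2 - 2 * k + j + j' = (k ^ 2 - 2 * k) + (j + j') := by omega
    have h6 : l ^ (j + j') ≤ L ^ (j + j') := pow_le_pow_left₀ hl0.le h3 _
    rw [e1, e2, pow_add, pow_add]
    calc _ = x * L ^ m * l ^ (k ^ 2 - 2 * k) * l ^ (j + j') := by ring
      _ ≤ x * L ^ m * l ^ (k ^ 2 - 2 * k) * L ^ (j + j') := by gcongr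
      _ = _ := by ring
  have t1 : |(I - x * L ^ m) * S| ≤ (m + 1) * (|s| + 2 * C) * (x * L ^ m * l ^ e) := by
    rw [abs_mul]
    calc _ ≤ ((m + 1) * (x * L ^ m / L)) * ((|s| + 2 * C) * l ^ (e + 1)) :=
          mul_le_mul hI hSb (abs_nonneg _) (by positivity)
      _ = (m + 1) * (|s| + 2 * C) * (x * L ^ m * (l ^ (e + 1) / L)) := by ring
      _ ≤ _ := by gcongr
  have t2 : |x * L ^ m * (S - s * l ^ (e + 1))| ≤ C * (x * L ^ m * l ^ e) := by
    rw [abs_mul, abs_of_nonneg (by positivity : 0 ≤ x * L ^ m)]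
    calc _ ≤ x * L ^ m * (C * l ^ e) := mul_le_mul_of_nonneg_left hS (by positivity)
      _ = _ := by ring
  rw [hdec, abs_mul, abs_of_nonneg hA0, mul_assoc A]
  refine mul_le_mul_of_nonneg_left ?_ hA0
  calc _ ≤ (m + 1) * (|s| + 2 * C) * (x * L ^ m * l ^ e) + C * (x * L ^ m * l ^ e) :=
        (abs_add_le _ _).trans (add_le_add t1 t2)
    _ = ((m + 1) * (|s| + 2 * C) + C) * (x * L ^ m * l ^ e) := by ring
    _ ≤ _ := mul_le_mul_of_nonneg_left hE (by positivity)

/-- The main terms add up to the polynomial `P_k`. -/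
lemma sum_mainTerm {k : ℕ} (hk : 2 ≤ k) {y : ℝ × ℝ} (h : InRange k y) :
    ∑ j ∈ Finset.range k, ∑ j' ∈ Finset.range k, mainTerm k j j' y =
      constC k * y.1 * (Real.log y.1 ^ (k ^ 2 - 1) / ((k ^ 2 - 1).factorial : ℝ)) *
        ((Real.log y.2 / Real.log y.1) ^ ((k - 1) ^ 2) *
          (polyP k).eval (Real.log y.2 / Real.log y.1)) := by
  obtain ⟨-, h2, -⟩ := h.log_le hk
  have hL : Real.log y.1 ≠ 0 := by linarith
  simp only [polyP, Polynomial.eval_finsetSum, Polynomial.eval_monomial, Finset.mul_sum]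
  refine Finset.sum_congr rfl fun j hj => Finset.sum_congr rfl fun j' hj' => ?_
  rw [Finset.mem_range] at hj hj'
  have hexp : k ^ 2 - 1 = ((k - 1) ^ 2 + j + j') + ((k - 1 - j) + (k - 1 - j')) := by
    obtain ⟨n, rfl⟩ : ∃ n, k = n + 1 := ⟨k - 1, by omega⟩
    have h1 : (n + 1) ^ 2 - 1 = n ^ 2 + 2 * n := by
      rw [show (n + 1) ^ 2 = n ^ 2 + 2 * n + 1 by ring, Nat.add_sub_cancel]
    rw [h1, Nat.add_sub_cancel]
    omega
  have hf : ((k ^ 2 - 1).factorial : ℝ) ≠ 0 := by positivity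
  have e1 : k - j - 1 = k - 1 - j := by omega
  have e2 : k - j' - 1 = k - 1 - j' := by omega
  have e3 : Real.log y.1 ^ (k ^ 2 - 1) * ((Real.log y.2 / Real.log y.1) ^ ((k - 1) ^ 2) *
      (Real.log y.2 / Real.log y.1) ^ (j + j')) =
      Real.log y.1 ^ ((k - 1 - j) + (k - 1 - j')) * Real.log y.2 ^ ((k - 1) ^ 2 + j + j') := by
    rw [← pow_add, ← add_assoc, hexp, pow_add (Real.log y.1) ((k - 1) ^ 2 + j + j'), div_pow]
    field_simp
  rw [coeffC_eq hj', mainTerm, e1, e2]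
  have h3 : ((k - 1 - j).factorial : ℝ) ≠ 0 := by positivity
  have h4 : ((k - 1 - j').factorial : ℝ) ≠ 0 := by positivity
  have h5 : (((k - 1) ^ 2 + j + j').factorial : ℝ) ≠ 0 := by positivity
  calc _ = (((k - 1 - j).factorial : ℝ)⁻¹ * ((k - 1 - j').factorial : ℝ)⁻¹ * y.1 *
        cf j j' (gramSymbol k) * constC k / (((k - 1) ^ 2 + j + j').factorial : ℝ)) *
        (Real.log y.1 ^ ((k - 1 - j) + (k - 1 - j')) * Real.log y.2 ^ ((k - 1) ^ 2 + j + j')) := by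
        ring
    _ = _ := by
        rw [← e3]
        field_simp

/-- In the given range `R^{12} ≤ x^{1/(8k)}`, which costs half of the saving `x^{1/(4k)}`; the other
half absorbs the logarithms. -/
lemma exists_rangeError_le {k : ℕ} (hk : 2 ≤ k) : ∃ C : ℝ, 0 ≤ C ∧ ∀ y : ℝ × ℝ, InRange k y →
    y.2 ^ 12 * (y.1 ^ (1 - 1 / (4 * (k : ℝ))) * (1 + Real.log y.1) ^ (2 * k)) ≤
      C * errTerm k y := by
  have hk0 : (0 : ℝ) < k := by have : 0 < k := by omega
                               exact_mod_cast this
  have hlt : 1 - 1 / (8 * (k : ℝ)) < 1 := by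
    have : 0 < 1 / (8 * (k : ℝ)) := by positivity
    linarith
  obtain ⟨C, hC, h⟩ := exists_log_pow_mul_rpow_le (2 * k) hlt
  refine ⟨C * 2 ^ (k ^ 2 - 2 * k), by positivity, fun y hy => ?_⟩
  obtain ⟨hx, hR, hRx⟩ := hy
  have hx0 : 0 < y.1 := by linarith
  have h1 : y.2 ^ 12 ≤ y.1 ^ (1 / (8 * (k : ℝ))) := by
    calc y.2 ^ 12 ≤ (y.1 ^ ((1 / 96 : ℝ) / (k : ℝ))) ^ 12 := pow_le_pow_left₀ (by linarith) hRx 12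
      _ = y.1 ^ (1 / (8 * (k : ℝ))) := by
          rw [← Real.rpow_mul_natCast hx0.le]
          congr 1
          push_cast
          field_simp
          norm_num
  have h2 : y.1 ^ (1 / (8 * (k : ℝ))) * y.1 ^ (1 - 1 / (4 * (k : ℝ))) =
      y.1 ^ (1 - 1 / (8 * (k : ℝ))) := by
    rw [← Real.rpow_add hx0]
    congr 1
    field_simp
    ring
  have h3 := h y.1 hx
  rw [Real.rpow_one] at h3
  have hl := Real.log_nonneg hx
  have hz : 0 ≤ y.1 ^ (1 - 1 / (4 * (k : ℝ))) := Real.rpow_nonneg hx0.le _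
  calc _ ≤ y.1 ^ (1 / (8 * (k : ℝ))) *
        (y.1 ^ (1 - 1 / (4 * (k : ℝ))) * (1 + Real.log y.1) ^ (2 * k)) := by gcongr
    _ = (1 + Real.log y.1) ^ (2 * k) * y.1 ^ (1 - 1 / (8 * (k : ℝ))) := by rw [← h2]; ring
    _ ≤ C * y.1 := h3
    _ ≤ C * (2 ^ (k ^ 2 - 2 * k) * errTerm k y) :=
        mul_le_mul_of_nonneg_left (InRange.fst_le hk ⟨hx, hR, hRx⟩) hC
    _ = _ := by ring

/-- The three sources of error are the reduction to the diagonal form, the asymptotics of `‖τ_k‖²`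
that define `Q_k`, and the evaluation of the diagonal form. -/
lemma exists_abs_normSq_Delta_sub_main_le {k : ℕ} (hk : 2 ≤ k) {Q : Polynomial ℝ}
    (hQ : IsPolyQ k Q) : ∃ C : ℝ, ∀ y : ℝ × ℝ, InRange k y →
      |normSq (Delta k y.2) y.1 -
        constC k * y.1 * (Real.log y.1 ^ (k ^ 2 - 1) / ((k ^ 2 - 1).factorial : ℝ)) *
          (1 - (Real.log y.2 / Real.log y.1) ^ ((k - 1) ^ 2) *
              (polyP k).eval (Real.log y.2 / Real.log y.1) +
            1 / Real.log y.1 * Q.eval (1 / Real.log y.1))| ≤ C * errTerm k y := by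
  obtain ⟨-, δ, hδ, K, hK⟩ := hQ
  obtain ⟨C₁, hC₁, h₁⟩ := exists_abs_normSq_Delta_sub_le (by omega : 0 < k)
  obtain ⟨C₂, hC₂, h₂⟩ := exists_rangeError_le hk
  obtain ⟨C₃, hC₃, h₃⟩ := exists_abs_sum_le (Finset.range k ×ˢ Finset.range k)
    (P := InRange k) (b := errTerm k)
    (f := fun q y => uInt k q.1 q.2 y.1 * gramSum k q.1 q.2 ⌊y.2⌋₊ - mainTerm k q.1 q.2 y)
    fun q hq => by
      rw [Finset.mem_product, Finset.mem_range, Finset.mem_range] at hq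
      exact exists_abs_uInt_mul_gramSum_sub_le hk hq.1 hq.2
  refine ⟨C₁ * C₂ + |K| * 2 ^ (k ^ 2 - 2 * k) + C₃, fun y hy => ?_⟩
  obtain ⟨-, hL, -⟩ := hy.log_le hk
  have hx2 : 2 ≤ y.1 := by
    have := Real.log_le_sub_one_of_pos (by linarith [hy.1] : (0 : ℝ) < y.1)
    linarith
  have a₁ := (h₁ y ⟨hy.1, by linarith [hy.2.1]⟩).trans
    (mul_le_mul_of_nonneg_left (h₂ y hy) hC₁)
  have a₂ : |K| * y.1 ^ (1 - δ) ≤ |K| * (2 ^ (k ^ 2 - 2 * k) * errTerm k y) := by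
    refine mul_le_mul_of_nonneg_left (le_trans ?_ (hy.fst_le hk)) (abs_nonneg K)
    calc y.1 ^ (1 - δ) ≤ y.1 ^ (1 : ℝ) :=
          Real.rpow_le_rpow_of_exponent_le hy.1 (by linarith)
      _ = y.1 := Real.rpow_one _
  have a₃ := ((hK y.1 hx2).trans (mul_le_mul_of_nonneg_right (le_abs_self K)
    (Real.rpow_nonneg (by linarith) _))).trans a₂
  have a₄ := h₃ y hy
  rw [Finset.sum_product, Finset.sum_congr rfl (fun _ _ => Finset.sum_sub_distrib _ _),
    Finset.sum_sub_distrib, sum_mainTerm hk hy] at a₄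
  rw [abs_le] at a₁ a₃ a₄ ⊢
  constructor <;> linarith [a₁.1, a₁.2, a₃.1, a₃.2, a₄.1, a₄.2]

end

end MajorArcs

theorem theorem6p1 :
    ∃ c' : ℝ, 0 < c' ∧ ∀ k : ℕ, 2 ≤ k →
      (MajorArcs.polyP k).natDegree = 2 * k - 2 ∧
      ∃ Q : Polynomial ℝ, MajorArcs.IsPolyQ k Q ∧
        ∃ C : ℝ, ∀ x R : ℝ, 1 ≤ x → 2 ≤ R → R ≤ x ^ (c' / (k : ℝ)) →
          |MajorArcs.normSq (MajorArcs.Delta k R) x -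
              MajorArcs.constC k * x *
                (Real.log x ^ (k ^ 2 - 1) / ((k ^ 2 - 1).factorial : ℝ)) *
                (1 - (Real.log R / Real.log x) ^ ((k - 1) ^ 2) *
                    (MajorArcs.polyP k).eval (Real.log R / Real.log x) +
                  1 / Real.log x * Q.eval (1 / Real.log x))| ≤
            C * (x * Real.log x ^ (2 * k - 2) * Real.log R ^ (k ^ 2 - 2 * k)) := by
  -- `R^{12} ≤ x^{12 / (96 k)} = x^{1 / (8 k)}`, half of the power saving `x^{1 / (4 k)}`
  refine ⟨1 / 96, by norm_num, fun k hk => ⟨MajorArcs.natDegree_polyP hk, ?_⟩⟩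
  obtain ⟨Q, hQ⟩ := MajorArcs.exists_isPolyQ hk
  obtain ⟨C, hC⟩ := MajorArcs.exists_abs_normSq_Delta_sub_main_le hk hQ
  exact ⟨Q, hQ, C, fun x R hx hR hRx => hC (x, R) ⟨hx, hR, hRx⟩⟩
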